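/- **Setting.** On $\mathbb R\times\mathbb R^d$ (points $x=(x_0,x')$) let $d(x,y)=\sqrt{|x_0-y_0|}+|x'-y'|$, and for $n\in\mathbb N\times\mathbb N^d$ let $|n|_{\mathfrak s}=2n_0+n_1+\dots+n_d$. Let $p_t(x,y)$ be the kernel of $e^{t(\partial_{x_0}^2-\Delta_{x'}^2)}$, let $q_r(x,y)$ be the kernel of $K_r=-(\partial_{x_0}+\Delta_{x'}-1)\,e^{r(\partial_{x_0}^2-(\Delta_{x'}-1)^2)}$, and set $\mathbf K=\int_0^1K_r\,dr-(e-1)K_1$ and $$\partial^n\mathbf K(\zeta)(x)=\int_0^1\langle\zeta,\partial_x^nq_r(x,\cdot)\rangle\,dr-(e-1)\langle\zeta,\partial_x^nq_1(x,\cdot)\rangle$$ for a tempered distribution $\zeta$, whenever the integral converges. **Regularity structure.** Let $T^+=\bigoplus_{\alpha\ge0}T^+_\alpha$ be a commutative connected graded bialgebra over $\mathbb R$ with coproduct $\Delta^+$, and let $T=\bigoplus_{\beta\in A}T_\beta$ be a right comodule over $T^+$ with splitting map $\Delta:T\to T\otimes T^+$, where $A\subset\mathbb R$ is locally finite with $\min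 A>-2$, each $T_\beta$ is finite dimensional and $\Delta T_\beta\subset\bigoplus_{\alpha\ge0}T_{\beta-\alpha}\otimes T^+_\alpha$. Fix homogeneous bases $\mathcal B$ of $T$ and $\mathcal B^+$ of $T^+$ and write $|\tau|$ for the homogeneity of $\tau$. Assume: (A) For each $\alpha\in\mathbb N$ the elements of $\mathcal B$, resp. $\mathcal B^+$, of homogeneity $\alpha$ are exactly the monomials $X^n$, resp. $X_+^n$, with $|n|_{\mathfrak s}=\alpha$; the $X_+^n$ are the monomials in the $X_+^{e_i}$; and $\Delta^+X_+^n=\sum_{\ell\le n}\binom n\ell X_+^\ell\otimes X_+^{n-\ell}$, $\Delta X^n=\sum_{\ell\le n}\binom n\ell X^\ell\otimes X_+^{n-\ell}$. There is a graded bilinear product $\star$ of $T_X=\mathrm{span}\{X^n\}$ and $T$ with $X^0\star\tau=\tau$ and $X^k\star X^\ell=X^{k+\ell}$. (B1) There are linear maps $\mathcal I_n^+:T\to T^+$ for $n\in\mathbb N\times\mathbb N^d$, and $\mathcal I_n:T\to T$ for $|n|_{\mathfrak s}\le1$, that vanish on the monomials $X^k$ and send $\tau\in\mathcal B$ to an element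 of homogeneity $|\tau|+2-|n|_{\mathfrak s}$, with $\mathcal I^+_n\tau=0$ if $|\tau|+2-|n|_{\mathfrak s}\le0$. The basis $\mathcal B^+$ is the commutative monoid freely generated by the $X_+^{e_i}$ and the $\mathcal I_n^+\tau$ with $\tau\in\mathcal B$ not a monomial and $|\tau|+2-|n|_{\mathfrak s}>0$. For all $\tau\in\mathcal B$, $$\Delta^+(\mathcal I_n^+\tau)=(\mathcal I_n^+\otimes\mathrm{Id})\Delta\tau+\sum_{|\ell|_{\mathfrak s}<|\tau|+2-|n|_{\mathfrak s}}\frac{X_+^\ell}{\ell!}\otimes\mathcal I^+_{n+\ell}\tau,\qquad \Delta(\mathcal I_n\tau)=(\mathcal I_n\otimes\mathrm{Id})\Delta\tau+\sum_{|\ell|_{\mathfrak s}<|\tau|+2-|n|_{\mathfrak s}}\frac{X^\ell}{\ell!}\otimes\mathcal I^+_{n+\ell}\tau .$$ Write $\mathcal I=\mathcal I_0$. **Model.** Let $\mathsf M=(\mathsf\Pi,\mathsf g)$ be a model: $\mathsf\Pi:T\to\mathcal S'(\mathbb R\times\mathbb R^d)$ is linear and each $\mathsf g_x$ is a character of $T^+$;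 with the convolution inverse $\mathsf g_x^{-1}$, $\mathsf g_{yx}=(\mathsf g_y\otimes\mathsf g_x^{-1})\Delta^+$, $\widehat{\mathsf g_{yx}}=(\mathrm{Id}\otimes\mathsf g_{yx})\Delta$ and $\mathsf\Pi^{\mathsf g}_x=(\mathsf\Pi\otimes\mathsf g_x^{-1})\Delta$, one has $\sup_{x,y}|\mathsf g_{yx}(\mu)|\,d(y,x)^{-|\mu|}<\infty$ for all $\mu\in\mathcal B^+$ and $\sup_{x,\,0<t\le1}t^{-|\tau|/4}|\langle\mathsf\Pi_x^{\mathsf g}\tau,p_t(x,\cdot)\rangle|<\infty$ for all $\tau\in\mathcal B$. Assume that $(\mathsf\Pi X^n)(y)=y^n$ and $\mathsf g_x(X_+^n)=x^n$, and that $\mathsf M$ is $\mathbf K$-admissible: $\mathsf\Pi(\mathcal I\tau)=\mathbf K(\mathsf\Pi\tau)$ for every $\tau\in\mathcal B$ that is not a monomial, and $\mathsf\Pi(X^n\star\tau)=x^n\,\mathsf\Pi\tau$ for all $n$ and all $\tau\in\mathcal B$. For $\gamma\in\mathbb R$ let $\mathcal D^\gamma(T,\mathsf g)$ be the space of functions $\boldsymbol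 f:\mathbb R\times\mathbb R^d\to\bigoplus_{\beta<\gamma}T_\beta$ with finite norm $$|||\boldsymbol f|||_{\mathcal D^\gamma}=\max_{\beta<\gamma}\sup_x\|\boldsymbol f(x)\|_\beta+\max_{\beta<\gamma}\sup_{x,y}\frac{\|\boldsymbol f(y)-\widehat{\mathsf g_{yx}}\boldsymbol f(x)\|_\beta}{d(y,x)^{\gamma-\beta}},$$ where $\|\cdot\|_\beta$ is a norm of the component in $T_\beta$. For $\gamma>0$ the reconstruction $\mathbf R^{\mathsf M}\boldsymbol f$ of $\boldsymbol f\in\mathcal D^\gamma(T,\mathsf g)$ is the tempered distribution with $|\langle\mathbf R^{\mathsf M}\boldsymbol f-\mathsf\Pi_x^{\mathsf g}\boldsymbol f(x),p_t(x,\cdot)\rangle|\lesssim t^{\gamma/4}$ uniformly in $x$ and $0<t\le1$. Set, for $\tau\in\mathcal B$ (and by linearity on $T$), $$\mathcal J^{\mathsf M}(x)\tau=\sum_{|n|_{\mathfrak s}<|\tau|+2}\frac{X^n}{n!}\,\partial^n\mathbf K(\mathsf\Pi_x^{\mathsf g}\tau)(x),\qquad(\mathcal N^{\mathsf M}\boldsymbol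 f)(x)=\sum_{|\ell|_{\mathfrak s}<\gamma+2}\frac{X^\ell}{\ell!}\,\partial^\ell\mathbf K\big(\mathbf R^{\mathsf M}\boldsymbol f-\mathsf\Pi_x^{\mathsf g}\boldsymbol f(x)\big)(x),$$ $$(\mathcal K^{\mathsf M}\boldsymbol f)(x)=\big(\mathcal I+\mathcal J^{\mathsf M}(x)\big)\boldsymbol f(x)+(\mathcal N^{\mathsf M}\boldsymbol f)(x).$$ **Theorem.** Let $\gamma>0$ be a non-integer. Each $\boldsymbol f\in\mathcal D^\gamma(T,\mathsf g)$ has a unique reconstruction, the integrals that define $\mathcal J^{\mathsf M}$ and $\mathcal N^{\mathsf M}$ converge, and $\mathcal K^{\mathsf M}$ is a continuous linear map from $\mathcal D^\gamma(T,\mathsf g)$ into $\mathcal D^{\gamma+2}(T,\mathsf g)$: there is a constant $C$ with $|||\mathcal K^{\mathsf M}\boldsymbol f|||_{\mathcal D^{\gamma+2}}\le C\,|||\boldsymbol f|||_{\mathcal D^\gamma}$ for all $\boldsymbol f\in\mathcal D^\gamma(T,\mathsf g)$. Moreover $\mathbf K(\mathbf R^{\mathsf M}\boldsymbol f)=\mathbf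 R^{\mathsf M}(\mathcal K^{\mathsf M}\boldsymbol f)$ for all $\boldsymbol f\in\mathcal D^\gamma(T,\mathsf g)$. -/

import Mathlib

noncomputable section

namespace RegStruct

open scoped SchwartzMap FourierTransform LineDeriv TensorProduct ENNReal NNReal
open MeasureTheory

/-! ### Space-time, multi-indices and the parabolic distance -/

/-- Space-time `ℝ × ℝᵈ`: the coordinate `0` is time, the coordinates `1, …, d` are space. -/
abbrev Spacetime (d : ℕ) : Type := EuclideanSpace ℝ (Fin (d + 1))

/-- Multi-indices `n ∈ ℕ × ℕᵈ`. -/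
abbrev MIdx (d : ℕ) : Type := Fin (d + 1) → ℕ

/-- The scaled degree `2 n₀ + n₁ + ⋯ + n_d`. -/
def sdeg {d : ℕ} (n : MIdx d) : ℕ := 2 * n 0 + ∑ i : Fin d, n i.succ

/-- `n! = n₀! n₁! ⋯ n_d!`. -/
def mfact {d : ℕ} (n : MIdx d) : ℕ := ∏ i, (n i).factorial

/-- The binomial coefficient of two multi-indices. -/
def mchoose {d : ℕ} (n l : MIdx d) : ℕ := ∏ i, (n i).choose (l i)

/-- The monomial `xⁿ`. -/
def mpow {d : ℕ} (x : Spacetime d) (n : MIdx d) : ℝ := ∏ i, x i ^ n i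

/-- The canonical basis vector `e_i` of `ℕ × ℕᵈ`. -/
def unitIdx {d : ℕ} (i : Fin (d + 1)) : MIdx d := Pi.single i 1

/-- The parabolic distance `√|x₀ - y₀| + |x' - y'|`. -/
def pdist {d : ℕ} (x y : Spacetime d) : ℝ :=
  √|x 0 - y 0| + √(∑ i : Fin d, (x i.succ - y i.succ) ^ 2)

/-- The finite set of the multi-indices of scaled degree `< c`. -/
def belowDeg (d : ℕ) (c : ℝ) : Finset (MIdx d) :=
  (Finset.Iic (fun _ => ⌈c⌉₊)).filter (fun n => (sdeg n : ℝ) < c)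

theorem mem_belowDeg {d : ℕ} {c : ℝ} {n : MIdx d} : n ∈ belowDeg d c ↔ (sdeg n : ℝ) < c := by
  simp only [belowDeg, Finset.mem_filter, Finset.mem_Iic, and_iff_right_iff_imp]
  intro h i
  have h1 : n i ≤ sdeg n := by
    unfold sdeg
    refine Fin.cases ?_ (fun j => ?_) i
    · omega
    · have := Finset.single_le_sum (f := fun i : Fin d => n i.succ) (fun _ _ => Nat.zero_le _)
        (Finset.mem_univ j)
      omega
  have h2 : (n i : ℝ) ≤ (⌈c⌉₊ : ℝ) :=
    le_trans (by exact_mod_cast h1) (le_trans h.le (Nat.le_ceil c))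
  exact_mod_cast h2

/-! ### Heat kernels -/

/-- The Fourier symbol of `-(∂₀² - (Δ' - c)²)`, for the Fourier transform
`∫ exp (-2πi ⟨x, ξ⟩) f x dx`. -/
def heatExponent {d : ℕ} (c : ℝ) (ξ : Spacetime d) : ℝ :=
  (2 * Real.pi * ξ 0) ^ 2 + ((∑ i : Fin d, (2 * Real.pi * ξ i.succ) ^ 2) + c) ^ 2

theorem heatExponent_hasTemperateGrowth {d : ℕ} (c r : ℝ) :
    (fun ξ : Spacetime d => -(r * heatExponent c ξ)).HasTemperateGrowth := by
  have hi : ∀ i : Fin (d + 1), (fun ξ : Spacetime d => ξ i).HasTemperateGrowth := fun i =>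
    (EuclideanSpace.proj i : Spacetime d →L[ℝ] ℝ).hasTemperateGrowth
  unfold heatExponent
  fun_prop

theorem le_heatExponent {d : ℕ} {c : ℝ} (hc : 0 ≤ c) (ξ : Spacetime d) :
    ‖ξ‖ ^ 2 - 1 ≤ heatExponent c ξ := by
  have hpi : (1 : ℝ) ≤ (2 * Real.pi) ^ 2 := by nlinarith [Real.pi_gt_three]
  have hn : ‖ξ‖ ^ 2 = (ξ 0) ^ 2 + ∑ i : Fin d, (ξ i.succ) ^ 2 := by
    rw [EuclideanSpace.norm_sq_eq, Fin.sum_univ_succ]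
    simp
  have hs : (0 : ℝ) ≤ ∑ i : Fin d, (ξ i.succ) ^ 2 := Finset.sum_nonneg fun _ _ => sq_nonneg _
  have he : heatExponent c ξ = (2 * Real.pi) ^ 2 * (ξ 0) ^ 2 +
      ((2 * Real.pi) ^ 2 * (∑ i : Fin d, (ξ i.succ) ^ 2) + c) ^ 2 := by
    simp only [heatExponent, mul_pow, Finset.mul_sum]
  rw [he, hn]
  set s := ∑ i : Fin d, (ξ i.succ) ^ 2
  set a := (2 * Real.pi) ^ 2
  have h1 : (ξ 0) ^ 2 ≤ a * (ξ 0) ^ 2 := by nlinarith [sq_nonneg (ξ 0)]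
  have h2 : s ≤ a * s + c := by nlinarith
  nlinarith [sq_nonneg (a * s + c - 1)]

theorem heatSymbol_decay {d : ℕ} {c r : ℝ} (hc : 0 ≤ c) (hr : 0 < r) (k n : ℕ) :
    ∃ C : ℝ, ∀ ξ : Spacetime d,
      ‖ξ‖ ^ k * ‖iteratedFDeriv ℝ n (fun ξ => Real.exp (-(r * heatExponent c ξ))) ξ‖ ≤ C := by
  have hP := heatExponent_hasTemperateGrowth (d := d) c r
  obtain ⟨m, C, hC0, hC⟩ := hP.norm_iteratedFDeriv_le_uniform n
  set N := k + m * n with hN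
  refine ⟨(n.factorial : ℝ) * (1 + C) ^ n * ((N.factorial : ℝ) * Real.exp (1 + r + 1 / (4 * r))), fun ξ => ?_⟩
  set s := ‖ξ‖ with hs
  have hs0 : 0 ≤ s := norm_nonneg _
  have hD1 : 1 ≤ (1 + C) * (1 + s) ^ m :=
    one_le_mul_of_one_le_of_one_le (by linarith) (one_le_pow₀ (by linarith))
  have key : ‖iteratedFDeriv ℝ n (fun ξ => Real.exp (-(r * heatExponent c ξ))) ξ‖ ≤
      (n.factorial : ℝ) * Real.exp (-(r * heatExponent c ξ)) * ((1 + C) * (1 + s) ^ m) ^ n := by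
    refine norm_iteratedFDeriv_comp_le (N := (n : ℕ∞)) (g := Real.exp)
      (f := fun ξ : Spacetime d => -(r * heatExponent c ξ)) Real.contDiff_exp
      (hP.1.of_le (by exact_mod_cast le_top)) le_rfl ξ ?_ ?_
    · intro i _
      rw [norm_iteratedFDeriv_eq_norm_iteratedDeriv, iteratedDeriv_eq_iterate,
        Real.iter_deriv_exp, Real.norm_eq_abs, abs_of_pos (Real.exp_pos _)]
    · intro i h1 hi
      refine (hC i hi ξ).trans (le_trans ?_ (le_self_pow₀ hD1 (by omega)))
      gcongr
      linarith
  have hpow : (1 + s) ^ N ≤ (N.factorial : ℝ) * Real.exp (1 + s) := by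
    have := Real.pow_div_factorial_le_exp (1 + s) (by linarith) N
    rwa [div_le_iff₀ (by positivity), mul_comm] at this
  have hexp : Real.exp (1 + s) * Real.exp (-(r * heatExponent c ξ)) ≤
      Real.exp (1 + r + 1 / (4 * r)) := by
    rw [← Real.exp_add]
    apply Real.exp_le_exp.2
    have h1 := mul_le_mul_of_nonneg_left (le_heatExponent hc ξ) hr.le
    have h2 : s ≤ r * s ^ 2 + 1 / (4 * r) := by
      have h3 : r * s ^ 2 + 1 / (4 * r) - s = (2 * r * s - 1) ^ 2 / (4 * r) := by
        field_simp
        ring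
      have h4 : 0 ≤ (2 * r * s - 1) ^ 2 / (4 * r) := by positivity
      linarith
    nlinarith
  have hk : s ^ k * (1 + s) ^ (m * n) ≤ (1 + s) ^ N := by
    rw [hN, pow_add]
    gcongr
    linarith
  calc s ^ k * ‖iteratedFDeriv ℝ n (fun ξ => Real.exp (-(r * heatExponent c ξ))) ξ‖
      ≤ s ^ k * ((n.factorial : ℝ) * Real.exp (-(r * heatExponent c ξ)) * ((1 + C) * (1 + s) ^ m) ^ n) := by
        gcongr
    _ = (n.factorial : ℝ) * (1 + C) ^ n * ((s ^ k * (1 + s) ^ (m * n)) *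
          Real.exp (-(r * heatExponent c ξ))) := by
        rw [mul_pow, ← pow_mul]
        ring
    _ ≤ (n.factorial : ℝ) * (1 + C) ^ n * (((N.factorial : ℝ) * Real.exp (1 + s)) *
          Real.exp (-(r * heatExponent c ξ))) := by
        have := hk.trans hpow
        gcongr (n.factorial : ℝ) * (1 + C) ^ n * (?_ * _)
    _ ≤ (n.factorial : ℝ) * (1 + C) ^ n * ((N.factorial : ℝ) * Real.exp (1 + r + 1 / (4 * r))) := by
        rw [mul_assoc (N.factorial : ℝ)]
        gcongr

/-- The Gaussian-type symbol `exp (-r ((2πξ₀)² + (|2πξ'|² + c)²))` of `exp (r (∂₀² - (Δ' - c)²))`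
as a Schwartz function. -/
def heatSymbol (d : ℕ) {c r : ℝ} (hc : 0 ≤ c) (hr : 0 < r) : 𝓢(Spacetime d, ℝ) where
  toFun ξ := Real.exp (-(r * heatExponent c ξ))
  smooth' := Real.contDiff_exp.comp (heatExponent_hasTemperateGrowth c r).1
  decay' k n := heatSymbol_decay hc hr k n

/-- The convolution kernel of `exp (r (∂₀² - (Δ' - c)²))` (for `r > 0` and `c ≥ 0`; the value `0`
for other parameters is never used). It is the inverse Fourier transform of `heatSymbol`, which is
real since the symbol is even. -/
def heatKernel (d : ℕ) (c r : ℝ) : 𝓢(Spacetime d, ℝ) :=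
  if h : 0 ≤ c ∧ 0 < r then
    SchwartzMap.postcompCLM Complex.reCLM
      (𝓕⁻ (SchwartzMap.postcompCLM (𝕜 := ℝ) Complex.ofRealCLM (heatSymbol d h.1 h.2)))
  else 0

/-- The partial derivative `∂_i`. -/
def pderiv {d : ℕ} (i : Fin (d + 1)) (φ : 𝓢(Spacetime d, ℝ)) : 𝓢(Spacetime d, ℝ) :=
  ∂_{EuclideanSpace.single i (1 : ℝ)} φ

/-- The partial derivative `∂ⁿ = ∂₀^{n₀} ⋯ ∂_d^{n_d}`. -/
def mderiv {d : ℕ} (n : MIdx d) (φ : 𝓢(Spacetime d, ℝ)) : 𝓢(Spacetime d, ℝ) :=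
  (List.finRange (d + 1)).foldr (fun i ψ => (pderiv i)^[n i] ψ) φ

/-- The function `y ↦ φ (x - y)`. -/
def reflectAt {d : ℕ} (x : Spacetime d) (φ : 𝓢(Spacetime d, ℝ)) : 𝓢(Spacetime d, ℝ) :=
  SchwartzMap.compSubConstCLM ℝ x
    (SchwartzMap.compCLMOfContinuousLinearEquiv ℝ (ContinuousLinearEquiv.neg ℝ) φ)

theorem reflectAt_apply {d : ℕ} (x y : Spacetime d) (φ : 𝓢(Spacetime d, ℝ)) :
    reflectAt x φ y = φ (x - y) := by
  simp [reflectAt]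

/-- The function `p_t(x, ·)`, where `p_t` is the kernel of `exp (t (∂₀² - Δ'²))`. -/
def pKer {d : ℕ} (t : ℝ) (x : Spacetime d) : 𝓢(Spacetime d, ℝ) :=
  reflectAt x (heatKernel d 0 t)

/-- The convolution kernel of `K_r = -(∂₀ + Δ' - 1) exp (r (∂₀² - (Δ' - 1)²))`. -/
def qConv (d : ℕ) (r : ℝ) : 𝓢(Spacetime d, ℝ) :=
  -(pderiv 0 (heatKernel d 1 r) +
    (∑ i : Fin d, pderiv i.succ (pderiv i.succ (heatKernel d 1 r))) - heatKernel d 1 r)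

/-- The function `∂ⁿ_x q_r(x, ·)`, where `q_r(x, y)` is the kernel of `K_r`. -/
def qKer {d : ℕ} (n : MIdx d) (r : ℝ) (x : Spacetime d) : 𝓢(Spacetime d, ℝ) :=
  reflectAt x (mderiv n (qConv d r))

/-! ### Tempered distributions and the operator `K` -/

/-- Real tempered distributions on space-time. -/
abbrev Distr (d : ℕ) : Type := 𝓢(Spacetime d, ℝ) →L[ℝ] ℝ

/-- The number `(∂ⁿ K ζ)(x) = ∫₀¹ ⟨ζ, ∂ⁿ_x q_r(x, ·)⟩ dr - (e - 1) ⟨ζ, ∂ⁿ_x q_1(x, ·)⟩`. -/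
def dKAt {d : ℕ} (n : MIdx d) (ζ : Distr d) (x : Spacetime d) : ℝ :=
  (∫ r in (0 : ℝ)..1, ζ (qKer n r x)) - (Real.exp 1 - 1) * ζ (qKer n 1 x)

/-- The convergence of the integral that defines `(∂ⁿ K ζ)(x)`. -/
def dKAtConverges {d : ℕ} (n : MIdx d) (ζ : Distr d) (x : Spacetime d) : Prop :=
  IntervalIntegrable (fun r => ζ (qKer n r x)) volume 0 1

/-- The distribution `K_r ζ`, that is, the function `x ↦ ⟨ζ, q_r(x, ·)⟩`, tested against `φ`. -/
def KrDistr {d : ℕ} (r : ℝ) (ζ : Distr d) (φ : 𝓢(Spacetime d, ℝ)) : ℝ :=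
  ∫ x, φ x * ζ (qKer 0 r x)

/-- The distribution `K ζ`, with `K = ∫₀¹ K_r dr - (e - 1) K_1`, tested against `φ`. -/
def KDistr {d : ℕ} (ζ : Distr d) (φ : 𝓢(Spacetime d, ℝ)) : ℝ :=
  (∫ r in (0 : ℝ)..1, KrDistr r ζ φ) - (Real.exp 1 - 1) * KrDistr 1 ζ φ

/-! ### Concrete regularity structures -/

/-- A concrete regularity structure: a connected graded bialgebra `Tp` (that is, `T⁺`) and a graded
right comodule `T` over it, with homogeneous bases indexed by `κ` and `ι`. The set of the
homogeneities of `T` is bounded below and locally finite with finite dimensional homogeneous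
spaces, which is `finite_lt`. -/
structure RegularityStructure (ι κ T Tp : Type*) [AddCommGroup T] [Module ℝ T]
    [CommRing Tp] [Bialgebra ℝ Tp] where
  /-- the homogeneous basis of `T` -/
  basis : Module.Basis ι ℝ T
  /-- the homogeneity of the basis elements of `T` -/
  deg : ι → ℝ
  /-- the homogeneous basis of `T⁺` -/
  basisP : Module.Basis κ ℝ Tp
  /-- the homogeneity of the basis elements of `T⁺` -/
  degP : κ → ℝ
  finite_lt : ∀ c : ℝ, {τ | deg τ < c}.Finite
  degP_nonneg : ∀ μ, 0 ≤ degP μ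
  connected : Submodule.span ℝ (basisP '' {μ | degP μ = 0}) = Submodule.span ℝ {1}
  mul_graded : ∀ μ ν, basisP μ * basisP ν ∈
    Submodule.span ℝ (basisP '' {η | degP η = degP μ + degP ν})
  comul_graded : ∀ μ, Coalgebra.comul (R := ℝ) (basisP μ) ∈
    Submodule.span ℝ {z | ∃ η ν, degP η + degP ν = degP μ ∧ z = basisP η ⊗ₜ[ℝ] basisP ν}
  /-- the splitting map of `T` -/
  Δ : T →ₗ[ℝ] T ⊗[ℝ] Tp
  Δ_coassoc : (TensorProduct.assoc ℝ T Tp Tp).toLinearMap ∘ₗ Δ.rTensor Tp ∘ₗ Δ =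
    (Coalgebra.comul (R := ℝ) (A := Tp)).lTensor T ∘ₗ Δ
  Δ_counit : (TensorProduct.rid ℝ T).toLinearMap ∘ₗ
    (Coalgebra.counit (R := ℝ) (A := Tp)).lTensor T ∘ₗ Δ = LinearMap.id
  Δ_graded : ∀ τ, Δ (basis τ) ∈
    Submodule.span ℝ {z | ∃ σ μ, deg σ + degP μ = deg τ ∧ z = basis σ ⊗ₜ[ℝ] basisP μ}

section

variable {d : ℕ} {ι κ T Tp : Type*} [AddCommGroup T] [Module ℝ T] [CommRing Tp] [Bialgebra ℝ Tp]

/-- The homogeneous subspace `T_β`. -/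
def RegularityStructure.hom (𝒯 : RegularityStructure ι κ T Tp) (β : ℝ) : Submodule ℝ T :=
  Submodule.span ℝ (𝒯.basis '' {τ | 𝒯.deg τ = β})

/-- The homogeneous subspace `T⁺_α`. -/
def RegularityStructure.homP (𝒯 : RegularityStructure ι κ T Tp) (α : ℝ) : Submodule ℝ Tp :=
  Submodule.span ℝ (𝒯.basisP '' {μ | 𝒯.degP μ = α})

/-- The subspace `T_{<γ}`. -/
def RegularityStructure.below (𝒯 : RegularityStructure ι κ T Tp) (γ : ℝ) : Submodule ℝ T :=
  Submodule.span ℝ (𝒯.basis '' {τ | 𝒯.deg τ < γ})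

/-- The norm on `T_β` (the maximum of the coefficients), applied to the component in `T_β` of `v`. -/
def RegularityStructure.homNorm (𝒯 : RegularityStructure ι κ T Tp) (β : ℝ) (v : T) : ℝ≥0∞ :=
  ⨆ (τ : ι) (_ : 𝒯.deg τ = β), ‖𝒯.basis.repr v τ‖ₑ

/-! ### Assumptions on the regularity structure -/

/-- The regularity structure contains the polynomial one: the basis elements of `T` and `T⁺` of
homogeneity a natural number are exactly the monomials `Xⁿ` and `X₊ⁿ`. -/
structure PolynomialPart (d : ℕ) (𝒯 : RegularityStructure ι κ T Tp) where
  /-- the index of `Xⁿ` -/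
  X : MIdx d → ι
  /-- the index of `X₊ⁿ` -/
  Xp : MIdx d → κ
  X_injective : Function.Injective X
  Xp_injective : Function.Injective Xp
  X_deg : ∀ a : ℕ, {τ | 𝒯.deg τ = a} = X '' {n | sdeg n = a}
  Xp_deg : ∀ a : ℕ, {μ | 𝒯.degP μ = a} = Xp '' {n | sdeg n = a}
  Xp_prod : ∀ n, 𝒯.basisP (Xp n) = ∏ i, 𝒯.basisP (Xp (unitIdx i)) ^ n i
  comul_Xp : ∀ n, Coalgebra.comul (R := ℝ) (𝒯.basisP (Xp n)) =
    ∑ l ∈ Finset.Iic n, (mchoose n l : ℝ) • (𝒯.basisP (Xp l) ⊗ₜ[ℝ] 𝒯.basisP (Xp (n - l)))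
  Δ_X : ∀ n, 𝒯.Δ (𝒯.basis (X n)) =
    ∑ l ∈ Finset.Iic n, (mchoose n l : ℝ) • (𝒯.basis (X l) ⊗ₜ[ℝ] 𝒯.basisP (Xp (n - l)))

/-- The product of `T_X` and `T`: `star n τ` is `Xⁿ ⋆ τ`, extended by linearity in `Xⁿ`. -/
structure PolynomialProduct {𝒯 : RegularityStructure ι κ T Tp} (P : PolynomialPart d 𝒯) where
  star : MIdx d → T →ₗ[ℝ] T
  star_graded : ∀ n τ, star n (𝒯.basis τ) ∈ 𝒯.hom (sdeg n + 𝒯.deg τ)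
  one_star : ∀ v, star 0 v = v
  X_star_X : ∀ n l, star n (𝒯.basis (P.X l)) = 𝒯.basis (P.X (n + l))

/-- The index set of the symbols `I⁺_n τ`: the basis elements `τ` of `T` that are not monomials, and
the `n` with `|τ| + 2 - |n| > 0`. -/
def IntegralSymbol {𝒯 : RegularityStructure ι κ T Tp} (P : PolynomialPart d 𝒯) : Type _ :=
  {s : ι × MIdx d // s.1 ∉ Set.range P.X ∧ 0 < 𝒯.deg s.1 + 2 - sdeg s.2}

/-- The abstract integration operators: `Ip n` is `I⁺_n : T → T⁺` and `I n`, for `|n| ≤ 1`, is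
`I_n : T → T`. They vanish on polynomials, and `I⁺_n τ` vanishes if `|τ| + 2 - |n| ≤ 0`. -/
structure IntegrationOperators {𝒯 : RegularityStructure ι κ T Tp} (P : PolynomialPart d 𝒯) where
  Ip : MIdx d → T →ₗ[ℝ] Tp
  Ip_X : ∀ n k, Ip n (𝒯.basis (P.X k)) = 0
  Ip_eq_zero : ∀ n τ, 𝒯.deg τ + 2 - sdeg n ≤ 0 → Ip n (𝒯.basis τ) = 0
  Ip_graded : ∀ n τ, Ip n (𝒯.basis τ) ∈ 𝒯.homP (𝒯.deg τ + 2 - sdeg n)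
  /-- the basis of `T⁺` is the free commutative monoid on the `X₊^{e_i}` and the `I⁺_n τ` -/
  free : ∃ e : (Fin (d + 1) ⊕ IntegralSymbol P →₀ ℕ) ≃ κ, ∀ m,
    𝒯.basisP (e m) = m.prod fun s k =>
      (Sum.elim (fun i => 𝒯.basisP (P.Xp (unitIdx i)))
        (fun s => Ip s.1.2 (𝒯.basis s.1.1)) s) ^ k
  comul_Ip : ∀ n τ, Coalgebra.comul (R := ℝ) (Ip n (𝒯.basis τ)) =
    (Ip n).rTensor Tp (𝒯.Δ (𝒯.basis τ)) +
      ∑ l ∈ belowDeg d (𝒯.deg τ + 2 - sdeg n),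
        ((mfact l : ℝ)⁻¹ • 𝒯.basisP (P.Xp l)) ⊗ₜ[ℝ] Ip (n + l) (𝒯.basis τ)
  I : MIdx d → T →ₗ[ℝ] T
  I_X : ∀ n, sdeg n ≤ 1 → ∀ k, I n (𝒯.basis (P.X k)) = 0
  I_graded : ∀ n, sdeg n ≤ 1 → ∀ τ, I n (𝒯.basis τ) ∈ 𝒯.hom (𝒯.deg τ + 2 - sdeg n)
  Δ_I : ∀ n, sdeg n ≤ 1 → ∀ τ, 𝒯.Δ (I n (𝒯.basis τ)) =
    (I n).rTensor Tp (𝒯.Δ (𝒯.basis τ)) +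
      ∑ l ∈ belowDeg d (𝒯.deg τ + 2 - sdeg n),
        ((mfact l : ℝ)⁻¹ • 𝒯.basis (P.X l)) ⊗ₜ[ℝ] Ip (n + l) (𝒯.basis τ)

/-! ### Models -/

/-- The inverse of a character of `T⁺` for the convolution product of the dual of `T⁺`. Every
character of a connected graded bialgebra is invertible. -/
def charInv (g : Tp →ₐ[ℝ] ℝ) : WithConv (Tp →ₗ[ℝ] ℝ) :=
  Ring.inverse (WithConv.toConv g.toLinearMap)

/-- `g_{yx} = g_y * g_x⁻¹`. -/
def transChar (g : Spacetime d → (Tp →ₐ[ℝ] ℝ)) (y x : Spacetime d) : Tp →ₗ[ℝ] ℝ :=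
  (WithConv.toConv (g y).toLinearMap * charInv (g x)).ofConv

/-- The map `ĝ = (Id ⊗ g) Δ : T → T`. -/
def RegularityStructure.hat (𝒯 : RegularityStructure ι κ T Tp) (g : Tp →ₗ[ℝ] ℝ) : T →ₗ[ℝ] T :=
  (TensorProduct.rid ℝ T).toLinearMap ∘ₗ g.lTensor T ∘ₗ 𝒯.Δ

/-- The map `Π_x^g = (Π ⊗ g_x⁻¹) Δ`. -/
def recenter (𝒯 : RegularityStructure ι κ T Tp) (Pi : T →ₗ[ℝ] Distr d)
    (g : Spacetime d → (Tp →ₐ[ℝ] ℝ)) (x : Spacetime d) : T →ₗ[ℝ] Distr d :=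
  (TensorProduct.rid ℝ (Distr d)).toLinearMap ∘ₗ
    TensorProduct.map Pi (charInv (g x)).ofConv ∘ₗ 𝒯.Δ

/-- A model over a regularity structure. -/
structure Model (d : ℕ) (𝒯 : RegularityStructure ι κ T Tp) where
  g : Spacetime d → (Tp →ₐ[ℝ] ℝ)
  Pi : T →ₗ[ℝ] Distr d
  g_bound : ∀ μ, ∃ C : ℝ, ∀ x y : Spacetime d,
    |transChar g y x (𝒯.basisP μ)| ≤ C * pdist y x ^ 𝒯.degP μ
  Pi_bound : ∀ τ, ∃ C : ℝ, ∀ (x : Spacetime d) (t : ℝ), 0 < t → t ≤ 1 →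
    |recenter 𝒯 Pi g x (𝒯.basis τ) (pKer t x)| ≤ C * t ^ (𝒯.deg τ / 4)

namespace Model

variable {𝒯 : RegularityStructure ι κ T Tp} (M : Model d 𝒯)

/-- `Π_x^g`. -/
def PiAt (x : Spacetime d) : T →ₗ[ℝ] Distr d := recenter 𝒯 M.Pi M.g x

/-- The transition map from `x` to `y`, the hat map of `g_{yx}`. -/
def trans (y x : Spacetime d) : T →ₗ[ℝ] T := 𝒯.hat (transChar M.g y x)

/-- The restriction of the model to the polynomials is the canonical one. -/
def IsCanonical (P : PolynomialPart d 𝒯) : Prop :=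
  (∀ n (φ : 𝓢(Spacetime d, ℝ)), M.Pi (𝒯.basis (P.X n)) φ = ∫ y, mpow y n * φ y) ∧
    ∀ n x, M.g x (𝒯.basisP (P.Xp n)) = mpow x n

/-- `K`-admissibility: `Π (I τ) = K (Π τ)` for all basis elements `τ` that are not monomials (`I`
vanishes on these), and `Π (Xⁿ ⋆ τ) = xⁿ Π τ` for all `τ` (here `xⁿ Π τ` is the product of a
tempered distribution and a polynomial). -/
def IsAdmissible {P : PolynomialPart d 𝒯} (S : PolynomialProduct P)
    (A : IntegrationOperators P) : Prop :=
  (∀ τ ∉ Set.range P.X, ∀ φ : 𝓢(Spacetime d, ℝ),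
    M.Pi (A.I 0 (𝒯.basis τ)) φ = KDistr (M.Pi (𝒯.basis τ)) φ) ∧
  ∀ n τ (φ : 𝓢(Spacetime d, ℝ)), M.Pi (S.star n (𝒯.basis τ)) φ =
    M.Pi (𝒯.basis τ) (SchwartzMap.smulLeftCLM ℝ (fun x : Spacetime d => mpow x n) φ)

/-! ### Modelled distributions -/

/-- `sup_{β < γ} sup_x ‖f x‖_β`. -/
def supNorm (γ : ℝ) (f : Spacetime d → T) : ℝ≥0∞ :=
  ⨆ (β : ℝ) (_ : β < γ) (x : Spacetime d), 𝒯.homNorm β (f x)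

/-- `sup_{β < γ} sup_{x, y} ‖f y - ĝ_{yx} (f x)‖_β / d(y, x)^{γ - β}`. -/
def holderNorm (γ : ℝ) (f : Spacetime d → T) : ℝ≥0∞ :=
  ⨆ (β : ℝ) (_ : β < γ) (x : Spacetime d) (y : Spacetime d),
    𝒯.homNorm β (f y - M.trans y x (f x)) / ENNReal.ofReal (pdist y x ^ (γ - β))

/-- The norm of the space of modelled distributions. -/
def modelledNorm (γ : ℝ) (f : Spacetime d → T) : ℝ≥0∞ :=
  supNorm (𝒯 := 𝒯) γ f + M.holderNorm γ f

/-- The space `D^γ(T, g)` of modelled distributions. -/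
def modelled (γ : ℝ) : Set (Spacetime d → T) :=
  {f | (∀ x, f x ∈ 𝒯.below γ) ∧ M.modelledNorm γ f < ⊤}

/-- `Λ` is a reconstruction of `f`:
`|⟨Λ - Π_x f(x), p_t(x, ·)⟩| ≲ t^{γ/4}` uniformly in `x` and `0 < t ≤ 1`. -/
def IsReconstruction (γ : ℝ) (f : Spacetime d → T) (Λ : Distr d) : Prop :=
  ∃ C : ℝ, ∀ (x : Spacetime d) (t : ℝ), 0 < t → t ≤ 1 →
    |(Λ - M.PiAt x (f x)) (pKer t x)| ≤ C * t ^ (γ / 4)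

open Classical in
/-- The reconstruction operator on `D^γ(T, g)`, `γ > 0`: the reconstruction of `f`, which exists and
is unique for `f ∈ D^γ(T, g)` (and `0` where there is none). -/
def R (γ : ℝ) (f : Spacetime d → T) : Distr d :=
  if h : ∃ Λ, M.IsReconstruction γ f Λ then h.choose else 0

/-! ### The lift of the operator `K` -/

/-- `J(x) τ = ∑_{|n| < |τ| + 2} Xⁿ / n! (∂ⁿ K (Π_x τ))(x)` for the basis elements `τ`. -/
def J (P : PolynomialPart d 𝒯) (x : Spacetime d) : T →ₗ[ℝ] T :=
  𝒯.basis.constr ℝ fun τ => ∑ n ∈ belowDeg d (𝒯.deg τ + 2),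
    ((mfact n : ℝ)⁻¹ * dKAt n (M.PiAt x (𝒯.basis τ)) x) • 𝒯.basis (P.X n)

/-- `(N f)(x) = ∑_{|l| < γ + 2} X^l / l! (∂^l K (R f - Π_x f(x)))(x)`. -/
def N (P : PolynomialPart d 𝒯) (γ : ℝ) (f : Spacetime d → T) (x : Spacetime d) : T :=
  ∑ l ∈ belowDeg d (γ + 2),
    ((mfact l : ℝ)⁻¹ * dKAt l (M.R γ f - M.PiAt x (f x)) x) • 𝒯.basis (P.X l)

/-- `(𝒦 f)(x) = (I + J(x)) f(x) + (N f)(x)`. -/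
def K {P : PolynomialPart d 𝒯} (A : IntegrationOperators P) (γ : ℝ) (f : Spacetime d → T)
    (x : Spacetime d) : T :=
  (A.I 0 + M.J P x) (f x) + M.N P γ f x

end Model

end

end RegStruct

end

noncomputable section

namespace RegStruct

open scoped SchwartzMap FourierTransform LineDeriv TensorProduct ENNReal NNReal
open MeasureTheory

/-! ### Translations of Schwartz functions -/

section Translation

variable {V : Type*} [NormedAddCommGroup V] [NormedSpace ℝ V]

/-! The whole estimate is one scaling count. Times are written `t = c ^ 4`, so that `c` is a
parabolic length, and a distribution is measured near `x` by testing it against the heat kernel at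
every point `y` and every scale `c ≤ 1` (`HasOrder`). The semigroup law `sconv_gauss` and the
scaling `gauss_scale` turn such a bound of order `γ` into the bound `c ^ (γ - |n| - 2)` for `∂ⁿ K_r
ζ` at `x`, where `r = c ^ 4` (`HasOrder.exists_qKer_le`). Hence the integral over `r` converges for
`|n| < γ + 2`, and two orders are gained. The recentered `Π_x τ` has order `|τ|` at `x`, and `R f -
Π_x f(x)` has order `γ` at `x` (`exists_hasOrder_PiAt`, `exists_hasOrder_sub`).

Reconstruction. The functions `F_t(x) = ⟨Π_x f(x), p_t(x, ·)⟩` almost form a semigroup orbit: `p_u *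
F_s` equals `F_{s+u}` up to `(s + u) ^ (γ / 4)` (`exists_germ_semigroup`). Since all homogeneities
exceed `-2`, `F_s` blows up more slowly than `s ^ (-1/2)`, while replacing a test function by its
convolution with `p_s` costs only `s ^ (1/2)`. So the `F_s` with `s = 2 ^ (-j)` are Cauchy as
distributions, and their limit is the reconstruction (`exists_reconstruction`).

Algebra. Modulo polynomials, `Π_x (I + J(x)) = K Π_x` is admissibility combined with the coaction
formula for `I`. The polynomial that remains is determined by its derivatives at `x`, which are read
off by testing against `∂ⁿ p_t(x, ·)` as `t → 0`; by `HasOrder.tendsto_Kop` they are the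
coefficients of `J(x)` (`PiAt_I_add_J`). The same principle shows that `I + J` intertwines the
transition maps (`trans_I_add_J`).

Hölder bound. By this intertwining the increment of the lift between `x` and `y` is `I` applied to
the increment of `f`, plus a polynomial. The coefficient of each `Xⁿ / n!` in that polynomial is the
average `∫₀¹ E(r) dr - (e - 1) E(1)` of an integrand that is estimated differently below and above
the scale `D = d(y, x)` (`exists_liftIntegrand_le`). Below `D` every term is bounded separately.
Above `D` the terms regroup into an anisotropic Taylor remainder and the terms with `|σ| + 2 ≤ |n|`.
A borderline exponent would give a logarithm; it is excluded because `γ` is not an integer, because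
non-monomial homogeneities are not integers (`IntegrationOperators.deg_ne_int`), and because `∂ⁿ`
kills monomials of lower degree. The summation over scales is `abs_integral_sub_le`.

Intertwining. `K (R f) - Π_x (𝒦 f)(x)` is `K` applied to `R f - Π_x f(x)`, minus its Taylor
polynomial at `x`. The same two regimes, now around the scale `t ^ (1/4)`, show that it has order `γ
+ 2`. So `K (R f)` is a reconstruction of `𝒦 f`, and uniqueness concludes. -/

/-- A continuous seminorm of `ψ` that bounds `(1 + ‖x‖)^k ‖D^n ψ x‖`. -/
def weightNorm (k n : ℕ) (ψ : 𝓢(V, ℝ)) : ℝ :=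
  2 ^ k * (Finset.Iic (k, n)).sup (fun m : ℕ × ℕ => SchwartzMap.seminorm ℝ m.1 m.2) ψ

theorem weightNorm_nonneg (k n : ℕ) (ψ : 𝓢(V, ℝ)) : 0 ≤ weightNorm k n ψ := by
  unfold weightNorm; positivity

theorem le_weightNorm (k n : ℕ) (ψ : 𝓢(V, ℝ)) (x : V) :
    (1 + ‖x‖) ^ k * ‖iteratedFDeriv ℝ n ψ x‖ ≤ weightNorm k n ψ :=
  SchwartzMap.one_add_le_sup_seminorm_apply (𝕜 := ℝ) (m := (k, n)) le_rfl le_rfl ψ x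

theorem abs_le_weightNorm (k : ℕ) (ψ : 𝓢(V, ℝ)) (x : V) :
    (1 + ‖x‖) ^ k * |ψ x| ≤ weightNorm k 0 ψ := by
  simpa using le_weightNorm k 0 ψ x

theorem norm_pow_le_translate {E : Type*} [NormedAddCommGroup E] (k : ℕ) (y w : E) {c : ℝ} (hc : ‖w‖ ≤ c) :
    ‖y‖ ^ k ≤ (1 + c) ^ k * (1 + ‖y - w‖) ^ k := by
  rw [← mul_pow]
  have h1 : ‖y‖ ≤ ‖w‖ + ‖y - w‖ := by simpa using norm_add_le w (y - w)
  have h0 := norm_nonneg w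
  have h2 := norm_nonneg (y - w)
  gcongr
  nlinarith

/-- The translate `y ↦ ψ (y - w)`. -/
abbrev translate (w : V) : 𝓢(V, ℝ) →L[ℝ] 𝓢(V, ℝ) := SchwartzMap.compSubConstCLM ℝ w

/-- The weight at `y` is at most a power of `1 + ‖w‖` times the weight at `y - w`. So translation
costs only polynomial growth in `w`, which is what later makes `w ↦ ζ (translate w ψ)` polynomially
bounded. -/
theorem seminorm_translate_le (k n : ℕ) (ψ : 𝓢(V, ℝ)) (w : V) :
    SchwartzMap.seminorm ℝ k n (translate w ψ) ≤ (1 + ‖w‖) ^ k * weightNorm k n ψ := by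
  refine SchwartzMap.seminorm_le_bound _ _ _ _
    (mul_nonneg (by positivity) (weightNorm_nonneg _ _ _)) fun y => ?_
  have h : iteratedFDeriv ℝ n (translate w ψ) y = iteratedFDeriv ℝ n ψ (y - w) := by
    have : (translate w ψ : V → ℝ) = fun y => ψ (y - w) := by ext; simp
    rw [this, iteratedFDeriv_comp_sub]
  rw [h]
  calc _ ≤ ((1 + ‖w‖) ^ k * (1 + ‖y - w‖) ^ k) * ‖iteratedFDeriv ℝ n ψ (y - w)‖ := by
        gcongr; exact norm_pow_le_translate k y w le_rfl
    _ = (1 + ‖w‖) ^ k * ((1 + ‖y - w‖) ^ k * ‖iteratedFDeriv ℝ n ψ (y - w)‖) := by ring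
    _ ≤ _ := by gcongr; exact le_weightNorm _ _ _ _

/-- Mean value inequality for the `n`-th derivative on the segment from `y - w'` to `y - w`. Every
point of it is `y` minus a vector of norm at most `‖w‖ + ‖w'‖`, so one weight serves for the whole
segment. -/
theorem seminorm_translate_sub_le (k n : ℕ) (ψ : 𝓢(V, ℝ)) (w w' : V) :
    SchwartzMap.seminorm ℝ k n (translate w ψ - translate w' ψ) ≤
      ‖w - w'‖ * ((1 + (‖w‖ + ‖w'‖)) ^ k * weightNorm k (n + 1) ψ) := by
  have hW := weightNorm_nonneg k (n + 1) ψ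
  refine SchwartzMap.seminorm_le_bound _ _ _ _ (by positivity) fun y => ?_
  have h : iteratedFDeriv ℝ n (translate w ψ - translate w' ψ : 𝓢(V, ℝ)) y =
      iteratedFDeriv ℝ n ψ (y - w) - iteratedFDeriv ℝ n ψ (y - w') := by
    have e : ∀ w, (translate w ψ : V → ℝ) = fun y => ψ (y - w) := fun w => by ext; simp
    have : ((translate w ψ - translate w' ψ : 𝓢(V, ℝ)) : V → ℝ) =
        (translate w ψ : V → ℝ) - (translate w' ψ : V → ℝ) := by ext; simp
    rw [this, iteratedFDeriv_sub_apply ((translate w ψ).contDiffAt n)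
      ((translate w' ψ).contDiffAt n), e, e, iteratedFDeriv_comp_sub, iteratedFDeriv_comp_sub]
  rw [h]
  have hd : Differentiable ℝ (iteratedFDeriv ℝ n ψ) :=
    (ψ.smooth ⊤).differentiable_iteratedFDeriv (mod_cast ENat.natCast_lt_top n)
  -- The bound on the segment is obtained by dividing by `‖y‖ ^ k`, so the case where this factor
  -- vanishes is treated apart.
  rcases eq_or_lt_of_le (pow_nonneg (norm_nonneg y) k) with h0 | h0
  · rw [← h0, zero_mul]; positivity
  have key : ‖iteratedFDeriv ℝ n ψ (y - w) - iteratedFDeriv ℝ n ψ (y - w')‖ ≤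
      ((1 + (‖w‖ + ‖w'‖)) ^ k * weightNorm k (n + 1) ψ / ‖y‖ ^ k) * ‖(y - w) - (y - w')‖ := by
    refine Convex.norm_image_sub_le_of_norm_fderiv_le (s := segment ℝ (y - w') (y - w))
      (fun z _ => hd z) ?_ (convex_segment _ _) (left_mem_segment _ _ _)
      (right_mem_segment _ _ _)
    intro z hz
    rw [norm_fderiv_iteratedFDeriv, le_div_iff₀ h0]
    obtain ⟨a, b, ha, hb, hab, rfl⟩ := hz
    set z := a • (y - w') + b • (y - w) with hzdef
    have hz : z = y - (a • w' + b • w) := by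
      rw [hzdef]
      have : y = a • y + b • y := by rw [← add_smul, hab, one_smul]
      nth_rewrite 3 [this]
      module
    have hwn : ‖a • w' + b • w‖ ≤ ‖w‖ + ‖w'‖ := by
      refine (norm_add_le _ _).trans ?_
      rw [norm_smul, norm_smul, Real.norm_of_nonneg ha, Real.norm_of_nonneg hb]
      nlinarith [norm_nonneg w, norm_nonneg w']
    have h1 := norm_pow_le_translate k y _ hwn
    rw [← hz] at h1
    calc _ ≤ ‖iteratedFDeriv ℝ (n + 1) ψ z‖ * ((1 + (‖w‖ + ‖w'‖)) ^ k * (1 + ‖z‖) ^ k) := by gcongr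
      _ = (1 + (‖w‖ + ‖w'‖)) ^ k * ((1 + ‖z‖) ^ k * ‖iteratedFDeriv ℝ (n + 1) ψ z‖) := by ring
      _ ≤ _ := by gcongr; exact le_weightNorm _ _ _ _
  have e : (y - w) - (y - w') = -(w - w') := by abel
  rw [e, norm_neg, div_mul_eq_mul_div, le_div_iff₀ h0] at key
  linarith

theorem continuous_translate (ψ : 𝓢(V, ℝ)) : Continuous fun w => translate w ψ := by
  rw [continuous_iff_continuousAt]
  intro w₀
  refine ((schwartz_withSeminorms ℝ V ℝ).tendsto_nhds _ _).2 fun i ε hε => ?_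
  have h : Filter.Tendsto (fun w => ‖w - w₀‖ * ((1 + (‖w‖ + ‖w₀‖)) ^ i.1 * weightNorm i.1 (i.2 + 1) ψ))
      (nhds w₀) (nhds 0) := by
    have : Continuous fun w => ‖w - w₀‖ * ((1 + (‖w‖ + ‖w₀‖)) ^ i.1 * weightNorm i.1 (i.2 + 1) ψ) := by
      fun_prop
    simpa using this.tendsto w₀
  filter_upwards [h.eventually (gt_mem_nhds hε)] with w hw
  exact (seminorm_translate_sub_le i.1 i.2 ψ w w₀).trans_lt hw

theorem lineDerivOp_translate (m w : V) (ψ : 𝓢(V, ℝ)) :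
    ∂_{m} (translate w ψ) = translate w (∂_{m} ψ) := by
  ext x
  have : (translate w ψ : V → ℝ) = fun y => ψ (y - w) := by ext; simp
  simp [SchwartzMap.lineDerivOp_apply_eq_fderiv, this, fderiv_comp_sub]

theorem lineDerivOp_comm (v w : V) (ψ : 𝓢(V, ℝ)) : ∂_{v} (∂_{w} ψ) = ∂_{w} (∂_{v} ψ) := by
  have h : ∀ v w : V, ∀ x, ∂_{v} (∂_{w} ψ) x = iteratedFDeriv ℝ 2 ψ x ![v, w] := fun v w x => by
    rw [← SchwartzMap.iteratedLineDerivOp_eq_iteratedFDeriv,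
      LineDeriv.iteratedLineDerivOp_succ_left, LineDeriv.iteratedLineDerivOp_one]
    rfl
  ext x
  rw [h, h, iteratedFDeriv_two_apply, iteratedFDeriv_two_apply]
  exact (ψ.contDiffAt 2).isSymmSndFDerivAt (by simp) _ _

theorem iteratedLineDerivOp_lineDerivOp {n : ℕ} (m : Fin n → V) (v : V) (ψ : 𝓢(V, ℝ)) :
    ∂^{m} (∂_{v} ψ) = ∂_{v} (∂^{m} ψ) := by
  induction n generalizing ψ with
  | zero => rfl
  | succ n ih => rw [LineDeriv.iteratedLineDerivOp_succ_left, LineDeriv.iteratedLineDerivOp_succ_left,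
      ih, lineDerivOp_comm]

theorem iteratedLineDerivOp_translate {n : ℕ} (m : Fin n → V) (w : V) (ψ : 𝓢(V, ℝ)) :
    ∂^{m} (translate w ψ) = translate w (∂^{m} ψ) := by
  induction n generalizing ψ with
  | zero => rfl
  | succ n ih => rw [LineDeriv.iteratedLineDerivOp_succ_left, LineDeriv.iteratedLineDerivOp_succ_left,
      ih, lineDerivOp_translate]

end Translation

/-! ### Distributions and integrals of Schwartz functions -/

section Pettis

open scoped BoundedContinuousFunction

variable {V : Type*} [NormedAddCommGroup V] [NormedSpace ℝ V]

theorem exists_seminorm_bound (ζ : 𝓢(V, ℝ) →L[ℝ] ℝ) : ∃ (s : Finset (ℕ × ℕ)) (C : ℝ), 0 ≤ C ∧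
    ∀ φ, |ζ φ| ≤ C * s.sup (schwartzSeminormFamily ℝ V ℝ) φ := by
  obtain ⟨s, C, _, h⟩ := Seminorm.bound_of_continuous (schwartz_withSeminorms ℝ V ℝ)
    ((normSeminorm ℝ ℝ).comp ζ.toLinearMap) (continuous_norm.comp ζ.continuous)
  exact ⟨s, C, C.2, fun φ => h φ⟩

/-- The normed space of the `n`-linear forms. -/
def MForm (V : Type*) [NormedAddCommGroup V] [NormedSpace ℝ V] (n : ℕ) : Type _ := V [×n]→L[ℝ] ℝ

instance (n : ℕ) : NormedAddCommGroup (MForm V n) :=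
  inferInstanceAs (NormedAddCommGroup (V [×n]→L[ℝ] ℝ))

instance (n : ℕ) : NormedSpace ℝ (MForm V n) := inferInstanceAs (NormedSpace ℝ (V [×n]→L[ℝ] ℝ))

instance (n : ℕ) : CompleteSpace (MForm V n) := inferInstanceAs (CompleteSpace (V [×n]→L[ℝ] ℝ))

/-- Evaluation of an `n`-linear form. -/
def MForm.eval {n : ℕ} (m : Fin n → V) : MForm V n →L[ℝ] ℝ :=
  ContinuousMultilinearMap.apply ℝ (fun _ : Fin n => V) ℝ m

theorem MForm.ext_eval {n : ℕ} {a b : MForm V n} (h : ∀ m, MForm.eval m a = MForm.eval m b) : a = b :=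
  ContinuousMultilinearMap.ext h

/-- The `n`-th derivative, as an `n`-linear form. -/
def mform (n : ℕ) (φ : 𝓢(V, ℝ)) (y : V) : MForm V n := iteratedFDeriv ℝ n φ y

theorem eval_mform {n : ℕ} (m : Fin n → V) (φ : 𝓢(V, ℝ)) (y : V) :
    MForm.eval m (mform n φ y) = (∂^{m} φ) y :=
  SchwartzMap.iteratedLineDerivOp_eq_iteratedFDeriv.symm

theorem mform_add (n : ℕ) (φ ψ : 𝓢(V, ℝ)) (y : V) :
    mform n (φ + ψ) y = mform n φ y + mform n ψ y :=
  MForm.ext_eval fun m => by simp [eval_mform, LineDeriv.iteratedLineDerivOp_add]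

theorem mform_smul (n : ℕ) (c : ℝ) (φ : 𝓢(V, ℝ)) (y : V) :
    mform n (c • φ) y = c • mform n φ y :=
  MForm.ext_eval fun m => by simp [eval_mform, LineDeriv.iteratedLineDerivOp_smul]

theorem continuous_mform (n : ℕ) (φ : 𝓢(V, ℝ)) : Continuous (mform n φ) :=
  (φ.smooth ⊤).continuous_iteratedFDeriv (mod_cast le_top)

/-- The function `y ↦ ‖y‖^k D^n φ y` as a bounded continuous function. -/
def weightedDeriv (k n : ℕ) : 𝓢(V, ℝ) →ₗ[ℝ] V →ᵇ MForm V n where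
  toFun φ := BoundedContinuousFunction.ofNormedAddCommGroup
    (fun y => ‖y‖ ^ k • mform n φ y) ((continuous_norm.pow k).smul (continuous_mform n φ))
    (SchwartzMap.seminorm ℝ k n φ) fun y => by
      rw [norm_smul, norm_pow, norm_norm]
      exact SchwartzMap.le_seminorm ℝ k n φ y
  map_add' φ ψ := by
    ext1 y
    simp [mform_add]
  map_smul' c φ := by
    ext1 y
    simp [mform_smul, smul_comm c]

theorem weightedDeriv_apply (k n : ℕ) (φ : 𝓢(V, ℝ)) (y : V) :
    weightedDeriv k n φ y = ‖y‖ ^ k • mform n φ y := rfl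

theorem norm_weightedDeriv_le (k n : ℕ) (φ : 𝓢(V, ℝ)) :
    ‖weightedDeriv k n φ‖ ≤ SchwartzMap.seminorm ℝ k n φ :=
  BoundedContinuousFunction.norm_ofNormedAddCommGroup_le _ (apply_nonneg _ _) fun y => by
    rw [norm_smul, norm_pow, norm_norm]
    exact SchwartzMap.le_seminorm ℝ k n φ y

theorem seminorm_le_norm_weightedDeriv (k n : ℕ) (φ : 𝓢(V, ℝ)) :
    SchwartzMap.seminorm ℝ k n φ ≤ ‖weightedDeriv k n φ‖ := by
  refine SchwartzMap.seminorm_le_bound _ _ _ _ (norm_nonneg _) fun y => ?_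
  have := (weightedDeriv k n φ).norm_coe_le_norm y
  rwa [weightedDeriv_apply, norm_smul, norm_pow, norm_norm] at this

theorem continuous_weightedDeriv (k n : ℕ) :
    Continuous (weightedDeriv k n : 𝓢(V, ℝ) → V →ᵇ MForm V n) := by
  refine WithSeminorms.continuous_of_isBounded (schwartz_withSeminorms ℝ V ℝ)
    (norm_withSeminorms ℝ _) (weightedDeriv k n) fun _ => ⟨{(k, n)}, 1, fun φ => ?_⟩
  simpa using norm_weightedDeriv_le k n φ

/-- A tempered distribution factors through a Banach space of bounded continuous functions. -/
theorem exists_factor (ζ : 𝓢(V, ℝ) →L[ℝ] ℝ) : ∃ (s : Finset (ℕ × ℕ))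
    (L : (∀ i : s, V →ᵇ MForm V i.1.2) →L[ℝ] ℝ),
    ∀ φ, ζ φ = L fun i => weightedDeriv i.1.1 i.1.2 φ := by
  obtain ⟨s, C, hC, hζ⟩ := exists_seminorm_bound ζ
  let J : 𝓢(V, ℝ) →ₗ[ℝ] (∀ i : s, V →ᵇ MForm V i.1.2) :=
    LinearMap.pi fun i => weightedDeriv i.1.1 i.1.2
  have hb : ∀ φ, |ζ φ| ≤ C * ‖J φ‖ := fun φ => by
    refine (hζ φ).trans (mul_le_mul_of_nonneg_left ?_ hC)
    refine Seminorm.finset_sup_apply_le (norm_nonneg _) fun i hi => ?_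
    exact (seminorm_le_norm_weightedDeriv _ _ _).trans (norm_le_pi_norm (J φ) ⟨i, hi⟩)
  -- The seminorm bound forces `ζ` to vanish on the kernel of `J`, so `ζ` descends to a bounded
  -- functional on the range of `J`.
  have hker : LinearMap.ker J ≤ LinearMap.ker ζ.toLinearMap := fun φ hφ => by
    have := hb φ
    rw [LinearMap.mem_ker.1 hφ, norm_zero, mul_zero] at this
    exact abs_nonpos_iff.1 this
  let e := J.quotKerEquivRange
  let ℓ : LinearMap.range J →ₗ[ℝ] ℝ := ((LinearMap.ker J).liftQ ζ.toLinearMap hker) ∘ₗ e.symm.toLinearMap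
  have hℓ : ∀ φ, ℓ ⟨J φ, LinearMap.mem_range_self J φ⟩ = ζ φ := fun φ => by
    have : e.symm ⟨J φ, LinearMap.mem_range_self J φ⟩ = Submodule.Quotient.mk φ := by
      rw [LinearEquiv.symm_apply_eq]
      rfl
    simp only [ℓ, LinearMap.comp_apply, LinearEquiv.coe_coe, this]
    rfl
  let ℓ' : LinearMap.range J →L[ℝ] ℝ := ℓ.mkContinuous C fun z => by
    obtain ⟨z, φ, rfl⟩ := z
    rw [hℓ]
    exact hb φ
  -- Hahn–Banach extends the functional from the range to the whole Banach space, where Bochner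
  -- integrals are available.
  obtain ⟨L, hL, -⟩ := exists_extension_norm_eq (LinearMap.range J) ℓ'
  refine ⟨s, L, fun φ => ?_⟩
  have := hL ⟨J φ, LinearMap.mem_range_self J φ⟩
  rw [← hℓ]
  exact this.symm

/-- Distributions commute with integrals of Schwartz functions. -/
theorem distr_integral {X : Type*} [TopologicalSpace X] [SecondCountableTopology X]
    [MeasurableSpace X] [OpensMeasurableSpace X] {μ : Measure X}
    (ζ : 𝓢(V, ℝ) →L[ℝ] ℝ) {F : X → 𝓢(V, ℝ)} {G : 𝓢(V, ℝ)} (hF : Continuous F)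
    (hint : ∀ k n, Integrable (fun w => SchwartzMap.seminorm ℝ k n (F w)) μ)
    (hG : ∀ n (m : Fin n → V) y, (∂^{m} G) y = ∫ w, (∂^{m} (F w)) y ∂μ) :
    Integrable (fun w => ζ (F w)) μ ∧ ζ G = ∫ w, ζ (F w) ∂μ := by
  obtain ⟨s, L, hL⟩ := exists_factor ζ
  have hc : ∀ i : s, Continuous fun w => weightedDeriv i.1.1 i.1.2 (F w) := fun i =>
    (continuous_weightedDeriv _ _).comp hF
  have hi : ∀ i : s, Integrable (fun w => weightedDeriv i.1.1 i.1.2 (F w)) μ := fun i =>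
    (hint i.1.1 i.1.2).mono' (hc i).aestronglyMeasurable
      (Filter.Eventually.of_forall fun w => norm_weightedDeriv_le _ _ _)
  have hI : Integrable (fun w => fun i : s => weightedDeriv i.1.1 i.1.2 (F w)) μ :=
    Integrable.of_eval hi
  -- The Bochner integral is identified with the image of `G` by evaluating at each point `y` and
  -- each tuple `m`; both evaluations are continuous and linear, and the pointwise identity is the
  -- hypothesis `hG`.
  have hIG : (∫ w, (fun i : s => weightedDeriv i.1.1 i.1.2 (F w)) ∂μ) =
      fun i : s => weightedDeriv i.1.1 i.1.2 G := by
    funext i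
    rw [eval_integral hi]
    ext1 y
    refine MForm.ext_eval fun m => ?_
    have hy := (BoundedContinuousFunction.evalCLM ℝ y).integral_comp_comm (hi i)
    have h1 : ∀ f : V →ᵇ MForm V i.1.2, BoundedContinuousFunction.evalCLM ℝ y f = f y :=
      fun f => rfl
    simp only [h1] at hy
    have hiy : Integrable (fun w => weightedDeriv i.1.1 i.1.2 (F w) y) μ :=
      (BoundedContinuousFunction.evalCLM ℝ y).integrable_comp (hi i)
    have hm := (MForm.eval m).integral_comp_comm hiy
    rw [← hy, ← hm]
    simp only [weightedDeriv_apply, map_smul, smul_eq_mul, eval_mform]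
    rw [hG, integral_const_mul]
  constructor
  · simp only [hL]
    exact L.integrable_comp hI
  · simp only [hL]
    rw [L.integral_comp_comm hI, hIG]

end Pettis

/-! ### Convolution of Schwartz functions and distributions -/

section Convolution

variable {d : ℕ}

/-- A continuous function of polynomial growth. -/
structure PolyBdd (U : Spacetime d → ℝ) : Prop where
  continuous : Continuous U
  bound : ∃ (C : ℝ) (k : ℕ), ∀ w, |U w| ≤ C * (1 + ‖w‖) ^ k

/-- A Schwartz function leaves room for `d + 2` further powers of decay, one more than the dimension
`d + 1`. -/
theorem integrable_one_add_pow_mul (φ : 𝓢(Spacetime d, ℝ)) (k : ℕ) :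
    Integrable fun w => (1 + ‖w‖) ^ k * |φ w| := by
  have hr : ((Module.finrank ℝ (Spacetime d) : ℕ) : ℝ) < ((d + 2 : ℕ) : ℝ) := by
    simp
  have h := (integrable_one_add_norm (μ := (volume : Measure (Spacetime d))) hr).const_mul
    (weightNorm (k + (d + 2)) 0 φ)
  refine h.mono' (by fun_prop) (Filter.Eventually.of_forall fun w => ?_)
  have h1 := abs_le_weightNorm (k + (d + 2)) φ w
  have h2 : (0 : ℝ) < 1 + ‖w‖ := by positivity
  rw [Real.norm_of_nonneg (by positivity), Real.rpow_neg h2.le, Real.rpow_natCast,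
    ← div_eq_mul_inv, le_div_iff₀ (by positivity)]
  calc _ = (1 + ‖w‖) ^ (k + (d + 2)) * |φ w| := by ring
    _ ≤ _ := h1

theorem PolyBdd.integrable_mul {U : Spacetime d → ℝ} (hU : PolyBdd U) (φ : 𝓢(Spacetime d, ℝ)) :
    Integrable fun w => φ w * U w := by
  obtain ⟨C, k, h⟩ := hU.bound
  refine ((integrable_one_add_pow_mul φ k).const_mul C).mono'
    ((φ.continuous.mul hU.continuous).aestronglyMeasurable)
    (Filter.Eventually.of_forall fun w => ?_)
  rw [norm_mul, Real.norm_eq_abs, Real.norm_eq_abs]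
  calc _ ≤ |φ w| * (C * (1 + ‖w‖) ^ k) := by gcongr; exact h w
    _ = _ := by ring

theorem weightNorm_mono {V : Type*} [NormedAddCommGroup V] [NormedSpace ℝ V] {k n k' n' : ℕ}
    (hk : k ≤ k') (hn : n ≤ n') (ψ : 𝓢(V, ℝ)) : weightNorm k n ψ ≤ weightNorm k' n' ψ := by
  unfold weightNorm
  have h : Finset.Iic (k, n) ⊆ Finset.Iic (k', n') :=
    Finset.Iic_subset_Iic.2 (Prod.mk_le_mk.2 ⟨hk, hn⟩)
  refine mul_le_mul (pow_le_pow_right₀ one_le_two hk) ?_ (apply_nonneg _ _) (by positivity)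
  exact Finset.sup_mono (f := fun m : ℕ × ℕ => SchwartzMap.seminorm ℝ m.1 m.2) h ψ

/-- The dependence on `ψ` is kept as an explicit seminorm, because the later continuity estimates of
`K ζ` need uniformity in the test function. -/
theorem distr_translate_bound (ζ : Distr d) : ∃ (k N : ℕ) (C : ℝ), 0 ≤ C ∧
    ∀ w ψ, |ζ (translate w ψ)| ≤ C * (1 + ‖w‖) ^ k * weightNorm k N ψ := by
  obtain ⟨s, C, hC, hζ⟩ := exists_seminorm_bound ζ
  refine ⟨s.sup Prod.fst, s.sup Prod.snd, C, hC, fun w ψ => (hζ _).trans ?_⟩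
  rw [mul_assoc]
  refine mul_le_mul_of_nonneg_left ?_ hC
  refine Seminorm.finset_sup_apply_le (mul_nonneg (by positivity) (weightNorm_nonneg _ _ _))
    fun i hi => ?_
  refine (seminorm_translate_le i.1 i.2 ψ w).trans ?_
  refine mul_le_mul (pow_le_pow_right₀ (by simp) (Finset.le_sup (f := Prod.fst) hi))
    (weightNorm_mono (Finset.le_sup (f := Prod.fst) hi) (Finset.le_sup (f := Prod.snd) hi) ψ)
    (weightNorm_nonneg _ _ _) (by positivity)

theorem polyBdd_translate (ζ : Distr d) (ψ : 𝓢(Spacetime d, ℝ)) :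
    PolyBdd fun w => ζ (translate w ψ) := by
  refine ⟨ζ.continuous.comp (continuous_translate ψ), ?_⟩
  obtain ⟨k, N, C, hC, h⟩ := distr_translate_bound ζ
  exact ⟨C * weightNorm k N ψ, k, fun w => (h w ψ).trans_eq (by ring)⟩

/-- The function `y ↦ ψ (-y)`. -/
def sneg (ψ : 𝓢(Spacetime d, ℝ)) : 𝓢(Spacetime d, ℝ) :=
  SchwartzMap.compCLMOfContinuousLinearEquiv ℝ (ContinuousLinearEquiv.neg ℝ) ψ

@[simp] theorem sneg_apply (ψ : 𝓢(Spacetime d, ℝ)) (y : Spacetime d) : sneg ψ y = ψ (-y) := rfl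

theorem reflectAt_eq (x : Spacetime d) (ψ : 𝓢(Spacetime d, ℝ)) :
    reflectAt x ψ = translate x (sneg ψ) := rfl

theorem polyBdd_reflectAt (ζ : Distr d) (ψ : 𝓢(Spacetime d, ℝ)) :
    PolyBdd fun x => ζ (reflectAt x ψ) := polyBdd_translate ζ (sneg ψ)

theorem reflectAt_smul (x : Spacetime d) (c : ℝ) (φ : 𝓢(Spacetime d, ℝ)) :
    reflectAt x (c • φ) = c • reflectAt x φ := by
  ext y; simp [reflectAt_apply]

/-- Real Schwartz functions as complex ones. -/
def toC (φ : 𝓢(Spacetime d, ℝ)) : 𝓢(Spacetime d, ℂ) :=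
  SchwartzMap.postcompCLM (𝕜 := ℝ) Complex.ofRealCLM φ

@[simp] theorem toC_apply (φ : 𝓢(Spacetime d, ℝ)) (x : Spacetime d) : toC φ x = (φ x : ℂ) := rfl

/-- The convolution of real Schwartz functions. -/
def sconv (φ ψ : 𝓢(Spacetime d, ℝ)) : 𝓢(Spacetime d, ℝ) :=
  SchwartzMap.postcompCLM (𝕜 := ℝ) Complex.reCLM
    (SchwartzMap.convolution (ContinuousLinearMap.mul ℂ ℂ) (toC φ) (toC ψ))

theorem convolution_toC_apply (φ ψ : 𝓢(Spacetime d, ℝ)) (x : Spacetime d) :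
    SchwartzMap.convolution (ContinuousLinearMap.mul ℂ ℂ) (toC φ) (toC ψ) x =
      ((∫ w, φ w * ψ (x - w) : ℝ) : ℂ) := by
  rw [SchwartzMap.convolution_apply]
  unfold convolution
  rw [← integral_complex_ofReal]
  simp

theorem sconv_apply (φ ψ : 𝓢(Spacetime d, ℝ)) (x : Spacetime d) :
    sconv φ ψ x = ∫ w, φ w * ψ (x - w) := by
  have h : sconv φ ψ x =
    (SchwartzMap.convolution (ContinuousLinearMap.mul ℂ ℂ) (toC φ) (toC ψ) x).re := rfl
  rw [h, convolution_toC_apply, Complex.ofReal_re]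

theorem toC_sconv (φ ψ : 𝓢(Spacetime d, ℝ)) : toC (sconv φ ψ) =
    SchwartzMap.convolution (ContinuousLinearMap.mul ℂ ℂ) (toC φ) (toC ψ) := by
  ext x
  rw [convolution_toC_apply, toC_apply, sconv_apply]

theorem sconv_comm (φ ψ : 𝓢(Spacetime d, ℝ)) : sconv φ ψ = sconv ψ φ := by
  ext x
  rw [sconv_apply, sconv_apply, ← integral_sub_left_eq_self _ volume x]
  simp [mul_comm]

theorem toC_injective : Function.Injective (toC (d := d)) := fun φ ψ h => by
  ext x
  have := congrArg (fun f : 𝓢(Spacetime d, ℂ) => f x) h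
  simpa using this

theorem toC_lineDerivOp (m : Spacetime d) (φ : 𝓢(Spacetime d, ℝ)) :
    toC (∂_{m} φ) = ∂_{m} (toC φ) := by
  ext x
  have h : (toC φ : Spacetime d → ℂ) = fun x => Complex.ofRealCLM (φ x) := rfl
  rw [SchwartzMap.lineDerivOp_apply_eq_fderiv, h, toC_apply,
    SchwartzMap.lineDerivOp_apply_eq_fderiv]
  have := (Complex.ofRealCLM.hasFDerivAt (x := φ x)).comp x (φ.hasFDerivAt x)
  erw [this.fderiv]
  simp

/-- On the Fourier side a convolution is a product and a derivative is multiplication by a linear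
symbol, so the two sides agree by commutativity of multiplication. -/
theorem lineDerivOp_sconv (m : Spacetime d) (φ ψ : 𝓢(Spacetime d, ℝ)) :
    ∂_{m} (sconv φ ψ) = sconv φ (∂_{m} ψ) := by
  apply toC_injective
  rw [toC_lineDerivOp, toC_sconv, toC_sconv, toC_lineDerivOp]
  set B := ContinuousLinearMap.mul ℂ ℂ
  have : Function.Injective (fun f : 𝓢(Spacetime d, ℂ) => 𝓕 f) := fun f g h => by
    have := congrArg (fun f : 𝓢(Spacetime d, ℂ) => 𝓕⁻ f) h
    simpa using this
  apply this
  simp only [SchwartzMap.fourier_lineDerivOp_eq, SchwartzMap.fourier_convolution]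
  ext ξ
  have ht : (fun ξ : Spacetime d => (inner ℝ ξ m : ℝ)).HasTemperateGrowth := by fun_prop
  simp [SchwartzMap.smulLeftCLM_apply_apply, ht, SchwartzMap.pairing_apply_apply, B]
  ring

theorem iteratedLineDerivOp_sconv {n : ℕ} (m : Fin n → Spacetime d) (φ ψ : 𝓢(Spacetime d, ℝ)) :
    ∂^{m} (sconv φ ψ) = sconv φ (∂^{m} ψ) := by
  induction n generalizing ψ with
  | zero => rfl
  | succ n ih => rw [LineDeriv.iteratedLineDerivOp_succ_left, LineDeriv.iteratedLineDerivOp_succ_left,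
      ih, lineDerivOp_sconv]

/-- A convolution is a superposition of translates, and `distr_integral` lets the distribution pass
under the integral. -/
theorem distr_sconv (ζ : Distr d) (φ ψ : 𝓢(Spacetime d, ℝ)) :
    ζ (sconv φ ψ) = ∫ w, φ w * ζ (translate w ψ) := by
  have h := (distr_integral (μ := (volume : Measure (Spacetime d))) ζ
    (F := fun w => φ w • translate w ψ) (G := sconv φ ψ)
    (φ.continuous.smul (continuous_translate ψ)) ?_ ?_).2
  · simpa using h
  · intro k n
    refine ((integrable_one_add_pow_mul φ k).const_mul (weightNorm k n ψ)).mono' ?_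
      (Filter.Eventually.of_forall fun w => ?_)
    · refine Continuous.aestronglyMeasurable ?_
      exact ((schwartz_withSeminorms ℝ (Spacetime d) ℝ).continuous_seminorm (k, n)).comp
        (φ.continuous.smul (continuous_translate ψ))
    · rw [Real.norm_of_nonneg (apply_nonneg _ _), map_smul_eq_mul, Real.norm_eq_abs]
      calc _ ≤ |φ w| * ((1 + ‖w‖) ^ k * weightNorm k n ψ) := by
            gcongr; exact seminorm_translate_le k n ψ w
        _ = _ := by ring
  · intro n m y
    rw [iteratedLineDerivOp_sconv, sconv_apply]
    refine integral_congr_ae (Filter.Eventually.of_forall fun w => ?_)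
    simp [LineDeriv.iteratedLineDerivOp_smul, iteratedLineDerivOp_translate]

theorem integral_mul_distr_reflectAt (ζ : Distr d) (φ ψ : 𝓢(Spacetime d, ℝ)) :
    ∫ x, φ x * ζ (reflectAt x ψ) = ζ (sconv φ (sneg ψ)) := (distr_sconv ζ φ (sneg ψ)).symm

/-- Main use of the convolution structure: a bound for `ζ` tested against `b` at all base points
passes to `a * b` by integrating against `a`. -/
theorem distr_reflectAt_sconv (ζ : Distr d) (x : Spacetime d) (a b : 𝓢(Spacetime d, ℝ)) :
    ζ (reflectAt x (sconv a b)) = ∫ w, a w * ζ (reflectAt (x - w) b) := by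
  have h : reflectAt x (sconv a b) = sconv (reflectAt x a) (sneg b) := by
    ext y
    rw [reflectAt_apply, sconv_apply, sconv_apply, ← integral_sub_left_eq_self _ volume x]
    refine integral_congr_ae (Filter.Eventually.of_forall fun w => ?_)
    simp only [reflectAt_apply, sneg_apply]
    congr 2
    abel
  rw [h, ← integral_mul_distr_reflectAt, ← integral_sub_left_eq_self _ volume x]
  refine integral_congr_ae (Filter.Eventually.of_forall fun w => ?_)
  simp [reflectAt_apply]

/-- The fundamental theorem of calculus for the translates, with `ζ` exchanged with the integral
over the line segment; the integrand is continuous, so the primitive is differentiable. -/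
theorem hasDerivAt_distr_translate (ζ : Distr d) (ψ : 𝓢(Spacetime d, ℝ)) (x v : Spacetime d)
    (s : ℝ) : HasDerivAt (fun s : ℝ => ζ (translate (x + s • v) ψ))
      (-ζ (translate (x + s • v) (∂_{v} ψ))) s := by
  have hc : Continuous fun s : ℝ => translate (x + s • v) (∂_{v} ψ) :=
    (continuous_translate (∂_{v} ψ)).comp (by fun_prop)
  have key : ∀ s : ℝ, ζ (translate (x + s • v) ψ) =
      ζ (translate x ψ) - ∫ θ in (0 : ℝ)..s, ζ (translate (x + θ • v) (∂_{v} ψ)) := by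
    have hgen : ∀ a b : ℝ, a ≤ b → ζ (translate (x + a • v) ψ - translate (x + b • v) ψ) =
        ∫ θ in a..b, ζ (translate (x + θ • v) (∂_{v} ψ)) := by
      intro a b hab
      rw [intervalIntegral.integral_of_le hab]
      refine (distr_integral (μ := volume.restrict (Set.Ioc a b)) ζ hc ?_ ?_).2
      · intro k n
        refine Continuous.integrableOn_Ioc ?_
        exact ((schwartz_withSeminorms ℝ (Spacetime d) ℝ).continuous_seminorm (k, n)).comp hc
      · intro n m y
        rw [← intervalIntegral.integral_of_le hab, sub_eq_add_neg,
          LineDeriv.iteratedLineDerivOp_add, LineDeriv.iteratedLineDerivOp_neg]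
        simp only [iteratedLineDerivOp_translate, iteratedLineDerivOp_lineDerivOp]
        set χ := ∂^{m} ψ
        have hd : ∀ θ ∈ Set.uIcc a b, HasDerivAt (fun θ : ℝ => -χ (y - (x + θ • v)))
            ((∂_{v} χ) (y - (x + θ • v))) θ := by
          intro θ _
          have h1 : HasDerivAt (fun θ : ℝ => y - (x + θ • v)) (-v) θ := by
            have := ((hasDerivAt_id θ).smul_const v).const_add x
            simpa using this.const_sub y
          have h2 := (χ.hasFDerivAt (y - (x + θ • v))).comp_hasDerivAt θ h1
          have h3 : HasDerivAt (fun θ : ℝ => -χ (y - (x + θ • v)))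
              (-(fderiv ℝ χ (y - (x + θ • v)) (-v))) θ := h2.neg
          simpa [SchwartzMap.lineDerivOp_apply_eq_fderiv] using h3
        have hcont : Continuous fun θ : ℝ => (∂_{v} χ) (y - (x + θ • v)) :=
          (∂_{v} χ).continuous.comp (by fun_prop)
        have h := intervalIntegral.integral_eq_sub_of_hasDerivAt hd
          (hcont.intervalIntegrable a b)
        simp only [SchwartzMap.compSubConstCLM_apply]
        rw [h]
        simp
        ring
    intro s
    rcases le_total 0 s with hs | hs
    · have := hgen 0 s hs
      rw [← this]
      simp
    · have := hgen s 0 hs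
      rw [intervalIntegral.integral_symm, ← this]
      simp
  have hc' : Continuous fun θ : ℝ => ζ (translate (x + θ • v) (∂_{v} ψ)) := ζ.continuous.comp hc
  have := (intervalIntegral.integral_hasDerivAt_right (hc'.intervalIntegrable 0 s)
    hc'.stronglyMeasurable.stronglyMeasurableAtFilter hc'.continuousAt).const_sub (ζ (translate x ψ))
  exact this.congr_of_eventuallyEq (Filter.Eventually.of_forall key)

theorem lineDerivOp_sneg (v : Spacetime d) (ψ : 𝓢(Spacetime d, ℝ)) :
    ∂_{v} (sneg ψ) = -sneg (∂_{v} ψ) := by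
  unfold sneg
  rw [SchwartzMap.lineDerivOp_compCLMOfContinuousLinearEquiv]
  simp [LineDeriv.lineDerivOp_left_neg]

theorem hasDerivAt_distr_reflectAt (ζ : Distr d) (ψ : 𝓢(Spacetime d, ℝ)) (x v : Spacetime d)
    (s : ℝ) : HasDerivAt (fun s : ℝ => ζ (reflectAt (x + s • v) ψ))
      (ζ (reflectAt (x + s • v) (∂_{v} ψ))) s := by
  have := hasDerivAt_distr_translate ζ (sneg ψ) x v s
  rw [lineDerivOp_sneg] at this
  simpa [reflectAt_eq] using this

end Convolution

/-! ### A two-parameter family of heat kernels -/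

section HeatKernels

variable {d : ℕ}

/-- The symbol `|2πξ'|²` of `-Δ'`. -/
def spaceSymbol (ξ : Spacetime d) : ℝ := ∑ i : Fin d, (2 * Real.pi * ξ i.succ) ^ 2

theorem spaceSymbol_nonneg (ξ : Spacetime d) : 0 ≤ spaceSymbol ξ :=
  Finset.sum_nonneg fun _ _ => sq_nonneg _

theorem hasTemperateGrowth_spaceSymbol : (spaceSymbol (d := d)).HasTemperateGrowth := by
  have hi : ∀ i : Fin (d + 1), (fun ξ : Spacetime d => ξ i).HasTemperateGrowth := fun i =>
    (EuclideanSpace.proj i : Spacetime d →L[ℝ] ℝ).hasTemperateGrowth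
  unfold spaceSymbol
  fun_prop

theorem hasTemperateGrowth_heatExponent (c : ℝ) :
    (heatExponent (d := d) c).HasTemperateGrowth := by
  have hi : ∀ i : Fin (d + 1), (fun ξ : Spacetime d => ξ i).HasTemperateGrowth := fun i =>
    (EuclideanSpace.proj i : Spacetime d →L[ℝ] ℝ).hasTemperateGrowth
  unfold heatExponent
  fun_prop

/-- The symbol of `-s (∂₀² - Δ'²) - u Δ'`. -/
def gaussExponent (s u : ℝ) (ξ : Spacetime d) : ℝ := s * heatExponent 0 ξ + u * spaceSymbol ξ

theorem heatExponent_nonneg (c : ℝ) (ξ : Spacetime d) : 0 ≤ heatExponent c ξ := by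
  unfold heatExponent; positivity

theorem exp_gaussExponent_le {s u : ℝ} (hu : 0 ≤ u) (ξ : Spacetime d) :
    Real.exp (-gaussExponent s u ξ) ≤ Real.exp (-(s * heatExponent 0 ξ)) := by
  apply Real.exp_le_exp.2
  have := mul_nonneg hu (spaceSymbol_nonneg ξ)
  unfold gaussExponent
  linarith

/-- The constant is uniform in `u`, which is the point: at unit scale the second parameter runs over
a compact interval. Derivatives of the exponential of a function of temperate growth cost polynomial
factors, and these are absorbed by the decay of the part with `u = 0`. -/
theorem gaussExponent_decay {s U : ℝ} (hs : 0 < s) (hU : 0 ≤ U) (k n : ℕ) :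
    ∃ C : ℝ, ∀ u, 0 ≤ u → u ≤ U → ∀ ξ : Spacetime d,
      ‖ξ‖ ^ k * ‖iteratedFDeriv ℝ n (fun ξ => Real.exp (-gaussExponent s u ξ)) ξ‖ ≤ C := by
  have hP := heatExponent_hasTemperateGrowth (d := d) 0 s
  have hQ := hasTemperateGrowth_spaceSymbol (d := d)
  obtain ⟨m₁, C₁, hC₁, h₁⟩ := hP.norm_iteratedFDeriv_le_uniform n
  obtain ⟨m₂, C₂, hC₂, h₂⟩ := hQ.norm_iteratedFDeriv_le_uniform n
  set C := C₁ + U * C₂ with hCdef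
  have hC0 : 0 ≤ C := by positivity
  set m := m₁ + m₂ with hm
  set N := k + m * n with hN
  refine ⟨(n.factorial : ℝ) * (1 + C) ^ n *
    ((N.factorial : ℝ) * Real.exp (1 + s + 1 / (4 * s))), fun u hu0 huU ξ => ?_⟩
  set z := ‖ξ‖ with hz
  have hz0 : 0 ≤ z := norm_nonneg _
  have hD1 : 1 ≤ (1 + C) * (1 + z) ^ m :=
    one_le_mul_of_one_le_of_one_le (by linarith) (one_le_pow₀ (by linarith))
  have hsm : ContDiff ℝ ((n : ℕ∞) : WithTop ℕ∞) fun ξ : Spacetime d => -gaussExponent s u ξ := by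
    have : (fun ξ : Spacetime d => -gaussExponent s u ξ) =
        fun ξ => -(s * heatExponent 0 ξ) + (-u) • spaceSymbol ξ := by
      ext ξ; simp [gaussExponent]; ring
    rw [this]
    exact (hP.1.add (hQ.1.const_smul _)).of_le (by exact_mod_cast le_top)
  have hbd : ∀ i ≤ n, ‖iteratedFDeriv ℝ i (fun ξ : Spacetime d => -gaussExponent s u ξ) ξ‖ ≤
      C * (1 + z) ^ m := by
    intro i hi
    have e : (fun ξ : Spacetime d => -gaussExponent s u ξ) =
        (fun ξ => -(s * heatExponent 0 ξ)) + (-u) • (spaceSymbol : Spacetime d → ℝ) := by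
      ext ξ; simp [gaussExponent]; ring
    have c1 : ContDiffAt ℝ i (fun ξ : Spacetime d => -(s * heatExponent 0 ξ)) ξ :=
      (hP.1.of_le (by exact_mod_cast le_top)).contDiffAt
    have c2 : ContDiffAt ℝ i (spaceSymbol : Spacetime d → ℝ) ξ :=
      (hQ.1.of_le (by exact_mod_cast le_top)).contDiffAt
    rw [e, iteratedFDeriv_add_apply (g := (-u) • (spaceSymbol : Spacetime d → ℝ)) c1
      (c2.const_smul (-u)), iteratedFDeriv_const_smul_apply c2]
    refine (norm_add_le _ _).trans ?_
    rw [norm_smul, norm_neg, Real.norm_of_nonneg hu0]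
    have p1 : (1 + z) ^ m₁ ≤ (1 + z) ^ m := pow_le_pow_right₀ (by linarith) (by omega)
    have p2 : (1 + z) ^ m₂ ≤ (1 + z) ^ m := pow_le_pow_right₀ (by linarith) (by omega)
    calc _ ≤ C₁ * (1 + z) ^ m₁ + U * (C₂ * (1 + z) ^ m₂) := by
          gcongr
          · exact h₁ i hi ξ
          · exact h₂ i hi ξ
      _ ≤ C₁ * (1 + z) ^ m + U * (C₂ * (1 + z) ^ m) := by gcongr
      _ = _ := by rw [hCdef]; ring
  have key : ‖iteratedFDeriv ℝ n (fun ξ => Real.exp (-gaussExponent s u ξ)) ξ‖ ≤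
      (n.factorial : ℝ) * Real.exp (-gaussExponent s u ξ) * ((1 + C) * (1 + z) ^ m) ^ n := by
    refine norm_iteratedFDeriv_comp_le (N := (n : ℕ∞)) (g := Real.exp)
      (f := fun ξ : Spacetime d => -gaussExponent s u ξ) Real.contDiff_exp
      hsm le_rfl ξ ?_ ?_
    · intro i _
      rw [norm_iteratedFDeriv_eq_norm_iteratedDeriv, iteratedDeriv_eq_iterate,
        Real.iter_deriv_exp, Real.norm_eq_abs, abs_of_pos (Real.exp_pos _)]
    · intro i h1 hi
      refine (hbd i hi).trans (le_trans ?_ (le_self_pow₀ hD1 (by omega)))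
      gcongr
      linarith
  have hpow : (1 + z) ^ N ≤ (N.factorial : ℝ) * Real.exp (1 + z) := by
    have := Real.pow_div_factorial_le_exp (1 + z) (by linarith) N
    rwa [div_le_iff₀ (by positivity), mul_comm] at this
  have hexp : Real.exp (1 + z) * Real.exp (-gaussExponent s u ξ) ≤
      Real.exp (1 + s + 1 / (4 * s)) := by
    refine (mul_le_mul_of_nonneg_left (exp_gaussExponent_le hu0 ξ) (Real.exp_pos _).le).trans ?_
    rw [← Real.exp_add]
    apply Real.exp_le_exp.2
    have h1 := mul_le_mul_of_nonneg_left (le_heatExponent (le_refl 0) ξ) hs.le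
    -- Completing the square gives `1 / (4 * s)`. The term `s` in the final constant comes from the
    -- `-1` in `le_heatExponent`.
    have h2 : z ≤ s * z ^ 2 + 1 / (4 * s) := by
      have h3 : s * z ^ 2 + 1 / (4 * s) - z = (2 * s * z - 1) ^ 2 / (4 * s) := by
        field_simp
        ring
      have h4 : 0 ≤ (2 * s * z - 1) ^ 2 / (4 * s) := by positivity
      linarith
    nlinarith
  have hk : z ^ k * (1 + z) ^ (m * n) ≤ (1 + z) ^ N := by
    rw [hN, pow_add]
    gcongr
    linarith
  calc z ^ k * ‖iteratedFDeriv ℝ n (fun ξ => Real.exp (-gaussExponent s u ξ)) ξ‖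
      ≤ z ^ k * ((n.factorial : ℝ) * Real.exp (-gaussExponent s u ξ) *
          ((1 + C) * (1 + z) ^ m) ^ n) := by gcongr
    _ = (n.factorial : ℝ) * (1 + C) ^ n * ((z ^ k * (1 + z) ^ (m * n)) *
          Real.exp (-gaussExponent s u ξ)) := by
        rw [mul_pow, ← pow_mul]
        ring
    _ ≤ (n.factorial : ℝ) * (1 + C) ^ n * (((N.factorial : ℝ) * Real.exp (1 + z)) *
          Real.exp (-gaussExponent s u ξ)) := by
        have := hk.trans hpow
        gcongr (n.factorial : ℝ) * (1 + C) ^ n * (?_ * _)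
    _ ≤ (n.factorial : ℝ) * (1 + C) ^ n * ((N.factorial : ℝ) * Real.exp (1 + s + 1 / (4 * s))) := by
        rw [mul_assoc (N.factorial : ℝ)]
        gcongr

open Classical in
/-- The symbol of `exp (s (∂₀² - Δ'²) + u Δ')` (for `s > 0` and `u ≥ 0`). -/
def gaussSymbol (s u : ℝ) : 𝓢(Spacetime d, ℝ) :=
  if h : 0 < s ∧ 0 ≤ u then
    { toFun := fun ξ => Real.exp (-gaussExponent s u ξ)
      smooth' := by
        refine Real.contDiff_exp.comp (ContDiff.neg ?_)
        exact (contDiff_const.mul (hasTemperateGrowth_heatExponent 0).1).add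
          (contDiff_const.mul hasTemperateGrowth_spaceSymbol.1)
      decay' := fun k n => by
        obtain ⟨C, hC⟩ := gaussExponent_decay (d := d) h.1 h.2 k n
        exact ⟨C, hC u h.2 le_rfl⟩ }
  else 0

theorem gaussSymbol_apply {s u : ℝ} (hs : 0 < s) (hu : 0 ≤ u) (ξ : Spacetime d) :
    gaussSymbol s u ξ = Real.exp (-gaussExponent s u ξ) := by
  rw [gaussSymbol, dif_pos ⟨hs, hu⟩]
  rfl

/-- The real part of the inverse Fourier transform of a real symbol. -/
def symbolKernel : 𝓢(Spacetime d, ℝ) →L[ℝ] 𝓢(Spacetime d, ℝ) :=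
  (SchwartzMap.postcompCLM (𝕜 := ℝ) Complex.reCLM).comp
    ((FourierTransform.fourierInvCLM ℝ 𝓢(Spacetime d, ℂ)).comp
      (SchwartzMap.postcompCLM (𝕜 := ℝ) Complex.ofRealCLM))

theorem fourierInv_toC_apply (σ : 𝓢(Spacetime d, ℝ)) (x : Spacetime d) :
    (𝓕⁻ (toC σ)) x = ∫ ξ, Complex.exp ((2 * Real.pi * inner ℝ ξ x : ℝ) * Complex.I) * (σ ξ : ℂ) := by
  rw [SchwartzMap.fourierInv_coe, Real.fourierInv_eq']
  simp

theorem integrable_exp_mul (σ : 𝓢(Spacetime d, ℝ)) (x : Spacetime d) :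
    Integrable fun ξ => Complex.exp ((2 * Real.pi * inner ℝ ξ x : ℝ) * Complex.I) * (σ ξ : ℂ) := by
  refine (σ.integrable (μ := volume)).norm.mono' ?_ (Filter.Eventually.of_forall fun ξ => ?_)
  · refine Continuous.aestronglyMeasurable ?_
    have := σ.continuous
    fun_prop
  · rw [norm_mul, Complex.norm_exp_ofReal_mul_I, one_mul, Complex.norm_real]

theorem symbolKernel_apply (σ : 𝓢(Spacetime d, ℝ)) (x : Spacetime d) :
    symbolKernel σ x = ∫ ξ, σ ξ * Real.cos (2 * Real.pi * inner ℝ ξ x) := by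
  have h : symbolKernel σ x = ((𝓕⁻ (toC σ)) x).re := rfl
  rw [h, fourierInv_toC_apply]
  have := (Complex.reCLM.integral_comp_comm (integrable_exp_mul σ x))
  simp only [Complex.reCLM_apply] at this
  rw [← this]
  refine integral_congr_ae (Filter.Eventually.of_forall fun ξ => ?_)
  simp only [Complex.re_mul_ofReal, Complex.exp_ofReal_mul_I_re]
  ring

/-- For an even symbol the imaginary part is the integral of an odd function, so taking the real
part loses nothing and Fourier inversion stays available for real kernels. -/
theorem toC_symbolKernel {σ : 𝓢(Spacetime d, ℝ)} (hσ : ∀ ξ, σ (-ξ) = σ ξ) :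
    toC (symbolKernel σ) = 𝓕⁻ (toC σ) := by
  ext x
  have h : symbolKernel σ x = ((𝓕⁻ (toC σ)) x).re := rfl
  have him : ((𝓕⁻ (toC σ)) x).im = 0 := by
    rw [fourierInv_toC_apply]
    have := (Complex.imCLM.integral_comp_comm (integrable_exp_mul σ x))
    simp only [Complex.imCLM_apply] at this
    rw [← this]
    have e := integral_neg_eq_self (fun ξ => (Complex.exp ((2 * Real.pi * inner ℝ ξ x : ℝ) *
      Complex.I) * (σ ξ : ℂ)).im) (volume : Measure (Spacetime d))
    simp only [Complex.im_mul_ofReal, Complex.exp_ofReal_mul_I_im, inner_neg_left, mul_neg,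
      Real.sin_neg, hσ, neg_mul, integral_neg] at e ⊢
    linarith
  rw [toC_apply, h]
  apply Complex.ext <;> simp [him]

theorem fourier_toC_symbolKernel {σ : 𝓢(Spacetime d, ℝ)} (hσ : ∀ ξ, σ (-ξ) = σ ξ) :
    𝓕 (toC (symbolKernel σ)) = toC σ := by
  rw [toC_symbolKernel hσ, FourierTransform.fourier_fourierInv_eq]

/-- The kernel of `exp (s (∂₀² - Δ'²) + u Δ')` (for `s > 0` and `u ≥ 0`). -/
def gauss (s u : ℝ) : 𝓢(Spacetime d, ℝ) := symbolKernel (gaussSymbol s u)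

theorem gauss_apply {s u : ℝ} (hs : 0 < s) (hu : 0 ≤ u) (x : Spacetime d) :
    gauss s u x = ∫ ξ, Real.exp (-gaussExponent s u ξ) * Real.cos (2 * Real.pi * inner ℝ ξ x) := by
  rw [gauss, symbolKernel_apply]
  simp only [gaussSymbol_apply hs hu]

theorem gaussExponent_neg (s u : ℝ) (ξ : Spacetime d) :
    gaussExponent s u (-ξ) = gaussExponent s u ξ := by
  simp [gaussExponent, heatExponent, spaceSymbol]

theorem gaussSymbol_neg {s u : ℝ} (hs : 0 < s) (hu : 0 ≤ u) (ξ : Spacetime d) :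
    gaussSymbol s u (-ξ) = gaussSymbol s u ξ := by
  rw [gaussSymbol_apply hs hu, gaussSymbol_apply hs hu, gaussExponent_neg]

theorem gauss_neg (s u : ℝ) (x : Spacetime d) : gauss s u (-x) = gauss s u x := by
  rw [gauss, symbolKernel_apply, symbolKernel_apply]
  simp

theorem sneg_gauss (s u : ℝ) : sneg (gauss (d := d) s u) = gauss s u := by
  ext x; simp [gauss_neg]

/-- The symbols multiply and `gaussExponent` is additive in the pair `(s, u)`. This law is used
instead of pointwise kernel bounds: it splits off a factor `gauss _ 0`, on which the hypotheses
about a distribution apply. -/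
theorem sconv_gauss {s u s' u' : ℝ} (hs : 0 < s) (hu : 0 ≤ u) (hs' : 0 < s') (hu' : 0 ≤ u') :
    sconv (gauss (d := d) s u) (gauss s' u') = gauss (s + s') (u + u') := by
  apply toC_injective
  have : Function.Injective (fun f : 𝓢(Spacetime d, ℂ) => 𝓕 f) := fun f g h => by
    have := congrArg (fun f : 𝓢(Spacetime d, ℂ) => 𝓕⁻ f) h
    simpa using this
  apply this
  have hs2 : 0 < s + s' := by positivity
  have hu2 : 0 ≤ u + u' := by positivity
  simp only [toC_sconv, SchwartzMap.fourier_convolution, gauss,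
    fourier_toC_symbolKernel (gaussSymbol_neg hs hu),
    fourier_toC_symbolKernel (gaussSymbol_neg hs' hu'),
    fourier_toC_symbolKernel (gaussSymbol_neg hs2 hu2)]
  ext ξ
  simp only [SchwartzMap.pairing_apply_apply, toC_apply, ContinuousLinearMap.mul_apply',
    gaussSymbol_apply hs hu, gaussSymbol_apply hs' hu', gaussSymbol_apply hs2 hu2]
  rw [← Complex.ofReal_mul, ← Real.exp_add]
  congr 2
  unfold gaussExponent
  ring

theorem integral_gauss {s u : ℝ} (hs : 0 < s) (hu : 0 ≤ u) :
    ∫ x : Spacetime d, gauss s u x = 1 := by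
  have h := congrArg (fun f : 𝓢(Spacetime d, ℂ) => f 0)
    (fourier_toC_symbolKernel (gaussSymbol_neg (d := d) hs hu))
  simp only [toC_apply, SchwartzMap.fourier_coe, Real.fourier_eq'] at h
  rw [gaussSymbol_apply hs hu] at h
  have h0 : gaussExponent s u (0 : Spacetime d) = 0 := by
    simp [gaussExponent, heatExponent, spaceSymbol]
  rw [h0] at h
  simp only [inner_zero_right, mul_zero, Complex.ofReal_zero, zero_mul, Complex.exp_zero, one_smul,
    neg_zero, Real.exp_zero, integral_complex_ofReal] at h
  exact_mod_cast h

theorem heatKernel_zero {t : ℝ} (ht : 0 < t) : heatKernel d 0 t = gauss t 0 := by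
  have h : heatKernel d 0 t = symbolKernel (heatSymbol d le_rfl ht) := by
    rw [heatKernel, dif_pos ⟨le_rfl, ht⟩]
    rfl
  rw [h, gauss]
  congr 1
  ext ξ
  rw [gaussSymbol_apply ht le_rfl]
  have : (heatSymbol d le_rfl ht : Spacetime d → ℝ) ξ =
    Real.exp (-(t * heatExponent 0 ξ)) := rfl
  rw [this]
  simp [gaussExponent]

/-- Expand `(Δ' - 1)² = Δ'² - 2Δ' + 1`: the massive kernel is an element of the two-parameter family
with `u = 2 r`, up to the harmless factor `exp (-r)`. This is why the second parameter is
introduced. -/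
theorem heatKernel_one {r : ℝ} (hr : 0 < r) :
    heatKernel d 1 r = Real.exp (-r) • gauss r (2 * r) := by
  have h : heatKernel d 1 r = symbolKernel (heatSymbol d zero_le_one hr) := by
    rw [heatKernel, dif_pos ⟨zero_le_one, hr⟩]
    rfl
  rw [h, gauss, ← map_smul]
  congr 1
  ext ξ
  have : (heatSymbol d zero_le_one hr : Spacetime d → ℝ) ξ =
    Real.exp (-(r * heatExponent 1 ξ)) := rfl
  rw [this, smul_apply, gaussSymbol_apply hr (by positivity), smul_eq_mul,
    ← Real.exp_add]
  congr 1
  simp only [gaussExponent, heatExponent, spaceSymbol]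
  ring

/-- Dominated convergence in the frequency variable: near `s₀` the symbols are bounded by the one at
time `s₀ / 2` with `u = 0`. -/
theorem continuousOn_gauss (x : Spacetime d) :
    ContinuousOn (fun p : ℝ × ℝ => gauss p.1 p.2 x) (Set.Ioi 0 ×ˢ Set.Ici 0) := by
  rintro ⟨s₀, u₀⟩ ⟨hs₀, hu₀⟩
  simp only [Set.mem_Ioi, Set.mem_Ici] at hs₀ hu₀
  have hev : ∀ᶠ p : ℝ × ℝ in nhdsWithin (s₀, u₀) (Set.Ioi 0 ×ˢ Set.Ici 0),
      s₀ / 2 < p.1 ∧ 0 ≤ p.2 := by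
    have h1 : ∀ᶠ p : ℝ × ℝ in nhds (s₀, u₀), s₀ / 2 < p.1 :=
      continuous_fst.continuousAt.eventually (lt_mem_nhds (by simp only []; linarith))
    filter_upwards [nhdsWithin_le_nhds h1, self_mem_nhdsWithin] with p hp hp'
    exact ⟨hp, hp'.2⟩
  have hs2 : 0 < s₀ / 2 := by positivity
  unfold ContinuousWithinAt
  simp only []
  rw [gauss_apply hs₀ hu₀]
  have hcongr : (fun p : ℝ × ℝ => ∫ ξ : Spacetime d, Real.exp (-gaussExponent p.1 p.2 ξ) *
      Real.cos (2 * Real.pi * inner ℝ ξ x)) =ᶠ[nhdsWithin (s₀, u₀) (Set.Ioi 0 ×ˢ Set.Ici 0)]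
      fun p => gauss p.1 p.2 x := by
    filter_upwards [hev] with p hp
    rw [gauss_apply (by linarith) hp.2]
  refine Filter.Tendsto.congr' hcongr ?_
  have hcE : Continuous (heatExponent (d := d) 0) := (hasTemperateGrowth_heatExponent 0).1.continuous
  have hcS : Continuous (spaceSymbol (d := d)) := hasTemperateGrowth_spaceSymbol.1.continuous
  refine tendsto_integral_filter_of_dominated_convergence
    (fun ξ => gaussSymbol (s₀ / 2) 0 ξ) ?_ ?_ (gaussSymbol (s₀ / 2) 0).integrable ?_
  · refine Filter.Eventually.of_forall fun p => Continuous.aestronglyMeasurable ?_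
    unfold gaussExponent
    fun_prop
  · filter_upwards [hev] with p hp
    refine Filter.Eventually.of_forall fun ξ => ?_
    rw [norm_mul, Real.norm_of_nonneg (Real.exp_pos _).le, gaussSymbol_apply hs2 le_rfl]
    refine (mul_le_of_le_one_right (Real.exp_pos _).le (Real.abs_cos_le_one _)).trans ?_
    apply Real.exp_le_exp.2
    unfold gaussExponent
    have := mul_nonneg hp.2 (spaceSymbol_nonneg ξ)
    have := mul_le_mul_of_nonneg_right hp.1.le (heatExponent_nonneg 0 ξ)
    linarith
  · refine Filter.Eventually.of_forall fun ξ => ?_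
    have : Continuous fun p : ℝ × ℝ => Real.exp (-gaussExponent p.1 p.2 ξ) *
        Real.cos (2 * Real.pi * inner ℝ ξ x) := by
      unfold gaussExponent
      fun_prop
    exact this.continuousAt.tendsto.mono_left nhdsWithin_le_nhds

end HeatKernels

/-! ### Multi-indices and derivatives -/

section MultiIndices

variable {d : ℕ}

/-- The parabolic weight of a coordinate. -/
def scal (i : Fin (d + 1)) : ℕ := if i = 0 then 2 else 1

@[simp] theorem scal_zero : scal (0 : Fin (d + 1)) = 2 := rfl

@[simp] theorem scal_succ (i : Fin d) : scal i.succ = 1 := by simp [scal]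

theorem scal_pos (i : Fin (d + 1)) : 1 ≤ scal i := by
  unfold scal; split_ifs <;> omega

theorem scal_le (i : Fin (d + 1)) : scal i ≤ 2 := by
  unfold scal; split_ifs <;> omega

theorem sdeg_eq_sum (n : MIdx d) : sdeg n = ∑ i, scal i * n i := by
  simp [sdeg, Fin.sum_univ_succ]

@[simp] theorem sdeg_zero : sdeg (0 : MIdx d) = 0 := by simp [sdeg]

theorem sdeg_add (n l : MIdx d) : sdeg (n + l) = sdeg n + sdeg l := by
  simp [sdeg_eq_sum, mul_add, Finset.sum_add_distrib]

@[simp] theorem sdeg_unitIdx (i : Fin (d + 1)) : sdeg (unitIdx i) = scal i := by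
  simp [sdeg_eq_sum, unitIdx, Pi.single_apply]

theorem sdeg_mono {n l : MIdx d} (h : n ≤ l) : sdeg n ≤ sdeg l := by
  simp only [sdeg_eq_sum]
  exact Finset.sum_le_sum fun i _ => Nat.mul_le_mul_left _ (h i)

theorem MIdx.induction {motive : MIdx d → Prop} (zero : motive 0)
    (add : ∀ n i, motive n → motive (n + unitIdx i)) (n : MIdx d) : motive n := by
  induction hk : ∑ i, n i generalizing n with
  | zero =>
    have : n = 0 := by
      funext i
      exact (Finset.sum_eq_zero_iff.1 hk) i (Finset.mem_univ i)
    rwa [this]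
  | succ k ih =>
    obtain ⟨i, -, hi⟩ := Finset.exists_ne_zero_of_sum_ne_zero (hk ▸ Nat.succ_ne_zero k :
      ∑ i, n i ≠ 0)
    have e : n = (n - unitIdx i) + unitIdx i := by
      funext j
      by_cases hj : j = i
      · subst hj
        simp only [unitIdx, Pi.add_apply, Pi.sub_apply, Pi.single_eq_same]
        omega
      · simp [unitIdx, hj]
    rw [e]
    refine add _ _ (ih _ ?_)
    rw [e] at hk
    simp only [Pi.add_apply, Finset.sum_add_distrib] at hk
    have : ∑ j, unitIdx i j = 1 := by simp [unitIdx, Pi.single_apply]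
    omega

theorem pderiv_comm (i j : Fin (d + 1)) (φ : 𝓢(Spacetime d, ℝ)) :
    pderiv i (pderiv j φ) = pderiv j (pderiv i φ) := lineDerivOp_comm _ _ _

theorem pderiv_iterate_comm (i j : Fin (d + 1)) (k : ℕ) (φ : 𝓢(Spacetime d, ℝ)) :
    pderiv i ((pderiv j)^[k] φ) = (pderiv j)^[k] (pderiv i φ) :=
  ((Function.Commute.iterate_right (f := pderiv i) (g := pderiv j)
    (fun φ => pderiv_comm i j φ)) k) φ

@[simp] theorem mderiv_zero (φ : 𝓢(Spacetime d, ℝ)) : mderiv 0 φ = φ := by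
  unfold mderiv
  induction List.finRange (d + 1) with
  | nil => rfl
  | cons a l _ => simp

/-- In the iterated product over the coordinates, the additional derivative commutes past the other
factors until it leaves its own slot. -/
theorem mderiv_add_unitIdx (n : MIdx d) (i : Fin (d + 1)) (φ : 𝓢(Spacetime d, ℝ)) :
    mderiv (n + unitIdx i) φ = pderiv i (mderiv n φ) := by
  unfold mderiv
  have h : ∀ l : List (Fin (d + 1)), l.Nodup →
      l.foldr (fun j ψ => (pderiv j)^[(n + unitIdx i) j] ψ) φ =
        if i ∈ l then pderiv i (l.foldr (fun j ψ => (pderiv j)^[n j] ψ) φ)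
        else l.foldr (fun j ψ => (pderiv j)^[n j] ψ) φ := by
    intro l hl
    induction l with
    | nil => simp
    | cons a l ih =>
      rw [List.nodup_cons] at hl
      rw [List.foldr_cons, List.foldr_cons, ih hl.2]
      by_cases hia : i = a
      · subst hia
        have e : (n + unitIdx i) i = n i + 1 := by simp [unitIdx]
        rw [if_neg hl.1, if_pos List.mem_cons_self, e, Function.iterate_succ_apply']
      · have e : (n + unitIdx i) a = n a := by simp [unitIdx, Ne.symm hia]
        rw [e]
        by_cases hil : i ∈ l
        · rw [if_pos hil, if_pos (List.mem_cons_of_mem a hil), pderiv_iterate_comm]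
        · rw [if_neg hil, if_neg (by simp [hia, hil])]
  rw [h _ (List.nodup_finRange _), if_pos (List.mem_finRange i)]

@[simp] theorem mderiv_unitIdx (i : Fin (d + 1)) (φ : 𝓢(Spacetime d, ℝ)) :
    mderiv (unitIdx i) φ = pderiv i φ := by
  have := mderiv_add_unitIdx 0 i φ
  simpa using this

theorem mderiv_mderiv (n l : MIdx d) (φ : 𝓢(Spacetime d, ℝ)) :
    mderiv n (mderiv l φ) = mderiv (n + l) φ := by
  induction n using MIdx.induction with
  | zero => simp
  | add n i ih =>
    rw [mderiv_add_unitIdx, ih, add_right_comm, mderiv_add_unitIdx]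

theorem pderiv_sconv (i : Fin (d + 1)) (a b : 𝓢(Spacetime d, ℝ)) :
    pderiv i (sconv a b) = sconv a (pderiv i b) := lineDerivOp_sconv _ _ _

theorem mderiv_sconv (n : MIdx d) (a b : 𝓢(Spacetime d, ℝ)) :
    mderiv n (sconv a b) = sconv a (mderiv n b) := by
  induction n using MIdx.induction with
  | zero => simp
  | add n i ih => rw [mderiv_add_unitIdx, ih, mderiv_add_unitIdx, pderiv_sconv]

theorem mderiv_sconv_left (n : MIdx d) (a b : 𝓢(Spacetime d, ℝ)) :
    mderiv n (sconv a b) = sconv (mderiv n a) b := by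
  rw [sconv_comm, mderiv_sconv, sconv_comm]

theorem exists_mderivCLM (n : MIdx d) :
    ∃ L : 𝓢(Spacetime d, ℝ) →L[ℝ] 𝓢(Spacetime d, ℝ), ∀ φ, L φ = mderiv n φ := by
  induction n using MIdx.induction with
  | zero => exact ⟨ContinuousLinearMap.id ℝ _, fun φ => by simp⟩
  | add n i ih =>
    obtain ⟨L, hL⟩ := ih
    refine ⟨(LineDeriv.lineDerivOpCLM ℝ 𝓢(Spacetime d, ℝ) (EuclideanSpace.single i (1 : ℝ))).comp L,
      fun φ => ?_⟩
    rw [mderiv_add_unitIdx, ← hL]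
    rfl

/-- The operator `∂ⁿ` as a continuous linear map. -/
def mderivCLM (n : MIdx d) : 𝓢(Spacetime d, ℝ) →L[ℝ] 𝓢(Spacetime d, ℝ) :=
  (exists_mderivCLM n).choose

theorem mderivCLM_apply (n : MIdx d) (φ : 𝓢(Spacetime d, ℝ)) : mderivCLM n φ = mderiv n φ :=
  (exists_mderivCLM n).choose_spec φ

theorem mderiv_smul (n : MIdx d) (c : ℝ) (φ : 𝓢(Spacetime d, ℝ)) :
    mderiv n (c • φ) = c • mderiv n φ := by
  simp only [← mderivCLM_apply, map_smul]

end MultiIndices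

/-! ### The parabolic norm and dilations -/

section Dilations

variable {d : ℕ}

/-- The parabolic distance to the origin. -/
def pnorm (z : Spacetime d) : ℝ := √|z 0| + √(∑ i : Fin d, (z i.succ) ^ 2)

theorem pdist_eq (x y : Spacetime d) : pdist x y = pnorm (x - y) := by
  simp [pdist, pnorm]

theorem pnorm_nonneg (z : Spacetime d) : 0 ≤ pnorm z := by unfold pnorm; positivity

theorem pdist_nonneg (x y : Spacetime d) : 0 ≤ pdist x y := by
  rw [pdist_eq]; exact pnorm_nonneg _

@[simp] theorem pnorm_zero : pnorm (0 : Spacetime d) = 0 := by simp [pnorm]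

@[simp] theorem pdist_self (x : Spacetime d) : pdist x x = 0 := by simp [pdist_eq]

theorem pnorm_neg (z : Spacetime d) : pnorm (-z) = pnorm z := by simp [pnorm]

theorem sqrt_sum_eq_norm (z : Spacetime d) : √(∑ i : Fin d, (z i.succ) ^ 2) =
    ‖(WithLp.toLp 2 fun i : Fin d => z i.succ : EuclideanSpace ℝ (Fin d))‖ := by
  rw [EuclideanSpace.norm_eq]
  simp

theorem pnorm_add_le (y z : Spacetime d) : pnorm (y + z) ≤ pnorm y + pnorm z := by
  have h1 : √|(y + z) 0| ≤ √|y 0| + √|z 0| := by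
    refine (Real.sqrt_le_sqrt (abs_add_le (y 0) (z 0))).trans ?_
    rw [Real.sqrt_le_left (by positivity), add_sq, Real.sq_sqrt (abs_nonneg _),
      Real.sq_sqrt (abs_nonneg _)]
    have := mul_nonneg (Real.sqrt_nonneg |y 0|) (Real.sqrt_nonneg |z 0|)
    linarith
  have h2 : √(∑ i : Fin d, ((y + z) i.succ) ^ 2) ≤
      √(∑ i : Fin d, (y i.succ) ^ 2) + √(∑ i : Fin d, (z i.succ) ^ 2) := by
    rw [sqrt_sum_eq_norm, sqrt_sum_eq_norm y, sqrt_sum_eq_norm z]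
    have e : (WithLp.toLp 2 fun i : Fin d => (y + z) i.succ : EuclideanSpace ℝ (Fin d)) =
        (WithLp.toLp 2 fun i : Fin d => y i.succ) + (WithLp.toLp 2 fun i : Fin d => z i.succ) := by
      ext i; simp
    rw [e]
    exact norm_add_le _ _
  unfold pnorm
  linarith

theorem abs_apply_le_pnorm_pow (z : Spacetime d) (i : Fin (d + 1)) :
    |z i| ≤ pnorm z ^ scal i := by
  refine Fin.cases ?_ (fun j => ?_) i
  · rw [scal_zero]
    have h := Real.sq_sqrt (abs_nonneg (z 0))
    have h1 : √|z 0| ≤ pnorm z := le_add_of_nonneg_right (Real.sqrt_nonneg _)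
    calc |z 0| = √|z 0| ^ 2 := h.symm
      _ ≤ _ := by gcongr
  · rw [scal_succ, pow_one]
    have h1 : |z j.succ| ≤ √(∑ i : Fin d, (z i.succ) ^ 2) := by
      rw [← Real.sqrt_sq_eq_abs]
      exact Real.sqrt_le_sqrt (Finset.single_le_sum (f := fun i : Fin d => (z i.succ) ^ 2)
        (fun _ _ => sq_nonneg _) (Finset.mem_univ j))
    refine h1.trans ?_
    unfold pnorm; simp

theorem norm_sq_eq_time_add_space (z : Spacetime d) :
    ‖z‖ ^ 2 = |z 0| ^ 2 + √(∑ i : Fin d, (z i.succ) ^ 2) ^ 2 := by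
  rw [EuclideanSpace.norm_sq_eq, Fin.sum_univ_succ,
    Real.sq_sqrt (Finset.sum_nonneg fun _ _ => sq_nonneg _)]
  simp

/-- Together with `one_add_norm_le` this trades Euclidean polynomial weights for parabolic ones;
only the degree of the weight changes. -/
theorem one_add_pnorm_le (z : Spacetime d) : 1 + pnorm z ≤ 2 * (1 + ‖z‖) := by
  have h := norm_sq_eq_time_add_space z
  set b := √(∑ i : Fin d, (z i.succ) ^ 2)
  have hb : b ≤ ‖z‖ := by
    refine le_of_sq_le_sq ?_ (norm_nonneg _)
    rw [h]; nlinarith [abs_nonneg (z 0)]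
  have ha : |z 0| ≤ ‖z‖ := by
    refine le_of_sq_le_sq ?_ (norm_nonneg _)
    rw [h]; nlinarith [sq_nonneg b]
  have h2 := Real.sq_sqrt (abs_nonneg (z 0))
  have h3 : pnorm z = √|z 0| + b := rfl
  nlinarith [sq_nonneg (√|z 0| - 1), norm_nonneg z]

theorem one_add_norm_le (z : Spacetime d) : 1 + ‖z‖ ≤ (1 + pnorm z) ^ 2 := by
  have h := norm_sq_eq_time_add_space z
  set b := √(∑ i : Fin d, (z i.succ) ^ 2)
  have hb : 0 ≤ b := Real.sqrt_nonneg _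
  have h2 := Real.sq_sqrt (abs_nonneg (z 0))
  have ha := Real.sqrt_nonneg |z 0|
  have h3 : pnorm z = √|z 0| + b := rfl
  have h4 : ‖z‖ ≤ |z 0| + b := by
    refine le_of_sq_le_sq ?_ (by positivity)
    rw [h]; nlinarith [abs_nonneg (z 0)]
  nlinarith

theorem continuous_pnorm : Continuous (pnorm (d := d)) := by
  unfold pnorm
  fun_prop

theorem pnorm_pos {z : Spacetime d} (hz : z ≠ 0) : 0 < pnorm z := by
  refine (pnorm_nonneg z).lt_of_ne fun h => hz ?_
  ext i
  have := abs_apply_le_pnorm_pow z i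
  rw [← h, zero_pow (by have := scal_pos i; omega)] at this
  simpa using abs_nonpos_iff.1 this

theorem pdist_pos {x y : Spacetime d} (h : x ≠ y) : 0 < pdist x y := by
  rw [pdist_eq]; exact pnorm_pos (sub_ne_zero.2 h)

/-- The parabolic dilation, as a linear map. -/
def dilMap (c : ℝ) : Spacetime d →ₗ[ℝ] Spacetime d where
  toFun x := WithLp.toLp 2 fun i => c ^ scal i * x i
  map_add' x y := by ext i; simp [mul_add]
  map_smul' a x := by ext i; simp; ring

theorem dilMap_apply (c : ℝ) (x : Spacetime d) (i : Fin (d + 1)) :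
    dilMap c x i = c ^ scal i * x i := rfl

theorem dilMap_dilMap (a b : ℝ) (x : Spacetime d) : dilMap a (dilMap b x) = dilMap (a * b) x := by
  ext i; simp [dilMap_apply, mul_pow, mul_assoc]

theorem dilMap_one (x : Spacetime d) : dilMap 1 x = x := by
  ext i; simp [dilMap_apply]

/-- The parabolic dilation. -/
def dil {c : ℝ} (hc : 0 < c) : Spacetime d ≃L[ℝ] Spacetime d :=
  LinearEquiv.toContinuousLinearEquiv
    { dilMap c with
      invFun := dilMap c⁻¹
      left_inv := fun x => by
        change dilMap c⁻¹ (dilMap c x) = x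
        rw [dilMap_dilMap, inv_mul_cancel₀ hc.ne', dilMap_one]
      right_inv := fun x => by
        change dilMap c (dilMap c⁻¹ x) = x
        rw [dilMap_dilMap, mul_inv_cancel₀ hc.ne', dilMap_one] }

theorem dil_apply {c : ℝ} (hc : 0 < c) (x : Spacetime d) : dil hc x = dilMap c x := rfl

theorem pnorm_dilMap {c : ℝ} (hc : 0 ≤ c) (x : Spacetime d) : pnorm (dilMap c x) = c * pnorm x := by
  unfold pnorm
  simp only [dilMap_apply, scal_zero, scal_succ, pow_one, mul_pow, ← Finset.mul_sum]
  rw [abs_mul, abs_of_nonneg (sq_nonneg c), Real.sqrt_mul (sq_nonneg c), Real.sqrt_mul (sq_nonneg c),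
    Real.sqrt_sq hc, mul_add]

theorem inner_dilMap (c : ℝ) (x y : Spacetime d) :
    inner ℝ (dilMap c x) y = inner ℝ x (dilMap c y) := by
  simp only [PiLp.inner_apply, dilMap_apply]
  refine Finset.sum_congr rfl fun i _ => ?_
  simp
  ring

/-- The factor by which a parabolic dilation changes the volume. -/
def dilFactor {d : ℕ} (c : ℝ) : ℝ := |(LinearMap.det (dilMap (d := d) c))⁻¹|

theorem dilFactor_pos {c : ℝ} (hc : 0 < c) : 0 < dilFactor (d := d) c := by
  unfold dilFactor
  have : LinearMap.det (dilMap (d := d) c) ≠ 0 := by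
    have := LinearEquiv.isUnit_det' (dil (d := d) hc).toLinearEquiv
    exact this.ne_zero
  positivity

theorem integral_dilMap {c : ℝ} (hc : 0 < c) (f : Spacetime d → ℝ) :
    ∫ x, f (dilMap c x) = dilFactor (d := d) c * ∫ x, f x := by
  have hdet : LinearMap.det (dilMap (d := d) c) ≠ 0 :=
    (LinearEquiv.isUnit_det' (dil (d := d) hc).toLinearEquiv).ne_zero
  have h := Measure.map_linearMap_addHaar_eq_smul_addHaar (μ := (volume : Measure (Spacetime d))) hdet
  have h2 := (dil (d := d) hc).toHomeomorph.measurableEmbedding.integral_map (μ := volume) f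
  have h3 : ⇑(dil (d := d) hc).toHomeomorph = ⇑(dilMap (d := d) c) := rfl
  rw [h3] at h2
  rw [← h2, h, integral_smul_measure, ENNReal.toReal_ofReal (abs_nonneg _)]
  rfl

end Dilations

/-! ### Scaling and estimates of the kernels -/

section KernelEstimates

variable {d : ℕ}

/-- `∂₀² - Δ'²` is homogeneous of parabolic degree `4` and `Δ'` of degree `2`, hence the powers `c ^
4` and `c ^ 2`. -/
theorem gaussExponent_dilMap {c : ℝ} (v : ℝ) (ξ : Spacetime d) :
    gaussExponent 1 v (dilMap c ξ) = gaussExponent (c ^ 4) (c ^ 2 * v) ξ := by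
  have h : spaceSymbol (dilMap c ξ) = c ^ 2 * spaceSymbol ξ := by
    simp only [spaceSymbol, dilMap_apply, scal_succ, pow_one, Finset.mul_sum]
    refine Finset.sum_congr rfl fun i _ => ?_
    ring
  have h2 : heatExponent 0 (dilMap c ξ) = c ^ 4 * heatExponent 0 ξ := by
    have e : ∀ ξ : Spacetime d, heatExponent 0 ξ = (2 * Real.pi * ξ 0) ^ 2 + spaceSymbol ξ ^ 2 :=
      fun ξ => by simp [heatExponent, spaceSymbol]
    rw [e, e, h, dilMap_apply, scal_zero]
    ring
  rw [gaussExponent, gaussExponent, h, h2]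
  ring

/-- Reduces every kernel to time `1`. For the massive kernel at time `c ^ 4` the rescaled second
parameter is `v = 2 * c ^ 2`, which stays bounded for `c ≤ 1`. -/
theorem gauss_scale {c v : ℝ} (hc : 0 < c) (hv : 0 ≤ v) :
    gauss (d := d) (c ^ 4) (c ^ 2 * v) = dilFactor (d := d) c •
      SchwartzMap.compCLMOfContinuousLinearEquiv ℝ (dil (inv_pos.2 hc)) (gauss 1 v) := by
  ext x
  have h1 : (dilFactor (d := d) c • SchwartzMap.compCLMOfContinuousLinearEquiv ℝ
      (dil (inv_pos.2 hc)) (gauss 1 v) : 𝓢(Spacetime d, ℝ)) x =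
      dilFactor (d := d) c * gauss 1 v (dilMap c⁻¹ x) := rfl
  rw [h1, gauss_apply (by positivity) (by positivity), gauss_apply one_pos hv, ← integral_dilMap hc]
  refine integral_congr_ae (Filter.Eventually.of_forall fun ξ => ?_)
  simp only [gaussExponent_dilMap]
  rw [inner_dilMap, dilMap_dilMap, mul_inv_cancel₀ hc.ne', dilMap_one]

theorem mderiv_comp_dil {c : ℝ} (hc : 0 < c) (n : MIdx d) (φ : 𝓢(Spacetime d, ℝ)) :
    mderiv n (SchwartzMap.compCLMOfContinuousLinearEquiv ℝ (dil hc) φ) =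
      c ^ sdeg n • SchwartzMap.compCLMOfContinuousLinearEquiv ℝ (dil hc) (mderiv n φ) := by
  induction n using MIdx.induction with
  | zero => simp
  | add n i ih =>
    rw [mderiv_add_unitIdx, ih, mderiv_add_unitIdx, sdeg_add, sdeg_unitIdx, pow_add, mul_smul]
    unfold pderiv
    have e : dil hc (EuclideanSpace.single i (1 : ℝ)) =
        c ^ scal i • (EuclideanSpace.single i (1 : ℝ) : Spacetime d) := by
      ext j
      rw [dil_apply, dilMap_apply]
      by_cases h : j = i
      · subst h; simp
      · simp [h]
    rw [LineDeriv.lineDerivOp_smul, SchwartzMap.lineDerivOp_compCLMOfContinuousLinearEquiv, e,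
      LineDeriv.lineDerivOp_left_smul, map_smul]

theorem mderiv_gauss_scale {c v : ℝ} (hc : 0 < c) (hv : 0 ≤ v) (n : MIdx d) (x : Spacetime d) :
    mderiv n (gauss (c ^ 4) (c ^ 2 * v)) x =
      dilFactor (d := d) c * ((c⁻¹) ^ sdeg n * mderiv n (gauss 1 v) (dilMap c⁻¹ x)) := by
  rw [gauss_scale hc hv, mderiv_smul, mderiv_comp_dil]
  rfl

theorem dilFactor_mul_integral {c : ℝ} (hc : 0 < c) (f : Spacetime d → ℝ) :
    dilFactor (d := d) c * ∫ x, f (dilMap c⁻¹ x) = ∫ x, f x := by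
  rw [← integral_dilMap hc]
  simp only [dilMap_dilMap, inv_mul_cancel₀ hc.ne', dilMap_one]

theorem integral_gauss_scale {c v : ℝ} (hc : 0 < c) (hv : 0 ≤ v) (U : Spacetime d → ℝ) :
    ∫ w, gauss (c ^ 4) (c ^ 2 * v) w * U w = ∫ w, gauss 1 v w * U (dilMap c w) := by
  rw [← dilFactor_mul_integral hc (fun w => gauss 1 v w * U (dilMap c w)), ← integral_const_mul]
  refine integral_congr_ae (Filter.Eventually.of_forall fun w => ?_)
  have h := mderiv_gauss_scale hc hv 0 w
  simp only [mderiv_zero, sdeg_zero, pow_zero, one_mul] at h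
  simp only [h, dilMap_dilMap, mul_inv_cancel₀ hc.ne', dilMap_one]
  ring

theorem integral_abs_mderiv_gauss_scale {c v : ℝ} (hc : 0 < c) (hv : 0 ≤ v) (n : MIdx d)
    (U : Spacetime d → ℝ) : ∫ w, |mderiv n (gauss (c ^ 4) (c ^ 2 * v)) w| * U w =
      (c⁻¹) ^ sdeg n * ∫ w, |mderiv n (gauss 1 v) w| * U (dilMap c w) := by
  rw [← dilFactor_mul_integral hc (fun w => |mderiv n (gauss 1 v) w| * U (dilMap c w)),
    ← integral_const_mul, ← integral_const_mul]
  refine integral_congr_ae (Filter.Eventually.of_forall fun w => ?_)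
  simp only [mderiv_gauss_scale hc hv, dilMap_dilMap, mul_inv_cancel₀ hc.ne', dilMap_one]
  rw [abs_mul, abs_mul, abs_of_pos (dilFactor_pos hc), abs_of_nonneg (by positivity)]
  ring

/-- Uniform decay of the kernels at unit scale. -/
theorem exists_weightNorm_gauss_le (n : MIdx d) (k N : ℕ) : ∃ C : ℝ, 0 ≤ C ∧
    ∀ v, 0 ≤ v → v ≤ 3 → weightNorm k N (mderiv n (gauss 1 v) : 𝓢(Spacetime d, ℝ)) ≤ C := by
  -- Boundedness of the family is checked on the symbols, where it is `gaussExponent_decay`.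
  -- Continuous linear maps preserve bounded sets, so it passes to the derivatives of the kernels
  -- with no estimate of an oscillatory integral.
  have hb : Bornology.IsVonNBounded ℝ
      ((fun v => gaussSymbol (d := d) 1 v) '' Set.Icc 0 3) := by
    rw [(schwartz_withSeminorms ℝ (Spacetime d) ℝ).image_isVonNBounded_iff_seminorm_bounded]
    intro i
    obtain ⟨C, hC⟩ := gaussExponent_decay (d := d) one_pos (by norm_num : (0 : ℝ) ≤ 3) i.1 i.2
    refine ⟨|C| + 1, by positivity, fun v hv => ?_⟩
    refine lt_of_le_of_lt (SchwartzMap.seminorm_le_bound ℝ i.1 i.2 _ (abs_nonneg C) fun ξ => ?_)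
      (lt_add_one _)
    have e : (gaussSymbol 1 v : Spacetime d → ℝ) = fun ξ => Real.exp (-gaussExponent 1 v ξ) := by
      ext ξ; exact gaussSymbol_apply one_pos hv.1 ξ
    rw [e]
    exact (hC v hv.1 hv.2 ξ).trans (le_abs_self C)
  have hb2 := hb.image ((mderivCLM n).comp symbolKernel)
  rw [← Set.image_comp, (schwartz_withSeminorms ℝ (Spacetime d)
    ℝ).image_isVonNBounded_iff_finset_seminorm_bounded] at hb2
  obtain ⟨r, hr, h⟩ := hb2 (Finset.Iic (k, N))
  refine ⟨2 ^ k * r, by positivity, fun v h0 h3 => ?_⟩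
  unfold weightNorm
  refine mul_le_mul_of_nonneg_left ?_ (by positivity)
  have := h v ⟨h0, h3⟩
  simp only [Function.comp_apply, ContinuousLinearMap.comp_apply, mderivCLM_apply] at this
  exact this.le

/-- The integral of `(1 + ‖w‖) ^ k` against a Schwartz function is bounded by a seminorm. -/
theorem exists_integral_weight_le (d k : ℕ) : ∃ C : ℝ, 0 ≤ C ∧ ∀ φ : 𝓢(Spacetime d, ℝ),
    ∫ w, (1 + ‖w‖) ^ k * |φ w| ≤ C * weightNorm (k + (d + 2)) 0 φ := by
  have hr : ((Module.finrank ℝ (Spacetime d) : ℕ) : ℝ) < ((d + 2 : ℕ) : ℝ) := by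
    simp
  have hI := (integrable_one_add_norm (μ := (volume : Measure (Spacetime d))) hr)
  refine ⟨∫ w : Spacetime d, (1 + ‖w‖) ^ (-((d + 2 : ℕ) : ℝ)),
    integral_nonneg fun w => by positivity, fun φ => ?_⟩
  rw [mul_comm, ← integral_const_mul]
  refine integral_mono (integrable_one_add_pow_mul φ k) (hI.const_mul _) fun w => ?_
  have h1 := abs_le_weightNorm (k + (d + 2)) φ w
  have h2 : (0 : ℝ) < 1 + ‖w‖ := by positivity
  simp only []
  rw [Real.rpow_neg h2.le, Real.rpow_natCast,
    ← div_eq_mul_inv, le_div_iff₀ (by positivity)]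
  calc _ = (1 + ‖w‖) ^ (k + (d + 2)) * |φ w| := by ring
    _ ≤ _ := h1

theorem polyBdd_pnorm_weight (c : ℝ) (m : ℕ) (hc : 0 < c) :
    PolyBdd fun w : Spacetime d => (1 + pnorm w / c) ^ m := by
  refine ⟨by have := continuous_pnorm (d := d); fun_prop, (1 + 2 / c) ^ m, m, fun w => ?_⟩
  have h := one_add_pnorm_le w
  have h0 := pnorm_nonneg w
  rw [abs_of_nonneg (by positivity), ← mul_pow]
  gcongr
  have : pnorm w / c ≤ (2 * (1 + ‖w‖)) / c := by gcongr; linarith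
  have h2 := norm_nonneg w
  calc 1 + pnorm w / c ≤ 1 + (2 * (1 + ‖w‖)) / c := by linarith
    _ ≤ (1 + ‖w‖) + (2 * (1 + ‖w‖)) / c := by linarith
    _ = _ := by ring

theorem integrable_abs_mul_weight (φ : 𝓢(Spacetime d, ℝ)) {c : ℝ} (hc : 0 < c) (m : ℕ) :
    Integrable fun w => |φ w| * (1 + pnorm w / c) ^ m := by
  have := ((polyBdd_pnorm_weight (d := d) c m hc).integrable_mul φ).norm
  refine this.congr (Filter.Eventually.of_forall fun w => ?_)
  have h0 := pnorm_nonneg w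
  simp only [norm_mul, Real.norm_eq_abs]
  rw [abs_of_nonneg (a := (1 + pnorm w / c) ^ m) (by positivity)]

/-- The scale invariant estimate of the kernels. -/
theorem exists_integral_mderiv_gauss_le (n : MIdx d) (m : ℕ) : ∃ K : ℝ, 0 ≤ K ∧
    ∀ c u, 0 < c → 0 ≤ u → u ≤ 3 * c ^ 2 →
      ∫ w, |mderiv n (gauss (c ^ 4) u) w| * (1 + pnorm w / c) ^ m ≤ K * (c⁻¹) ^ sdeg n := by
  obtain ⟨C₁, hC₁, h₁⟩ := exists_integral_weight_le d m
  obtain ⟨C₂, hC₂, h₂⟩ := exists_weightNorm_gauss_le n (m + (d + 2)) 0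
  refine ⟨2 ^ m * (C₁ * C₂), by positivity, fun c u hc hu hu3 => ?_⟩
  -- The condition `u ≤ 3 * c ^ 2` says that after rescaling `v` lies in the interval `[0, 3]` of
  -- the uniform estimate.
  set v := u / c ^ 2 with hv
  have hv0 : 0 ≤ v := by positivity
  have hv3 : v ≤ 3 := by rw [hv, div_le_iff₀ (by positivity)]; exact hu3
  have huv : u = c ^ 2 * v := by rw [hv]; field_simp
  rw [huv, integral_abs_mderiv_gauss_scale hc hv0, mul_comm]
  refine mul_le_mul_of_nonneg_right ?_ (by positivity)
  simp only [pnorm_dilMap hc.le, mul_div_cancel_left₀ _ hc.ne']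
  set φ : 𝓢(Spacetime d, ℝ) := mderiv n (gauss 1 v)
  have hint := integrable_abs_mul_weight φ one_pos m
  simp only [div_one] at hint
  calc ∫ w, |φ w| * (1 + pnorm w) ^ m ≤ ∫ w, 2 ^ m * ((1 + ‖w‖) ^ m * |φ w|) := by
        refine integral_mono hint ((integrable_one_add_pow_mul φ m).const_mul _) fun w => ?_
        have := one_add_pnorm_le w
        have h0 := pnorm_nonneg w
        calc |φ w| * (1 + pnorm w) ^ m ≤ |φ w| * (2 * (1 + ‖w‖)) ^ m := by gcongr
          _ = _ := by rw [mul_pow]; ring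
    _ = 2 ^ m * ∫ w, (1 + ‖w‖) ^ m * |φ w| := integral_const_mul _ _
    _ ≤ 2 ^ m * (C₁ * C₂) := by
        gcongr
        refine (h₁ φ).trans ?_
        gcongr
        exact h₂ v hv0 hv3

/-- Continuity of the integral of a function against the kernels up to time zero. -/
theorem tendsto_integral_gauss {ι : Type*} {l : Filter ι} [l.IsCountablyGenerated]
    {U : Spacetime d → ℝ} (hU : PolyBdd U) {c v : ι → ℝ} {c₀ v₀ : ℝ}
    (hc : Filter.Tendsto c l (nhds c₀)) (hv : Filter.Tendsto v l (nhds v₀))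
    (hcpos : ∀ᶠ i in l, 0 < c i) (hc1 : ∀ᶠ i in l, c i ≤ 2) (hv0 : ∀ᶠ i in l, 0 ≤ v i ∧ v i ≤ 3)
    (hv0' : 0 ≤ v₀) :
    Filter.Tendsto (fun i => ∫ w, gauss ((c i) ^ 4) ((c i) ^ 2 * v i) w * U w) l
      (nhds (∫ w, gauss 1 v₀ w * U (dilMap c₀ w))) := by
  -- After rescaling, the degeneration `c → 0` sits in the argument of `U` and no longer in the
  -- kernel, so the limit `c₀ = 0` is covered by dominated convergence as well.
  have hcongr : (fun i => ∫ w, gauss 1 (v i) w * U (dilMap (c i) w)) =ᶠ[l]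
      fun i => ∫ w, gauss ((c i) ^ 4) ((c i) ^ 2 * v i) w * U w := by
    filter_upwards [hcpos, hv0] with i h1 h2
    rw [integral_gauss_scale h1 h2.1]
  refine Filter.Tendsto.congr' hcongr ?_
  obtain ⟨C, k, hCk⟩ := hU.bound
  have hC : 0 ≤ C := by
    have := (abs_nonneg _).trans (hCk 0)
    simpa using this
  obtain ⟨B, hB, hBv⟩ := exists_weightNorm_gauss_le (d := d) 0 (2 * k + (d + 2)) 0
  have hr : ((Module.finrank ℝ (Spacetime d) : ℕ) : ℝ) < ((d + 2 : ℕ) : ℝ) := by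
    simp
  have hI := (integrable_one_add_norm (μ := (volume : Measure (Spacetime d))) hr).const_mul
    (C * 6 ^ (2 * k) * B)
  have hdil : ∀ w : Spacetime d, Continuous fun c : ℝ => dilMap c w := by
    intro w
    have : (fun c : ℝ => dilMap c w) = fun c => WithLp.toLp 2 fun i => c ^ scal i * w i := rfl
    rw [this]
    fun_prop
  refine tendsto_integral_filter_of_dominated_convergence _ ?_ ?_ hI ?_
  · refine Filter.Eventually.of_forall fun i => Continuous.aestronglyMeasurable ?_
    exact (gauss 1 (v i)).continuous.mul (hU.continuous.comp (LinearMap.continuous_of_finiteDimensional _))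
  · filter_upwards [hcpos, hc1, hv0] with i h1 h2 h3
    refine Filter.Eventually.of_forall fun w => ?_
    have e1 := abs_le_weightNorm (2 * k + (d + 2)) (gauss (d := d) 1 (v i)) w
    have e2 := hBv (v i) h3.1 h3.2
    rw [mderiv_zero] at e2
    have e3 : 1 + ‖dilMap (c i) w‖ ≤ (6 * (1 + ‖w‖)) ^ 2 := by
      refine (one_add_norm_le _).trans ?_
      rw [pnorm_dilMap h1.le]
      have := one_add_pnorm_le w
      have h0 := pnorm_nonneg w
      have := norm_nonneg w
      gcongr
      nlinarith
    have hp : (0 : ℝ) < 1 + ‖w‖ := by positivity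
    rw [norm_mul, Real.norm_eq_abs, Real.norm_eq_abs, Real.rpow_neg hp.le, Real.rpow_natCast,
      ← div_eq_mul_inv, le_div_iff₀ (by positivity)]
    calc |gauss 1 (v i) w| * |U (dilMap (c i) w)| * (1 + ‖w‖) ^ (d + 2)
        ≤ |gauss 1 (v i) w| * (C * ((6 * (1 + ‖w‖)) ^ 2) ^ k) * (1 + ‖w‖) ^ (d + 2) := by
          gcongr
          exact (hCk _).trans (by gcongr)
      _ = C * 6 ^ (2 * k) * ((1 + ‖w‖) ^ (2 * k + (d + 2)) * |gauss 1 (v i) w|) := by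
          rw [← pow_mul, mul_pow]; ring
      _ ≤ C * 6 ^ (2 * k) * B := by gcongr; exact e1.trans e2
  · refine Filter.Eventually.of_forall fun w => ?_
    have h1 := continuousOn_gauss w (1, v₀) ⟨by simp, hv0'⟩
    have h2 : Filter.Tendsto (fun i => ((1 : ℝ), v i)) l
        (nhdsWithin (1, v₀) (Set.Ioi 0 ×ˢ Set.Ici 0)) := by
      refine tendsto_nhdsWithin_iff.2 ⟨?_, ?_⟩
      · exact (tendsto_const_nhds.prodMk_nhds hv)
      · filter_upwards [hv0] with i hi
        exact ⟨by simp, hi.1⟩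
    have h3 : Filter.Tendsto (fun p : ℝ × ℝ => gauss p.1 p.2 w)
        (nhdsWithin (1, v₀) (Set.Ioi 0 ×ˢ Set.Ici 0)) (nhds (gauss 1 v₀ w)) := h1
    have h4 := h3.comp h2
    simp only [Function.comp_def] at h4
    exact h4.mul ((hU.continuous.tendsto _).comp ((hdil w).continuousAt.tendsto.comp hc))

end KernelEstimates

/-! ### Distributions of a given order at a point -/

section Order

variable {d : ℕ}

/-- The distribution `ζ` is of order `γ` at `x`, with a polynomial loss of degree `m`. -/
def HasOrder (ζ : Distr d) (x : Spacetime d) (γ C : ℝ) (m : ℕ) : Prop :=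
  ∀ y c, 0 < c → c ≤ 1 →
    |ζ (reflectAt y (gauss (c ^ 4) 0))| ≤ C * (c ^ γ * (1 + pdist y x / c) ^ m)

theorem one_add_pdist_sub_le (x y w : Spacetime d) {c : ℝ} (hc : 0 < c) :
    1 + pdist (y - w) x / c ≤ (1 + pdist y x / c) * (1 + pnorm w / c) := by
  have h : pdist (y - w) x ≤ pdist y x + pnorm w := by
    rw [pdist_eq, pdist_eq]
    have := pnorm_add_le (y - x) (-w)
    rw [pnorm_neg] at this
    have e : y - w - x = y - x + -w := by abel
    rwa [e]
  have h1 : pdist (y - w) x / c ≤ (pdist y x + pnorm w) / c := by gcongr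
  have h2 : 0 ≤ pdist y x / c := div_nonneg (pdist_nonneg _ _) hc.le
  have h3 : 0 ≤ pnorm w / c := div_nonneg (pnorm_nonneg _) hc.le
  rw [add_div] at h1
  nlinarith

theorem abs_integral_mul_le {a U : Spacetime d → ℝ} {A : Spacetime d → ℝ}
    (hA : Integrable fun w => |a w| * A w) (hU : ∀ w, |U w| ≤ A w) :
    |∫ w, a w * U w| ≤ ∫ w, |a w| * A w := by
  rw [← Real.norm_eq_abs]
  refine norm_integral_le_of_norm_le hA (Filter.Eventually.of_forall fun w => ?_)
  rw [norm_mul, Real.norm_eq_abs, Real.norm_eq_abs]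
  gcongr
  exact hU w

/-- Convolution with the kernels preserves weighted bounds. -/
theorem exists_sconv_bound (n : MIdx d) (m : ℕ) : ∃ K : ℝ, 0 ≤ K ∧
    ∀ (U : Spacetime d → ℝ) (x : Spacetime d) (B c u : ℝ), 0 < c → 0 ≤ u → u ≤ 3 * c ^ 2 →
      (∀ y, |U y| ≤ B * (1 + pdist y x / c) ^ m) →
      ∀ y, |∫ w, mderiv n (gauss (c ^ 4) u) w * U (y - w)| ≤
        K * B * ((c⁻¹) ^ sdeg n * (1 + pdist y x / c) ^ m) := by
  obtain ⟨K, hK, h⟩ := exists_integral_mderiv_gauss_le n m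
  refine ⟨K, hK, fun U x B c u hc hu hu3 hU y => ?_⟩
  have hB : 0 ≤ B := by
    have := (abs_nonneg _).trans (hU x)
    simpa using this
  have hp := pdist_nonneg y x
  have hint := (integrable_abs_mul_weight (mderiv n (gauss (c ^ 4) u) : 𝓢(Spacetime d, ℝ)) hc m)
  have h1 := abs_integral_mul_le (a := mderiv n (gauss (c ^ 4) u)) (U := fun w => U (y - w))
    (A := fun w => B * (1 + pdist y x / c) ^ m * (1 + pnorm w / c) ^ m) ?_ ?_
  · refine h1.trans ?_
    have e : ∀ w, |mderiv n (gauss (c ^ 4) u) w| * (B * (1 + pdist y x / c) ^ m *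
        (1 + pnorm w / c) ^ m) = (B * (1 + pdist y x / c) ^ m) *
        (|mderiv n (gauss (c ^ 4) u) w| * (1 + pnorm w / c) ^ m) := fun w => by ring
    simp only [e]
    rw [integral_const_mul]
    calc _ ≤ (B * (1 + pdist y x / c) ^ m) * (K * (c⁻¹) ^ sdeg n) := by
          gcongr; exact h c u hc hu hu3
      _ = _ := by ring
  · have e : (fun w => |mderiv n (gauss (c ^ 4) u) w| * (B * (1 + pdist y x / c) ^ m *
        (1 + pnorm w / c) ^ m)) = fun w => (B * (1 + pdist y x / c) ^ m) *
        (|mderiv n (gauss (c ^ 4) u) w| * (1 + pnorm w / c) ^ m) := by ext w; ring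
    rw [e]
    exact hint.const_mul _
  · intro w
    refine (hU _).trans ?_
    rw [mul_assoc, ← mul_pow]
    have h0 := pdist_nonneg (y - w) x
    gcongr
    exact one_add_pdist_sub_le x y w hc

/-- Half of the time is given to a factor `gauss _ 0`, on which the order bound applies; the
derivatives and the parameter `u` go to the other half, whose scale invariant `L¹` bound produces `c
^ (-|n|)`. -/
theorem HasOrder.exists_gauss_le (γ : ℝ) (n : MIdx d) (m : ℕ) : ∃ K : ℝ, 0 ≤ K ∧
    ∀ (ζ : Distr d) (x : Spacetime d) (C : ℝ), HasOrder ζ x γ C m →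
      ∀ y c u, 0 < c → c ^ 4 ≤ 2 → 0 ≤ u → u ≤ 2 * c ^ 2 →
        |ζ (reflectAt y (mderiv n (gauss (c ^ 4) u)))| ≤
          K * C * (c ^ (γ - sdeg n) * (1 + pdist y x / c) ^ m) := by
  obtain ⟨K, hK, h⟩ := exists_sconv_bound n m
  -- `a` is the change of length that halves the time. So `c ^ 4 ≤ 2` becomes `c' ≤ 1`, and `u ≤ 2 *
  -- c ^ 2` becomes `u ≤ 3 * c' ^ 2` because `2 ≤ 3 * a ^ 2`; this is the origin of the constant `3`
  -- in the kernel estimates.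
  set a : ℝ := (1 / 2) ^ (1 / 4 : ℝ) with ha
  have ha0 : 0 < a := by positivity
  have ha4 : a ^ 4 = 1 / 2 := by
    rw [ha, ← Real.rpow_natCast, ← Real.rpow_mul (by norm_num)]
    norm_num
  have ha2 : 2 ≤ 3 * a ^ 2 := by nlinarith [sq_nonneg a]
  refine ⟨K * (a ^ (γ - sdeg n) * (a⁻¹) ^ m), by positivity, fun ζ x C hζ y c u hc hc4 hu hu2 => ?_⟩
  have hC : 0 ≤ C := by
    have := (abs_nonneg _).trans (hζ x 1 one_pos le_rfl)
    simpa using this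
  set c' := a * c with hc'
  have hc'0 : 0 < c' := by positivity
  have hc'4 : c' ^ 4 = c ^ 4 / 2 := by rw [hc', mul_pow, ha4]; ring
  have hc'1 : c' ≤ 1 := by
    by_contra hcon
    push Not at hcon
    have : 1 < c' ^ 4 := one_lt_pow₀ hcon (by norm_num)
    linarith
  have e : (gauss (c ^ 4) u : 𝓢(Spacetime d, ℝ)) = sconv (gauss (c' ^ 4) u) (gauss (c' ^ 4) 0) := by
    rw [sconv_gauss (by positivity) hu (by positivity) le_rfl, hc'4]
    congr 1 <;> ring
  rw [e, mderiv_sconv_left, distr_reflectAt_sconv]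
  have hp := pdist_nonneg y x
  refine (h (fun y => ζ (reflectAt y (gauss (c' ^ 4) 0))) x (C * c' ^ γ) c' u hc'0 hu ?_ ?_ y).trans ?_
  · rw [hc', mul_pow]
    nlinarith [sq_nonneg c]
  · intro y
    exact (hζ y c' hc'0 hc'1).trans_eq (by ring)
  · have e1 : c' ^ γ * (c'⁻¹) ^ sdeg n = a ^ (γ - sdeg n) * c ^ (γ - sdeg n) := by
      rw [← Real.mul_rpow ha0.le hc.le, ← hc', Real.rpow_sub hc'0, Real.rpow_natCast, inv_pow,
        div_eq_mul_inv]
    have e2 : (1 + pdist y x / c') ^ m ≤ (a⁻¹) ^ m * (1 + pdist y x / c) ^ m := by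
      rw [← mul_pow]
      gcongr
      have h1 : pdist y x / c' = a⁻¹ * (pdist y x / c) := by rw [hc']; field_simp
      have h2 : 1 ≤ a⁻¹ := by
        rw [one_le_inv₀ ha0]
        by_contra hcon
        push Not at hcon
        have : 1 < a ^ 4 := one_lt_pow₀ hcon (by norm_num)
        linarith
      rw [h1]
      linarith
    calc K * (C * c' ^ γ) * ((c'⁻¹) ^ sdeg n * (1 + pdist y x / c') ^ m)
        = K * C * (c' ^ γ * (c'⁻¹) ^ sdeg n) * (1 + pdist y x / c') ^ m := by ring
      _ ≤ K * C * (a ^ (γ - sdeg n) * c ^ (γ - sdeg n)) * ((a⁻¹) ^ m * (1 + pdist y x / c) ^ m) := by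
          rw [e1]; gcongr
      _ = _ := by ring

/-- The operator `-(∂₀ + Δ' - 1)`. -/
def qOp : 𝓢(Spacetime d, ℝ) →L[ℝ] 𝓢(Spacetime d, ℝ) :=
  -(mderivCLM (unitIdx 0) + (∑ i : Fin d, mderivCLM (unitIdx i.succ + unitIdx i.succ)) -
    ContinuousLinearMap.id ℝ _)

theorem qOp_apply (φ : 𝓢(Spacetime d, ℝ)) : qOp φ = -(mderiv (unitIdx 0) φ +
    (∑ i : Fin d, mderiv (unitIdx i.succ + unitIdx i.succ) φ) - φ) := by
  simp [qOp, mderivCLM_apply]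

theorem mderiv_qOp (n : MIdx d) (φ : 𝓢(Spacetime d, ℝ)) : mderiv n (qOp φ) =
    -(mderiv (n + unitIdx 0) φ +
    (∑ i : Fin d, mderiv (n + (unitIdx i.succ + unitIdx i.succ)) φ) - mderiv n φ) := by
  rw [qOp_apply, ← mderivCLM_apply]
  simp only [map_neg, map_sub, map_add, map_sum, mderivCLM_apply, mderiv_mderiv]

theorem sconv_add_right (a φ ψ : 𝓢(Spacetime d, ℝ)) : sconv a (φ + ψ) = sconv a φ + sconv a ψ := by
  apply toC_injective
  have h : ∀ φ ψ : 𝓢(Spacetime d, ℝ), toC (φ + ψ) = toC φ + toC ψ := fun φ ψ => by ext; simp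
  rw [h, toC_sconv, toC_sconv, toC_sconv, h, map_add]

theorem sconv_smul_right (c : ℝ) (a φ : 𝓢(Spacetime d, ℝ)) : sconv a (c • φ) = c • sconv a φ := by
  ext x
  rw [sconv_apply, smul_apply, sconv_apply, smul_eq_mul, ← integral_const_mul]
  refine integral_congr_ae (Filter.Eventually.of_forall fun w => ?_)
  simp
  ring

/-- Convolution by a fixed function as a linear map. -/
def sconvLM (a : 𝓢(Spacetime d, ℝ)) : 𝓢(Spacetime d, ℝ) →ₗ[ℝ] 𝓢(Spacetime d, ℝ) where
  toFun := sconv a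
  map_add' := sconv_add_right a
  map_smul' c φ := sconv_smul_right c a φ

theorem sconvLM_apply (a φ : 𝓢(Spacetime d, ℝ)) : sconvLM a φ = sconv a φ := rfl

theorem qOp_sconv (a b : 𝓢(Spacetime d, ℝ)) : qOp (sconv a b) = sconv a (qOp b) := by
  rw [qOp_apply, qOp_apply, ← sconvLM_apply a (-(_)), map_neg, map_sub, map_add, map_sum]
  simp only [mderiv_sconv, sconvLM_apply]

theorem qConv_eq {r : ℝ} (hr : 0 < r) :
    qConv d r = Real.exp (-r) • qOp (gauss r (2 * r)) := by
  have : qConv d r = qOp (heatKernel d 1 r) := by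
    rw [qOp_apply, qConv]
    simp only [mderiv_add_unitIdx, mderiv_unitIdx]
  rw [this, heatKernel_one hr, map_smul]

/-- `∂₀` and `∂ᵢ²` both have parabolic degree `2` and cost `c ^ (-2)`; the zeroth order term is
better and is absorbed. Times up to `2` are admitted because `r + t` with `r, t ≤ 1` occurs later.
-/
theorem HasOrder.exists_qOp_gauss_le (γ : ℝ) (n : MIdx d) (m : ℕ) : ∃ K : ℝ, 0 ≤ K ∧
    ∀ (ζ : Distr d) (x : Spacetime d) (C : ℝ), HasOrder ζ x γ C m →
      ∀ y c u, 0 < c → c ^ 4 ≤ 2 → 0 ≤ u → u ≤ 2 * c ^ 2 →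
        |ζ (reflectAt y (mderiv n (qOp (gauss (c ^ 4) u))))| ≤
          K * C * (c ^ (γ - sdeg n - 2) * (1 + pdist y x / c) ^ m) := by
  obtain ⟨K₀, hK₀, h₀⟩ := HasOrder.exists_gauss_le (d := d) γ (n + unitIdx 0) m
  choose K₁ hK₁ h₁ using fun i : Fin d =>
    HasOrder.exists_gauss_le (d := d) γ (n + (unitIdx i.succ + unitIdx i.succ)) m
  obtain ⟨K₂, hK₂, h₂⟩ := HasOrder.exists_gauss_le (d := d) γ n m
  have hK1s : 0 ≤ ∑ i, K₁ i := Finset.sum_nonneg fun i _ => hK₁ i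
  refine ⟨K₀ + ∑ i, K₁ i + 2 * K₂, by positivity, fun ζ x C hζ y c u hc hc4 hu hu2 => ?_⟩
  have hC : 0 ≤ C := by
    have := (abs_nonneg _).trans (hζ x 1 one_pos le_rfl)
    simpa using this
  have hp := pdist_nonneg y x
  set W := (1 + pdist y x / c) ^ m with hW
  have hW0 : 0 ≤ W := by positivity
  set p := γ - sdeg n - 2 with hpdef
  have e0 : γ - (sdeg (n + unitIdx (0 : Fin (d + 1))) : ℕ) = p := by
    rw [sdeg_add, sdeg_unitIdx, scal_zero, hpdef]; push_cast; ring
  have e1 : ∀ i : Fin d, γ - (sdeg (n + (unitIdx i.succ + unitIdx i.succ)) : ℕ) = p := by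
    intro i
    rw [sdeg_add, sdeg_add, sdeg_unitIdx, scal_succ, hpdef]; push_cast; ring
  -- The surplus factor `c ^ 2` of the zeroth order term is at most `2`, since `c ^ 4 ≤ 2`.
  have e2 : c ^ (γ - sdeg n) ≤ 2 * c ^ p := by
    have : γ - sdeg n = p + 2 := by rw [hpdef]; ring
    rw [this, Real.rpow_add hc]
    have hc2 : c ^ (2 : ℝ) ≤ 2 := by
      rw [Real.rpow_two]
      nlinarith [sq_nonneg (c ^ 2), sq_nonneg c]
    rw [mul_comm (2 : ℝ)]
    exact mul_le_mul_of_nonneg_left hc2 (Real.rpow_nonneg hc.le p)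
  have b0 := h₀ ζ x C hζ y c u hc hc4 hu hu2
  have b1 := fun i => h₁ i ζ x C hζ y c u hc hc4 hu hu2
  have b2 := h₂ ζ x C hζ y c u hc hc4 hu hu2
  rw [e0] at b0
  simp only [e1] at b1
  have lin : ζ (reflectAt y (mderiv n (qOp (gauss (c ^ 4) u)))) =
      -(ζ (reflectAt y (mderiv (n + unitIdx 0) (gauss (c ^ 4) u))) +
        ∑ i : Fin d, ζ (reflectAt y (mderiv (n + (unitIdx i.succ + unitIdx i.succ)) (gauss (c ^ 4) u)))
        - ζ (reflectAt y (mderiv n (gauss (c ^ 4) u)))) := by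
    rw [mderiv_qOp]
    have hr : ∀ φ, reflectAt y φ = (SchwartzMap.compSubConstCLM ℝ y).comp
      (SchwartzMap.compCLMOfContinuousLinearEquiv ℝ (ContinuousLinearEquiv.neg ℝ)) φ := fun φ => rfl
    simp only [hr, map_neg, map_sub, map_add, map_sum]
  rw [lin, abs_neg]
  calc _ ≤ |ζ (reflectAt y (mderiv (n + unitIdx 0) (gauss (c ^ 4) u)))| +
        ∑ i : Fin d, |ζ (reflectAt y (mderiv (n + (unitIdx i.succ + unitIdx i.succ)) (gauss (c ^ 4) u)))|
        + |ζ (reflectAt y (mderiv n (gauss (c ^ 4) u)))| := by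
        refine (abs_sub _ _).trans ?_
        gcongr
        refine (abs_add_le _ _).trans ?_
        gcongr
        exact Finset.abs_sum_le_sum_abs _ _
    _ ≤ K₀ * C * (c ^ p * W) + ∑ i, K₁ i * C * (c ^ p * W) + K₂ * C * (2 * c ^ p * W) := by
        gcongr with i
        · exact b1 i
        · exact b2.trans (by gcongr)
    _ = _ := by
        rw [← Finset.sum_mul, ← Finset.sum_mul]
        ring

/-- In the variable `r = c ^ 4` the bound at `y = x` is `r ^ ((γ - |n| - 2) / 4)`, integrable at `0`
exactly when `|n| < γ + 2`: this is the gain of two orders. -/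
theorem HasOrder.exists_qKer_le (γ : ℝ) (n : MIdx d) (m : ℕ) : ∃ K : ℝ, 0 ≤ K ∧
    ∀ (ζ : Distr d) (x : Spacetime d) (C : ℝ), HasOrder ζ x γ C m →
      ∀ y c, 0 < c → c ≤ 1 →
        |ζ (qKer n (c ^ 4) y)| ≤ K * C * (c ^ (γ - sdeg n - 2) * (1 + pdist y x / c) ^ m) := by
  obtain ⟨K, hK, h⟩ := HasOrder.exists_qOp_gauss_le (d := d) γ n m
  refine ⟨K, hK, fun ζ x C hζ y c hc hc1 => ?_⟩
  have hc4 : c ^ 4 ≤ 1 := pow_le_one₀ hc.le hc1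
  have h1 := h ζ x C hζ y c (2 * c ^ 4) hc (by linarith) (by positivity) (by
    nlinarith [pow_le_one₀ (n := 2) hc.le hc1, sq_nonneg c])
  rw [qKer, qConv_eq (by positivity), mderiv_smul, reflectAt_smul, map_smul, smul_eq_mul, abs_mul,
    abs_of_pos (Real.exp_pos _)]
  refine (mul_le_of_le_one_left (abs_nonneg _) ?_).trans h1
  rw [Real.exp_le_one_iff]
  have : 0 < c ^ 4 := by positivity
  linarith

end Order

/-! ### Anisotropic Taylor expansions -/

section Taylor

variable {d : ℕ}

theorem mpow_add (z : Spacetime d) (k l : MIdx d) : mpow z (k + l) = mpow z k * mpow z l := by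
  simp [mpow, pow_add, Finset.prod_mul_distrib]

@[simp] theorem mpow_zero (z : Spacetime d) : mpow z 0 = 1 := by simp [mpow]

@[simp] theorem mpow_unitIdx (z : Spacetime d) (i : Fin (d + 1)) : mpow z (unitIdx i) = z i := by
  simp [mpow, unitIdx, Pi.single_apply]

theorem mpow_smul (s : ℝ) (z : Spacetime d) (l : MIdx d) :
    mpow (s • z) l = s ^ (∑ i, l i) * mpow z l := by
  simp [mpow, mul_pow, Finset.prod_mul_distrib, Finset.prod_pow_eq_pow_sum]

theorem abs_mpow_le (z : Spacetime d) (l : MIdx d) : |mpow z l| ≤ pnorm z ^ sdeg l := by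
  rw [mpow, Finset.abs_prod, sdeg_eq_sum, ← Finset.prod_pow_eq_pow_sum]
  refine Finset.prod_le_prod (fun i _ => abs_nonneg _) fun i _ => ?_
  rw [abs_pow, pow_mul]
  gcongr
  exact abs_apply_le_pnorm_pow z i

theorem mpow_zero_left {l : MIdx d} (hl : l ≠ 0) : mpow (0 : Spacetime d) l = 0 := by
  obtain ⟨i, hi⟩ : ∃ i, l i ≠ 0 := by
    by_contra h
    push Not at h
    exact hl (funext h)
  exact Finset.prod_eq_zero (Finset.mem_univ i) (by simp [hi])

@[simp] theorem mfact_zero : mfact (0 : MIdx d) = 1 := by simp [mfact]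

theorem mfact_pos (l : MIdx d) : 0 < mfact l :=
  Finset.prod_pos fun _ _ => Nat.factorial_pos _

theorem mfact_add_unitIdx (l : MIdx d) (i : Fin (d + 1)) :
    mfact (l + unitIdx i) = (l i + 1) * mfact l := by
  unfold mfact
  rw [← Finset.mul_prod_erase _ _ (Finset.mem_univ i),
    ← Finset.mul_prod_erase _ (fun j => (l j).factorial) (Finset.mem_univ i)]
  have h : ∀ j ∈ Finset.univ.erase i, ((l + unitIdx i) j).factorial = (l j).factorial := by
    intro j hj
    have : j ≠ i := (Finset.mem_erase.1 hj).1
    simp [unitIdx, this]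
  rw [Finset.prod_congr rfl h]
  simp [unitIdx, Nat.factorial_succ, mul_assoc]

/-- Reindexing `l ↦ l + e_i`; removing one derivative in direction `i` lowers the truncation by the
weight of that coordinate, not by `1`. -/
theorem sum_belowDeg_shift (a : ℝ) (i : Fin (d + 1)) (F : MIdx d → ℝ)
    (hF : ∀ l, l i = 0 → F l = 0) :
    ∑ l ∈ belowDeg d a, F l = ∑ l ∈ belowDeg d (a - scal i), F (l + unitIdx i) := by
  symm
  refine Finset.sum_of_injOn (fun l => l + unitIdx i) ?_ ?_ ?_ ?_
  · intro l _ l' _ h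
    exact add_right_cancel h
  · intro l hl
    simp only [Finset.mem_coe, mem_belowDeg] at hl ⊢
    rw [sdeg_add, sdeg_unitIdx]
    push_cast
    linarith
  · intro l hl hl'
    refine hF l ?_
    by_contra hne
    apply hl'
    refine ⟨l - unitIdx i, ?_, ?_⟩
    · have e : l - unitIdx i + unitIdx i = l := by
        funext j
        by_cases hj : j = i
        · subst hj
          simp only [unitIdx, Pi.add_apply, Pi.sub_apply, Pi.single_eq_same]
          omega
        · simp [unitIdx, hj]
      have h2 := congrArg sdeg e
      rw [sdeg_add, sdeg_unitIdx] at h2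
      simp only [Finset.mem_coe, mem_belowDeg] at hl ⊢
      rw [← h2] at hl
      push_cast at hl
      linarith
    · funext j
      by_cases hj : j = i
      · subst hj
        simp only [unitIdx, Pi.add_apply, Pi.sub_apply, Pi.single_eq_same]
        omega
      · simp [unitIdx, hj]
  · intro l _; rfl

/-- A polynomial with prescribed derivatives at the origin. -/
def jet (a : ℝ) (w : MIdx d → ℝ) (z : Spacetime d) : ℝ :=
  ∑ l ∈ belowDeg d a, mpow z l * ((mfact l : ℝ)⁻¹ * w l)

theorem jet_zero {a : ℝ} (ha : 0 < a) (w : MIdx d → ℝ) : jet a w 0 = w 0 := by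
  unfold jet
  rw [Finset.sum_eq_single 0]
  · simp
  · intro l _ hl
    rw [mpow_zero_left hl, zero_mul]
  · intro h
    exact absurd (mem_belowDeg.2 (by simpa using ha)) h

/-- Differentiating a jet along a ray gives jets of the differentiated data, truncated at `a - scal
i`. This self-similarity drives the induction in the anisotropic Taylor formula. -/
theorem hasDerivAt_jet (a : ℝ) (w : MIdx d → ℝ) (v : Spacetime d) (s : ℝ) :
    HasDerivAt (fun s : ℝ => jet a w (s • v))
      (∑ i, v i * jet (a - scal i) (fun l => w (l + unitIdx i)) (s • v)) s := by
  have h1 : HasDerivAt (fun s : ℝ => jet a w (s • v))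
      (∑ l ∈ belowDeg d a, ((∑ i, l i : ℕ) * s ^ ((∑ i, l i) - 1) * mpow v l) *
        ((mfact l : ℝ)⁻¹ * w l)) s := by
    unfold jet
    simp only [mpow_smul]
    refine HasDerivAt.fun_sum fun l _ => ?_
    exact ((hasDerivAt_pow _ s).mul_const _).mul_const _
  convert h1 using 1
  have h2 : ∀ l : MIdx d, (((∑ i, l i : ℕ) : ℝ) * s ^ ((∑ i, l i) - 1) * mpow v l) *
        ((mfact l : ℝ)⁻¹ * w l) = ∑ i, (l i : ℝ) * (s ^ ((∑ i, l i) - 1) * mpow v l *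
        ((mfact l : ℝ)⁻¹ * w l)) := by
    intro l
    rw [← Finset.sum_mul]
    push_cast
    ring
  simp only [h2]
  rw [Finset.sum_comm]
  refine Finset.sum_congr rfl fun i _ => ?_
  rw [sum_belowDeg_shift a i _ (fun l hl => by simp [hl]), jet, Finset.mul_sum]
  refine Finset.sum_congr rfl fun l _ => ?_
  have e1 : ∑ j, (l + unitIdx i) j = (∑ j, l j) + 1 := by
    simp [Finset.sum_add_distrib, unitIdx, Pi.single_apply]
  rw [e1, mfact_add_unitIdx, mpow_add, mpow_unitIdx, mpow_smul, Nat.add_sub_cancel]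
  have e2 : ((l + unitIdx i) i : ℝ) = l i + 1 := by simp [unitIdx]
  have e3 : (mfact l : ℝ) ≠ 0 := by exact_mod_cast (mfact_pos l).ne'
  have e4 : (l i : ℝ) + 1 ≠ 0 := by positivity
  rw [e2]
  push_cast
  field_simp

theorem pnorm_smul_le {s : ℝ} (h0 : 0 ≤ s) (h1 : s ≤ 1) (v : Spacetime d) : pnorm (s • v) ≤ pnorm v := by
  unfold pnorm
  have hs : s ^ 2 ≤ 1 := pow_le_one₀ h0 h1
  simp only [PiLp.smul_apply, smul_eq_mul, abs_mul, abs_of_nonneg h0, mul_pow, ← Finset.mul_sum]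
  have h : 0 ≤ ∑ i : Fin d, (v i.succ) ^ 2 := Finset.sum_nonneg fun _ _ => sq_nonneg _
  refine add_le_add (Real.sqrt_le_sqrt ?_) (Real.sqrt_le_sqrt ?_)
  · exact mul_le_of_le_one_left (abs_nonneg _) h1
  · exact mul_le_of_le_one_left h hs

/-- The remainder of the anisotropic Taylor expansion. -/
theorem exists_taylor_bound (K : MIdx d → ℝ) (hK : ∀ l, 0 ≤ K l) (m k : ℕ) :
    ∀ (a : ℝ) (n : MIdx d), a ≤ k → ∃ K' : ℝ, 0 ≤ K' ∧
    ∀ (V : MIdx d → Spacetime d → ℝ) (x : Spacetime d) (B c : ℝ), 0 < c → 0 ≤ B →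
      (∀ l z v (s : ℝ), HasDerivAt (fun s : ℝ => V l (z + s • v))
        (∑ i, v i * V (l + unitIdx i) (z + s • v)) s) →
      (∀ l z, |V l z| ≤ B * K l * ((c⁻¹) ^ sdeg l * (1 + pnorm (z - x) / c) ^ m)) →
      ∀ y, |V n y - jet a (fun l => V (n + l) x) (y - x)| ≤
        K' * B * ((c⁻¹) ^ sdeg n * ((pnorm (y - x) / c) ^ ⌈a⌉₊ * (1 + pnorm (y - x) / c) ^ (m + k))) := by
  induction k with
  | zero =>
    intro a n ha
    refine ⟨K n, hK n, fun V x B c hc hB hV hb y => ?_⟩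
    have h0 : belowDeg d a = ∅ := by
      ext l
      simp only [mem_belowDeg, Finset.notMem_empty, iff_false, not_lt]
      exact ha.trans (by simp)
    have h1 : ⌈a⌉₊ = 0 := Nat.ceil_eq_zero.2 (by simpa using ha)
    rw [jet, h0, h1]
    simp only [Finset.sum_empty, sub_zero, pow_zero, one_mul, add_zero]
    exact (hb n y).trans_eq (by ring)
  | succ k ih =>
    intro a n ha
    rcases le_or_gt a 0 with ha0 | ha0
    · obtain ⟨K', hK', h⟩ := ih a n (ha0.trans (by positivity))
      refine ⟨K', hK', fun V x B c hc hB hV hb y => (h V x B c hc hB hV hb y).trans ?_⟩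
      have hp := pnorm_nonneg (y - x)
      gcongr
      · exact le_add_of_nonneg_right (by positivity)
      · omega
    · choose K' hK' h using fun i : Fin (d + 1) => ih (a - scal i) (n + unitIdx i) (by
        have : (1 : ℝ) ≤ scal i := by exact_mod_cast scal_pos i
        push_cast at ha
        linarith)
      refine ⟨∑ i, K' i, Finset.sum_nonneg fun i _ => hK' i, fun V x B c hc hB hV hb y => ?_⟩
      set v := y - x with hv
      set δ := pnorm v / c with hδ
      have hδ0 : 0 ≤ δ := div_nonneg (pnorm_nonneg _) hc.le
      -- Along the segment the derivative of the remainder of order `a` is a combination of the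
      -- remainders of order `a - scal i` with coefficients `v i`, bounded by `pnorm v ^ scal i`.
      -- Since `scal i ≥ 1`, the induction on an integer bound for `a` closes.
      set g : ℝ → ℝ := fun s => V n (x + s • v) - jet a (fun l => V (n + l) x) (s • v) with hg
      set g' : ℝ → ℝ := fun s => ∑ i, v i * V (n + unitIdx i) (x + s • v) -
        ∑ i, v i * jet (a - scal i) (fun l => V (n + (l + unitIdx i)) x) (s • v) with hg'
      have hd : ∀ s, HasDerivAt g (g' s) s := fun s =>
        (hV n x v s).sub (hasDerivAt_jet a (fun l => V (n + l) x) v s)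
      have hg0 : g 0 = 0 := by
        simp only [hg, zero_smul, add_zero]
        rw [jet_zero ha0, add_zero, sub_self]
      have hg1 : g 1 = V n y - jet a (fun l => V (n + l) x) v := by
        simp [hg, hv]
      have key := norm_image_sub_le_of_norm_deriv_le_segment_01' (f := g) (f' := g')
        (C := (∑ i, K' i) * B * ((c⁻¹) ^ sdeg n * (δ ^ ⌈a⌉₊ * (1 + δ) ^ (m + (k + 1)))))
        (fun s _ => (hd s).hasDerivWithinAt) ?_
      · rwa [hg0, sub_zero, hg1, Real.norm_eq_abs] at key
      intro s hs
      have e : g' s = ∑ i, v i * (V (n + unitIdx i) (x + s • v) -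
          jet (a - scal i) (fun l => V (n + unitIdx i + l) x) (s • v)) := by
        simp only [hg', ← Finset.sum_sub_distrib, mul_sub]
        refine Finset.sum_congr rfl fun i _ => ?_
        congr 3
        funext l
        rw [add_comm l, ← add_assoc]
      rw [e, Real.norm_eq_abs, Finset.sum_mul, Finset.sum_mul]
      refine (Finset.abs_sum_le_sum_abs _ _).trans (Finset.sum_le_sum fun i _ => ?_)
      rw [abs_mul]
      have hi := h i V x B c hc hB hV hb (x + s • v)
      rw [add_sub_cancel_left] at hi
      have hs1 := pnorm_smul_le hs.1 hs.2.le v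
      have hps := pnorm_nonneg (s • v)
      have hvi : |v i| ≤ pnorm v ^ scal i := abs_apply_le_pnorm_pow v i
      -- A time step may overshoot the ceiling by one when `a ≤ 1`. The surplus factor `δ` is
      -- absorbed in `1 + δ`, which is why the exponent of the weight grows by one with each
      -- induction step.
      have hceil : δ ^ (scal i + ⌈a - scal i⌉₊) ≤ δ ^ ⌈a⌉₊ * (1 + δ) := by
        have l1 : ⌈a⌉₊ ≤ scal i + ⌈a - scal i⌉₊ := by
          rw [Nat.ceil_le]
          push_cast
          have := Nat.le_ceil (a - scal i)
          linarith
        have l2 : scal i + ⌈a - scal i⌉₊ ≤ ⌈a⌉₊ + 1 := by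
          have c1 : 1 ≤ ⌈a⌉₊ := Nat.one_le_iff_ne_zero.2 (by simpa using ha0)
          rcases le_or_gt (a - scal i) 0 with hn | hn
          · rw [Nat.ceil_eq_zero.2 hn]
            have := scal_le i
            omega
          · have c2 : ⌈a - scal i⌉₊ = ⌈a⌉₊ - scal i := Nat.ceil_sub_natCast a (scal i)
            have c3 : scal i ≤ ⌈a⌉₊ := by
              have : (scal i : ℝ) ≤ ⌈a⌉₊ := by linarith [Nat.le_ceil a]
              exact_mod_cast this
            omega
        rcases Nat.eq_or_lt_of_le l1 with h3 | h3
        · rw [← h3]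
          exact le_mul_of_one_le_right (by positivity) (by linarith)
        · have h4 : scal i + ⌈a - scal i⌉₊ = ⌈a⌉₊ + 1 := by omega
          rw [h4, pow_succ]
          gcongr
          linarith
      have hc0 : 0 ≤ c⁻¹ := by positivity
      have hKi := hK' i
      calc |v i| * _ ≤ pnorm v ^ scal i * (K' i * B * ((c⁻¹) ^ sdeg (n + unitIdx i) *
            (δ ^ ⌈a - scal i⌉₊ * (1 + δ) ^ (m + k)))) := by
            refine mul_le_mul hvi (hi.trans ?_) (abs_nonneg _) (pow_nonneg (pnorm_nonneg _) _)
            have : pnorm (s • v) / c ≤ δ := by rw [hδ]; gcongr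
            have : 0 ≤ pnorm (s • v) / c := by positivity
            gcongr
        _ = K' i * B * ((c⁻¹) ^ sdeg n * (δ ^ (scal i + ⌈a - scal i⌉₊) * (1 + δ) ^ (m + k))) := by
            have e : δ ^ scal i = pnorm v ^ scal i * (c⁻¹) ^ scal i := by
              rw [hδ, div_eq_mul_inv, mul_pow]
            rw [sdeg_add, sdeg_unitIdx, pow_add, pow_add δ, e]
            ring
        _ ≤ K' i * B * ((c⁻¹) ^ sdeg n * ((δ ^ ⌈a⌉₊ * (1 + δ)) * (1 + δ) ^ (m + k))) := by
            gcongr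
        _ = _ := by ring

theorem lineDerivOp_eq_sum (v : Spacetime d) (φ : 𝓢(Spacetime d, ℝ)) :
    ∂_{v} φ = ∑ i, v i • pderiv i φ := by
  have hv : v = ∑ i, v i • (EuclideanSpace.single i (1 : ℝ) : Spacetime d) := by
    ext j
    simp [Finset.sum_apply, Pi.single_apply]
  conv_lhs => rw [hv]
  rw [LineDeriv.lineDerivOp_left_sum]
  simp only [LineDeriv.lineDerivOp_left_smul]
  rfl

/-- The reflection at a point as a continuous linear map. -/
def reflectCLM (y : Spacetime d) : 𝓢(Spacetime d, ℝ) →L[ℝ] 𝓢(Spacetime d, ℝ) :=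
  (SchwartzMap.compSubConstCLM ℝ y).comp
      (SchwartzMap.compCLMOfContinuousLinearEquiv ℝ (ContinuousLinearEquiv.neg ℝ))

theorem reflectCLM_apply (y : Spacetime d) (φ : 𝓢(Spacetime d, ℝ)) :
    reflectCLM y φ = reflectAt y φ := rfl

theorem hasDerivAt_distr_mderiv (ζ : Distr d) (ψ : 𝓢(Spacetime d, ℝ)) (l : MIdx d)
    (z v : Spacetime d) (s : ℝ) :
    HasDerivAt (fun s : ℝ => ζ (reflectAt (z + s • v) (mderiv l ψ)))
      (∑ i, v i * ζ (reflectAt (z + s • v) (mderiv (l + unitIdx i) ψ))) s := by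
  have h := hasDerivAt_distr_reflectAt ζ (mderiv l ψ) z v s
  rw [lineDerivOp_eq_sum, ← reflectCLM_apply, map_sum, map_sum] at h
  simpa only [map_smul, smul_eq_mul, reflectCLM_apply, ← mderiv_add_unitIdx] using h

/-- The remainder of the Taylor expansion of `K_r ζ`, for a distribution of order `γ` at `x`. -/
theorem HasOrder.exists_taylor_le (γ a : ℝ) (n : MIdx d) (m : ℕ) : ∃ (K : ℝ) (M : ℕ), 0 ≤ K ∧
    ∀ (ζ : Distr d) (x : Spacetime d) (C : ℝ), HasOrder ζ x γ C m →
      ∀ y c, 0 < c → c ≤ 1 →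
        |ζ (qKer n (c ^ 4) y) - jet a (fun l => ζ (qKer (n + l) (c ^ 4) x)) (y - x)| ≤
          K * C * (c ^ (γ - sdeg n - 2) * ((pdist y x / c) ^ ⌈a⌉₊ * (1 + pdist y x / c) ^ M)) := by
  choose K₁ hK₁ h₁ using fun l : MIdx d => HasOrder.exists_qKer_le (d := d) γ l m
  obtain ⟨K, hK, h⟩ := exists_taylor_bound K₁ hK₁ m ⌈a⌉₊ a n (Nat.le_ceil a)
  refine ⟨K, m + ⌈a⌉₊, hK, fun ζ x C hζ y c hc hc1 => ?_⟩
  have hC : 0 ≤ C := by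
    have := (abs_nonneg _).trans (hζ x 1 one_pos le_rfl)
    simpa using this
  have h2 := h (fun l z => ζ (qKer l (c ^ 4) z)) x (C * c ^ (γ - 2)) c hc (by positivity)
    (fun l z v s => hasDerivAt_distr_mderiv ζ (qConv d (c ^ 4)) l z v s) ?_ y
  · rw [← pdist_eq] at h2
    refine h2.trans_eq ?_
    have e : c ^ (γ - sdeg n - 2) = c ^ (γ - 2) * (c⁻¹) ^ sdeg n := by
      rw [show γ - (sdeg n : ℝ) - 2 = (γ - 2) - sdeg n by ring, Real.rpow_sub hc, Real.rpow_natCast,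
        inv_pow, div_eq_mul_inv]
    rw [e]
    ring
  · intro l z
    refine (h₁ l ζ x C hζ z c hc hc1).trans_eq ?_
    have e : c ^ (γ - sdeg l - 2) = c ^ (γ - 2) * (c⁻¹) ^ sdeg l := by
      rw [show γ - (sdeg l : ℝ) - 2 = (γ - 2) - sdeg l by ring, Real.rpow_sub hc, Real.rpow_natCast,
        inv_pow, div_eq_mul_inv]
    rw [e, pdist_eq]
    ring

end Taylor

/-! ### Continuity in the time variable of the kernels -/

section TimeContinuity

variable {d : ℕ}

theorem continuousOn_integral_gauss {U : Spacetime d → ℝ} (hU : PolyBdd U) {a : ℝ} (ha : 0 ≤ a)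
    (ha2 : a ≤ 2) : ContinuousOn (fun s => ∫ w, gauss s (a * s) w * U w) (Set.Ioc 0 1) := by
  intro s₀ hs₀
  have hcont : Filter.Tendsto (fun s : ℝ => s ^ (1 / 4 : ℝ)) (nhdsWithin s₀ (Set.Ioc 0 1))
      (nhds (s₀ ^ (1 / 4 : ℝ))) :=
    (Real.continuousAt_rpow_const _ _ (Or.inl hs₀.1.ne')).tendsto.mono_left nhdsWithin_le_nhds
  have hmem : ∀ᶠ s in nhdsWithin s₀ (Set.Ioc 0 1), s ∈ Set.Ioc (0 : ℝ) 1 := self_mem_nhdsWithin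
  have h4 : ∀ s ∈ Set.Ioc (0 : ℝ) 1, (s ^ (1 / 4 : ℝ)) ^ 4 = s := fun s hs => by
    rw [← Real.rpow_natCast, ← Real.rpow_mul hs.1.le]; norm_num
  have hle : ∀ s ∈ Set.Ioc (0 : ℝ) 1, s ^ (1 / 4 : ℝ) ≤ 1 := fun s hs =>
    Real.rpow_le_one hs.1.le hs.2 (by norm_num)
  have hpos : ∀ s ∈ Set.Ioc (0 : ℝ) 1, 0 < s ^ (1 / 4 : ℝ) := fun s hs => Real.rpow_pos_of_pos hs.1 _
  have he : ∀ s ∈ Set.Ioc (0 : ℝ) 1, ∫ w, gauss ((s ^ (1 / 4 : ℝ)) ^ 4)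
      ((s ^ (1 / 4 : ℝ)) ^ 2 * (a * (s ^ (1 / 4 : ℝ)) ^ 2)) w * U w =
        ∫ w, gauss s (a * s) w * U w := fun s hs => by
    rw [show (s ^ (1 / 4 : ℝ)) ^ 2 * (a * (s ^ (1 / 4 : ℝ)) ^ 2) = a * (s ^ (1 / 4 : ℝ)) ^ 4 by ring,
      h4 s hs]
  have h := tendsto_integral_gauss hU hcont ((hcont.pow 2).const_mul a)
    (hmem.mono hpos) (hmem.mono fun s hs => (hle s hs).trans (by norm_num))
    (hmem.mono fun s hs => ⟨by positivity, ?_⟩) (by positivity)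
  · rw [← integral_gauss_scale (hpos s₀ hs₀) (by positivity), he s₀ hs₀] at h
    exact h.congr' (hmem.mono he)
  · have := pow_le_one₀ (n := 2) (hpos s hs).le (hle s hs)
    nlinarith

/-- Splitting off the fixed time `e = s₀ / 2` turns `ζ` into a continuous function of polynomial
growth, and the remaining kernel depends continuously on its time. -/
theorem continuousOn_distr_gauss (ζ : Distr d) {a : ℝ} (ha : 0 ≤ a) (ha2 : a ≤ 2) :
    ContinuousOn (fun s => ζ (gauss s (a * s))) (Set.Ioc 0 1) := by
  intro s₀ hs₀
  have h0 := hs₀.1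
  set e := s₀ / 2 with he
  have he0 : 0 < e := by positivity
  have h1 := continuousOn_integral_gauss (polyBdd_translate ζ (gauss e (a * e))) ha ha2 (s₀ - e)
    ⟨by linarith, by linarith [hs₀.2]⟩
  have h2 : ContinuousWithinAt (fun s => s - e) (Set.Ioc e 1) s₀ := by fun_prop
  have h3 := ContinuousWithinAt.comp (f := fun s => s - e) h1 h2 (fun s hs => ⟨by linarith [hs.1], by linarith [hs.2]⟩)
  have h4 : ∀ s ∈ Set.Ioc e 1, ∫ w, gauss (s - e) (a * (s - e)) w * ζ (translate w (gauss e (a * e)))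
      = ζ (gauss s (a * s)) := fun s hs => by
    have := sub_pos.2 hs.1
    rw [← distr_sconv, sconv_gauss this (by positivity) he0 (by positivity)]
    congr 3 <;> ring
  have h5 : ContinuousWithinAt (fun s => ζ (gauss s (a * s))) (Set.Ioc e 1) s₀ :=
    h3.congr (fun s hs => (h4 s hs).symm) (h4 s₀ ⟨by linarith, hs₀.2⟩).symm
  refine h5.mono_of_mem_nhdsWithin ?_
  filter_upwards [self_mem_nhdsWithin, nhdsWithin_le_nhds (lt_mem_nhds (show e < s₀ by linarith))]
    with s hs hs' using ⟨hs', hs.2⟩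

theorem mderiv_qConv (n : MIdx d) {r : ℝ} (hr : 0 < r) :
    mderiv n (qConv d r) = Real.exp (-r) • mderiv n (qOp (gauss r (2 * r))) := by
  rw [qConv_eq hr, mderiv_smul]

theorem continuousOn_distr_qKer (ζ : Distr d) (n : MIdx d) (x : Spacetime d) :
    ContinuousOn (fun r => ζ (qKer n r x)) (Set.Ioc 0 1) := by
  have h := continuousOn_distr_gauss (ζ.comp ((reflectCLM x).comp ((mderivCLM n).comp qOp)))
    (a := 2) (by norm_num) le_rfl
  have h' := (Real.continuous_exp.comp continuous_neg).continuousOn.mul h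
  refine h'.congr fun r hr => ?_
  simp only [qKer, mderiv_qConv n hr.1, reflectAt_smul, map_smul, smul_eq_mul,
    Pi.mul_apply, Function.comp_apply, ContinuousLinearMap.comp_apply, reflectCLM_apply,
    mderivCLM_apply]

theorem continuousOn_distr_pKer (ζ : Distr d) (x : Spacetime d) :
    ContinuousOn (fun r => ζ (pKer r x)) (Set.Ioc 0 1) := by
  have h := continuousOn_distr_gauss (ζ.comp (reflectCLM x)) (a := 0) le_rfl (by norm_num)
  refine ContinuousOn.congr h fun r hr => ?_
  simp only [pKer, heatKernel_zero hr.1, zero_mul]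
  rfl

/-- The kernels are an approximate identity: the dilation by `0` collapses the argument of `U` to
the origin, and the kernel at time `1` has integral `1`. -/
theorem tendsto_integral_heat {U : Spacetime d → ℝ} (hU : PolyBdd U) :
    Filter.Tendsto (fun c : ℝ => ∫ w, gauss (c ^ 4) 0 w * U w) (nhdsWithin 0 (Set.Ioi 0))
      (nhds (U 0)) := by
  have h := tendsto_integral_gauss (l := nhdsWithin (0 : ℝ) (Set.Ioi 0)) hU (c := fun c => c)
    (v := fun _ => 0) (c₀ := 0) (v₀ := 0) (Filter.tendsto_id.mono_left nhdsWithin_le_nhds)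
    tendsto_const_nhds self_mem_nhdsWithin
    (nhdsWithin_le_nhds ((gt_mem_nhds (by norm_num : (0 : ℝ) < 2)).mono fun _ h => h.le))
    (Filter.Eventually.of_forall fun _ => ⟨le_rfl, by norm_num⟩) le_rfl
  have h0 : ∀ w : Spacetime d, dilMap 0 w = 0 := fun w => by
    ext i
    have : scal i ≠ 0 := Nat.one_le_iff_ne_zero.1 (scal_pos i)
    simp [dilMap_apply, this]
  simpa only [h0, integral_mul_const, integral_gauss one_pos le_rfl, one_mul, mul_zero] using h

theorem tendsto_distr_sconv_gauss (ζ : Distr d) (ψ : 𝓢(Spacetime d, ℝ)) :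
    Filter.Tendsto (fun c : ℝ => ζ (sconv (gauss (c ^ 4) 0) ψ)) (nhdsWithin 0 (Set.Ioi 0))
      (nhds (ζ ψ)) := by
  have h := tendsto_integral_heat (polyBdd_translate ζ ψ)
  have h0 : translate (0 : Spacetime d) ψ = ψ := by ext y; simp
  rw [h0] at h
  simpa only [distr_sconv] using h

end TimeContinuity

/-! ### An integral estimate -/

/-- Summation over scales behind the Schauder estimates. With `r = c ^ 4` the bounds are `r⁻¹` times
a power that is integrable on either side of `r = D ^ 4`. With `δ = ε / 4` each side contributes `B
/ δ`, hence `8 / ε`; the `2` bounds `e - 1` in front of `E 1`. -/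
theorem abs_integral_sub_le {ε : ℝ} (hε : 0 < ε) {E : ℝ → ℝ} {D B : ℝ} (hD : 0 < D) (hB : 0 ≤ B)
    (hlt : ∀ c, 0 < c → c ≤ 1 → c < D → |E (c ^ 4)| ≤ B * (c ^ (-4 : ℝ) * (c / D) ^ ε))
    (hge : ∀ c, 0 < c → c ≤ 1 → D ≤ c → |E (c ^ 4)| ≤ B * (c ^ (-4 : ℝ) * (c / D) ^ (-ε))) :
    |(∫ r in (0 : ℝ)..1, E r) - (Real.exp 1 - 1) * E 1| ≤ (8 / ε + 2) * B := by
  set ρ := D ^ 4 with hρ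
  have hρ0 : 0 < ρ := by positivity
  set δ := ε / 4 with hδ
  have hδ0 : 0 < δ := by positivity
  set f₁ : ℝ → ℝ := fun r => B * ρ ^ (-δ) * r ^ (δ - 1) with hf₁
  set f₂ : ℝ → ℝ := fun r => B * ρ ^ δ * r ^ (-δ - 1) with hf₂
  have i₁ : IntegrableOn f₁ (Set.Ioc 0 ρ) :=
    ((intervalIntegrable_iff_integrableOn_Ioc_of_le hρ0.le).1
      (intervalIntegral.intervalIntegrable_rpow' (by linarith))).const_mul _
  have i₂ : IntegrableOn f₂ (Set.Ioi ρ) :=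
    (integrableOn_Ioi_rpow_of_lt (by linarith) hρ0).const_mul _
  have v₁ : ∫ r in Set.Ioc 0 ρ, f₁ r = B / δ := by
    rw [← intervalIntegral.integral_of_le hρ0.le, intervalIntegral.integral_const_mul,
      integral_rpow (Or.inl (by linarith)), sub_add_cancel, Real.zero_rpow hδ0.ne', sub_zero,
      Real.rpow_neg hρ0.le]
    have := (Real.rpow_pos_of_pos hρ0 δ).ne'
    field_simp
  have v₂ : ∫ r in Set.Ioi ρ, f₂ r = B / δ := by
    rw [integral_const_mul, integral_Ioi_rpow_of_lt (by linarith) hρ0, sub_add_cancel,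
      Real.rpow_neg hρ0.le]
    have := (Real.rpow_pos_of_pos hρ0 δ).ne'
    field_simp
  have hroot : ∀ r ∈ Set.Ioc (0 : ℝ) 1, ∃ c, 0 < c ∧ c ≤ 1 ∧ r = c ^ 4 := fun r hr =>
    ⟨r ^ (1 / 4 : ℝ), Real.rpow_pos_of_pos hr.1 _, Real.rpow_le_one hr.1.le hr.2 (by norm_num), by
      rw [← Real.rpow_natCast, ← Real.rpow_mul hr.1.le]; norm_num⟩
  have hpw : ∀ c p : ℝ, 0 < c → (c ^ 4 : ℝ) ^ p = c ^ (4 * p) := fun c p hc => by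
    rw [← Real.rpow_natCast, ← Real.rpow_mul hc.le]; norm_num
  have hbound : ∀ r ∈ Set.Ioc (0 : ℝ) 1, |E r| ≤
      (Set.Ioc 0 ρ).indicator f₁ r + (Set.Ioi ρ).indicator f₂ r := by
    intro r hr
    obtain ⟨c, hc, hc1, rfl⟩ := hroot r hr
    rcases le_or_gt D c with h | h
    · have e : B * (c ^ (-4 : ℝ) * (c / D) ^ (-ε)) = f₂ (c ^ 4) := by
        simp only [hf₂, hρ]
        rw [hpw _ _ hc, hpw _ _ hD, Real.div_rpow hc.le hD.le, show 4 * δ = ε by rw [hδ]; ring,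
          show 4 * (-δ - 1) = -4 + -ε by rw [hδ]; ring, Real.rpow_add hc, Real.rpow_neg hD.le ε]
        have := (Real.rpow_pos_of_pos hD ε).ne'
        field_simp
      -- The half-open intervals put the boundary point `c = D` on the side of `f₁`, although the
      -- hypothesis there is the one for `D ≤ c`; both majorants agree at that point.
      have e' : B * (c ^ (-4 : ℝ) * (c / D) ^ (-ε)) ≤ f₁ (c ^ 4) ∨ ρ < c ^ 4 := by
        rcases eq_or_lt_of_le h with h | h
        · left
          simp only [hf₁, hρ, h]
          rw [hpw _ _ hc, hpw _ _ hc, show 4 * -δ = -ε by rw [hδ]; ring,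
            show 4 * (δ - 1) = -4 + ε by rw [hδ]; ring, Real.rpow_add hc, Real.rpow_neg hc.le ε,
            div_self hc.ne', Real.one_rpow]
          have := (Real.rpow_pos_of_pos hc ε).ne'
          field_simp
          rfl
        · right
          exact pow_lt_pow_left₀ h hD.le (by norm_num)
      rcases le_or_gt (c ^ 4) ρ with h4 | h4
      · rw [Set.indicator_of_mem (show c ^ 4 ∈ Set.Ioc 0 ρ from ⟨hr.1, h4⟩),
          Set.indicator_of_notMem (by simpa using h4), add_zero]
        exact (hge c hc hc1 h).trans (e'.resolve_right h4.not_gt)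
      · rw [Set.indicator_of_notMem (fun hh => h4.not_ge hh.2),
          Set.indicator_of_mem (show c ^ 4 ∈ Set.Ioi ρ from h4), zero_add, ← e]
        exact hge c hc hc1 h
    · have h4 : c ^ 4 < ρ := pow_lt_pow_left₀ h hc.le (by norm_num)
      rw [Set.indicator_of_mem (show c ^ 4 ∈ Set.Ioc 0 ρ from ⟨hr.1, h4.le⟩),
        Set.indicator_of_notMem (by simpa using h4.le), add_zero]
      refine (hlt c hc hc1 h).trans_eq ?_
      simp only [hf₁, hρ]
      rw [hpw _ _ hc, hpw _ _ hD, Real.div_rpow hc.le hD.le, show 4 * -δ = -ε by rw [hδ]; ring,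
          show 4 * (δ - 1) = -4 + ε by rw [hδ]; ring, Real.rpow_add hc, Real.rpow_neg hD.le ε]
      have := (Real.rpow_pos_of_pos hD ε).ne'
      field_simp
  have hI : |∫ r in (0 : ℝ)..1, E r| ≤ 2 * (B / δ) := by
    rw [intervalIntegral.integral_of_le zero_le_one, ← integral_indicator measurableSet_Ioc,
      ← Real.norm_eq_abs]
    have i₁' := (integrable_indicator_iff measurableSet_Ioc).2 i₁
    have i₂' := (integrable_indicator_iff measurableSet_Ioi).2 i₂
    refine (norm_integral_le_of_norm_le (i₁'.add i₂')
      (Filter.Eventually.of_forall fun r => ?_)).trans_eq ?_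
    · rw [norm_indicator_eq_indicator_norm]
      by_cases hr : r ∈ Set.Ioc (0 : ℝ) 1
      · rw [Set.indicator_of_mem hr]
        exact hbound r hr
      · rw [Set.indicator_of_notMem hr]
        refine add_nonneg (Set.indicator_nonneg (fun s hs => ?_) _)
          (Set.indicator_nonneg (fun s hs => ?_) _)
        · have := hs.1
          positivity
        · have : 0 < s := hρ0.trans hs
          positivity
    · rw [integral_add' i₁' i₂', integral_indicator measurableSet_Ioc,
        integral_indicator measurableSet_Ioi, v₁, v₂]
      ring
  have hE : |E 1| ≤ B := by
    rcases le_or_gt D 1 with h | h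
    · have := hge 1 one_pos le_rfl h
      rw [one_pow, Real.one_rpow, one_mul, one_div, Real.inv_rpow hD.le, Real.rpow_neg hD.le,
        inv_inv] at this
      exact this.trans (mul_le_of_le_one_right hB (Real.rpow_le_one hD.le h hε.le))
    · have := hlt 1 one_pos le_rfl h
      rw [one_pow, Real.one_rpow, one_mul] at this
      exact this.trans (mul_le_of_le_one_right hB (Real.rpow_le_one (by positivity)
        ((div_le_one hD).2 h.le) hε.le))
  have he : |Real.exp 1 - 1| ≤ 2 := by
    have h1 := Real.exp_one_lt_three
    have h2 := Real.add_one_le_exp (1 : ℝ)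
    rw [abs_le]
    constructor <;> linarith
  calc _ ≤ |∫ r in (0 : ℝ)..1, E r| + |(Real.exp 1 - 1) * E 1| := abs_sub _ _
    _ ≤ 2 * (B / δ) + 2 * B := by
        rw [abs_mul]
        gcongr
    _ = _ := by rw [hδ]; field_simp; ring

/-! ### The operator `K` on tempered distributions -/

section KOperator

variable {d : ℕ}

theorem exists_fourth_root {r : ℝ} (hr : 0 < r) : ∃ c, 0 < c ∧ c ^ 4 = r :=
  ⟨r ^ (1 / 4 : ℝ), Real.rpow_pos_of_pos hr _, by
    rw [← Real.rpow_natCast, ← Real.rpow_mul hr.le]; norm_num⟩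

/-- Since `c ≤ 1`, the polynomial growth of the translated pairing is dominated by the rescaled
weight `(1 + pnorm w / c) ^ (2 * k)`, whose integral against the kernel is bounded uniformly in `r`.
-/
theorem exists_integral_gauss_translate_le (ζ : Distr d) : ∃ (k N : ℕ) (C : ℝ), 0 ≤ C ∧
    ∀ r ∈ Set.Ioc (0 : ℝ) 1, ∀ ψ : 𝓢(Spacetime d, ℝ),
      |∫ w, gauss r (2 * r) w * ζ (translate w ψ)| ≤ C * weightNorm k N ψ := by
  obtain ⟨k, N, C, hC, h⟩ := distr_translate_bound ζ
  obtain ⟨K, hK, hb⟩ := exists_integral_mderiv_gauss_le (0 : MIdx d) (2 * k)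
  refine ⟨k, N, C * K, by positivity, fun r hr ψ => ?_⟩
  obtain ⟨c, hc, rfl⟩ := exists_fourth_root hr.1
  have hc1 : c ≤ 1 := by
    by_contra hh
    push Not at hh
    exact absurd hr.2 (not_le.2 (one_lt_pow₀ hh (by norm_num)))
  have hc2 : c ^ 2 ≤ 1 := pow_le_one₀ hc.le hc1
  have hb' := hb c (2 * c ^ 4) hc (by positivity) (by nlinarith [sq_nonneg c])
  simp only [mderiv_zero, sdeg_zero, pow_zero, mul_one] at hb'
  have hW := weightNorm_nonneg k N ψ
  rw [← Real.norm_eq_abs]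
  refine (norm_integral_le_of_norm_le ((integrable_abs_mul_weight (gauss (c ^ 4) (2 * c ^ 4)) hc
    (2 * k)).const_mul (C * weightNorm k N ψ)) (Filter.Eventually.of_forall fun w => ?_)).trans ?_
  · rw [norm_mul, Real.norm_eq_abs, Real.norm_eq_abs]
    have h1 : (1 + ‖w‖) ^ k ≤ (1 + pnorm w / c) ^ (2 * k) := by
      rw [pow_mul]
      have : 1 + pnorm w ≤ 1 + pnorm w / c := by
        have := le_div_self (pnorm_nonneg w) hc hc1
        linarith
      have hp := pnorm_nonneg w
      gcongr
      refine (one_add_norm_le w).trans ?_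
      gcongr
    calc |gauss (c ^ 4) (2 * c ^ 4) w| * |ζ (translate w ψ)|
        ≤ |gauss (c ^ 4) (2 * c ^ 4) w| * (C * (1 + pnorm w / c) ^ (2 * k) * weightNorm k N ψ) := by
          gcongr
          refine (h w ψ).trans ?_
          gcongr
      _ = _ := by ring
  · rw [integral_const_mul]
    calc _ ≤ C * weightNorm k N ψ * K := by gcongr
      _ = _ := by ring

/-- The functional `ψ ↦ ∫₀¹ (h_r * ψ) dr - (e - 1) h_1 * ψ` applied to `ζ`, where `h_r` is the
kernel of `exp (r (∂₀² - (Δ' - 1)²))`. -/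
def heatAverage (ζ : Distr d) (ψ : 𝓢(Spacetime d, ℝ)) : ℝ :=
  (∫ r in (0 : ℝ)..1, Real.exp (-r) * ∫ w, gauss r (2 * r) w * ζ (translate w ψ)) -
    (Real.exp 1 - 1) * (Real.exp (-1) * ∫ w, gauss 1 (2 * 1) w * ζ (translate w ψ))

theorem continuousOn_heatAverage (ζ : Distr d) (ψ : 𝓢(Spacetime d, ℝ)) :
    ContinuousOn (fun r => Real.exp (-r) * ∫ w, gauss r (2 * r) w * ζ (translate w ψ))
      (Set.Ioc 0 1) :=
  (Real.continuous_exp.comp continuous_neg).continuousOn.mul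
    (continuousOn_integral_gauss (polyBdd_translate ζ ψ) (by norm_num) le_rfl)

theorem exists_heatAverage_integrand_le (ζ : Distr d) : ∃ (k N : ℕ) (C : ℝ), 0 ≤ C ∧
    ∀ r ∈ Set.Ioc (0 : ℝ) 1, ∀ ψ : 𝓢(Spacetime d, ℝ),
      |Real.exp (-r) * ∫ w, gauss r (2 * r) w * ζ (translate w ψ)| ≤ C * weightNorm k N ψ := by
  obtain ⟨k, N, C, hC, h⟩ := exists_integral_gauss_translate_le ζ
  refine ⟨k, N, C, hC, fun r hr ψ => ?_⟩
  rw [abs_mul, abs_of_pos (Real.exp_pos _)]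
  exact (mul_le_of_le_one_left (abs_nonneg _) (Real.exp_le_one_iff.2 (by linarith [hr.1]))).trans
    (h r hr ψ)

theorem intervalIntegrable_heatAverage (ζ : Distr d) (ψ : 𝓢(Spacetime d, ℝ)) :
    IntervalIntegrable (fun r => Real.exp (-r) * ∫ w, gauss r (2 * r) w * ζ (translate w ψ))
      volume 0 1 := by
  obtain ⟨k, N, C, hC, h⟩ := exists_heatAverage_integrand_le ζ
  rw [intervalIntegrable_iff_integrableOn_Ioc_of_le zero_le_one]
  refine Integrable.mono' (integrable_const (C * weightNorm k N ψ))
    ((continuousOn_heatAverage ζ ψ).aestronglyMeasurable measurableSet_Ioc) ?_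
  filter_upwards [ae_restrict_mem measurableSet_Ioc] with r hr using h r hr ψ

/-- `heatAverage` as a tempered distribution. -/
def heatAverageCLM (ζ : Distr d) : Distr d :=
  SchwartzMap.mkCLMtoNormedSpace (𝕜 := ℝ) (heatAverage ζ)
    (fun φ ψ => by
      have hi : ∀ r, Integrable (fun w => gauss r (2 * r) w * ζ (translate w φ)) :=
        fun r => (polyBdd_translate ζ φ).integrable_mul _
      have hi' : ∀ r, Integrable (fun w => gauss r (2 * r) w * ζ (translate w ψ)) :=
        fun r => (polyBdd_translate ζ ψ).integrable_mul _
      have e : ∀ r, ∫ w, gauss r (2 * r) w * ζ (translate w (φ + ψ)) =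
          (∫ w, gauss r (2 * r) w * ζ (translate w φ)) +
            ∫ w, gauss r (2 * r) w * ζ (translate w ψ) := fun r => by
        rw [← integral_add (hi r) (hi' r)]
        simp only [map_add, mul_add]
      simp only [heatAverage, e, mul_add]
      rw [intervalIntegral.integral_add (intervalIntegrable_heatAverage ζ φ)
        (intervalIntegrable_heatAverage ζ ψ)]
      ring)
    (fun a φ => by
      have e : ∀ r, ∫ w, gauss r (2 * r) w * ζ (translate w (a • φ)) =
          a * ∫ w, gauss r (2 * r) w * ζ (translate w φ) := fun r => by
        rw [← integral_const_mul]
        simp only [map_smul, smul_eq_mul, mul_left_comm]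
      have e' : ∀ r I : ℝ, Real.exp r * (a * I) = a * (Real.exp r * I) := fun r I => by ring
      simp only [heatAverage, e, e', intervalIntegral.integral_const_mul, smul_eq_mul,
        RingHom.id_apply]
      ring)
    (by
      obtain ⟨k, N, C, hC, h⟩ := exists_heatAverage_integrand_le ζ
      refine ⟨Finset.Iic (k, N), (C + |Real.exp 1 - 1| * C) * 2 ^ k, by positivity, fun φ => ?_⟩
      have h1 : ‖∫ r in (0 : ℝ)..1, Real.exp (-r) * ∫ w, gauss r (2 * r) w * ζ (translate w φ)‖ ≤
          C * weightNorm k N φ * |1 - 0| :=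
        intervalIntegral.norm_integral_le_of_norm_le_const fun r hr => by
          rw [Set.uIoc_of_le zero_le_one] at hr
          exact h r hr φ
      have h2 := h 1 ⟨one_pos, le_rfl⟩ φ
      have h3 : ‖heatAverage ζ φ‖ ≤ C * weightNorm k N φ + |Real.exp 1 - 1| * (C * weightNorm k N φ) := by
        refine (norm_sub_le _ _).trans (add_le_add (h1.trans_eq (by simp)) ?_)
        rw [norm_mul, Real.norm_eq_abs, Real.norm_eq_abs]
        gcongr
      refine h3.trans_eq ?_
      unfold weightNorm schwartzSeminormFamily
      ring)

theorem heatAverageCLM_apply (ζ : Distr d) (ψ : 𝓢(Spacetime d, ℝ)) :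
    heatAverageCLM ζ ψ = heatAverage ζ ψ := rfl

/-- The reflection at the origin as a continuous linear map. -/
def snegCLM : 𝓢(Spacetime d, ℝ) →L[ℝ] 𝓢(Spacetime d, ℝ) :=
  SchwartzMap.compCLMOfContinuousLinearEquiv ℝ (ContinuousLinearEquiv.neg ℝ)

theorem snegCLM_apply (φ : 𝓢(Spacetime d, ℝ)) : snegCLM φ = sneg φ := rfl

/-- The adjoint of `qOp`. -/
def qAdj : 𝓢(Spacetime d, ℝ) →L[ℝ] 𝓢(Spacetime d, ℝ) := snegCLM.comp (qOp.comp snegCLM)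

theorem sneg_sneg (φ : 𝓢(Spacetime d, ℝ)) : sneg (sneg φ) = φ := by
  ext y; simp

theorem sneg_sconv (φ ψ : 𝓢(Spacetime d, ℝ)) : sneg (sconv φ ψ) = sconv (sneg φ) (sneg ψ) := by
  ext y
  rw [sneg_apply, sconv_apply, sconv_apply, ← integral_neg_eq_self]
  refine integral_congr_ae (Filter.Eventually.of_forall fun w => ?_)
  simp only [sneg_apply]
  congr 2
  abel

/-- Moving the differential operator from the kernel to the test function removes the singularity at
`r = 0`: what remains is bounded on `(0, 1]`. Hence `K ζ` is a tempered distribution for every `ζ`,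
with no assumption on its order. -/
theorem KrDistr_eq {r : ℝ} (hr : 0 < r) (ζ : Distr d) (φ : 𝓢(Spacetime d, ℝ)) :
    KrDistr r ζ φ = Real.exp (-r) * ∫ w, gauss r (2 * r) w * ζ (translate w (qAdj φ)) := by
  have h : sconv φ (sneg (qConv d r)) = Real.exp (-r) • sconv (gauss r (2 * r)) (qAdj φ) := by
    have : sconv φ (sneg (qConv d r)) = sneg (sconv (sneg φ) (qConv d r)) := by
      rw [sneg_sconv, sneg_sneg]
    rw [this, qConv_eq hr, sconv_smul_right, ← qOp_sconv, sconv_comm, qOp_sconv, ← snegCLM_apply,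
      map_smul, snegCLM_apply, sneg_sconv, sneg_gauss]
    rfl
  simp only [KrDistr, qKer, mderiv_zero]
  rw [integral_mul_distr_reflectAt, h, map_smul, smul_eq_mul, distr_sconv]

/-- `K ζ` as a tempered distribution. -/
def Kop (ζ : Distr d) : Distr d := (heatAverageCLM ζ).comp qAdj

theorem Kop_apply (ζ : Distr d) (φ : 𝓢(Spacetime d, ℝ)) : Kop ζ φ = KDistr ζ φ := by
  rw [Kop, ContinuousLinearMap.comp_apply, heatAverageCLM_apply, heatAverage, KDistr,
    KrDistr_eq one_pos]
  congr 1
  refine intervalIntegral.integral_congr_ae (Filter.Eventually.of_forall fun r hr => ?_)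
  rw [Set.uIoc_of_le zero_le_one] at hr
  rw [KrDistr_eq hr.1]

theorem intervalIntegrable_KrDistr (ζ : Distr d) (φ : 𝓢(Spacetime d, ℝ)) :
    IntervalIntegrable (fun r => KrDistr r ζ φ) volume 0 1 := by
  refine (intervalIntegrable_heatAverage ζ (qAdj φ)).congr fun r hr => ?_
  rw [Set.uIoc_of_le zero_le_one] at hr
  exact (KrDistr_eq hr.1 ζ φ).symm

theorem KrDistr_add (r : ℝ) (ζ ζ' : Distr d) (φ : 𝓢(Spacetime d, ℝ)) :
    KrDistr r (ζ + ζ') φ = KrDistr r ζ φ + KrDistr r ζ' φ := by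
  unfold KrDistr qKer
  rw [← integral_add ((polyBdd_reflectAt ζ _).integrable_mul φ)
    ((polyBdd_reflectAt ζ' _).integrable_mul φ)]
  simp only [add_apply, mul_add]

theorem KrDistr_smul (r a : ℝ) (ζ : Distr d) (φ : 𝓢(Spacetime d, ℝ)) :
    KrDistr r (a • ζ) φ = a * KrDistr r ζ φ := by
  unfold KrDistr
  rw [← integral_const_mul]
  simp only [smul_apply, smul_eq_mul, mul_left_comm]

/-- The operator `K` as a linear map. -/
def KopLM : Distr d →ₗ[ℝ] Distr d where
  toFun := Kop
  map_add' ζ ζ' := by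
    ext φ
    rw [add_apply, Kop_apply, Kop_apply, Kop_apply]
    simp only [KDistr, KrDistr_add]
    rw [intervalIntegral.integral_add (intervalIntegrable_KrDistr ζ φ)
      (intervalIntegrable_KrDistr ζ' φ)]
    ring
  map_smul' a ζ := by
    ext φ
    rw [smul_apply, Kop_apply, Kop_apply]
    simp only [KDistr, KrDistr_smul, intervalIntegral.integral_const_mul, smul_eq_mul,
      RingHom.id_apply]
    ring

theorem KopLM_apply (ζ : Distr d) (φ : 𝓢(Spacetime d, ℝ)) : KopLM ζ φ = KDistr ζ φ :=
  Kop_apply ζ φ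

theorem KrDistr_reflectAt (r : ℝ) (ζ : Distr d) (x : Spacetime d) (ψ : 𝓢(Spacetime d, ℝ)) :
    KrDistr r ζ (reflectAt x ψ) = ζ (reflectAt x (sconv ψ (qConv d r))) := by
  rw [distr_reflectAt_sconv, KrDistr, ← integral_sub_left_eq_self _ volume x]
  simp only [reflectAt_apply, sub_sub_cancel, qKer, mderiv_zero]

theorem KrDistr_reflectAt_mderiv_gauss {r t : ℝ} (hr : 0 < r) (ht : 0 < t) (ζ : Distr d)
    (x : Spacetime d) (n : MIdx d) : KrDistr r ζ (reflectAt x (mderiv n (gauss t 0))) =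
      Real.exp (-r) * ζ (reflectAt x (mderiv n (qOp (gauss (r + t) (2 * r))))) := by
  rw [KrDistr_reflectAt, ← mderiv_sconv_left, qConv_eq hr, sconv_smul_right, ← qOp_sconv,
    sconv_gauss ht le_rfl hr (by positivity), mderiv_smul, reflectAt_smul, map_smul, smul_eq_mul,
    add_comm t, zero_add]

/-- The kernels `∂ⁿ p_t * q_r` tested against a distribution of order `γ` at `x`. -/
theorem HasOrder.exists_KrDistr_le (γ : ℝ) (n : MIdx d) (m : ℕ) : ∃ K : ℝ, 0 ≤ K ∧
    ∀ (ζ : Distr d) (x : Spacetime d) (C : ℝ), HasOrder ζ x γ C m →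
      ∀ y r t e, 0 < r → r ≤ 1 → 0 < t → t ≤ 1 → 0 < e → e ^ 4 = r + t →
        |KrDistr r ζ (reflectAt y (mderiv n (gauss t 0)))| ≤
          K * C * (e ^ (γ - sdeg n - 2) * (1 + pdist y x / e) ^ m) := by
  obtain ⟨K, hK, h⟩ := HasOrder.exists_qOp_gauss_le (d := d) γ n m
  refine ⟨K, hK, fun ζ x C hζ y r t e hr hr1 ht ht1 he he4 => ?_⟩
  rw [KrDistr_reflectAt_mderiv_gauss hr ht, abs_mul, abs_of_pos (Real.exp_pos _), ← he4]
  refine (mul_le_of_le_one_left (abs_nonneg _) (Real.exp_le_one_iff.2 (by linarith))).trans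
    (h ζ x C hζ y e (2 * r) he (by linarith) (by positivity) ?_)
  -- As `r ≤ 1`, one has `r ^ 2 ≤ r ≤ e ^ 4`; this gives the condition `2 * r ≤ 2 * e ^ 2` on the
  -- second parameter.
  have : r ≤ e ^ 2 := by
    by_contra hh
    push Not at hh
    nlinarith [sq_nonneg e]
  linarith

theorem intervalIntegrable_of_abs_le {E : ℝ → ℝ} (hE : ContinuousOn E (Set.Ioc 0 1)) {ε B : ℝ}
    (hε : 0 < ε) (h : ∀ c, 0 < c → c ≤ 1 → |E (c ^ 4)| ≤ B * c ^ (ε - 4)) :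
    IntervalIntegrable E volume 0 1 := by
  rw [intervalIntegrable_iff_integrableOn_Ioc_of_le zero_le_one]
  have hi : IntegrableOn (fun r : ℝ => B * r ^ (ε / 4 - 1)) (Set.Ioc 0 1) :=
    ((intervalIntegrable_iff_integrableOn_Ioc_of_le zero_le_one).1
      (intervalIntegral.intervalIntegrable_rpow' (by linarith))).const_mul _
  refine Integrable.mono' hi (hE.aestronglyMeasurable measurableSet_Ioc) ?_
  filter_upwards [ae_restrict_mem measurableSet_Ioc] with r hr
  obtain ⟨c, hc, rfl⟩ := exists_fourth_root hr.1
  have hc1 : c ≤ 1 := by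
    by_contra hh
    push Not at hh
    exact absurd hr.2 (not_le.2 (one_lt_pow₀ hh (by norm_num)))
  refine (h c hc hc1).trans_eq ?_
  rw [← Real.rpow_natCast c 4, ← Real.rpow_mul hc.le]
  congr 2
  push_cast
  ring

theorem HasOrder.nonneg {ζ : Distr d} {x : Spacetime d} {γ C : ℝ} {m : ℕ} (h : HasOrder ζ x γ C m) :
    0 ≤ C := by
  have := (abs_nonneg _).trans (h x 1 one_pos le_rfl)
  simpa using this

theorem HasOrder.dKAtConverges {ζ : Distr d} {x : Spacetime d} {γ C : ℝ} {m : ℕ}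
    (h : HasOrder ζ x γ C m) {n : MIdx d} (hn : (sdeg n : ℝ) < γ + 2) : dKAtConverges n ζ x := by
  obtain ⟨K, hK, hb⟩ := HasOrder.exists_qKer_le (d := d) γ n m
  refine intervalIntegrable_of_abs_le (continuousOn_distr_qKer ζ n x)
    (ε := γ + 2 - sdeg n) (B := K * C) (by linarith) fun c hc hc1 => ?_
  refine (hb ζ x C h x c hc hc1).trans_eq ?_
  rw [pdist_self, zero_div, add_zero, one_pow, mul_one]
  congr 2
  ring

theorem dKAt_add {n : MIdx d} {ζ ζ' : Distr d} {x : Spacetime d} (h : dKAtConverges n ζ x)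
    (h' : dKAtConverges n ζ' x) : dKAt n (ζ + ζ') x = dKAt n ζ x + dKAt n ζ' x := by
  simp only [dKAt, add_apply]
  rw [intervalIntegral.integral_add h h']
  ring

theorem dKAt_smul (a : ℝ) (n : MIdx d) (ζ : Distr d) (x : Spacetime d) :
    dKAt n (a • ζ) x = a * dKAt n ζ x := by
  simp only [dKAt, smul_apply, smul_eq_mul, intervalIntegral.integral_const_mul]
  ring

theorem dKAtConverges.smul {n : MIdx d} {ζ : Distr d} {x : Spacetime d} (h : dKAtConverges n ζ x)
    (a : ℝ) : dKAtConverges n (a • ζ) x := IntervalIntegrable.const_mul h a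

/-- Identifies the number `dKAt n ζ x` with the derivative at `x` of the distribution `K ζ`, as a
limit of mollifications. Dominated convergence applies with `r ^ p + 2 ^ p`, where `p > -1`: the sum
`r + c ^ 4` is compared with `r` if `p ≤ 0` and with `2` if `p > 0`. -/
theorem HasOrder.tendsto_Kop {ζ : Distr d} {x : Spacetime d} {γ C : ℝ} {m : ℕ}
    (h : HasOrder ζ x γ C m) {n : MIdx d} (hn : (sdeg n : ℝ) < γ + 2) :
    Filter.Tendsto (fun c : ℝ => Kop ζ (reflectAt x (mderiv n (gauss (c ^ 4) 0))))
      (nhdsWithin 0 (Set.Ioi 0)) (nhds (dKAt n ζ x)) := by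
  simp only [Kop_apply, KDistr]
  have hpt : ∀ r, Filter.Tendsto (fun c : ℝ => KrDistr r ζ (reflectAt x (mderiv n (gauss (c ^ 4) 0))))
      (nhdsWithin 0 (Set.Ioi 0)) (nhds (ζ (qKer n r x))) := fun r => by
    refine (tendsto_distr_sconv_gauss (ζ.comp (reflectCLM x)) (mderiv n (qConv d r))).congr
      fun c => ?_
    rw [KrDistr_reflectAt, ← mderiv_sconv_left, mderiv_sconv]
    rfl
  refine Filter.Tendsto.sub ?_ ((hpt 1).const_mul _)
  obtain ⟨K, hK, hb⟩ := HasOrder.exists_KrDistr_le (d := d) γ n m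
  set p := (γ - sdeg n - 2) / 4 with hp
  have hC := h.nonneg
  refine intervalIntegral.tendsto_integral_filter_of_dominated_convergence
    (fun r => K * C * (r ^ p + 2 ^ p)) ?_ ?_ ?_ ?_
  · refine Filter.Eventually.of_forall fun c => ?_
    have := (intervalIntegrable_KrDistr ζ (reflectAt x (mderiv n (gauss (c ^ 4) 0)))).1
    rw [Set.uIoc_of_le zero_le_one]
    exact this.aestronglyMeasurable
  · filter_upwards [self_mem_nhdsWithin, nhdsWithin_le_nhds (gt_mem_nhds (zero_lt_one' ℝ))]
      with c hc hc1
    refine Filter.Eventually.of_forall fun r hr => ?_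
    rw [Set.uIoc_of_le zero_le_one] at hr
    have hc0 : 0 < c := hc
    have hr0 := hr.1
    obtain ⟨e, he, he4⟩ := exists_fourth_root (show 0 < r + c ^ 4 by positivity)
    have h1 := hb ζ x C h x r (c ^ 4) e hr.1 hr.2 (by positivity)
      (pow_le_one₀ hc0.le hc1.le) he he4
    rw [pdist_self, zero_div, add_zero, one_pow, mul_one] at h1
    refine h1.trans ?_
    gcongr
    have e1 : e ^ (γ - sdeg n - 2) = (r + c ^ 4) ^ p := by
      rw [← he4, ← Real.rpow_natCast, ← Real.rpow_mul he.le, hp]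
      congr 1
      push_cast
      ring
    have hc4 : c ^ 4 ≤ 1 := pow_le_one₀ hc0.le hc1.le
    have hc4' : 0 < c ^ 4 := by positivity
    rw [e1]
    rcases le_or_gt p 0 with hp0 | hp0
    · exact (Real.rpow_le_rpow_of_nonpos hr0 (by linarith) hp0).trans
        (le_add_of_nonneg_right (by positivity))
    · exact (Real.rpow_le_rpow (by positivity) (by linarith [hr.2]) hp0.le).trans
        (le_add_of_nonneg_left (by positivity))
  · exact ((intervalIntegral.intervalIntegrable_rpow' (by rw [hp]; linarith)).add
      intervalIntegrable_const).const_mul _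
  · exact Filter.Eventually.of_forall fun r _ => hpt r

end KOperator

/-! ### Coactions and the inverse of a character -/

section Coaction

variable {T Tp : Type*} [AddCommGroup T] [Module ℝ T] [CommRing Tp] [Bialgebra ℝ Tp]

/-- The map `Id ⊗ g : T ⊗ T⁺ → T`. -/
def contract (T : Type*) [AddCommGroup T] [Module ℝ T] (g : Tp →ₗ[ℝ] ℝ) : T ⊗[ℝ] Tp →ₗ[ℝ] T :=
  (TensorProduct.rid ℝ T).toLinearMap ∘ₗ g.lTensor T

@[simp] theorem contract_tmul (g : Tp →ₗ[ℝ] ℝ) (a : T) (b : Tp) :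
    contract T g (a ⊗ₜ[ℝ] b) = g b • a := by simp [contract]

/-- Coassociativity read through two functionals: convolution products of functionals act as
compositions. It serves both for the comodule `T` and for `T⁺` acting on itself. -/
theorem contract_comp_contract (Δ : T →ₗ[ℝ] T ⊗[ℝ] Tp)
    (hΔ : (TensorProduct.assoc ℝ T Tp Tp).toLinearMap ∘ₗ Δ.rTensor Tp ∘ₗ Δ =
      (Coalgebra.comul (R := ℝ) (A := Tp)).lTensor T ∘ₗ Δ)
    (φ ψ : WithConv (Tp →ₗ[ℝ] ℝ)) (v : T) :
    contract T (φ * ψ).ofConv (Δ v) = contract T φ.ofConv (Δ (contract T ψ.ofConv (Δ v))) := by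
  have h1 : ∀ z : T ⊗[ℝ] Tp, contract T (φ * ψ).ofConv z =
      contract T φ.ofConv (contract (T ⊗[ℝ] Tp) ψ.ofConv ((TensorProduct.assoc ℝ T Tp Tp).symm
        ((Coalgebra.comul (R := ℝ) (A := Tp)).lTensor T z))) := by
    intro z
    induction z with
    | zero => simp
    | add a b ha hb => simp only [map_add, ha, hb]
    | tmul a b =>
      rw [contract_tmul, LinearMap.convMul_apply, LinearMap.lTensor_tmul]
      generalize Coalgebra.comul (R := ℝ) b = w
      induction w with
      | zero => simp
      | add p q hp hq => simp only [map_add, TensorProduct.tmul_add, add_smul, hp, hq]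
      | tmul p q => simp [mul_smul, smul_comm (φ p)]
  have h2 : ∀ z : T ⊗[ℝ] Tp, contract (T ⊗[ℝ] Tp) ψ.ofConv (Δ.rTensor Tp z) =
      Δ (contract T ψ.ofConv z) := by
    intro z
    induction z with
    | zero => simp
    | add a b ha hb => simp only [map_add, ha, hb]
    | tmul a b => simp
  have h3 : (Coalgebra.comul (R := ℝ) (A := Tp)).lTensor T (Δ v) =
      TensorProduct.assoc ℝ T Tp Tp (Δ.rTensor Tp (Δ v)) := (LinearMap.congr_fun hΔ v).symm
  rw [h1, h3, LinearEquiv.symm_apply_apply, h2]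

/-- A tensor is a finite sum, so all its contractions lie in a single finite dimensional space. This
finiteness replaces an antipode in the inversion of characters. -/
theorem exists_finset_contract_mem (z : T ⊗[ℝ] Tp) :
    ∃ F : Finset T, ∀ g : Tp →ₗ[ℝ] ℝ, contract T g z ∈ Submodule.span ℝ (F : Set T) := by
  classical
  induction z with
  | zero => exact ⟨∅, fun g => by simp⟩
  | tmul a b =>
    exact ⟨{a}, fun g => by
      rw [contract_tmul]
      exact Submodule.smul_mem _ _ (Submodule.subset_span (by simp))⟩
  | add a b ha hb =>
    obtain ⟨F, hF⟩ := ha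
    obtain ⟨G, hG⟩ := hb
    refine ⟨F ∪ G, fun g => ?_⟩
    rw [map_add, Finset.coe_union]
    exact add_mem (Submodule.span_mono Set.subset_union_left (hF g))
      (Submodule.span_mono Set.subset_union_right (hG g))

/-- `(Id ⊗ g) Δ⁺`. -/
def leftMul (g : WithConv (Tp →ₗ[ℝ] ℝ)) : Tp →ₗ[ℝ] Tp :=
  contract Tp g.ofConv ∘ₗ Coalgebra.comul (R := ℝ)

theorem leftMul_mul (φ ψ : WithConv (Tp →ₗ[ℝ] ℝ)) :
    leftMul (φ * ψ) = leftMul φ ∘ₗ leftMul ψ := by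
  ext v
  exact contract_comp_contract _ (by ext v; exact Coalgebra.coassoc_apply v) φ ψ v

theorem leftMul_one : leftMul (1 : WithConv (Tp →ₗ[ℝ] ℝ)) = LinearMap.id := by
  ext v
  have h := Coalgebra.lTensor_counit_comul (R := ℝ) v
  have h1 : (1 : WithConv (Tp →ₗ[ℝ] ℝ)).ofConv = Coalgebra.counit := by
    ext; simp [LinearMap.convOne_def]
  simp [leftMul, contract, h1, h]

theorem counit_leftMul (g : WithConv (Tp →ₗ[ℝ] ℝ)) (v : Tp) :
    Coalgebra.counit (R := ℝ) (leftMul g v) = g.ofConv v := by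
  have h : ∀ z : Tp ⊗[ℝ] Tp, Coalgebra.counit (R := ℝ) (contract Tp g.ofConv z) =
      g.ofConv (TensorProduct.lid ℝ Tp ((Coalgebra.counit (R := ℝ)).rTensor Tp z)) := by
    intro z
    induction z with
    | zero => simp
    | add a b ha hb => simp only [map_add, ha, hb]
    | tmul a b => simp [mul_comm]
  simp [leftMul, h, Coalgebra.rTensor_counit_comul]

/-- The space `W` of all contractions of `Δ⁺ μ` is finite dimensional, contains `μ` and is stable
under `leftMul g`. Injectivity therefore gives surjectivity, and the inverse functional is the
counit composed with the inverse operator. -/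
theorem isUnit_of_injective_leftMul (g : WithConv (Tp →ₗ[ℝ] ℝ))
    (hg : Function.Injective (leftMul g)) : IsUnit g := by
  have hsurj : Function.Surjective (leftMul g) := by
    intro μ
    obtain ⟨F, hF⟩ := exists_finset_contract_mem (Coalgebra.comul (R := ℝ) μ)
    let L : (Tp →ₗ[ℝ] ℝ) →ₗ[ℝ] Tp :=
      { toFun := fun v => leftMul (WithConv.toConv v) μ
        map_add' := fun v w => by simp [leftMul, contract, LinearMap.lTensor_add]
        map_smul' := fun a v => by simp [leftMul, contract, LinearMap.lTensor_smul] }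
    let W : Submodule ℝ Tp := LinearMap.range L
    have hWF : W ≤ Submodule.span ℝ (F : Set Tp) := by
      rintro _ ⟨v, rfl⟩
      exact hF v
    have : FiniteDimensional ℝ (Submodule.span ℝ (F : Set Tp)) :=
      FiniteDimensional.span_finset ℝ F
    have : FiniteDimensional ℝ W := Submodule.finiteDimensional_of_le hWF
    have hstable : ∀ w ∈ W, leftMul g w ∈ W := by
      rintro _ ⟨v, rfl⟩
      refine ⟨(g * WithConv.toConv v).ofConv, ?_⟩
      exact LinearMap.congr_fun (leftMul_mul g (WithConv.toConv v)) μ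
    have hinj : Function.Injective ((leftMul g).restrict hstable) := fun a b hab =>
      Subtype.ext (hg (congrArg Subtype.val hab))
    have hμ : μ ∈ W := ⟨(1 : WithConv (Tp →ₗ[ℝ] ℝ)).ofConv, LinearMap.congr_fun leftMul_one μ⟩
    obtain ⟨w, hw⟩ := LinearMap.injective_iff_surjective.1 hinj ⟨μ, hμ⟩
    exact ⟨w, congrArg Subtype.val hw⟩
  let e := LinearEquiv.ofBijective (leftMul g) ⟨hg, hsurj⟩
  let G : WithConv (Tp →ₗ[ℝ] ℝ) := WithConv.toConv (Coalgebra.counit (R := ℝ) ∘ₗ e.symm.toLinearMap)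
  have key : ∀ a b : WithConv (Tp →ₗ[ℝ] ℝ), leftMul a = leftMul b → a = b := fun a b h => by
    apply WithConv.ext
    ext v
    have := counit_leftMul a v
    rw [h, counit_leftMul] at this
    exact this.symm
  have h1 : G * g = 1 := by
    apply WithConv.ext
    ext v
    rw [← counit_leftMul, leftMul_mul, LinearMap.comp_apply, counit_leftMul]
    have : e.symm (leftMul g v) = v := e.symm_apply_apply v
    simp [G, this, LinearMap.convOne_def]
  have h2 : leftMul G ∘ₗ leftMul g = LinearMap.id := by rw [← leftMul_mul, h1, leftMul_one]
  have h3 : g * G = 1 := by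
    apply key
    rw [leftMul_mul, leftMul_one]
    ext v
    obtain ⟨w, rfl⟩ := hsurj v
    have := LinearMap.congr_fun h2 w
    simp only [LinearMap.comp_apply, LinearMap.id_apply] at this ⊢
    rw [this]
  exact ⟨⟨g, G, h3, h1⟩, rfl⟩

end Coaction

/-! ### Inverses of characters, transition maps and recentering -/

section Structure

variable {d : ℕ} {ι κ T Tp : Type*} [AddCommGroup T] [Module ℝ T] [CommRing Tp] [Bialgebra ℝ Tp]
  (𝒯 : RegularityStructure ι κ T Tp)

namespace RegularityStructure

theorem apply_basisP_eq_zero {u : Tp →ₗ[ℝ] ℝ} (hu : u 1 = 0) {μ : κ} (hμ : 𝒯.degP μ = 0) :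
    u (𝒯.basisP μ) = 0 := by
  have h : 𝒯.basisP μ ∈ Submodule.span ℝ ({1} : Set Tp) := by
    rw [← 𝒯.connected]
    exact Submodule.subset_span ⟨μ, hμ, rfl⟩
  obtain ⟨a, ha⟩ := Submodule.mem_span_singleton.1 h
  rw [← ha, map_smul, hu, smul_zero]

/-- `g` and the counit agree on `1`, hence by connectedness on all of degree `0`. So only terms
whose right factor has positive degree survive, and their left factor has smaller degree: the action
is unipotent. -/
theorem leftMul_sub_mem (g : Tp →ₐ[ℝ] ℝ) (μ : κ) :
    leftMul (WithConv.toConv g.toLinearMap) (𝒯.basisP μ) - 𝒯.basisP μ ∈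
      Submodule.span ℝ (𝒯.basisP '' {η | 𝒯.degP η < 𝒯.degP μ}) := by
  set u : Tp →ₗ[ℝ] ℝ := g.toLinearMap - Coalgebra.counit with hu
  have hu1 : u 1 = 0 := by simp [hu]
  have h1 : leftMul (WithConv.toConv g.toLinearMap) (𝒯.basisP μ) - 𝒯.basisP μ =
      contract Tp u (Coalgebra.comul (R := ℝ) (𝒯.basisP μ)) := by
    have h := LinearMap.congr_fun (leftMul_one (Tp := Tp)) (𝒯.basisP μ)
    have h1 : (1 : WithConv (Tp →ₗ[ℝ] ℝ)).ofConv = Coalgebra.counit := by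
      ext; simp [LinearMap.convOne_def]
    simp only [leftMul, LinearMap.comp_apply, LinearMap.id_apply, h1] at h
    conv_lhs => rw [← h]
    simp [leftMul, contract, hu, LinearMap.lTensor_sub]
  rw [h1]
  have h2 := Submodule.mem_map_of_mem (f := contract Tp u) (𝒯.comul_graded μ)
  rw [Submodule.map_span] at h2
  refine Submodule.span_le.2 ?_ h2
  rintro _ ⟨_, ⟨η, ν, hdeg, rfl⟩, rfl⟩
  rw [contract_tmul]
  rcases eq_or_lt_of_le (𝒯.degP_nonneg ν) with h0 | h0
  · rw [𝒯.apply_basisP_eq_zero hu1 h0.symm, zero_smul]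
    exact zero_mem _
  · exact Submodule.smul_mem _ _ (Submodule.subset_span ⟨η, by simp only [Set.mem_ofPred_eq]; linarith, rfl⟩)

/-- At a basis element of maximal degree in the support of `w`, the strictly degree lowering part
cannot contribute, so a vector of the kernel has vanishing top coordinate. -/
theorem injective_leftMul (𝒯 : RegularityStructure ι κ T Tp) (g : Tp →ₐ[ℝ] ℝ) :
    Function.Injective (leftMul (WithConv.toConv g.toLinearMap)) := by
  rw [← LinearMap.ker_eq_bot, LinearMap.ker_eq_bot']
  intro w hw
  by_contra hne
  set L := leftMul (WithConv.toConv g.toLinearMap) with hL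
  have hsup : (𝒯.basisP.repr w).support.Nonempty := by
    rw [Finsupp.support_nonempty_iff]
    simpa using hne
  obtain ⟨η, hη, hmax⟩ := Finset.exists_max_image _ 𝒯.degP hsup
  have hcoord : ∀ μ ∈ (𝒯.basisP.repr w).support,
      𝒯.basisP.repr (L (𝒯.basisP μ) - 𝒯.basisP μ) η = 0 := by
    intro μ hμ
    have h := 𝒯.leftMul_sub_mem g μ
    have hs := 𝒯.basisP.repr_support_subset_of_mem_span _ h
    by_contra h0
    have := hs (Finsupp.mem_support_iff.2 h0)
    simp only [Set.mem_ofPred_eq] at this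
    linarith [hmax μ hμ]
  have hw' : w = ∑ μ ∈ (𝒯.basisP.repr w).support, 𝒯.basisP.repr w μ • 𝒯.basisP μ :=
    (𝒯.basisP.linearCombination_repr w).symm
  have h1 : L w - w = ∑ μ ∈ (𝒯.basisP.repr w).support,
      𝒯.basisP.repr w μ • (L (𝒯.basisP μ) - 𝒯.basisP μ) := by
    simp only [smul_sub, Finset.sum_sub_distrib]
    rw [← hw']
    conv_lhs => rw [hw']
    simp only [map_sum, map_smul]
    rw [← hw']
  have h2 : 𝒯.basisP.repr (L w - w) η = 0 := by
    rw [h1, map_sum, Finsupp.finsetSum_apply]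
    refine Finset.sum_eq_zero fun μ hμ => ?_
    rw [map_smul, Finsupp.smul_apply, hcoord μ hμ, smul_zero]
  rw [hw, zero_sub, map_neg, Finsupp.neg_apply, neg_eq_zero] at h2
  exact Finsupp.mem_support_iff.1 hη h2

theorem isUnit_toConv (𝒯 : RegularityStructure ι κ T Tp) (g : Tp →ₐ[ℝ] ℝ) : IsUnit (WithConv.toConv g.toLinearMap) :=
  isUnit_of_injective_leftMul _ (𝒯.injective_leftMul g)

theorem mul_charInv (𝒯 : RegularityStructure ι κ T Tp) (g : Tp →ₐ[ℝ] ℝ) : WithConv.toConv g.toLinearMap * charInv g = 1 :=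
  Ring.mul_inverse_cancel _ (𝒯.isUnit_toConv g)

theorem charInv_mul (𝒯 : RegularityStructure ι κ T Tp) (g : Tp →ₐ[ℝ] ℝ) : charInv g * WithConv.toConv g.toLinearMap = 1 :=
  Ring.inverse_mul_cancel _ (𝒯.isUnit_toConv g)

theorem hat_mul (φ ψ : WithConv (Tp →ₗ[ℝ] ℝ)) (v : T) :
    𝒯.hat (φ * ψ).ofConv v = 𝒯.hat φ.ofConv (𝒯.hat ψ.ofConv v) :=
  contract_comp_contract 𝒯.Δ 𝒯.Δ_coassoc φ ψ v

theorem hat_one (v : T) : 𝒯.hat (1 : WithConv (Tp →ₗ[ℝ] ℝ)).ofConv v = v := by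
  have h1 : (1 : WithConv (Tp →ₗ[ℝ] ℝ)).ofConv = Coalgebra.counit := by
    ext; simp [LinearMap.convOne_def]
  rw [h1]
  exact LinearMap.congr_fun 𝒯.Δ_counit v

theorem hat_eq (g : Tp →ₗ[ℝ] ℝ) (v : T) : 𝒯.hat g v = contract T g (𝒯.Δ v) := rfl

theorem hat_basis_mem_below (g : Tp →ₗ[ℝ] ℝ) {τ : ι} {γ : ℝ} (h : 𝒯.deg τ < γ) :
    𝒯.hat g (𝒯.basis τ) ∈ 𝒯.below γ := by
  have h2 := Submodule.mem_map_of_mem (f := contract T g) (𝒯.Δ_graded τ)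
  rw [Submodule.map_span] at h2
  refine Submodule.span_le.2 ?_ h2
  rintro _ ⟨_, ⟨σ, ν, hdeg, rfl⟩, rfl⟩
  rw [contract_tmul]
  exact Submodule.smul_mem _ _ (Submodule.subset_span ⟨σ, by
    simp only [Set.mem_ofPred_eq]; linarith [𝒯.degP_nonneg ν], rfl⟩)

theorem hat_mem_below (g : Tp →ₗ[ℝ] ℝ) {v : T} {γ : ℝ} (h : v ∈ 𝒯.below γ) :
    𝒯.hat g v ∈ 𝒯.below γ := by
  have h2 := Submodule.mem_map_of_mem (f := 𝒯.hat g) h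
  rw [below, Submodule.map_span] at h2
  refine Submodule.span_le.2 ?_ h2
  rintro _ ⟨_, ⟨τ, hτ, rfl⟩, rfl⟩
  exact 𝒯.hat_basis_mem_below g hτ

theorem repr_eq_zero_of_mem_below {v : T} {γ : ℝ} (h : v ∈ 𝒯.below γ) {τ : ι} (hτ : γ ≤ 𝒯.deg τ) :
    𝒯.basis.repr v τ = 0 := by
  by_contra h0
  have := 𝒯.basis.repr_support_subset_of_mem_span _ h (Finsupp.mem_support_iff.2 h0)
  simp only [Set.mem_ofPred_eq] at this
  linarith

/-- The finite set of the basis elements of homogeneity `< γ`. -/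
def low (γ : ℝ) : Finset ι := (𝒯.finite_lt γ).toFinset

theorem mem_low {γ : ℝ} {τ : ι} : τ ∈ 𝒯.low γ ↔ 𝒯.deg τ < γ := by simp [low]

theorem eq_sum_of_mem_below {v : T} {γ : ℝ} (h : v ∈ 𝒯.below γ) :
    v = ∑ τ ∈ 𝒯.low γ, 𝒯.basis.repr v τ • 𝒯.basis τ := by
  conv_lhs => rw [← 𝒯.basis.linearCombination_repr v]
  rw [Finsupp.linearCombination_apply, Finsupp.sum]
  refine Finset.sum_subset (fun τ hτ => ?_) fun τ _ hτ => ?_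
  · rw [mem_low]
    by_contra hh
    exact Finsupp.mem_support_iff.1 hτ (𝒯.repr_eq_zero_of_mem_below h (not_lt.1 hh))
  · rw [Finsupp.notMem_support_iff.1 hτ, zero_smul]

end RegularityStructure

variable {𝒯}

namespace Model

variable (M : Model d 𝒯)

theorem PiAt_eq (x : Spacetime d) (v : T) :
    M.PiAt x v = M.Pi (𝒯.hat (charInv (M.g x)).ofConv v) := by
  rw [RegularityStructure.hat_eq]
  have : ∀ z : T ⊗[ℝ] Tp, TensorProduct.rid ℝ (Distr d)
      (TensorProduct.map M.Pi (charInv (M.g x)).ofConv z) =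
        M.Pi (contract T (charInv (M.g x)).ofConv z) := by
    intro z
    induction z with
    | zero => simp
    | add a b ha hb => simp only [map_add, ha, hb]
    | tmul a b => simp
  exact this _

theorem Pi_eq (x : Spacetime d) (v : T) :
    M.Pi v = M.PiAt x (𝒯.hat (M.g x).toLinearMap v) := by
  rw [PiAt_eq]
  have := 𝒯.hat_mul (charInv (M.g x)) (WithConv.toConv (M.g x).toLinearMap) v
  rw [𝒯.charInv_mul, 𝒯.hat_one] at this
  rw [← this]

theorem trans_eq (y x : Spacetime d) (v : T) :
    M.trans y x v = 𝒯.hat (M.g y).toLinearMap (𝒯.hat (charInv (M.g x)).ofConv v) :=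
  𝒯.hat_mul _ _ v

theorem PiAt_trans (y x : Spacetime d) (v : T) : M.PiAt y (M.trans y x v) = M.PiAt x v := by
  rw [trans_eq, ← Pi_eq, PiAt_eq]

theorem trans_self (x : Spacetime d) (v : T) : M.trans x x v = v := by
  rw [trans, transChar, 𝒯.mul_charInv, 𝒯.hat_one]

theorem trans_mem_below (y x : Spacetime d) {v : T} {γ : ℝ} (h : v ∈ 𝒯.below γ) :
    M.trans y x v ∈ 𝒯.below γ := 𝒯.hat_mem_below _ h

/-- On a graded tensor `σ ⊗ μ` the transition map has coefficient `g_{yx}(μ)`, and the grading turns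
`|μ|` into the difference of the homogeneities; linear combinations follow by induction on the span.
-/
theorem exists_trans_bound (τ σ : ι) : ∃ C : ℝ, 0 ≤ C ∧ ∀ x y : Spacetime d,
    |𝒯.basis.repr (M.trans y x (𝒯.basis τ)) σ| ≤ C * pdist y x ^ (𝒯.deg τ - 𝒯.deg σ) := by
  have key : ∀ z ∈ Submodule.span ℝ
      {z | ∃ σ μ, 𝒯.deg σ + 𝒯.degP μ = 𝒯.deg τ ∧ z = 𝒯.basis σ ⊗ₜ[ℝ] 𝒯.basisP μ},
      ∃ C : ℝ, 0 ≤ C ∧ ∀ x y : Spacetime d,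
        |𝒯.basis.repr (contract T (transChar M.g y x) z) σ| ≤
          C * pdist y x ^ (𝒯.deg τ - 𝒯.deg σ) := by
    intro z hz
    induction hz using Submodule.span_induction with
    | mem z hz =>
      obtain ⟨ρ, μ, hdeg, rfl⟩ := hz
      obtain ⟨C, hC⟩ := M.g_bound μ
      refine ⟨|C|, abs_nonneg _, fun x y => ?_⟩
      have hp := pdist_nonneg y x
      rw [contract_tmul, map_smul, Finsupp.smul_apply, Module.Basis.repr_self, smul_eq_mul]
      by_cases h : ρ = σ
      · subst h
        rw [Finsupp.single_eq_same, mul_one, show 𝒯.deg τ - 𝒯.deg ρ = 𝒯.degP μ by linarith]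
        refine (hC x y).trans ?_
        gcongr
        exact le_abs_self C
      · rw [Finsupp.single_eq_of_ne (Ne.symm h), mul_zero, abs_zero]
        positivity
    | zero => exact ⟨0, le_rfl, fun x y => by simp⟩
    | add a b _ _ ha hb =>
      obtain ⟨C, hC, h⟩ := ha
      obtain ⟨C', hC', h'⟩ := hb
      refine ⟨C + C', by positivity, fun x y => ?_⟩
      rw [map_add, map_add, Finsupp.add_apply, add_mul]
      exact (abs_add_le _ _).trans (add_le_add (h x y) (h' x y))
    | smul c a _ ha =>
      obtain ⟨C, hC, h⟩ := ha
      refine ⟨|c| * C, by positivity, fun x y => ?_⟩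
      rw [map_smul, map_smul, Finsupp.smul_apply, smul_eq_mul, abs_mul, mul_assoc]
      exact mul_le_mul_of_nonneg_left (h x y) (abs_nonneg c)
  exact key _ (𝒯.Δ_graded τ)

end Model

end Structure

/-! ### Polynomials -/

section Moments

variable {d : ℕ}

theorem mpow_add_left (x y : Spacetime d) (n : MIdx d) : mpow (x + y) n =
    ∑ l ∈ Finset.Iic n, (mchoose n l : ℝ) * (mpow x l * mpow y (n - l)) := by
  have h : ∀ i, (x + y) i ^ n i = ∑ j ∈ Finset.Iic (n i), x i ^ j * y i ^ (n i - j) * (n i).choose j := by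
    intro i
    rw [PiLp.add_apply, add_pow, Nat.range_succ_eq_Iic]
  unfold mpow mchoose
  simp only [h]
  rw [Finset.prod_univ_sum]
  refine Finset.sum_congr rfl fun l _ => ?_
  push_cast
  rw [← Finset.prod_mul_distrib, ← Finset.prod_mul_distrib]
  refine Finset.prod_congr rfl fun i _ => ?_
  simp only [Pi.sub_apply]
  ring

theorem mchoose_mul_mfact {n l : MIdx d} (h : l ≤ n) :
    mchoose n l * mfact l * mfact (n - l) = mfact n := by
  unfold mchoose mfact
  rw [← Finset.prod_mul_distrib, ← Finset.prod_mul_distrib]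
  exact Finset.prod_congr rfl fun i _ => Nat.choose_mul_factorial_mul_factorial (h i)

@[simp] theorem mchoose_self (n : MIdx d) : mchoose n n = 1 := by simp [mchoose]

theorem polyBdd_mpow (l : MIdx d) : PolyBdd fun w : Spacetime d => mpow w l := by
  refine ⟨?_, 2 ^ sdeg l, sdeg l, fun w => ?_⟩
  · unfold mpow
    fun_prop
  · refine (abs_mpow_le w l).trans ?_
    rw [← mul_pow]
    have := pnorm_nonneg w
    gcongr
    linarith [one_add_pnorm_le w]

theorem PolyBdd.comp_neg {U : Spacetime d → ℝ} (hU : PolyBdd U) : PolyBdd fun w => U (-w) := by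
  obtain ⟨C, k, h⟩ := hU.bound
  exact ⟨hU.continuous.comp continuous_neg, C, k, fun w => by simpa using h (-w)⟩

theorem PolyBdd.comp_sub_const {U : Spacetime d → ℝ} (hU : PolyBdd U) (x : Spacetime d) :
    PolyBdd fun w => U (w - x) := by
  obtain ⟨C, k, h⟩ := hU.bound
  refine ⟨hU.continuous.comp (by fun_prop), C * (1 + ‖x‖) ^ k, k, fun w => (h (w - x)).trans ?_⟩
  have hC : 0 ≤ C := by
    have := (abs_nonneg _).trans (h 0)
    simpa using this
  rw [mul_assoc, ← mul_pow]
  gcongr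
  nlinarith [norm_sub_le w x, norm_nonneg w, norm_nonneg x]

/-- The moment `∫ (-w)^l ψ(w) dw`. -/
def moment (l : MIdx d) (ψ : 𝓢(Spacetime d, ℝ)) : ℝ := ∫ w, mpow (-w) l * ψ w

theorem integrable_moment (l : MIdx d) (ψ : 𝓢(Spacetime d, ℝ)) :
    Integrable fun w => mpow (-w) l * ψ w := by
  simpa only [mul_comm] using (polyBdd_mpow l).comp_neg.integrable_mul ψ

theorem hasLineDerivAt_mpow_neg (l : MIdx d) (i : Fin (d + 1)) (w : Spacetime d) :
    HasLineDerivAt ℝ (fun w : Spacetime d => mpow (-w) l) (-(l i * mpow (-w) (l - unitIdx i))) w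
      (EuclideanSpace.single i 1) := by
  unfold HasLineDerivAt mpow
  have h : ∀ j ∈ Finset.univ, HasDerivAt
      (fun t : ℝ => (-(w + t • (EuclideanSpace.single i (1 : ℝ) : Spacetime d))) j ^ l j)
      (l j * (-(w + (0 : ℝ) • (EuclideanSpace.single i (1 : ℝ) : Spacetime d))) j ^ (l j - 1) *
        (-(EuclideanSpace.single i (1 : ℝ) : Spacetime d) j)) 0 := by
    intro j _
    have h1 : HasDerivAt (fun t : ℝ => (-(w + t • (EuclideanSpace.single i (1 : ℝ) : Spacetime d))) j)
        (-(EuclideanSpace.single i (1 : ℝ) : Spacetime d) j) 0 := by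
      have : HasDerivAt (fun t : ℝ => -(w j + t * (EuclideanSpace.single i (1 : ℝ) : Spacetime d) j))
          (-(1 * (EuclideanSpace.single i (1 : ℝ) : Spacetime d) j)) 0 :=
        (((hasDerivAt_id (0 : ℝ)).mul_const _).const_add _).neg
      simpa using this
    exact h1.pow (l j)
  have h2 := HasDerivAt.fun_finsetProd h
  refine h2.congr_deriv ?_
  rw [Finset.sum_eq_single i]
  · rw [← Finset.mul_prod_erase Finset.univ _ (Finset.mem_univ i)]
    simp only [zero_smul, add_zero, smul_eq_mul, unitIdx, Pi.sub_apply, Pi.single_eq_same]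
    have e : ∏ j ∈ Finset.univ.erase i, (-w) j ^ (l j - (Pi.single i 1 : MIdx d) j) =
        ∏ j ∈ Finset.univ.erase i, (-w) j ^ l j :=
      Finset.prod_congr rfl fun j hj => by simp [(Finset.mem_erase.1 hj).1]
    rw [e]
    simp
    ring
  · intro j _ hj
    simp [hj]
  · simp

/-- Integration by parts. The monomial is taken at `-w`, so its own sign cancels the one of the
integration by parts. -/
theorem moment_pderiv (l : MIdx d) (i : Fin (d + 1)) (ψ : 𝓢(Spacetime d, ℝ)) :
    moment l (pderiv i ψ) = l i * moment (l - unitIdx i) ψ := by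
  have h := integral_bilinear_hasLineDerivAt_right_eq_neg_left_of_integrable
    (μ := (volume : Measure (Spacetime d))) (B := ContinuousLinearMap.mul ℝ ℝ)
    (f := fun w : Spacetime d => mpow (-w) l)
    (f' := fun w => -(l i * mpow (-w) (l - unitIdx i))) (g := ψ) (g' := pderiv i ψ)
    (v := EuclideanSpace.single i 1) ?_ ?_ ?_
    (fun w _ => hasLineDerivAt_mpow_neg l i w) (fun w _ => ?_)
  · simp only [ContinuousLinearMap.mul_apply', neg_mul, integral_neg, neg_neg, mul_assoc,
      integral_const_mul] at h
    exact h
  · simpa [mul_assoc] using (integrable_moment (l - unitIdx i) ψ).const_mul (l i : ℝ)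
  · simpa using integrable_moment l (pderiv i ψ)
  · simpa using integrable_moment l ψ
  · rw [pderiv, SchwartzMap.lineDerivOp_apply]
    exact (ψ.differentiable w).lineDifferentiableAt.hasLineDerivAt

theorem moment_mderiv (n l : MIdx d) (ψ : 𝓢(Spacetime d, ℝ)) :
    moment l (mderiv n ψ) = (∏ i, (l i).descFactorial (n i) : ℕ) * moment (l - n) ψ := by
  induction n using MIdx.induction generalizing l with
  | zero => simp [mderiv_zero]
  | add n i ih =>
    rw [mderiv_add_unitIdx, moment_pderiv, ih, ← mul_assoc]
    congr 1
    · norm_cast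
      rw [← Finset.mul_prod_erase Finset.univ _ (Finset.mem_univ i),
        ← Finset.mul_prod_erase Finset.univ (fun j => (l j).descFactorial _) (Finset.mem_univ i),
        ← mul_assoc]
      congr 1
      · simp only [unitIdx, Pi.sub_apply, Pi.add_apply, Pi.single_eq_same]
        cases l i with
        | zero => simp
        | succ k => rw [Nat.succ_descFactorial_succ, Nat.add_sub_cancel]
      · exact Finset.prod_congr rfl fun j hj => by simp [unitIdx, (Finset.mem_erase.1 hj).1]
    · rw [tsub_tsub, add_comm (unitIdx i)]

/-- In the limit the derived heat kernels form a dual family to the monomials: they extract the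
coefficient of `Xⁿ / n!`. If `l` exceeds `n` the remaining monomial vanishes at the origin;
otherwise the falling factorial does. -/
theorem tendsto_moment_mderiv_gauss (n l : MIdx d) :
    Filter.Tendsto (fun c : ℝ => moment l (mderiv n (gauss (c ^ 4) 0))) (nhdsWithin 0 (Set.Ioi 0))
      (nhds (if l = n then (mfact n : ℝ) else 0)) := by
  simp only [moment_mderiv]
  have h := (tendsto_integral_heat (polyBdd_mpow (l - n)).comp_neg).const_mul
    ((∏ i, (l i).descFactorial (n i) : ℕ) : ℝ)
  simp only [mul_comm (gauss _ _ _)] at h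
  suffices e : (if l = n then (mfact n : ℝ) else 0) =
      ((∏ i, (l i).descFactorial (n i) : ℕ) : ℝ) * mpow (-0) (l - n) by
    rw [e]
    exact h
  rw [neg_zero]
  split_ifs with hl
  · subst hl
    simp [mfact, Nat.descFactorial_self]
  · by_cases hle : n ≤ l
    · rw [mpow_zero_left, mul_zero]
      intro h0
      exact hl (le_antisymm (tsub_eq_zero_iff_le.1 h0) hle)
    · obtain ⟨i, hi⟩ : ∃ i, ¬ n i ≤ l i := by
        by_contra hh
        push Not at hh
        exact hle hh
      rw [Finset.prod_eq_zero (Finset.mem_univ i) (Nat.descFactorial_of_lt (not_le.1 hi))]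
      simp

end Moments

/-! ### Polynomials in the regularity structure and in the model -/

section PolynomialPart

variable {d : ℕ} {ι κ T Tp : Type*} [AddCommGroup T] [Module ℝ T] [CommRing Tp] [Bialgebra ℝ Tp]
  {𝒯 : RegularityStructure ι κ T Tp}

namespace PolynomialPart

variable (P : PolynomialPart d 𝒯)

theorem deg_X (n : MIdx d) : 𝒯.deg (P.X n) = sdeg n := by
  have : P.X n ∈ {τ | 𝒯.deg τ = (sdeg n : ℕ)} := by
    rw [P.X_deg]
    exact ⟨n, rfl, rfl⟩
  exact this

theorem basisP_Xp_zero : 𝒯.basisP (P.Xp 0) = 1 := by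
  rw [P.Xp_prod]; simp

/-- Not an assumption but a consequence of the counit axiom, by comparing the coefficients of the
unit monomial in the binomial coproduct. -/
theorem counit_Xp (m : MIdx d) :
    Coalgebra.counit (R := ℝ) (𝒯.basisP (P.Xp m)) = if m = 0 then (1 : ℝ) else 0 := by
  split_ifs with h
  · rw [h, P.basisP_Xp_zero, Bialgebra.counit_one]
  · have h1 := Coalgebra.rTensor_counit_comul (R := ℝ) (𝒯.basisP (P.Xp m))
    rw [P.comul_Xp] at h1
    have h2 := congrArg (fun z => 𝒯.basisP.repr (TensorProduct.lid ℝ Tp z) (P.Xp 0)) h1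
    simp only [map_sum, map_smul, LinearMap.rTensor_tmul, TensorProduct.lid_tmul, one_smul,
      Finsupp.finsetSum_apply, Finsupp.smul_apply, Module.Basis.repr_self, smul_eq_mul] at h2
    rw [Finsupp.single_eq_of_ne (fun hh => h (P.Xp_injective hh.symm)),
      Finset.sum_eq_single m] at h2
    · simpa using h2
    · intro l hl hlm
      have : P.Xp 0 ≠ P.Xp (m - l) := fun hh => hlm (le_antisymm (Finset.mem_Iic.1 hl)
        (tsub_eq_zero_iff_le.1 (P.Xp_injective hh).symm))
      rw [Finsupp.single_eq_of_ne this]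
      simp
    · simp

theorem conv_Xp (φ ψ : WithConv (Tp →ₗ[ℝ] ℝ)) (m : MIdx d) :
    (φ * ψ).ofConv (𝒯.basisP (P.Xp m)) = ∑ l ∈ Finset.Iic m,
      (mchoose m l : ℝ) * (φ.ofConv (𝒯.basisP (P.Xp l)) * ψ.ofConv (𝒯.basisP (P.Xp (m - l)))) := by
  rw [LinearMap.convMul_apply, P.comul_Xp]
  simp

/-- The span of the monomials of scaled degree `< a`. -/
def polyBelow (a : ℝ) : Submodule ℝ T :=
  Submodule.span ℝ ((fun n => 𝒯.basis (P.X n)) '' {n | (sdeg n : ℝ) < a})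

/-- The polynomial with the derivatives `w n` at the base point, truncated at degree `a`. -/
def poly (a : ℝ) (w : MIdx d → ℝ) : T :=
  ∑ n ∈ belowDeg d a, ((mfact n : ℝ)⁻¹ * w n) • 𝒯.basis (P.X n)

theorem poly_mem (a : ℝ) (w : MIdx d → ℝ) : P.poly a w ∈ P.polyBelow a :=
  Submodule.sum_mem _ fun n hn => Submodule.smul_mem _ _
    (Submodule.subset_span ⟨n, mem_belowDeg.1 hn, rfl⟩)

theorem polyBelow_le_below (a : ℝ) : P.polyBelow a ≤ 𝒯.below a := by
  refine Submodule.span_le.2 ?_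
  rintro _ ⟨n, hn, rfl⟩
  exact Submodule.subset_span ⟨P.X n, by simpa [P.deg_X] using hn, rfl⟩

theorem polyBelow_mono {a b : ℝ} (h : a ≤ b) : P.polyBelow a ≤ P.polyBelow b :=
  Submodule.span_mono (Set.image_mono fun _ hn => lt_of_lt_of_le hn h)

theorem eq_poly_of_mem {a : ℝ} {v : T} (hv : v ∈ P.polyBelow a) : ∃ w, v = P.poly a w := by
  induction hv using Submodule.span_induction with
  | mem v hv =>
    obtain ⟨n, hn, rfl⟩ := hv
    refine ⟨fun l => if l = n then mfact n else 0, ?_⟩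
    rw [poly, Finset.sum_eq_single n]
    · have : (mfact n : ℝ) ≠ 0 := by exact_mod_cast (mfact_pos n).ne'
      simp [this]
    · intro l _ hl
      simp [hl]
    · intro h
      exact absurd (mem_belowDeg.2 hn) h
  | zero => exact ⟨0, by simp [poly]⟩
  | add u v _ _ hu hv =>
    obtain ⟨w, rfl⟩ := hu
    obtain ⟨w', rfl⟩ := hv
    refine ⟨w + w', ?_⟩
    simp [poly, ← Finset.sum_add_distrib, ← add_smul, mul_add]
  | smul c v _ hv =>
    obtain ⟨w, rfl⟩ := hv
    refine ⟨c • w, ?_⟩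
    simp only [poly, Finset.smul_sum, smul_smul, Pi.smul_apply, smul_eq_mul]
    refine Finset.sum_congr rfl fun n _ => ?_
    congr 1
    ring

theorem hat_X (φ : Tp →ₗ[ℝ] ℝ) (n : MIdx d) : 𝒯.hat φ (𝒯.basis (P.X n)) =
    ∑ l ∈ Finset.Iic n, ((mchoose n l : ℝ) * φ (𝒯.basisP (P.Xp (n - l)))) • 𝒯.basis (P.X l) := by
  rw [RegularityStructure.hat_eq, P.Δ_X]
  simp [smul_smul]

theorem hat_mem_polyBelow (φ : Tp →ₗ[ℝ] ℝ) {a : ℝ} {v : T} (hv : v ∈ P.polyBelow a) :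
    𝒯.hat φ v ∈ P.polyBelow a := by
  have h2 := Submodule.mem_map_of_mem (f := 𝒯.hat φ) hv
  rw [polyBelow, Submodule.map_span] at h2
  refine Submodule.span_le.2 ?_ h2
  rintro _ ⟨_, ⟨n, hn, rfl⟩, rfl⟩
  simp only [P.hat_X]
  refine Submodule.sum_mem _ fun l hl => Submodule.smul_mem _ _ (Submodule.subset_span ⟨l, ?_, rfl⟩)
  have hle : (sdeg l : ℝ) ≤ sdeg n := by exact_mod_cast sdeg_mono (Finset.mem_Iic.1 hl)
  exact lt_of_le_of_lt hle (show (sdeg n : ℝ) < a from hn)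

end PolynomialPart

namespace IntegrationOperators

variable {P : PolynomialPart d 𝒯} (A : IntegrationOperators P)

/-- The coaction on `I τ` differs from `I` applied to the coaction on `τ` only by tensors with a
monomial of degree `< |τ| + 2` on the left. Hence every algebraic identity for `I` reduces to one
between polynomials. -/
theorem hat_I_sub_mem (φ : Tp →ₗ[ℝ] ℝ) (τ : ι) :
    𝒯.hat φ (A.I 0 (𝒯.basis τ)) - A.I 0 (𝒯.hat φ (𝒯.basis τ)) ∈ P.polyBelow (𝒯.deg τ + 2) := by
  have h : ∀ z : T ⊗[ℝ] Tp, contract T φ ((A.I 0).rTensor Tp z) = A.I 0 (contract T φ z) := by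
    intro z
    induction z with
    | zero => simp
    | add a b ha hb => simp only [map_add, ha, hb]
    | tmul a b => simp
  rw [RegularityStructure.hat_eq, RegularityStructure.hat_eq, A.Δ_I 0 (by simp [sdeg_zero]), map_add,
    h, add_sub_cancel_left, map_sum]
  refine Submodule.sum_mem _ fun l hl => ?_
  rw [contract_tmul]
  refine Submodule.smul_mem _ _ (Submodule.smul_mem _ _ (Submodule.subset_span ⟨l, ?_, rfl⟩))
  have := mem_belowDeg.1 hl
  simpa [sdeg_zero] using this

end IntegrationOperators

namespace Model

variable (M : Model d 𝒯) {P : PolynomialPart d 𝒯}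

/-- Induction on the degree: both the inverse character and `mpow (-x)` satisfy the binomial
identity that expresses `(-x + x) ^ m`, and once the lower terms agree only the top term is left to
compare. -/
theorem charInv_Xp (hcan : M.IsCanonical P) (x : Spacetime d) (m : MIdx d) :
    (charInv (M.g x)).ofConv (𝒯.basisP (P.Xp m)) = mpow (-x) m := by
  induction hk : sdeg m using Nat.strong_induction_on generalizing m with
  | _ k ih =>
  have h1 : (charInv (M.g x) * WithConv.toConv (M.g x).toLinearMap).ofConv (𝒯.basisP (P.Xp m)) =
      mpow (-x + x) m := by
    rw [𝒯.charInv_mul, LinearMap.convOne_def]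
    simp only [Algebra.linearMap_self, LinearMap.id_comp, P.counit_Xp, neg_add_cancel]
    split_ifs with h
    · simp [h]
    · rw [mpow_zero_left h]
  rw [P.conv_Xp, mpow_add_left, ← Finset.sum_erase_add _ _ (Finset.mem_Iic.2 (le_refl m)),
    ← Finset.sum_erase_add (Finset.Iic m) _ (Finset.mem_Iic.2 (le_refl m))] at h1
  have h2 : ∀ l, (WithConv.toConv (M.g x).toLinearMap).ofConv (𝒯.basisP (P.Xp l)) = mpow x l :=
    fun l => hcan.2 l x
  simp only [h2] at h1
  rw [Finset.sum_congr rfl fun l hl => by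
    have hl' := Finset.mem_erase.1 hl
    have hle := Finset.mem_Iic.1 hl'.2
    have hlt : sdeg l < k := by
      rw [← hk]
      have e : m = l + (m - l) := (add_tsub_cancel_of_le hle).symm
      have h3 : 0 < sdeg (m - l) := by
        by_contra h0
        have h4 : ∀ i, (m - l) i = 0 := by
          have h5 : sdeg (m - l) = 0 := by omega
          rw [sdeg_eq_sum, Finset.sum_eq_zero_iff] at h5
          intro i
          have := h5 i (Finset.mem_univ i)
          have hs := scal_pos i
          rcases Nat.mul_eq_zero.1 this with h | h
          · omega
          · exact h
        exact hl'.1 (le_antisymm hle (tsub_eq_zero_iff_le.1 (funext h4)))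
      rw [e, sdeg_add]
      omega
    rw [ih _ hlt l rfl]] at h1
  have h3 := add_left_cancel h1
  simpa using h3

theorem transChar_Xp (hcan : M.IsCanonical P) (y x : Spacetime d) (m : MIdx d) :
    transChar M.g y x (𝒯.basisP (P.Xp m)) = mpow (y - x) m := by
  rw [transChar, P.conv_Xp, sub_eq_add_neg, mpow_add_left]
  refine Finset.sum_congr rfl fun l _ => ?_
  rw [M.charInv_Xp hcan]
  congr 2
  exact hcan.2 l y

theorem PiAt_X (hcan : M.IsCanonical P) (x : Spacetime d) (n : MIdx d) (φ : 𝓢(Spacetime d, ℝ)) :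
    M.PiAt x (𝒯.basis (P.X n)) φ = ∫ y, mpow (y - x) n * φ y := by
  have hi : ∀ l, Integrable fun y : Spacetime d => mpow y l * φ y := fun l => by
    simpa only [mul_comm] using (polyBdd_mpow l).integrable_mul φ
  rw [PiAt_eq, P.hat_X, map_sum, sum_apply]
  simp only [map_smul, smul_apply, hcan.1, M.charInv_Xp hcan, smul_eq_mul, sub_eq_add_neg,
    mpow_add_left, Finset.sum_mul]
  rw [integral_finsetSum]
  · refine Finset.sum_congr rfl fun l _ => ?_
    rw [← integral_const_mul]
    refine integral_congr_ae (Filter.Eventually.of_forall fun y => ?_)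
    simp only
    ring
  · intro l _
    refine ((hi l).const_mul ((mchoose n l : ℝ) * mpow (-x) (n - l))).congr
      (Filter.Eventually.of_forall fun y => ?_)
    simp only
    ring

theorem PiAt_X_reflectAt (hcan : M.IsCanonical P) (x : Spacetime d) (n : MIdx d)
    (ψ : 𝓢(Spacetime d, ℝ)) : M.PiAt x (𝒯.basis (P.X n)) (reflectAt x ψ) = moment n ψ := by
  rw [M.PiAt_X hcan, moment, ← integral_sub_left_eq_self _ volume x]
  refine integral_congr_ae (Filter.Eventually.of_forall fun y => ?_)
  simp [reflectAt_apply]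

theorem tendsto_PiAt_poly (hcan : M.IsCanonical P) (x : Spacetime d) (a : ℝ) (w : MIdx d → ℝ)
    (n : MIdx d) (hn : (sdeg n : ℝ) < a) :
    Filter.Tendsto (fun c : ℝ => M.PiAt x (P.poly a w) (reflectAt x (mderiv n (gauss (c ^ 4) 0))))
      (nhdsWithin 0 (Set.Ioi 0)) (nhds (w n)) := by
  have h := tendsto_finsetSum (belowDeg d a) fun l _ =>
    (tendsto_moment_mderiv_gauss n l).const_mul ((mfact l : ℝ)⁻¹ * w l)
  have e : ∑ l ∈ belowDeg d a, ((mfact l : ℝ)⁻¹ * w l) * (if l = n then (mfact n : ℝ) else 0) = w n := by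
    rw [Finset.sum_eq_single n]
    · have : (mfact n : ℝ) ≠ 0 := by exact_mod_cast (mfact_pos n).ne'
      rw [if_pos rfl]
      field_simp
    · intro l _ hl
      simp [hl]
    · intro h
      exact absurd (mem_belowDeg.2 hn) h
  rw [e] at h
  refine h.congr fun c => ?_
  rw [PolynomialPart.poly, map_sum, sum_apply]
  simp only [map_smul, smul_apply, M.PiAt_X_reflectAt hcan, smul_eq_mul]

/-- The device by which identities in `T` are deduced from identities between distributions: on
polynomials `Π_x` is injective, as seen by mollified derivatives at `x`. -/
theorem eq_zero_of_tendsto (hcan : M.IsCanonical P) (x : Spacetime d) {a : ℝ} {v : T}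
    (hv : v ∈ P.polyBelow a) (h : ∀ n, (sdeg n : ℝ) < a → Filter.Tendsto
      (fun c : ℝ => M.PiAt x v (reflectAt x (mderiv n (gauss (c ^ 4) 0))))
      (nhdsWithin 0 (Set.Ioi 0)) (nhds 0)) : v = 0 := by
  obtain ⟨w, rfl⟩ := P.eq_poly_of_mem hv
  refine Finset.sum_eq_zero fun n hn => ?_
  have hn := mem_belowDeg.1 hn
  rw [tendsto_nhds_unique (M.tendsto_PiAt_poly hcan x a w n hn) (h n hn)]
  simp

/-- On polynomials the transition map is re-expansion at another base point: the new derivatives are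
the jets of the old ones, with truncation lowered by the number of derivatives taken. -/
theorem trans_poly (hcan : M.IsCanonical P) (y x : Spacetime d) (a : ℝ) (w : MIdx d → ℝ) :
    M.trans y x (P.poly a w) =
      P.poly a fun n => jet (a - sdeg n) (fun k => w (n + k)) (y - x) := by
  rw [PolynomialPart.poly, PolynomialPart.poly, map_sum]
  simp only [map_smul, trans, P.hat_X, M.transChar_Xp hcan, Finset.smul_sum, smul_smul, jet,
    Finset.mul_sum, Finset.sum_smul]
  rw [Finset.sum_sigma', Finset.sum_sigma']
  -- The pairs `(l, n)` with `n ≤ l` are reparametrised by `(n, k)` with `k = l - n`.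
  refine Finset.sum_bij' (fun p _ => ⟨p.2, p.1 - p.2⟩) (fun p _ => ⟨p.1 + p.2, p.1⟩) ?_ ?_ ?_ ?_ ?_
  · rintro ⟨l, n⟩ h
    simp only [Finset.mem_sigma, mem_belowDeg, Finset.mem_Iic] at h ⊢
    have e : sdeg l = sdeg n + sdeg (l - n) := by
      rw [← sdeg_add, add_tsub_cancel_of_le h.2]
    have h1 := h.1
    rw [e] at h1
    push_cast at h1
    have : (0 : ℝ) ≤ sdeg (l - n) := by positivity
    exact ⟨by linarith, by linarith⟩
  · rintro ⟨n, k⟩ h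
    simp only [Finset.mem_sigma, mem_belowDeg, Finset.mem_Iic] at h ⊢
    refine ⟨?_, le_self_add⟩
    rw [sdeg_add]
    push_cast
    linarith [h.2]
  · rintro ⟨l, n⟩ h
    simp only [Finset.mem_sigma, mem_belowDeg, Finset.mem_Iic] at h
    simp only [add_tsub_cancel_of_le h.2]
  · rintro ⟨n, k⟩ h
    simp
  · rintro ⟨l, n⟩ h
    simp only [Finset.mem_sigma, mem_belowDeg, Finset.mem_Iic] at h
    simp only [add_tsub_cancel_of_le h.2]
    congr 1
    have h1 : (mchoose l n : ℝ) * mfact n * mfact (l - n) = mfact l := by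
      exact_mod_cast mchoose_mul_mfact h.2
    have e1 : (mfact n : ℝ) ≠ 0 := by exact_mod_cast (mfact_pos n).ne'
    have e2 : (mfact (l - n) : ℝ) ≠ 0 := by exact_mod_cast (mfact_pos (l - n)).ne'
    have e3 : (mfact l : ℝ) ≠ 0 := by exact_mod_cast (mfact_pos l).ne'
    rw [show (mfact l : ℝ)⁻¹ * w l * (mchoose l n * mpow (y - x) (l - n)) =
      mpow (y - x) (l - n) * w l * ((mfact l : ℝ)⁻¹ * mchoose l n) by ring]
    have : (mfact l : ℝ)⁻¹ * mchoose l n = (mfact n : ℝ)⁻¹ * (mfact (l - n) : ℝ)⁻¹ := by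
      rw [← h1] at e3 ⊢
      have e4 : (mchoose l n : ℝ) ≠ 0 := fun h0 => e3 (by simp [h0])
      field_simp
    rw [this]
    ring

theorem Pi_X_eq (hcan : M.IsCanonical P) (n : MIdx d) :
    M.PiAt 0 (𝒯.basis (P.X n)) = M.Pi (𝒯.basis (P.X n)) := by
  ext φ
  rw [M.PiAt_X hcan, hcan.1]
  simp

/-- Convolution sends polynomials to polynomials of no larger degree: expand the monomial at `z - y`
by the binomial formula; the coefficients are moments of the kernel. -/
theorem KrDistr_Pi_X (hcan : M.IsCanonical P) (r : ℝ) (k : MIdx d) (φ : 𝓢(Spacetime d, ℝ)) :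
    KrDistr r (M.Pi (𝒯.basis (P.X k))) φ = ∑ l ∈ Finset.Iic k, (mchoose k l : ℝ) *
      (M.Pi (𝒯.basis (P.X (k - l))) (qKer 0 r 0) * M.Pi (𝒯.basis (P.X l)) φ) := by
  have h1 : ∀ z, M.Pi (𝒯.basis (P.X k)) (qKer 0 r z) = ∑ l ∈ Finset.Iic k, (mchoose k l : ℝ) *
      (M.Pi (𝒯.basis (P.X (k - l))) (qKer 0 r 0) * mpow z l) := by
    intro z
    rw [qKer, qKer, mderiv_zero]
    rw [← M.Pi_X_eq hcan, M.PiAt_X hcan, ← integral_sub_left_eq_self _ volume z]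
    have h2 : ∀ l, M.Pi (𝒯.basis (P.X l)) (reflectAt 0 (qConv d r)) = moment l (qConv d r) :=
      fun l => by rw [← M.Pi_X_eq hcan, M.PiAt_X_reflectAt hcan]
    simp only [reflectAt_apply, sub_sub_cancel, sub_zero, h2]
    simp only [sub_eq_add_neg, mpow_add_left, Finset.sum_mul]
    rw [integral_finsetSum]
    · refine Finset.sum_congr rfl fun l _ => ?_
      rw [moment, ← integral_mul_const, ← integral_const_mul]
      refine integral_congr_ae (Filter.Eventually.of_forall fun y => ?_)
      simp only
      ring
    · intro l _
      convert (integrable_moment (k - l) (qConv d r)).const_mul ((mchoose k l : ℝ) * mpow z l) using 2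
      ring
  unfold KrDistr
  simp only [h1, Finset.mul_sum]
  rw [integral_finsetSum]
  · refine Finset.sum_congr rfl fun l _ => ?_
    rw [hcan.1 l φ, ← integral_const_mul, ← integral_const_mul]
    refine integral_congr_ae (Filter.Eventually.of_forall fun y => ?_)
    simp only
    ring
  · intro l _
    convert ((polyBdd_mpow l).integrable_mul φ).const_mul ((mchoose k l : ℝ) *
      M.Pi (𝒯.basis (P.X (k - l))) (qKer 0 r 0)) using 2
    ring

end Model

end PolynomialPart

/-! ### Orders of the recentered model and norms of modelled distributions -/

section Order

variable {d : ℕ} {ι κ T Tp : Type*} [AddCommGroup T] [Module ℝ T] [CommRing Tp] [Bialgebra ℝ Tp]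
  {𝒯 : RegularityStructure ι κ T Tp}

theorem pKer_eq {t : ℝ} (ht : 0 < t) (x : Spacetime d) : pKer t x = reflectAt x (gauss t 0) := by
  rw [pKer, heatKernel_zero ht]

theorem rpow_fourth {c : ℝ} (hc : 0 < c) (p : ℝ) : (c ^ 4) ^ (p / 4) = c ^ p := by
  rw [← Real.rpow_natCast, ← Real.rpow_mul hc.le]
  congr 1
  push_cast
  ring

theorem eq_unitIdx_of_sdeg_eq_one {n : MIdx d} (h : sdeg n = 1) : ∃ i, n = unitIdx i := by
  rw [sdeg_eq_sum] at h
  obtain ⟨i, hi⟩ : ∃ i, n i ≠ 0 := by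
    by_contra hh
    push Not at hh
    simp [hh] at h
  refine ⟨i, funext fun j => ?_⟩
  have hs : ∀ j : Fin (d + 1), 1 ≤ scal j := scal_pos
  by_cases hj : j = i
  · subst hj
    have := Finset.single_le_sum (f := fun j => scal j * n j) (fun _ _ => Nat.zero_le _)
      (Finset.mem_univ j)
    simp only [unitIdx, Pi.single_eq_same]
    have h1 := hs j
    have : n j ≤ scal j * n j := Nat.le_mul_of_pos_left _ h1
    omega
  · have h2 : scal i * n i + scal j * n j ≤ ∑ j, scal j * n j := by
      rw [← Finset.sum_pair (f := fun j => scal j * n j) (Ne.symm hj)]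
      exact Finset.sum_le_sum_of_subset (Finset.subset_univ _)
    have h3 : n i ≤ scal i * n i := Nat.le_mul_of_pos_left _ (hs i)
    have h4 : n j ≤ scal j * n j := Nat.le_mul_of_pos_left _ (hs j)
    simp only [unitIdx, Pi.single_apply, hj, if_false]
    omega

/-- The homogeneity of a basis element that is not a monomial is not an integer. -/
theorem IntegrationOperators.deg_ne_int (hβ : ∀ τ, -2 < 𝒯.deg τ) {P : PolynomialPart d 𝒯}
    (A : IntegrationOperators P) {τ : ι} (hτ : τ ∉ Set.range P.X) (k : ℤ) : 𝒯.deg τ ≠ k := by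
  intro hk
  have hnat : ∀ a : ℕ, 𝒯.deg τ ≠ a := fun a ha => by
    have : τ ∈ {τ | 𝒯.deg τ = a} := ha
    rw [P.X_deg] at this
    obtain ⟨n, _, hn⟩ := this
    exact hτ ⟨n, hn⟩
  have h2 := hβ τ
  rw [hk] at h2
  have h3 : -2 < k := by exact_mod_cast h2
  rcases lt_or_ge k 0 with h | h
  swap
  · lift k to ℕ using h
    exact hnat k (by exact_mod_cast hk)
  -- Natural degrees belong to monomials and degrees exceed `-2`, so only `-1` remains. Then `I⁺_0
  -- τ` would be a basis element of degree `1`, hence one of the `X₊^{e_i}`, contrary to the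
  -- freeness of the generators.
  have h1 : 𝒯.deg τ = -1 := by
    rw [hk, show k = -1 by omega]
    simp
  obtain ⟨e, he⟩ := A.free
  let s : IntegralSymbol P := ⟨(τ, 0), hτ, by rw [h1, sdeg_zero]; norm_num⟩
  have e1 : 𝒯.basisP (e (Finsupp.single (Sum.inr s) 1)) = A.Ip 0 (𝒯.basis τ) := by
    refine (he _).trans ((Finsupp.prod_single_index ?_).trans ?_)
    · exact pow_zero _
    · exact pow_one _
  have e2 := A.Ip_graded 0 τ
  rw [← e1, h1, sdeg_zero, RegularityStructure.homP] at e2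
  have e3 := (𝒯.basisP.mem_span_image).1 e2
  rw [Module.Basis.repr_self] at e3
  have e4 : e (Finsupp.single (Sum.inr s) 1) ∈ {μ | 𝒯.degP μ = -1 + 2 - ((0 : ℕ) : ℝ)} :=
    e3 (by simp)
  have e5 : e (Finsupp.single (Sum.inr s) 1) ∈ {μ | 𝒯.degP μ = (1 : ℕ)} := by
    have h5 : 𝒯.degP (e (Finsupp.single (Sum.inr s) 1)) = -1 + 2 - ((0 : ℕ) : ℝ) := e4
    show 𝒯.degP _ = _
    rw [h5]
    norm_num
  rw [P.Xp_deg] at e5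
  obtain ⟨n, hn, hn'⟩ := e5
  obtain ⟨i, rfl⟩ := eq_unitIdx_of_sdeg_eq_one hn
  have e6 : 𝒯.basisP (e (Finsupp.single (Sum.inl i) 1)) = 𝒯.basisP (P.Xp (unitIdx i)) := by
    rw [he, Finsupp.prod_single_index] <;> simp
  have e7 := e.injective ((𝒯.basisP.injective e6).trans hn')
  have := Finsupp.single_left_injective (one_ne_zero (α := ℕ)) e7
  exact absurd this (by simp)

namespace Model

variable (M : Model d 𝒯)

theorem exists_Pi_bound (τ : ι) : ∃ C : ℝ, 0 ≤ C ∧ ∀ (x : Spacetime d) (c : ℝ), 0 < c → c ≤ 1 →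
    |M.PiAt x (𝒯.basis τ) (reflectAt x (gauss (c ^ 4) 0))| ≤ C * c ^ 𝒯.deg τ := by
  obtain ⟨C, hC⟩ := M.Pi_bound τ
  refine ⟨|C|, abs_nonneg _, fun x c hc hc1 => ?_⟩
  have h := hC x (c ^ 4) (by positivity) (pow_le_one₀ hc.le hc1)
  rw [pKer_eq (by positivity), rpow_fourth hc] at h
  refine h.trans ?_
  gcongr
  exact le_abs_self C

/-- The growth exponent of distributions of order `γ`. -/
def growth (γ : ℝ) : ℕ := ⌈γ + 2⌉₊

/-- Coefficients of size `δ ^ (γ - |σ|)` against model bounds `c ^ |σ|` give `c ^ γ (δ / c) ^ (γ -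
|σ|)`. As `|σ| > -2`, all these exponents are below `γ + 2`, which explains `growth`. -/
theorem exists_PiAt_le (hβ : ∀ τ, -2 < 𝒯.deg τ) (γ : ℝ) : ∃ K : ℝ, 0 ≤ K ∧
    ∀ (v : T) (B δ : ℝ), 0 ≤ B → 0 ≤ δ → (∀ σ, γ < 𝒯.deg σ → 𝒯.basis.repr v σ = 0) →
      (∀ σ, 𝒯.deg σ ≤ γ → |𝒯.basis.repr v σ| ≤ B * δ ^ (γ - 𝒯.deg σ)) →
      ∀ (y : Spacetime d) (c : ℝ), 0 < c → c ≤ 1 →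
        |M.PiAt y v (reflectAt y (gauss (c ^ 4) 0))| ≤ K * B * (c ^ γ * (1 + δ / c) ^ growth γ) := by
  choose C hC0 hC using M.exists_Pi_bound
  refine ⟨∑ σ ∈ 𝒯.low (γ + 1), C σ, Finset.sum_nonneg fun σ _ => hC0 σ,
    fun v B δ hB hδ hv0 hv y c hc hc1 => ?_⟩
  -- `below` is strict, but elements of homogeneity exactly `γ` must be kept: the lemma is also
  -- applied with `γ` equal to the homogeneity of a basis element.
  have hmem : v ∈ 𝒯.below (γ + 1) := by
    rw [← 𝒯.basis.linearCombination_repr v, Finsupp.linearCombination_apply]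
    refine Submodule.sum_mem _ fun σ hσ => Submodule.smul_mem _ _ (Submodule.subset_span ⟨σ, ?_, rfl⟩)
    by_contra hh
    have hh' : ¬ 𝒯.deg σ < γ + 1 := hh
    exact Finsupp.mem_support_iff.1 hσ (hv0 σ (by linarith [not_lt.1 hh']))
  conv_lhs => rw [𝒯.eq_sum_of_mem_below hmem, map_sum, sum_apply]
  rw [Finset.sum_mul, Finset.sum_mul]
  refine (Finset.abs_sum_le_sum_abs _ _).trans (Finset.sum_le_sum fun σ _ => ?_)
  have hCσ := hC0 σ
  rw [map_smul, smul_apply, smul_eq_mul, abs_mul]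
  rcases lt_or_ge γ (𝒯.deg σ) with h | h
  · rw [hv0 σ h, abs_zero, zero_mul]
    positivity
  · calc _ ≤ (B * δ ^ (γ - 𝒯.deg σ)) * (C σ * c ^ 𝒯.deg σ) :=
          mul_le_mul (hv σ h) (hC σ y c hc hc1) (abs_nonneg _) (by positivity)
      _ = C σ * B * (c ^ γ * (δ / c) ^ (γ - 𝒯.deg σ)) := by
          rw [Real.div_rpow hδ hc.le, Real.rpow_sub hc γ]
          have h1 := (Real.rpow_pos_of_pos hc γ).ne'
          have h2 := (Real.rpow_pos_of_pos hc (𝒯.deg σ)).ne'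
          field_simp
      _ ≤ C σ * B * (c ^ γ * (1 + δ / c) ^ growth γ) := by
          gcongr
          calc (δ / c) ^ (γ - 𝒯.deg σ) ≤ (1 + δ / c) ^ (γ - 𝒯.deg σ) := by
                apply Real.rpow_le_rpow (by positivity) (by linarith) (by linarith)
            _ ≤ (1 + δ / c) ^ ((growth γ : ℕ) : ℝ) := by
                apply Real.rpow_le_rpow_of_exponent_le
                · have : 0 ≤ δ / c := by positivity
                  linarith
                · have := Nat.le_ceil (γ + 2)
                  unfold growth
                  linarith [hβ σ]
            _ = _ := Real.rpow_natCast _ _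

/-- The recentered model at `x` has order `deg τ` at `x`. -/
theorem exists_hasOrder_PiAt (hβ : ∀ τ, -2 < 𝒯.deg τ) (τ : ι) : ∃ C : ℝ, ∀ x : Spacetime d,
    HasOrder (M.PiAt x (𝒯.basis τ)) x (𝒯.deg τ) C (growth (𝒯.deg τ)) := by
  obtain ⟨K, hK, h⟩ := M.exists_PiAt_le hβ (𝒯.deg τ)
  choose C hC0 hC using M.exists_trans_bound τ
  refine ⟨K * ∑ σ ∈ 𝒯.low (𝒯.deg τ + 1), C σ, fun x y c hc hc1 => ?_⟩
  have hmem : ∀ σ, 𝒯.deg τ < 𝒯.deg σ → 𝒯.basis.repr (M.trans y x (𝒯.basis τ)) σ = 0 := fun σ hσ =>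
    𝒯.repr_eq_zero_of_mem_below (𝒯.hat_basis_mem_below _ hσ) le_rfl
  -- The model bound at `y` needs base point `y`, so the expansion is transported there; the
  -- transition map supplies the powers of the distance.
  rw [← M.PiAt_trans y x]
  refine h (M.trans y x (𝒯.basis τ)) (∑ σ ∈ 𝒯.low (𝒯.deg τ + 1), C σ) (pdist y x)
    (Finset.sum_nonneg fun σ _ => hC0 σ) (pdist_nonneg _ _) hmem (fun σ hσ => ?_) y c hc hc1
  have hp := pdist_nonneg y x
  refine (hC σ x y).trans ?_
  gcongr
  exact Finset.single_le_sum (fun σ _ => hC0 σ) (𝒯.mem_low.2 (by linarith))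

theorem dKAtConverges_PiAt (hβ : ∀ τ, -2 < 𝒯.deg τ) (x : Spacetime d) (τ : ι) (n : MIdx d)
    (hn : (sdeg n : ℝ) < 𝒯.deg τ + 2) : dKAtConverges n (M.PiAt x (𝒯.basis τ)) x := by
  obtain ⟨C, hC⟩ := M.exists_hasOrder_PiAt hβ τ
  exact (hC x).dKAtConverges hn

end Model

/-! ### Norms of modelled distributions -/

namespace Model

variable (M : Model d 𝒯)

/-- A bound of the coefficients of a modelled distribution. -/
structure ModelledBound (γ : ℝ) (f : Spacetime d → T) (N : ℝ) : Prop where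
  mem : ∀ x, f x ∈ 𝒯.below γ
  coeff : ∀ x τ, 𝒯.deg τ < γ → |𝒯.basis.repr (f x) τ| ≤ N
  holder : ∀ x y τ, 𝒯.deg τ < γ →
    |𝒯.basis.repr (f y - M.trans y x (f x)) τ| ≤ N * pdist y x ^ (γ - 𝒯.deg τ)

/-- Turns the extended norms into real bounds of single coefficients, the form in which all
estimates are made. The diagonal is separate because the quotient by the distance carries no usable
information there. -/
theorem modelledBound_of_mem {γ : ℝ} {f : Spacetime d → T} (hf : f ∈ M.modelled γ) :
    M.ModelledBound γ f (M.modelledNorm γ f).toReal := by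
  have htop := hf.2.ne
  have h1 : supNorm (𝒯 := 𝒯) γ f ≤ M.modelledNorm γ f := le_self_add
  have h2 : M.holderNorm γ f ≤ M.modelledNorm γ f := le_add_self
  refine ⟨hf.1, fun x τ hτ => ?_, fun x y τ hτ => ?_⟩
  · have h3 : ‖𝒯.basis.repr (f x) τ‖ₑ ≤ M.modelledNorm γ f := by
      refine le_trans ?_ h1
      refine le_trans ?_ (le_iSup₂_of_le (𝒯.deg τ) hτ (le_iSup (fun x => 𝒯.homNorm (𝒯.deg τ) (f x)) x))
      exact le_iSup₂_of_le τ rfl le_rfl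
    have := ENNReal.toReal_mono htop h3
    simpa using this
  · rcases eq_or_ne y x with rfl | hne
    · rw [M.trans_self, sub_self, map_zero, Finsupp.zero_apply, abs_zero, pdist_self]
      exact mul_nonneg ENNReal.toReal_nonneg (Real.rpow_nonneg le_rfl _)
    · have hp : 0 < pdist y x := pdist_pos hne
      have hp' : 0 < pdist y x ^ (γ - 𝒯.deg τ) := Real.rpow_pos_of_pos hp _
      have h3 : ‖𝒯.basis.repr (f y - M.trans y x (f x)) τ‖ₑ / ENNReal.ofReal (pdist y x ^ (γ - 𝒯.deg τ))
          ≤ M.modelledNorm γ f := by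
        refine le_trans ?_ h2
        refine le_trans ?_ (le_iSup₂_of_le (𝒯.deg τ) hτ (le_iSup₂_of_le x y le_rfl))
        refine ENNReal.div_le_div_right ?_ _
        exact le_iSup₂_of_le τ rfl le_rfl
      have h4 := ENNReal.toReal_mono htop h3
      rw [ENNReal.toReal_div, ENNReal.toReal_ofReal hp'.le, div_le_iff₀ hp'] at h4
      simpa using h4

theorem ModelledBound.modelledNorm_le {γ : ℝ} {f : Spacetime d → T} {N : ℝ}
    (h : M.ModelledBound γ f N) : M.modelledNorm γ f ≤ ENNReal.ofReal (2 * N) := by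
  -- A negative bound is possible only if no basis element lies below `γ`, and then `f = 0`.
  rcases lt_or_ge N 0 with hN | hN
  · have hz : ∀ x, f x = 0 := by
      intro x
      rw [𝒯.eq_sum_of_mem_below (h.mem x)]
      refine Finset.sum_eq_zero fun τ hτ => ?_
      have := (abs_nonneg _).trans (h.coeff x τ (𝒯.mem_low.1 hτ))
      linarith
    simp [modelledNorm, supNorm, holderNorm, RegularityStructure.homNorm, hz]
  rw [two_mul, ENNReal.ofReal_add hN hN]
  refine add_le_add ?_ ?_
  · refine iSup₂_le fun β hb => iSup_le fun x => iSup₂_le fun τ hτ => ?_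
    rw [← ofReal_norm, Real.norm_eq_abs]
    exact ENNReal.ofReal_le_ofReal (h.coeff x τ (hτ ▸ hb))
  · refine iSup₂_le fun β hb => iSup₂_le fun x y => ?_
    refine ENNReal.div_le_of_le_mul (iSup₂_le fun τ hτ => ?_)
    have hp := pdist_nonneg y x
    rw [← ofReal_norm, Real.norm_eq_abs, ← ENNReal.ofReal_mul hN]
    refine ENNReal.ofReal_le_ofReal ?_
    have := h.holder x y τ (hτ ▸ hb)
    rwa [hτ] at this

theorem ModelledBound.mem_modelled {γ : ℝ} {f : Spacetime d → T} {N : ℝ}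
    (h : M.ModelledBound γ f N) : f ∈ M.modelled γ :=
  ⟨h.mem, lt_of_le_of_lt (h.modelledNorm_le M) ENNReal.ofReal_lt_top⟩

theorem ModelledBound.repr_eq_zero {γ : ℝ} {f : Spacetime d → T} {N : ℝ}
    (h : M.ModelledBound γ f N) (x y : Spacetime d) {τ : ι} (hτ : γ ≤ 𝒯.deg τ) :
    𝒯.basis.repr (f y - M.trans y x (f x)) τ = 0 :=
  𝒯.repr_eq_zero_of_mem_below (sub_mem (h.mem y) (M.trans_mem_below y x (h.mem x))) hτ

/-- A quantitative form of `IsReconstruction`. -/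
def RecBound (γ : ℝ) (f : Spacetime d → T) (Λ : Distr d) (C : ℝ) : Prop :=
  ∀ (x : Spacetime d) (c : ℝ), 0 < c → c ≤ 1 →
    |(Λ - M.PiAt x (f x)) (reflectAt x (gauss (c ^ 4) 0))| ≤ C * c ^ γ

theorem isReconstruction_iff {γ : ℝ} {f : Spacetime d → T} {Λ : Distr d} :
    M.IsReconstruction γ f Λ ↔ ∃ C, M.RecBound γ f Λ C := by
  constructor
  · rintro ⟨C, hC⟩
    refine ⟨C, fun x c hc hc1 => ?_⟩
    have h := hC x (c ^ 4) (by positivity) (pow_le_one₀ hc.le hc1)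
    rwa [pKer_eq (by positivity), rpow_fourth hc] at h
  · rintro ⟨C, hC⟩
    refine ⟨C, fun x t ht ht1 => ?_⟩
    obtain ⟨c, hc, rfl⟩ := exists_fourth_root ht
    have hc1 : c ≤ 1 := by
      by_contra hh
      push Not at hh
      exact absurd ht1 (not_le.2 (one_lt_pow₀ hh (by norm_num)))
    rw [pKer_eq (by positivity), rpow_fourth hc]
    exact hC x c hc hc1

/-- The uniqueness of the reconstruction. -/
theorem isReconstruction_unique {γ : ℝ} (hγ : 0 < γ) {f : Spacetime d → T} {Λ Λ' : Distr d}
    (h : M.IsReconstruction γ f Λ) (h' : M.IsReconstruction γ f Λ') : Λ = Λ' := by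
  obtain ⟨C, hC⟩ := M.isReconstruction_iff.1 h
  obtain ⟨C', hC'⟩ := M.isReconstruction_iff.1 h'
  rw [← sub_eq_zero]
  set D := Λ - Λ' with hD
  have hb : ∀ x c, 0 < c → c ≤ 1 → |D (reflectAt x (gauss (c ^ 4) 0))| ≤ (C + C') * c ^ γ := by
    intro x c hc hc1
    have e : D (reflectAt x (gauss (c ^ 4) 0)) =
        (Λ - M.PiAt x (f x)) (reflectAt x (gauss (c ^ 4) 0)) -
          (Λ' - M.PiAt x (f x)) (reflectAt x (gauss (c ^ 4) 0)) := by
      simp [hD]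
    rw [e, add_mul]
    exact (abs_sub _ _).trans (add_le_add (hC x c hc hc1) (hC' x c hc hc1))
  ext φ
  -- The mollifications of the difference converge to it weakly, but they are also uniformly of size
  -- `c ^ γ` with `γ > 0`.
  refine tendsto_nhds_unique (tendsto_distr_sconv_gauss D φ) ?_
  have hlim : Filter.Tendsto (fun c : ℝ => (C + C') * c ^ γ * ∫ x, |φ x|) (nhdsWithin 0 (Set.Ioi 0))
      (nhds 0) := by
    have : Filter.Tendsto (fun c : ℝ => c ^ γ) (nhdsWithin 0 (Set.Ioi 0)) (nhds 0) := by
      have := (Real.continuousAt_rpow_const (0 : ℝ) γ (Or.inr hγ.le)).tendsto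
      rw [Real.zero_rpow hγ.ne'] at this
      exact this.mono_left nhdsWithin_le_nhds
    simpa using (this.const_mul (C + C')).mul_const (∫ x, |φ x|)
  refine squeeze_zero_norm' ?_ hlim
  filter_upwards [self_mem_nhdsWithin, nhdsWithin_le_nhds (gt_mem_nhds (zero_lt_one' ℝ))] with c hc hc1
  have hc0 : 0 < c := hc
  rw [sconv_comm, ← sneg_gauss, ← integral_mul_distr_reflectAt, ← integral_const_mul]
  refine norm_integral_le_of_norm_le ((φ.integrable.abs).const_mul _)
    (Filter.Eventually.of_forall fun x => ?_)
  rw [norm_mul, Real.norm_eq_abs, Real.norm_eq_abs, mul_comm]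
  gcongr
  exact hb x c hc0 hc1.le

/-- The order of the difference of a reconstruction and the local expansion. -/
theorem exists_hasOrder_sub (hβ : ∀ τ, -2 < 𝒯.deg τ) (γ : ℝ) : ∃ K : ℝ, 0 ≤ K ∧
    ∀ (f : Spacetime d → T) (N : ℝ) (Λ : Distr d) (C : ℝ), 0 ≤ N → 0 ≤ C → M.ModelledBound γ f N →
      M.RecBound γ f Λ C → ∀ x, HasOrder (Λ - M.PiAt x (f x)) x γ (K * N + C) (growth γ) := by
  obtain ⟨K, hK, h⟩ := M.exists_PiAt_le hβ γ
  refine ⟨K, hK, fun f N Λ C hN hC hf hΛ x y c hc hc1 => ?_⟩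
  -- Change of base point: the error at `y` is the reconstruction error there plus the model applied
  -- to the increment `f y - Γ_{yx} f x`, which `exists_PiAt_le` bounds.
  have e : (Λ - M.PiAt x (f x)) (reflectAt y (gauss (c ^ 4) 0)) =
      (Λ - M.PiAt y (f y)) (reflectAt y (gauss (c ^ 4) 0)) +
        M.PiAt y (f y - M.trans y x (f x)) (reflectAt y (gauss (c ^ 4) 0)) := by
    rw [map_sub, M.PiAt_trans]
    simp
  have h1 := hΛ y c hc hc1
  have h2 := h (f y - M.trans y x (f x)) N (pdist y x) hN (pdist_nonneg _ _)
    (fun σ hσ => hf.repr_eq_zero M x y hσ.le) (fun σ hσ => ?_) y c hc hc1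
  · rw [e]
    refine (abs_add_le _ _).trans ((add_le_add h1 h2).trans ?_)
    have hp : 0 ≤ pdist y x / c := div_nonneg (pdist_nonneg _ _) hc.le
    have h3 : C * c ^ γ ≤ C * (c ^ γ * (1 + pdist y x / c) ^ growth γ) := by
      gcongr
      exact le_mul_of_one_le_right (by positivity) (one_le_pow₀ (by linarith))
    linarith
  · rcases eq_or_lt_of_le hσ with h0 | h0
    · rw [hf.repr_eq_zero M x y h0.ge, abs_zero]
      have := pdist_nonneg y x
      positivity
    · exact hf.holder x y σ h0

end Model

end Order

/-! ### Bounded functions as distributions -/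

section BoundedFunctions

variable {d : ℕ}

theorem exists_integral_abs_le (d : ℕ) : ∃ C : ℝ, 0 ≤ C ∧ ∀ φ : 𝓢(Spacetime d, ℝ),
    ∫ w, |φ w| ≤ C * weightNorm (d + 2) 0 φ := by
  obtain ⟨C, hC, h⟩ := exists_integral_weight_le d 0
  exact ⟨C, hC, fun φ => by simpa using h φ⟩

theorem integrable_mul_of_bounded {F : Spacetime d → ℝ} (hF : Continuous F) {B : ℝ}
    (hB : ∀ x, |F x| ≤ B) (φ : 𝓢(Spacetime d, ℝ)) : Integrable fun x => φ x * F x :=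
  PolyBdd.integrable_mul ⟨hF, B, 0, by simpa using hB⟩ φ

open Classical in
/-- The distribution `φ ↦ ∫ φ F` of a bounded continuous function `F` (and `0` for other `F`). -/
def fnDistr (F : Spacetime d → ℝ) : Distr d :=
  if h : Continuous F ∧ ∃ B, ∀ x, |F x| ≤ B then
    SchwartzMap.mkCLMtoNormedSpace (𝕜 := ℝ) (fun φ => ∫ x, φ x * F x)
      (fun φ ψ => by
        obtain ⟨B, hB⟩ := h.2
        rw [← integral_add (integrable_mul_of_bounded h.1 hB φ) (integrable_mul_of_bounded h.1 hB ψ)]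
        simp [add_mul])
      (fun a φ => by
        rw [RingHom.id_apply, smul_eq_mul, ← integral_const_mul]
        simp [mul_assoc])
      (by
        obtain ⟨B, hB⟩ := h.2
        obtain ⟨C, hC, hb⟩ := exists_integral_abs_le d
        have hB0 : 0 ≤ B := (abs_nonneg _).trans (hB 0)
        refine ⟨Finset.Iic (d + 2, 0), C * B * 2 ^ (d + 2), by positivity, fun φ => ?_⟩
        refine (norm_integral_le_of_norm_le (φ.integrable.abs.mul_const B)
          (Filter.Eventually.of_forall fun x => ?_)).trans ?_
        · rw [norm_mul, Real.norm_eq_abs, Real.norm_eq_abs]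
          gcongr
          exact hB x
        · rw [integral_mul_const]
          calc _ ≤ (C * weightNorm (d + 2) 0 φ) * B := by gcongr; exact hb φ
            _ = _ := by unfold weightNorm schwartzSeminormFamily; ring)
  else 0

theorem fnDistr_apply {F : Spacetime d → ℝ} (hF : Continuous F) {B : ℝ} (hB : ∀ x, |F x| ≤ B)
    (φ : 𝓢(Spacetime d, ℝ)) : fnDistr F φ = ∫ x, φ x * F x := by
  rw [fnDistr, dif_pos ⟨hF, B, hB⟩]
  rfl

theorem fnDistr_reflectAt {F : Spacetime d → ℝ} (hF : Continuous F) {B : ℝ} (hB : ∀ x, |F x| ≤ B)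
    (x : Spacetime d) (ψ : 𝓢(Spacetime d, ℝ)) :
    fnDistr F (reflectAt x ψ) = ∫ w, ψ w * F (x - w) := by
  rw [fnDistr_apply hF hB, ← integral_sub_left_eq_self _ volume x]
  simp [reflectAt_apply]

theorem abs_fnDistr_le {F : Spacetime d → ℝ} (hF : Continuous F) {B : ℝ} (hB : ∀ x, |F x| ≤ B)
    (φ : 𝓢(Spacetime d, ℝ)) : |fnDistr F φ| ≤ B * ∫ x, |φ x| := by
  rw [fnDistr_apply hF hB, mul_comm, ← integral_mul_const]
  exact abs_integral_mul_le (φ.integrable.abs.mul_const B) hB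

theorem exists_weightNorm_CLM_le (L : 𝓢(Spacetime d, ℝ) →L[ℝ] 𝓢(Spacetime d, ℝ)) (k n : ℕ) :
    ∃ (k' n' : ℕ) (C : ℝ), 0 ≤ C ∧ ∀ φ, weightNorm k n (L φ) ≤ C * weightNorm k' n' φ := by
  classical
  have hcont : ∀ s : Finset (ℕ × ℕ), Continuous ⇑(s.sup (schwartzSeminormFamily ℝ (Spacetime d) ℝ)) := by
    intro s
    induction s using Finset.induction_on with
    | empty => exact continuous_const
    | insert m s _ ih =>
      rw [Finset.sup_insert]
      exact ((schwartz_withSeminorms ℝ (Spacetime d) ℝ).continuous_seminorm m).sup ih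
  obtain ⟨s, C, _, h⟩ := Seminorm.bound_of_continuous (schwartz_withSeminorms ℝ (Spacetime d) ℝ)
    (((Finset.Iic (k, n)).sup (schwartzSeminormFamily ℝ (Spacetime d) ℝ)).comp L.toLinearMap)
    ((hcont (Finset.Iic (k, n))).comp L.continuous)
  refine ⟨s.sup Prod.fst, s.sup Prod.snd, 2 ^ k * C, by positivity, fun φ => ?_⟩
  unfold weightNorm
  rw [mul_assoc]
  refine mul_le_mul_of_nonneg_left ((h φ).trans ?_) (by positivity)
  refine mul_le_mul_of_nonneg_left ?_ C.2
  have h1 : s.sup (schwartzSeminormFamily ℝ (Spacetime d) ℝ) ≤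
      (Finset.Iic (s.sup Prod.fst, s.sup Prod.snd)).sup
        (fun m : ℕ × ℕ => SchwartzMap.seminorm ℝ m.1 m.2) :=
    Finset.sup_mono fun i hi => Finset.mem_Iic.2
      ⟨Finset.le_sup (f := Prod.fst) hi, Finset.le_sup (f := Prod.snd) hi⟩
  exact (h1 φ).trans (le_mul_of_one_le_left (apply_nonneg _ _) (one_le_pow₀ one_le_two))

theorem weightNorm_translate_sub_le (k : ℕ) (ψ : 𝓢(Spacetime d, ℝ)) (a b : Spacetime d) :
    weightNorm k 0 (translate a ψ - translate b ψ) ≤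
      2 ^ k * (‖a - b‖ * ((1 + (‖a‖ + ‖b‖)) ^ k * weightNorm k 1 ψ)) := by
  have hW := weightNorm_nonneg k 1 ψ
  unfold weightNorm at *
  refine mul_le_mul_of_nonneg_left (Seminorm.finset_sup_apply_le (by positivity) fun i hi => ?_)
    (by positivity)
  have hi' := Finset.mem_Iic.1 hi
  refine (seminorm_translate_sub_le i.1 i.2 ψ a b).trans ?_
  have h1 : weightNorm i.1 (i.2 + 1) ψ ≤ weightNorm k 1 ψ :=
    weightNorm_mono hi'.1 (by have := hi'.2; simp only at this; omega) ψ
  have h0 := weightNorm_nonneg i.1 (i.2 + 1) ψ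
  gcongr
  · exact le_add_of_nonneg_right (by positivity)
  · exact hi'.1
  · exact h1

/-- The second difference of a bounded distribution. -/
theorem exists_second_difference_le (d : ℕ) : ∃ (k N m : ℕ) (C : ℝ), 0 ≤ C ∧
    ∀ (ζ : Distr d) (B : ℝ), (∀ ψ, |ζ ψ| ≤ B * ∫ x, |ψ x|) → ∀ (φ : 𝓢(Spacetime d, ℝ)) w,
      |ζ (translate w φ) + ζ (translate (-w) φ) - 2 * ζ φ| ≤
        C * B * weightNorm k N φ * (‖w‖ ^ 2 * (1 + ‖w‖) ^ m) := by
  obtain ⟨C₁, hC₁, h₁⟩ := exists_integral_abs_le d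
  choose k n C₂ hC₂ h₂ using fun i : Fin (d + 1) =>
    exists_weightNorm_CLM_le (mderivCLM (d := d) (unitIdx i)) (d + 2) 1
  refine ⟨Finset.univ.sup k, Finset.univ.sup n, d + 2,
    C₁ * (2 ^ (d + 2) * (2 * 2 ^ (d + 2))) * ∑ i, C₂ i,
    mul_nonneg (by positivity) (Finset.sum_nonneg fun i _ => hC₂ i), fun ζ B hζ φ w => ?_⟩
  set W := weightNorm (Finset.univ.sup k) (Finset.univ.sup n) φ with hW
  have hW0 : 0 ≤ W := weightNorm_nonneg _ _ _
  -- The sign of `B` follows by testing against a kernel of integral `1`.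
  have hB : 0 ≤ B := by
    have h3 := (abs_nonneg _).trans (hζ (gauss 1 0))
    have h4 : 0 < ∫ x : Spacetime d, |gauss 1 0 x| := by
      refine lt_of_lt_of_le zero_lt_one ?_
      have h5 := integral_gauss (d := d) one_pos (le_refl (0 : ℝ))
      refine h5.symm.le.trans ?_
      exact integral_mono (gauss 1 0).integrable (gauss 1 0).integrable.abs fun x => le_abs_self _
    exact nonneg_of_mul_nonneg_left h3 h4
  have hlip : ∀ (i : Fin (d + 1)) (s : ℝ), 0 ≤ s → s ≤ 1 →
      |ζ (translate (-(s • w)) (pderiv i φ)) - ζ (translate (s • w) (pderiv i φ))| ≤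
        C₁ * (2 ^ (d + 2) * (2 * 2 ^ (d + 2))) * B * C₂ i * W * (‖w‖ * (1 + ‖w‖) ^ (d + 2)) := by
    intro i s hs hs1
    have hsw : ‖s • w‖ ≤ ‖w‖ := by
      rw [norm_smul, Real.norm_eq_abs, abs_of_nonneg hs]
      exact mul_le_of_le_one_left (norm_nonneg _) hs1
    have hn : ‖-(s • w) - s • w‖ ≤ 2 * ‖w‖ := by
      refine (norm_sub_le _ _).trans ?_
      rw [norm_neg]
      linarith
    rw [← map_sub]
    refine (hζ _).trans ?_
    have hc2 : weightNorm (d + 2) 1 (pderiv i φ) ≤ C₂ i * W := by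
      have := h₂ i φ
      rw [mderivCLM_apply, mderiv_unitIdx] at this
      refine this.trans (mul_le_mul_of_nonneg_left ?_ (hC₂ i))
      exact weightNorm_mono (Finset.le_sup (Finset.mem_univ i)) (Finset.le_sup (Finset.mem_univ i)) φ
    have h00 := weightNorm_nonneg (d + 2) 1 (pderiv i φ)
    calc _ ≤ B * (C₁ * (2 ^ (d + 2) * (‖-(s • w) - s • w‖ * ((1 + (‖-(s • w)‖ + ‖s • w‖)) ^ (d + 2) *
          weightNorm (d + 2) 1 (pderiv i φ))))) := by
          gcongr
          exact (h₁ _).trans (mul_le_mul_of_nonneg_left (weightNorm_translate_sub_le _ _ _ _) hC₁)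
      _ ≤ B * (C₁ * (2 ^ (d + 2) * ((2 * ‖w‖) * ((2 * (1 + ‖w‖)) ^ (d + 2) * (C₂ i * W))))) := by
          gcongr
          rw [norm_neg]
          linarith
      _ = _ := by rw [mul_pow]; ring
  -- The derivative of the symmetric sum in `s` is `w` times a first difference, which `hlip` bounds
  -- by a further factor `‖w‖`; integrating it gives `‖w‖ ^ 2`.
  have hder : ∀ s : ℝ, HasDerivAt
      (fun s : ℝ => ζ (translate (s • w) φ) + ζ (translate (-(s • w)) φ))
      (∑ i, w i * (ζ (translate (-(s • w)) (pderiv i φ)) - ζ (translate (s • w) (pderiv i φ)))) s := by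
    intro s
    have e1 := hasDerivAt_distr_translate ζ φ 0 w s
    have e2 := hasDerivAt_distr_translate ζ φ 0 (-w) s
    simp only [zero_add, smul_neg] at e1 e2
    refine (e1.add e2).congr_deriv ?_
    rw [LineDeriv.lineDerivOp_left_neg, lineDerivOp_eq_sum]
    simp only [map_neg, map_sum, map_smul, smul_eq_mul, neg_neg, mul_sub, Finset.sum_sub_distrib]
    ring
  have key := norm_image_sub_le_of_norm_deriv_le_segment_01'
    (f := fun s : ℝ => ζ (translate (s • w) φ) + ζ (translate (-(s • w)) φ))
    (C := C₁ * (2 ^ (d + 2) * (2 * 2 ^ (d + 2))) * (∑ i, C₂ i) * B * W *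
      (‖w‖ ^ 2 * (1 + ‖w‖) ^ (d + 2)))
    (fun s _ => (hder s).hasDerivWithinAt) ?_
  · have h0 : translate (0 : Spacetime d) φ = φ := by ext y; simp
    simp only [one_smul, zero_smul, neg_zero, h0, Real.norm_eq_abs] at key
    rwa [← two_mul] at key
  · intro s hs
    rw [Real.norm_eq_abs]
    refine (Finset.abs_sum_le_sum_abs _ _).trans ?_
    have e : C₁ * (2 ^ (d + 2) * (2 * 2 ^ (d + 2))) * (∑ i, C₂ i) * B * W *
      (‖w‖ ^ 2 * (1 + ‖w‖) ^ (d + 2)) = ∑ i, ‖w‖ * (C₁ * (2 ^ (d + 2) * (2 * 2 ^ (d + 2))) * B * C₂ i *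
        W * (‖w‖ * (1 + ‖w‖) ^ (d + 2))) := by
      rw [Finset.mul_sum, Finset.sum_mul, Finset.sum_mul, Finset.sum_mul]
      refine Finset.sum_congr rfl fun i _ => ?_
      ring
    rw [e]
    refine Finset.sum_le_sum fun i _ => ?_
    rw [abs_mul]
    exact mul_le_mul (by simpa using PiLp.norm_apply_le w i) (hlip i s hs.1 hs.2.le) (abs_nonneg _)
      (norm_nonneg _)

theorem norm_le_pnorm (z : Spacetime d) : ‖z‖ ≤ pnorm z + pnorm z ^ 2 := by
  have h0 : |z 0| ≤ pnorm z ^ 2 := by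
    have := abs_apply_le_pnorm_pow z 0
    rwa [scal_zero] at this
  have h1 : √(∑ i : Fin d, (z i.succ) ^ 2) ≤ pnorm z := le_add_of_nonneg_left (Real.sqrt_nonneg _)
  have h2 : ‖z‖ ^ 2 = (z 0) ^ 2 + ∑ i : Fin d, (z i.succ) ^ 2 := by
    rw [EuclideanSpace.norm_sq_eq, Fin.sum_univ_succ]
    simp
  have h3 : ∑ i : Fin d, (z i.succ) ^ 2 ≤ pnorm z ^ 2 := by
    have hs : (0 : ℝ) ≤ ∑ i : Fin d, (z i.succ) ^ 2 := Finset.sum_nonneg fun _ _ => sq_nonneg _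
    rw [← Real.sq_sqrt hs]
    gcongr
  have hp := pnorm_nonneg z
  refine abs_le_of_sq_le_sq' ?_ (by positivity) |>.2
  rw [h2]
  have h4 : (z 0) ^ 2 ≤ (pnorm z ^ 2) ^ 2 := by
    rw [← sq_abs]
    gcongr
  nlinarith [mul_nonneg hp (sq_nonneg (pnorm z))]

/-- The rate of convergence of the heat semigroup against bounded distributions. -/
theorem exists_sconv_gauss_sub_le (d : ℕ) : ∃ (k N : ℕ) (C : ℝ), 0 ≤ C ∧
    ∀ (ζ : Distr d) (B : ℝ), 0 ≤ B → (∀ ψ, |ζ ψ| ≤ B * ∫ x, |ψ x|) → ∀ (φ : 𝓢(Spacetime d, ℝ)) c,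
      0 < c → c ≤ 1 → |ζ (sconv (gauss (c ^ 4) 0) φ) - ζ φ| ≤ C * B * c ^ 2 * weightNorm k N φ := by
  obtain ⟨k, N, m, C, hC, h⟩ := exists_second_difference_le d
  obtain ⟨K, hK, hb⟩ := exists_integral_mderiv_gauss_le (0 : MIdx d) (4 + 2 * m)
  refine ⟨k, N, C * K, by positivity, fun ζ B hB hζ φ c hc hc1 => ?_⟩
  have hb' := hb c 0 hc le_rfl (by positivity)
  simp only [mderiv_zero, sdeg_zero, pow_zero, mul_one] at hb'
  have hW := weightNorm_nonneg k N φ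
  have hi : Integrable fun w => gauss (c ^ 4) 0 w * ζ (translate w φ) :=
    (polyBdd_translate ζ φ).integrable_mul _
  have hi' : Integrable fun w => gauss (c ^ 4) 0 w * ζ (translate (-w) φ) :=
    (polyBdd_translate ζ φ).comp_neg.integrable_mul _
  have hi2 : Integrable fun w : Spacetime d => gauss (c ^ 4) 0 w * (2 * ζ φ) := (gauss (c ^ 4) 0).integrable.mul_const _
  have e1 : ζ (sconv (gauss (c ^ 4) 0) φ) = ∫ w, gauss (c ^ 4) 0 w * ζ (translate (-w) φ) := by
    rw [distr_sconv, ← integral_neg_eq_self]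
    simp only [gauss_neg]
  -- The kernel is even, so the first order term cancels and the second difference gives the rate `c
  -- ^ 2`. This rate is needed in full, since the germs may grow almost like `c ^ (-2)`.
  have e2 : 2 * (ζ (sconv (gauss (c ^ 4) 0) φ) - ζ φ) = ∫ w, gauss (c ^ 4) 0 w *
      (ζ (translate w φ) + ζ (translate (-w) φ) - 2 * ζ φ) := by
    have e3 : ∫ w : Spacetime d, gauss (c ^ 4) 0 w * (2 * ζ φ) = 2 * ζ φ := by
      rw [integral_mul_const, integral_gauss (by positivity) le_rfl, one_mul]
    have e4 : ∫ w, gauss (c ^ 4) 0 w * ζ (translate w φ) = ζ (sconv (gauss (c ^ 4) 0) φ) :=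
      (distr_sconv ζ _ _).symm
    have e5 := integral_sub (hi.add hi') hi2
    rw [integral_add' hi hi', e3, ← e1, e4] at e5
    simp only [Pi.add_apply, ← mul_add, ← mul_sub] at e5
    rw [e5]
    ring
  have key : |2 * (ζ (sconv (gauss (c ^ 4) 0) φ) - ζ φ)| ≤ C * B * weightNorm k N φ * c ^ 2 * K := by
    rw [e2]
    have hA : Integrable fun w : Spacetime d => |gauss (c ^ 4) 0 w| *
        (C * B * weightNorm k N φ * c ^ 2 * (1 + pnorm w / c) ^ (4 + 2 * m)) := by
      refine ((integrable_abs_mul_weight (gauss (c ^ 4) 0) hc (4 + 2 * m)).const_mul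
        (C * B * weightNorm k N φ * c ^ 2)).congr (Filter.Eventually.of_forall fun w => ?_)
      simp only
      ring
    refine (abs_integral_mul_le hA fun w => ?_).trans ?_
    · refine (h ζ B hζ φ w).trans ?_
      rw [mul_assoc (C * B * weightNorm k N φ)]
      refine mul_le_mul_of_nonneg_left ?_ (by positivity)
      set δ := pnorm w / c with hδ
      have hδ0 : 0 ≤ δ := div_nonneg (pnorm_nonneg _) hc.le
      have hpn : pnorm w = c * δ := by rw [hδ]; field_simp
      have h1 : ‖w‖ ≤ c * (1 + δ) ^ 2 := by
        refine (norm_le_pnorm w).trans ?_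
        rw [hpn]
        have : (c * δ) ^ 2 ≤ c * δ ^ 2 := by
          rw [mul_pow]
          refine mul_le_mul_of_nonneg_right ?_ (by positivity)
          nlinarith
        nlinarith
      have h2 : 1 + ‖w‖ ≤ (1 + δ) ^ 2 := by
        refine (one_add_norm_le w).trans ?_
        rw [hpn]
        gcongr
        exact mul_le_of_le_one_left hδ0 hc1
      calc ‖w‖ ^ 2 * (1 + ‖w‖) ^ m ≤ (c * (1 + δ) ^ 2) ^ 2 * ((1 + δ) ^ 2) ^ m := by gcongr
        _ = _ := by rw [mul_pow, ← pow_mul, ← pow_mul, pow_add]; ring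
    · have e4 : ∫ w : Spacetime d, |gauss (c ^ 4) 0 w| *
          (C * B * weightNorm k N φ * c ^ 2 * (1 + pnorm w / c) ^ (4 + 2 * m)) =
          C * B * weightNorm k N φ * c ^ 2 * ∫ w : Spacetime d, |gauss (c ^ 4) 0 w| *
            (1 + pnorm w / c) ^ (4 + 2 * m) := by
        rw [← integral_const_mul]
        refine integral_congr_ae (Filter.Eventually.of_forall fun w => ?_)
        simp only
        ring
      rw [e4]
      gcongr
  rw [abs_mul, abs_two] at key
  have h0 := abs_nonneg (ζ (sconv (gauss (c ^ 4) 0) φ) - ζ φ)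
  calc _ ≤ C * B * weightNorm k N φ * c ^ 2 * K := by linarith
    _ = _ := by ring

end BoundedFunctions

/-! ### The reconstruction theorem -/

section Reconstruction

variable {d : ℕ} {ι κ T Tp : Type*} [AddCommGroup T] [Module ℝ T] [CommRing Tp] [Bialgebra ℝ Tp]
  {𝒯 : RegularityStructure ι κ T Tp}

theorem exists_fourth_root_le_one {t : ℝ} (ht : 0 < t) (ht1 : t ≤ 1) :
    ∃ c, 0 < c ∧ c ≤ 1 ∧ c ^ 4 = t := by
  obtain ⟨c, hc, rfl⟩ := exists_fourth_root ht
  refine ⟨c, hc, ?_, rfl⟩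
  by_contra hh
  push Not at hh
  exact absurd ht1 (not_le.2 (one_lt_pow₀ hh (by norm_num)))

namespace Model

variable (M : Model d 𝒯)

/-- The function `x ↦ ⟨Π_x f(x), p_t(x, ·)⟩`. -/
def germ (f : Spacetime d → T) (t : ℝ) (x : Spacetime d) : ℝ :=
  M.PiAt x (f x) (reflectAt x (gauss t 0))

theorem exists_abs_PiAt_le (γ : ℝ) : ∃ C : ι → ℝ, (∀ σ, 0 ≤ C σ) ∧ ∀ (v : T) (x : Spacetime d) (c : ℝ),
    v ∈ 𝒯.below γ → 0 < c → c ≤ 1 → |M.PiAt x v (reflectAt x (gauss (c ^ 4) 0))| ≤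
      ∑ σ ∈ 𝒯.low γ, |𝒯.basis.repr v σ| * (C σ * c ^ 𝒯.deg σ) := by
  choose C hC0 hC using M.exists_Pi_bound
  refine ⟨C, hC0, fun v x c hv hc hc1 => ?_⟩
  conv_lhs => rw [𝒯.eq_sum_of_mem_below hv, map_sum, sum_apply]
  refine (Finset.abs_sum_le_sum_abs _ _).trans (Finset.sum_le_sum fun σ _ => ?_)
  rw [map_smul, smul_apply, smul_eq_mul, abs_mul]
  exact mul_le_mul_of_nonneg_left (hC σ x c hc hc1) (abs_nonneg _)

/-- With `x` frozen the pairing is continuous in the base point of the kernel; the correction for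
recentering at `y` is controlled by positive powers of the distance. -/
theorem continuous_germ {γ : ℝ} {f : Spacetime d → T} {N : ℝ} (hf : M.ModelledBound γ f N) {t : ℝ}
    (ht : 0 < t) (ht1 : t ≤ 1) : Continuous (M.germ f t) := by
  obtain ⟨C, hC0, hC⟩ := M.exists_abs_PiAt_le γ
  obtain ⟨c, hc, hc1, rfl⟩ := exists_fourth_root_le_one ht ht1
  rw [continuous_iff_continuousAt]
  intro x
  have h1 : Filter.Tendsto (fun y => M.PiAt x (f x) (reflectAt y (gauss (c ^ 4) 0))) (nhds x)
      (nhds (M.germ f (c ^ 4) x)) :=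
    (polyBdd_reflectAt (M.PiAt x (f x)) (gauss (c ^ 4) 0)).continuous.tendsto x
  have h2 : Filter.Tendsto (fun y => M.PiAt y (f y - M.trans y x (f x))
      (reflectAt y (gauss (c ^ 4) 0))) (nhds x) (nhds 0) := by
    have hlim : Filter.Tendsto (fun y => ∑ σ ∈ 𝒯.low γ, (N * pdist y x ^ (γ - 𝒯.deg σ)) *
        (C σ * c ^ 𝒯.deg σ)) (nhds x) (nhds 0) := by
      have : ∑ σ ∈ 𝒯.low γ, (N * 0) * (C σ * c ^ 𝒯.deg σ) = 0 :=
        Finset.sum_eq_zero fun σ _ => by simp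
      rw [← this]
      refine tendsto_finsetSum _ fun σ hσ => ?_
      refine Filter.Tendsto.mul_const _ (Filter.Tendsto.const_mul _ ?_)
      have hp : 0 < γ - 𝒯.deg σ := by linarith [𝒯.mem_low.1 hσ]
      have h3 : Filter.Tendsto (fun y => pdist y x) (nhds x) (nhds 0) := by
        have : Continuous fun y => pdist y x := by
          simp only [pdist_eq]
          exact continuous_pnorm.comp (by fun_prop)
        simpa [pdist_self] using this.tendsto x
      have h4 := (Real.continuousAt_rpow_const (0 : ℝ) (γ - 𝒯.deg σ) (Or.inr hp.le)).tendsto.comp h3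
      rwa [Real.zero_rpow hp.ne'] at h4
    refine squeeze_zero_norm (fun y => ?_) hlim
    refine (hC _ y c (sub_mem (hf.mem y) (M.trans_mem_below y x (hf.mem x))) hc hc1).trans ?_
    refine Finset.sum_le_sum fun σ hσ => mul_le_mul_of_nonneg_right
      (hf.holder x y σ (𝒯.mem_low.1 hσ)) (mul_nonneg (hC0 σ) (by positivity))
  have h3 := h1.add h2
  rw [add_zero] at h3
  refine h3.congr fun y => ?_
  rw [map_sub, M.PiAt_trans, sub_apply, germ]
  ring

/-- Only finitely many homogeneities lie below `γ` and all exceed `-2`, so they are bounded below by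
some `4 * ε - 2`. With `t = c ^ 4` this is strictly better than `t ^ (-1/2)`. -/
theorem exists_germ_le (hβ : ∀ τ, -2 < 𝒯.deg τ) (γ : ℝ) : ∃ ε : ℝ, 0 < ε ∧ ∃ K : ℝ, 0 ≤ K ∧
    ∀ (f : Spacetime d → T) (N : ℝ), M.ModelledBound γ f N → ∀ x t, 0 < t → t ≤ 1 →
      |M.germ f t x| ≤ K * N * t ^ (ε - 1 / 2) := by
  obtain ⟨C, hC0, hC⟩ := M.exists_abs_PiAt_le γ
  obtain ⟨ε, hε, hεσ⟩ : ∃ ε : ℝ, 0 < ε ∧ ∀ σ ∈ 𝒯.low γ, 4 * ε - 2 ≤ 𝒯.deg σ := by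
    rcases (𝒯.low γ).eq_empty_or_nonempty with h | h
    · exact ⟨1, one_pos, by simp [h]⟩
    · obtain ⟨σ, _, hσ⟩ := Finset.exists_min_image _ 𝒯.deg h
      exact ⟨(𝒯.deg σ + 2) / 4, by linarith [hβ σ], fun ρ hρ => by linarith [hσ ρ hρ]⟩
  refine ⟨ε, hε, ∑ σ ∈ 𝒯.low γ, C σ, Finset.sum_nonneg fun σ _ => hC0 σ,
    fun f N hf x t ht ht1 => ?_⟩
  obtain ⟨c, hc, hc1, rfl⟩ := exists_fourth_root_le_one ht ht1
  refine (hC (f x) x c (hf.mem x) hc hc1).trans ?_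
  rw [Finset.sum_mul, Finset.sum_mul]
  refine Finset.sum_le_sum fun σ hσ => ?_
  have h1 := hf.coeff x σ (𝒯.mem_low.1 hσ)
  have hN : 0 ≤ N := (abs_nonneg _).trans h1
  have h2 : c ^ 𝒯.deg σ ≤ (c ^ 4) ^ (ε - 1 / 2) := by
    rw [show ε - 1 / 2 = (4 * ε - 2) / 4 by ring, rpow_fourth hc]
    exact Real.rpow_le_rpow_of_exponent_ge hc hc1 (hεσ σ hσ)
  have hCσ := hC0 σ
  calc _ ≤ N * (C σ * (c ^ 4) ^ (ε - 1 / 2)) := by gcongr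
    _ = _ := by ring

theorem germ_bounded (hβ : ∀ τ, -2 < 𝒯.deg τ) {γ : ℝ} {f : Spacetime d → T} {N : ℝ}
    (hf : M.ModelledBound γ f N) {t : ℝ} (ht : 0 < t) (ht1 : t ≤ 1) :
    ∃ B, ∀ x, |M.germ f t x| ≤ B := by
  obtain ⟨ε, _, K, _, h⟩ := M.exists_germ_le hβ γ
  exact ⟨_, fun x => h f N hf x t ht ht1⟩

/-- With a frozen expansion the semigroup law is exact, so the error is `p_u` applied to the model
evaluated on the increment of `f`. Its weight lives at the scale of `s`, and `u ≤ s` lets the kernel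
at the smaller scale absorb it. -/
theorem exists_germ_consistency (hβ : ∀ τ, -2 < 𝒯.deg τ) (γ : ℝ) : ∃ K : ℝ, 0 ≤ K ∧
    ∀ (f : Spacetime d → T) (N : ℝ), 0 ≤ N → M.ModelledBound γ f N → ∀ x s u, 0 < u → u ≤ s → s ≤ 1 →
      |fnDistr (M.germ f s) (reflectAt x (gauss u 0)) - M.germ f (s + u) x| ≤ K * N * s ^ (γ / 4) := by
  obtain ⟨K, hK, h⟩ := M.exists_PiAt_le hβ γ
  obtain ⟨K', hK', h'⟩ := exists_sconv_bound (0 : MIdx d) (growth γ)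
  refine ⟨K' * K, by positivity, fun f N hN hf x s u hu hus hs1 => ?_⟩
  have hs : 0 < s := hu.trans_le hus
  obtain ⟨B, hB⟩ := M.germ_bounded hβ hf hs hs1
  have hcont := M.continuous_germ hf hs hs1
  rw [fnDistr_reflectAt hcont hB]
  obtain ⟨c, hc, hc1, rfl⟩ := exists_fourth_root_le_one hs hs1
  obtain ⟨e, he, rfl⟩ := exists_fourth_root hu
  have hec : e ≤ c := le_of_pow_le_pow_left₀ (by norm_num) hc.le hus
  have e1 : M.germ f (c ^ 4 + e ^ 4) x =
      ∫ w, gauss (e ^ 4) 0 w * M.PiAt x (f x) (reflectAt (x - w) (gauss (c ^ 4) 0)) := by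
    rw [← distr_reflectAt_sconv, sconv_gauss hu le_rfl hs le_rfl, add_zero, add_comm (e ^ 4), germ]
  have i1 : Integrable fun w => gauss (e ^ 4) 0 w * M.germ f (c ^ 4) (x - w) :=
    integrable_mul_of_bounded (hcont.comp (by fun_prop)) (fun w => hB (x - w)) _
  have i2 : Integrable fun w =>
      gauss (e ^ 4) 0 w * M.PiAt x (f x) (reflectAt (x - w) (gauss (c ^ 4) 0)) := by
    have := ((polyBdd_reflectAt (M.PiAt x (f x)) (gauss (c ^ 4) 0)).comp_sub_const (-x)).comp_neg
    refine (this.integrable_mul (gauss (e ^ 4) 0)).congr (Filter.Eventually.of_forall fun w => ?_)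
    simp only [sub_neg_eq_add, neg_add_eq_sub]
  rw [e1, ← integral_sub i1 i2]
  have h3 := h' (fun y => M.PiAt y (f y - M.trans y x (f x)) (reflectAt y (gauss (c ^ 4) 0))) x
    (K * N * c ^ γ) e 0 he le_rfl (by positivity) (fun y => ?_) x
  · simp only [mderiv_zero, sdeg_zero, pow_zero, pdist_self, zero_div, add_zero, one_pow,
      mul_one] at h3
    rw [rpow_fourth hc]
    have e2 : ∀ w, gauss (e ^ 4) 0 w * M.germ f (c ^ 4) (x - w) -
        gauss (e ^ 4) 0 w * M.PiAt x (f x) (reflectAt (x - w) (gauss (c ^ 4) 0)) =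
        gauss (e ^ 4) 0 w * M.PiAt (x - w) (f (x - w) - M.trans (x - w) x (f x))
          (reflectAt (x - w) (gauss (c ^ 4) 0)) := fun w => by
      rw [map_sub, M.PiAt_trans, sub_apply, germ]
      ring
    simp only [e2]
    refine h3.trans_eq ?_
    ring
  · refine (h (f y - M.trans y x (f x)) N (pdist y x) hN (pdist_nonneg _ _)
      (fun σ hσ => hf.repr_eq_zero M x y hσ.le) (fun σ hσ => ?_) y c hc hc1).trans ?_
    · rcases eq_or_lt_of_le hσ with h0 | h0
      · rw [hf.repr_eq_zero M x y h0.ge, abs_zero]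
        have := pdist_nonneg y x
        positivity
      · exact hf.holder x y σ h0
    · have := pdist_nonneg y x
      rw [← mul_assoc]
      gcongr

/-- The almost semigroup property of the germs. -/
theorem exists_germ_semigroup (hβ : ∀ τ, -2 < 𝒯.deg τ) {γ : ℝ} (hγ : 0 < γ) : ∃ K : ℝ, 0 ≤ K ∧
    ∀ (f : Spacetime d → T) (N : ℝ), 0 ≤ N → M.ModelledBound γ f N → ∀ x s u, 0 < s → 0 < u →
      s + u ≤ 1 →
      |fnDistr (M.germ f s) (reflectAt x (gauss u 0)) - M.germ f (s + u) x| ≤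
        K * N * (s + u) ^ (γ / 4) := by
  obtain ⟨K, hK, h⟩ := M.exists_germ_consistency hβ γ
  obtain ⟨K₀, hK₀, h₀⟩ := exists_sconv_bound (0 : MIdx d) 0
  set p := γ / 4 with hp
  have hp0 : 0 < p := by positivity
  have hb : (0 : ℝ) < 2 ^ p - 1 := sub_pos.2 (Real.one_lt_rpow one_lt_two hp0)
  set K₁ := K * (1 + K₀) with hK₁
  have hK₁0 : 0 ≤ K₁ := by positivity
  -- Chosen so that `K₃ * (2 ^ p - 1) = K₁`: the negative term `K₃ * s ^ p` in the induction
  -- hypothesis then pays for one doubling of `s`, and the geometric sum telescopes.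
  set K₃ := K₁ / (2 ^ p - 1) with hK₃
  have hK₃0 : 0 ≤ K₃ := by positivity
  refine ⟨K₁ + K₃, by positivity, fun f N hN hf => ?_⟩
  have key : ∀ j : ℕ, ∀ x s u, 0 < s → 0 < u → s + u ≤ 1 → u ≤ (2 ^ (j + 1) - 1) * s →
      |fnDistr (M.germ f s) (reflectAt x (gauss u 0)) - M.germ f (s + u) x| ≤
        N * ((K₁ + K₃) * (s + u) ^ p - K₃ * s ^ p) := by
    intro j
    have base : ∀ x s u, 0 < s → 0 < u → s + u ≤ 1 → u ≤ s →
        |fnDistr (M.germ f s) (reflectAt x (gauss u 0)) - M.germ f (s + u) x| ≤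
          N * ((K₁ + K₃) * (s + u) ^ p - K₃ * s ^ p) := by
      intro x s u hs hu hsu hus
      refine (h f N hN hf x s u hu hus (by linarith)).trans ?_
      have h1 : s ^ p ≤ (s + u) ^ p := Real.rpow_le_rpow hs.le (by linarith) hp0.le
      have h2 : 0 ≤ s ^ p := by positivity
      have h3 : K ≤ K₁ := by rw [hK₁]; nlinarith
      have h4 : K * s ^ p ≤ (K₁ + K₃) * (s + u) ^ p - K₃ * s ^ p := by nlinarith
      calc K * N * s ^ p = N * (K * s ^ p) := by ring
        _ ≤ _ := mul_le_mul_of_nonneg_left h4 hN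
    induction j with
    | zero =>
      intro x s u hs hu hsu hus
      exact base x s u hs hu hsu (by norm_num at hus; linarith)
    | succ j ih =>
      intro x s u hs hu hsu hus
      rcases le_or_gt u s with hle | hlt
      · exact base x s u hs hu hsu hle
      -- Doubling: the time `s` is first moved from `u` into the germ, with an error of consistency
      -- type averaged by `p_{u-s}`; the induction hypothesis then applies to the pair `(2 * s, u -
      -- s)` with the same total time.
      · have hu' : 0 < u - s := by linarith
        have h1 := ih x (2 * s) (u - s) (by linarith) hu' (by linarith) (by
          rw [pow_succ] at hus
          nlinarith)
        rw [show 2 * s + (u - s) = s + u by ring] at h1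
        obtain ⟨B, hB⟩ := M.germ_bounded hβ hf hs (by linarith)
        obtain ⟨B₂, hB₂⟩ := M.germ_bounded hβ hf (show 0 < 2 * s by linarith) (by linarith)
        have hcont := M.continuous_germ hf hs (by linarith)
        have hcont₂ := M.continuous_germ hf (show 0 < 2 * s by linarith) (by linarith)
        obtain ⟨e, he, he4⟩ := exists_fourth_root hu'
        have e1 : fnDistr (M.germ f s) (reflectAt x (gauss u 0)) =
            ∫ w, gauss (u - s) 0 w * fnDistr (M.germ f s) (reflectAt (x - w) (gauss s 0)) := by
          rw [← distr_reflectAt_sconv, sconv_gauss hu' le_rfl hs le_rfl, add_zero, sub_add_cancel]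
        have e2 := fnDistr_reflectAt hcont₂ hB₂ x (gauss (u - s) 0)
        have i1 : Integrable fun w =>
            gauss (u - s) 0 w * fnDistr (M.germ f s) (reflectAt (x - w) (gauss s 0)) := by
          have := ((polyBdd_reflectAt (fnDistr (M.germ f s)) (gauss s 0)).comp_sub_const
            (-x)).comp_neg
          refine (this.integrable_mul (gauss (u - s) 0)).congr
            (Filter.Eventually.of_forall fun w => ?_)
          simp only [sub_neg_eq_add, neg_add_eq_sub]
        have i2 : Integrable fun w => gauss (u - s) 0 w * M.germ f (2 * s) (x - w) :=
          integrable_mul_of_bounded (hcont₂.comp (by fun_prop)) (fun w => hB₂ (x - w)) _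
        have h2 := h₀ (fun y => fnDistr (M.germ f s) (reflectAt y (gauss s 0)) - M.germ f (2 * s) y) x
          (K * N * s ^ p) e 0 he le_rfl (by positivity) (fun y => by
            have := h f N hN hf y s s hs le_rfl (by linarith)
            rw [← two_mul] at this
            simpa using this) x
        simp only [mderiv_zero, sdeg_zero, pow_zero, mul_one, he4, mul_sub] at h2
        rw [integral_sub i1 i2, ← e1, ← e2] at h2
        have h3 : |fnDistr (M.germ f s) (reflectAt x (gauss u 0)) - M.germ f (s + u) x| ≤
            K₀ * (K * N * s ^ p) + N * ((K₁ + K₃) * (s + u) ^ p - K₃ * (2 * s) ^ p) := by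
          refine (abs_sub_le _ (fnDistr (M.germ f (2 * s)) (reflectAt x (gauss (u - s) 0))) _).trans
            (add_le_add h2 h1)
        refine h3.trans ?_
        rw [Real.mul_rpow (by norm_num) hs.le]
        have h4 : K₃ * (2 ^ p - 1) = K₁ := by rw [hK₃]; field_simp
        have h5 : K₀ * K ≤ K₁ := by rw [hK₁]; nlinarith
        have h6 : 0 ≤ N * s ^ p := by positivity
        have h7 : K₀ * K * (N * s ^ p) ≤ K₃ * (2 ^ p - 1) * (N * s ^ p) := by
          rw [h4]
          exact mul_le_mul_of_nonneg_right h5 h6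
        linarith [h7, show K₃ * (2 ^ p - 1) * (N * s ^ p) =
          N * (K₃ * (2 ^ p * s ^ p)) - N * (K₃ * s ^ p) by ring]
  intro x s u hs hu hsu
  obtain ⟨j, hj⟩ := pow_unbounded_of_one_lt (u / s + 1) (one_lt_two (α := ℝ))
  have hj' : u ≤ (2 ^ (j + 1) - 1) * s := by
    have h1 : u / s + 1 ≤ 2 ^ (j + 1) := hj.le.trans (pow_le_pow_right₀ one_le_two (by omega))
    have h2 : u / s ≤ 2 ^ (j + 1) - 1 := by linarith
    rwa [div_le_iff₀ hs] at h2
  refine (key j x s u hs hu hsu hj').trans ?_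
  have : 0 ≤ N * (K₃ * s ^ p) := by positivity
  linarith [this, show N * ((K₁ + K₃) * (s + u) ^ p - K₃ * s ^ p) =
    (K₁ + K₃) * N * (s + u) ^ p - N * (K₃ * s ^ p) by ring]

end Model

end Reconstruction

/-! ### Convergence of the germs and existence of the reconstruction -/

section Reconstruction

variable {d : ℕ} {ι κ T Tp : Type*} [AddCommGroup T] [Module ℝ T] [CommRing Tp] [Bialgebra ℝ Tp]
  {𝒯 : RegularityStructure ι κ T Tp}

/-- A sequence of distributions that is Cauchy at a geometric rate converges to a distribution. -/
theorem exists_distr_limit (Λ : ℕ → Distr d) {q C : ℝ} (hq : q < 1) (hC : 0 ≤ C) (k n : ℕ)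
    (h : ∀ j φ, |Λ (j + 1) φ - Λ j φ| ≤ C * q ^ j * weightNorm k n φ) :
    ∃ L : Distr d, ∀ φ, Filter.Tendsto (fun j => Λ j φ) Filter.atTop (nhds (L φ)) := by
  have hdist : ∀ φ j, dist (Λ j φ) (Λ (j + 1) φ) ≤ (C * weightNorm k n φ) * q ^ j := fun φ j => by
    rw [dist_comm, Real.dist_eq]
    exact (h j φ).trans (le_of_eq (by ring))
  choose L hL using fun φ => cauchySeq_tendsto_of_complete
    (cauchySeq_of_le_geometric q (C * weightNorm k n φ) hq (hdist φ))
  have hbound : ∀ φ, |L φ - Λ 0 φ| ≤ C * weightNorm k n φ / (1 - q) := fun φ => by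
    have := dist_le_of_le_geometric_of_tendsto₀ q _ hq (hdist φ) (hL φ)
    rwa [dist_comm, Real.dist_eq] at this
  let D : Distr d := SchwartzMap.mkCLMtoNormedSpace (𝕜 := ℝ) (fun φ => L φ - Λ 0 φ)
    (fun φ ψ => by
      have h1 := tendsto_nhds_unique (hL (φ + ψ))
        (((hL φ).add (hL ψ)).congr fun j => (map_add (Λ j) φ ψ).symm)
      rw [h1, map_add]
      ring)
    (fun a φ => by
      have h1 := tendsto_nhds_unique (hL (a • φ))
        (((hL φ).const_smul a).congr fun j => (map_smul (Λ j) a φ).symm)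
      rw [h1, map_smul, RingHom.id_apply, smul_sub])
    ⟨Finset.Iic (k, n), C * 2 ^ k / (1 - q), div_nonneg (by positivity) (by linarith), fun φ => by
      refine (hbound φ).trans (le_of_eq ?_)
      unfold weightNorm schwartzSeminormFamily
      ring⟩
  refine ⟨D + Λ 0, fun φ => ?_⟩
  have hD : D φ = L φ - Λ 0 φ := rfl
  rw [add_apply, hD, sub_add_cancel]
  exact hL φ

theorem continuousOn_distr_heat (ζ : Distr d) (x : Spacetime d) :
    ContinuousOn (fun t => ζ (reflectAt x (gauss t 0))) (Set.Ioc 0 1) :=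
  (continuousOn_distr_pKer ζ x).congr fun t ht => by simp only [pKer_eq ht.1]

namespace Model

variable (M : Model d 𝒯)

/-- Pass from `F_s` to `F_{2s}` through `p_s * F_s`. The first step costs the growth `s ^ (ε - 1/2)`
times the mollification rate `s ^ (1/2)`; the second is the consistency error `s ^ (γ / 4)`. Both
exponents are positive. -/
theorem exists_germ_step_le (hβ : ∀ τ, -2 < 𝒯.deg τ) {γ : ℝ} (hγ : 0 < γ) :
    ∃ (η : ℝ) (k n : ℕ) (K : ℝ), 0 < η ∧ 0 ≤ K ∧ ∀ (f : Spacetime d → T) (N : ℝ), 0 ≤ N →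
      M.ModelledBound γ f N → ∀ s, 0 < s → 2 * s ≤ 1 → ∀ φ,
        |fnDistr (M.germ f s) φ - fnDistr (M.germ f (2 * s)) φ| ≤ K * N * s ^ η * weightNorm k n φ := by
  obtain ⟨ε, hε, K₁, hK₁, hg⟩ := M.exists_germ_le hβ γ
  obtain ⟨K₂, hK₂, hcons⟩ := M.exists_germ_consistency hβ γ
  obtain ⟨k, n, C, hC, hconv⟩ := exists_sconv_gauss_sub_le d
  obtain ⟨C', hC', hint⟩ := exists_integral_abs_le d
  refine ⟨min ε (γ / 4), max k (d + 2), n, C * K₁ + K₂ * C', lt_min hε (by positivity),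
    by positivity, fun f N hN hf s hs hs2 φ => ?_⟩
  have hs1 : s ≤ 1 := by linarith
  obtain ⟨c, hc, hc1, hcs⟩ := exists_fourth_root_le_one hs hs1
  have hcont := M.continuous_germ hf hs hs1
  have hcont₂ := M.continuous_germ hf (show 0 < 2 * s by linarith) hs2
  obtain ⟨B₂, hB₂⟩ := M.germ_bounded hβ hf (show 0 < 2 * s by linarith) hs2
  set W := weightNorm (max k (d + 2)) n φ
  have hW : 0 ≤ W := weightNorm_nonneg _ _ _
  have h1 := hconv (fnDistr (M.germ f s)) (K₁ * N * s ^ (ε - 1 / 2)) (by positivity)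
    (abs_fnDistr_le hcont (fun x => hg f N hf x s hs hs1)) φ c hc hc1
  rw [hcs] at h1
  have hc2 : s ^ (ε - 1 / 2) * c ^ 2 = s ^ ε := by
    rw [← hcs, show ε - 1 / 2 = (4 * ε - 2) / 4 by ring, rpow_fourth hc,
      show ε = (4 * ε) / 4 by ring, rpow_fourth hc, ← Real.rpow_natCast c 2, ← Real.rpow_add hc]
    congr 1
    push_cast
    ring
  have h1' : |fnDistr (M.germ f s) (sconv (gauss s 0) φ) - fnDistr (M.germ f s) φ| ≤
      C * K₁ * N * s ^ ε * W := by
    refine h1.trans ?_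
    have : weightNorm k n φ ≤ W := weightNorm_mono (le_max_left _ _) le_rfl φ
    calc _ = C * K₁ * N * (s ^ (ε - 1 / 2) * c ^ 2) * weightNorm k n φ := by ring
      _ ≤ _ := by rw [hc2]; gcongr
  have h2 : |fnDistr (M.germ f s) (sconv (gauss s 0) φ) - fnDistr (M.germ f (2 * s)) φ| ≤
      K₂ * N * s ^ (γ / 4) * ∫ x, |φ x| := by
    have e : sconv (gauss s 0) φ = sconv φ (sneg (gauss (d := d) s 0)) := by
      rw [sneg_gauss, sconv_comm]
    rw [e, ← integral_mul_distr_reflectAt, fnDistr_apply hcont₂ hB₂,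
      ← integral_sub ((polyBdd_reflectAt (fnDistr (M.germ f s)) (gauss s 0)).integrable_mul φ)
        (integrable_mul_of_bounded hcont₂ hB₂ φ), ← integral_const_mul]
    have hφ : Integrable fun x => |φ x| := φ.integrable.abs
    rw [← Real.norm_eq_abs]
    refine norm_integral_le_of_norm_le (hφ.const_mul _)
      (Filter.Eventually.of_forall fun x => ?_)
    rw [← mul_sub, norm_mul, Real.norm_eq_abs, Real.norm_eq_abs, mul_comm]
    refine mul_le_mul_of_nonneg_right ?_ (abs_nonneg _)
    have := hcons f N hN hf x s s hs le_rfl hs1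
    rwa [← two_mul] at this
  have h2' : |fnDistr (M.germ f s) (sconv (gauss s 0) φ) - fnDistr (M.germ f (2 * s)) φ| ≤
      K₂ * N * s ^ (γ / 4) * (C' * W) := by
    refine h2.trans (mul_le_mul_of_nonneg_left ((hint φ).trans ?_) (by positivity))
    exact mul_le_mul_of_nonneg_left (weightNorm_mono (le_max_right _ _) (Nat.zero_le _) φ) hC'
  have e1 : s ^ ε ≤ s ^ min ε (γ / 4) :=
    Real.rpow_le_rpow_of_exponent_ge hs hs1 (min_le_left _ _)
  have e2 : s ^ (γ / 4) ≤ s ^ min ε (γ / 4) :=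
    Real.rpow_le_rpow_of_exponent_ge hs hs1 (min_le_right _ _)
  refine (abs_sub_le _ (fnDistr (M.germ f s) (sconv (gauss s 0) φ)) _).trans ?_
  rw [abs_sub_comm]
  calc _ ≤ C * K₁ * N * s ^ ε * W + K₂ * N * s ^ (γ / 4) * (C' * W) := add_le_add h1' h2'
    _ ≤ C * K₁ * N * s ^ min ε (γ / 4) * W + K₂ * N * s ^ min ε (γ / 4) * (C' * W) := by gcongr
    _ = _ := by ring

/-- The reconstruction theorem. -/
theorem exists_reconstruction (hβ : ∀ τ, -2 < 𝒯.deg τ) {γ : ℝ} (hγ : 0 < γ) :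
    ∃ K : ℝ, 0 ≤ K ∧ ∀ (f : Spacetime d → T) (N : ℝ), 0 ≤ N → M.ModelledBound γ f N →
      ∃ Λ : Distr d, M.RecBound γ f Λ (K * N) := by
  obtain ⟨η, k, n, K₁, hη, hK₁, hstep⟩ := M.exists_germ_step_le hβ hγ
  obtain ⟨K, hK, hsemi⟩ := M.exists_germ_semigroup hβ hγ
  refine ⟨K, hK, fun f N hN hf => ?_⟩
  set s : ℕ → ℝ := fun j => (1 / 2) ^ j with hs
  have hs0 : ∀ j, 0 < s j := fun j => by simp only [hs]; positivity
  have hs1 : ∀ j, s j ≤ 1 := fun j => pow_le_one₀ (by norm_num) (by norm_num)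
  have hslim : Filter.Tendsto s Filter.atTop (nhds 0) :=
    tendsto_pow_atTop_nhds_zero_of_lt_one (by norm_num) (by norm_num)
  obtain ⟨Λ, hΛ⟩ := exists_distr_limit (fun j => fnDistr (M.germ f (s j)))
    (q := (1 / 2 : ℝ) ^ η) (C := K₁ * N) (Real.rpow_lt_one (by norm_num) (by norm_num) hη)
    (by positivity) k n (fun j φ => by
      have h2 : 2 * s (j + 1) = s j := by simp only [hs, pow_succ]; ring
      have h := hstep f N hN hf (s (j + 1)) (hs0 _) (by rw [h2]; exact hs1 j) φ
      rw [h2] at h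
      refine h.trans ?_
      have hW : 0 ≤ weightNorm k n φ := weightNorm_nonneg _ _ _
      have : s (j + 1) ^ η ≤ ((1 / 2 : ℝ) ^ η) ^ j := by
        rw [← Real.rpow_mul_natCast (by norm_num), mul_comm η, Real.rpow_mul (by norm_num),
          Real.rpow_natCast]
        refine Real.rpow_le_rpow (hs0 _).le ?_ hη.le
        exact pow_le_pow_of_le_one (by norm_num) (by norm_num) (Nat.le_succ j)
      gcongr)
  -- The time of the germ goes to zero in the semigroup estimate with `t` fixed. That estimate
  -- requires `s j + t ≤ 1`, hence `t < 1`; the endpoint `t = 1` follows afterwards by continuity in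
  -- time.
  have main : ∀ x t, 0 < t → t < 1 →
      |(Λ - M.PiAt x (f x)) (reflectAt x (gauss t 0))| ≤ K * N * t ^ (γ / 4) := by
    intro x t ht ht1
    have h1 : Filter.Tendsto (fun j => s j + t) Filter.atTop (nhds t) := by
      simpa using hslim.add_const t
    have hev : ∀ᶠ j in Filter.atTop, s j + t ≤ 1 :=
      (h1.eventually (gt_mem_nhds ht1)).mono fun j hj => le_of_lt hj
    have h2 : Filter.Tendsto (fun j => s j + t) Filter.atTop (nhdsWithin t (Set.Ioc 0 1)) :=
      tendsto_nhdsWithin_iff.2 ⟨h1, hev.mono fun j hj => ⟨by linarith [hs0 j], hj⟩⟩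
    have h3 : Filter.Tendsto (fun j => M.germ f (s j + t) x) Filter.atTop
        (nhds (M.PiAt x (f x) (reflectAt x (gauss t 0)))) :=
      (continuousOn_distr_heat (M.PiAt x (f x)) x t ⟨ht, ht1.le⟩).tendsto.comp h2
    have h4 : Filter.Tendsto (fun j => K * N * (s j + t) ^ (γ / 4)) Filter.atTop
        (nhds (K * N * t ^ (γ / 4))) :=
      (h1.rpow_const (Or.inl ht.ne')).const_mul _
    refine le_of_tendsto_of_tendsto ((hΛ (reflectAt x (gauss t 0))).sub h3).abs h4
      (hev.mono fun j hj => ?_)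
    exact hsemi f N hN hf x (s j) t (hs0 j) ht hj
  refine ⟨Λ, fun x c hc hc1 => ?_⟩
  have hcl : closure (Set.Ioo (0 : ℝ) 1) = Set.Icc 0 1 := closure_Ioo (by norm_num)
  rcases hc1.lt_or_eq with hlt | rfl
  · have h := main x (c ^ 4) (by positivity) (pow_lt_one₀ hc.le hlt (by norm_num))
    rwa [rpow_fourth hc] at h
  · rw [one_pow, Real.one_rpow]
    have hne : (nhdsWithin (1 : ℝ) (Set.Ioo 0 1)).NeBot :=
      mem_closure_iff_nhdsWithin_neBot.1 (by rw [hcl]; simp)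
    have h1 : Filter.Tendsto
        (fun t => (Λ - M.PiAt x (f x)) (reflectAt x (gauss t 0))) (nhdsWithin 1 (Set.Ioo 0 1))
        (nhds ((Λ - M.PiAt x (f x)) (reflectAt x (gauss 1 0)))) :=
      ((continuousOn_distr_heat (Λ - M.PiAt x (f x)) x 1 ⟨one_pos, le_rfl⟩).tendsto).mono_left
        (nhdsWithin_mono _ Set.Ioo_subset_Ioc_self)
    have h2 : Filter.Tendsto (fun t : ℝ => K * N * t ^ (γ / 4)) (nhdsWithin 1 (Set.Ioo 0 1))
        (nhds (K * N * 1)) := by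
      have : Filter.Tendsto (fun t : ℝ => t ^ (γ / 4)) (nhds 1) (nhds (1 ^ (γ / 4))) :=
        Filter.Tendsto.rpow_const Filter.tendsto_id (Or.inl one_ne_zero)
      rw [Real.one_rpow] at this
      exact (this.mono_left nhdsWithin_le_nhds).const_mul _
    exact le_of_tendsto_of_tendsto h1.abs h2
      (eventually_nhdsWithin_of_forall fun t ht => main x t ht.1 ht.2)

end Model

end Reconstruction

/-! ### The lift of `K` on the regularity structure -/

section Lift

variable {d : ℕ} {ι κ T Tp : Type*} [AddCommGroup T] [Module ℝ T] [CommRing Tp] [Bialgebra ℝ Tp]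
  {𝒯 : RegularityStructure ι κ T Tp}

theorem RegularityStructure.repr_hat_eq_zero (φ : Tp →ₗ[ℝ] ℝ) {τ σ : ι}
    (h : 𝒯.deg τ < 𝒯.deg σ) : 𝒯.basis.repr (𝒯.hat φ (𝒯.basis τ)) σ = 0 :=
  𝒯.repr_eq_zero_of_mem_below (𝒯.hat_basis_mem_below φ h) le_rfl

theorem PolynomialPart.map_mem_polyBelow (P : PolynomialPart d 𝒯) (L : T →ₗ[ℝ] T)
    (hL : ∀ σ, L (𝒯.basis σ) ∈ P.polyBelow (𝒯.deg σ + 2)) {v : T} {β : ℝ}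
    (hv : ∀ σ, β < 𝒯.deg σ → 𝒯.basis.repr v σ = 0) : L v ∈ P.polyBelow (β + 2) := by
  rw [← 𝒯.basis.linearCombination_repr v, Finsupp.linearCombination_apply, Finsupp.sum, map_sum]
  refine Submodule.sum_mem _ fun σ hσ => ?_
  rw [map_smul]
  refine Submodule.smul_mem _ _ (P.polyBelow_mono ?_ (hL σ))
  by_contra hh
  exact Finsupp.mem_support_iff.1 hσ (hv σ (by linarith))

namespace Model

variable (M : Model d 𝒯) {P : PolynomialPart d 𝒯}

theorem J_basis (x : Spacetime d) (τ : ι) : M.J P x (𝒯.basis τ) =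
    P.poly (𝒯.deg τ + 2) fun n => dKAt n (M.PiAt x (𝒯.basis τ)) x := by
  rw [J, Module.Basis.constr_basis, PolynomialPart.poly]

theorem J_basis_mem (x : Spacetime d) (τ : ι) :
    M.J P x (𝒯.basis τ) ∈ P.polyBelow (𝒯.deg τ + 2) := by
  rw [J_basis]
  exact P.poly_mem _ _

theorem KDistr_Pi_X (hβ : ∀ τ, -2 < 𝒯.deg τ) (hcan : M.IsCanonical P) (k : MIdx d)
    (φ : 𝓢(Spacetime d, ℝ)) : KDistr (M.Pi (𝒯.basis (P.X k))) φ = ∑ l ∈ Finset.Iic k,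
      (mchoose k l : ℝ) * (dKAt 0 (M.Pi (𝒯.basis (P.X (k - l)))) 0 * M.Pi (𝒯.basis (P.X l)) φ) := by
  have hconv : ∀ l, IntervalIntegrable (fun r => M.Pi (𝒯.basis (P.X l)) (qKer 0 r 0)) volume 0 1 := by
    intro l
    have := M.dKAtConverges_PiAt hβ 0 (P.X l) 0 (by
      simpa [sdeg_zero] using (by linarith [hβ (P.X l)] : (0 : ℝ) < 𝒯.deg (P.X l) + 2))
    rwa [M.Pi_X_eq hcan] at this
  simp only [KDistr, M.KrDistr_Pi_X hcan]
  rw [intervalIntegral.integral_finsetSum fun l _ => ((hconv (k - l)).mul_const _).const_mul _,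
    Finset.mul_sum, ← Finset.sum_sub_distrib]
  refine Finset.sum_congr rfl fun l _ => ?_
  rw [intervalIntegral.integral_const_mul, intervalIntegral.integral_mul_const, dKAt]
  ring

/-- Unites two cases: off the monomials admissibility is an exact identity, and on a monomial `I`
vanishes while `K` produces a polynomial of no larger degree. Either way `K Π` and `Π I` differ by a
polynomial of degree below `|τ| + 2`. -/
theorem exists_Kop_Pi (hβ : ∀ τ, -2 < 𝒯.deg τ) {S : PolynomialProduct P}
    (A : IntegrationOperators P) (hcan : M.IsCanonical P) (hadm : M.IsAdmissible S A) (τ : ι) :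
    ∃ p ∈ P.polyBelow (𝒯.deg τ + 2),
      KopLM (M.Pi (𝒯.basis τ)) = M.Pi (A.I 0 (𝒯.basis τ)) + M.Pi p := by
  by_cases hτ : τ ∈ Set.range P.X
  · obtain ⟨k, rfl⟩ := hτ
    refine ⟨∑ l ∈ Finset.Iic k, ((mchoose k l : ℝ) * dKAt 0 (M.Pi (𝒯.basis (P.X (k - l)))) 0) •
      𝒯.basis (P.X l), Submodule.sum_mem _ fun l hl => Submodule.smul_mem _ _
        (Submodule.subset_span ⟨l, ?_, rfl⟩), ?_⟩
    · have h : (sdeg l : ℝ) ≤ sdeg k := by exact_mod_cast sdeg_mono (Finset.mem_Iic.1 hl)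
      simp only [Set.mem_ofPred_eq, P.deg_X]
      linarith
    · ext φ
      rw [KopLM_apply, M.KDistr_Pi_X hβ hcan, A.I_X 0 (by simp [sdeg_zero]), map_zero, zero_add,
        map_sum, sum_apply]
      simp only [map_smul, smul_apply, smul_eq_mul, mul_assoc]
  · refine ⟨0, zero_mem _, ?_⟩
    ext φ
    rw [KopLM_apply, map_zero, add_zero, hadm.1 τ hτ]

/-- A distribution of order `a` at `x` has vanishing mollified derivatives at `x` of every degree
below `a`. So `I τ` does not contribute when the coefficients of a polynomial correction are read
off. -/
theorem tendsto_PiAt_hom (hβ : ∀ τ, -2 < 𝒯.deg τ) (x : Spacetime d) {a : ℝ} {v : T}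
    (hv : v ∈ 𝒯.hom a) {n : MIdx d} (hn : (sdeg n : ℝ) < a) :
    Filter.Tendsto (fun c : ℝ => M.PiAt x v (reflectAt x (mderiv n (gauss (c ^ 4) 0))))
      (nhdsWithin 0 (Set.Ioi 0)) (nhds 0) := by
  induction hv using Submodule.span_induction with
  | mem v hv =>
    obtain ⟨σ, hσ, rfl⟩ := hv
    have hσ' : 𝒯.deg σ = a := hσ
    obtain ⟨C, hC⟩ := M.exists_hasOrder_PiAt hβ σ
    obtain ⟨K, hK, h⟩ := HasOrder.exists_gauss_le (d := d) (𝒯.deg σ) n (growth (𝒯.deg σ))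
    have hlim : Filter.Tendsto (fun c : ℝ => K * C * c ^ (a - sdeg n)) (nhdsWithin 0 (Set.Ioi 0))
        (nhds 0) := by
      have h1 : Filter.Tendsto (fun c : ℝ => c ^ (a - sdeg n)) (nhds 0) (nhds (0 ^ (a - sdeg n))) :=
        Filter.Tendsto.rpow_const Filter.tendsto_id (Or.inr (by linarith))
      rw [Real.zero_rpow (by linarith)] at h1
      simpa using (h1.mono_left nhdsWithin_le_nhds).const_mul (K * C)
    refine squeeze_zero_norm' ?_ hlim
    filter_upwards [Ioo_mem_nhdsGT (zero_lt_one' ℝ)] with c hc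
    have h2 := h _ x C (hC x) x c 0 hc.1 (by linarith [pow_le_one₀ (n := 4) hc.1.le hc.2.le]) le_rfl
      (by positivity)
    simpa [pdist_self, hσ'] using h2
  | zero => simp
  | add u v _ _ hu hv => simpa using hu.add hv
  | smul a v _ hv => simpa using hv.const_mul a

/-- `Π_x (I + J(x)) = K Π_x`. -/
theorem PiAt_I_add_J (hβ : ∀ τ, -2 < 𝒯.deg τ) {S : PolynomialProduct P}
    (A : IntegrationOperators P) (hcan : M.IsCanonical P) (hadm : M.IsAdmissible S A)
    (x : Spacetime d) (v : T) : M.PiAt x ((A.I 0 + M.J P x) v) = KopLM (M.PiAt x v) := by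
  suffices h : M.PiAt x ∘ₗ (A.I 0 + M.J P x) = KopLM ∘ₗ M.PiAt x from LinearMap.congr_fun h v
  refine 𝒯.basis.ext fun τ => ?_
  choose p hp hKp using M.exists_Kop_Pi hβ A hcan hadm
  set L := 𝒯.basis.constr ℝ p with hL
  have hLb : ∀ σ, L (𝒯.basis σ) = p σ := fun σ => by rw [hL, Module.Basis.constr_basis]
  have hKL : ∀ w, KopLM (M.Pi w) = M.Pi (A.I 0 w) + M.Pi (L w) := by
    intro w
    suffices h : KopLM ∘ₗ M.Pi = M.Pi ∘ₗ A.I 0 + M.Pi ∘ₗ L from LinearMap.congr_fun h w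
    exact 𝒯.basis.ext fun σ => by simp [hKp, hLb]
  set φ := (charInv (M.g x)).ofConv with hφ
  -- `u` is built so that `Π_x u = K Π_x τ - Π_x I τ`: it gathers the polynomial defects of
  -- admissibility and of the coaction on `I`, transported back by `g_x`.
  set u := 𝒯.hat (M.g x).toLinearMap (L (𝒯.hat φ (𝒯.basis τ)) -
    (𝒯.hat φ (A.I 0 (𝒯.basis τ)) - A.I 0 (𝒯.hat φ (𝒯.basis τ)))) with hu
  have hu1 : u ∈ P.polyBelow (𝒯.deg τ + 2) := by
    refine P.hat_mem_polyBelow _ (sub_mem ?_ (A.hat_I_sub_mem φ τ))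
    exact P.map_mem_polyBelow L (fun σ => by rw [hLb]; exact hp σ)
      fun σ hσ => 𝒯.repr_hat_eq_zero φ hσ
  have hu2 : M.PiAt x u = KopLM (M.PiAt x (𝒯.basis τ)) - M.PiAt x (A.I 0 (𝒯.basis τ)) := by
    rw [hu, ← M.Pi_eq, M.PiAt_eq, M.PiAt_eq, hKL, map_sub, map_sub]
    abel
  obtain ⟨w, hw⟩ := P.eq_poly_of_mem hu1
  obtain ⟨C, hC⟩ := M.exists_hasOrder_PiAt hβ τ
  -- Testing against `∂ⁿ p_t(x, ·)` as `t → 0` gives `w n` on the polynomial side, `dKAt` on the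
  -- side of `K`, and zero from `I τ`. So `u` is the polynomial that defines `J`.
  have hw' : ∀ n, (sdeg n : ℝ) < 𝒯.deg τ + 2 → w n = dKAt n (M.PiAt x (𝒯.basis τ)) x := by
    intro n hn
    have h1 := M.tendsto_PiAt_poly hcan x _ w n hn
    rw [← hw, hu2] at h1
    have hI := A.I_graded 0 (by simp [sdeg_zero]) τ
    simp only [sdeg_zero, Nat.cast_zero, sub_zero] at hI
    have h2 := ((hC x).tendsto_Kop hn).sub (M.tendsto_PiAt_hom hβ x hI hn)
    rw [sub_zero] at h2
    exact tendsto_nhds_unique h1 h2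
  have hJ : M.J P x (𝒯.basis τ) = u := by
    rw [J_basis, hw]
    exact Finset.sum_congr rfl fun n hn => by rw [hw' n (mem_belowDeg.1 hn)]
  rw [LinearMap.comp_apply, LinearMap.comp_apply, LinearMap.add_apply, map_add, hJ, hu2]
  abel

/-- The lift intertwines the transition maps. -/
theorem trans_I_add_J (hβ : ∀ τ, -2 < 𝒯.deg τ) {S : PolynomialProduct P}
    (A : IntegrationOperators P) (hcan : M.IsCanonical P) (hadm : M.IsAdmissible S A)
    (y x : Spacetime d) (v : T) :
    M.trans y x ((A.I 0 + M.J P x) v) = (A.I 0 + M.J P y) (M.trans y x v) := by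
  suffices h : M.trans y x ∘ₗ (A.I 0 + M.J P x) = (A.I 0 + M.J P y) ∘ₗ M.trans y x from
    LinearMap.congr_fun h v
  refine 𝒯.basis.ext fun τ => ?_
  rw [← sub_eq_zero, LinearMap.comp_apply, LinearMap.comp_apply]
  -- The difference of the two sides is a polynomial, and `Π_y` maps both sides to `K Π_x τ`, so it
  -- vanishes.
  refine M.eq_zero_of_tendsto hcan y (a := 𝒯.deg τ + 2) ?_ fun n _ => ?_
  · have e : M.trans y x ((A.I 0 + M.J P x) (𝒯.basis τ)) -
        (A.I 0 + M.J P y) (M.trans y x (𝒯.basis τ)) =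
        (M.trans y x (A.I 0 (𝒯.basis τ)) - A.I 0 (M.trans y x (𝒯.basis τ))) +
          M.trans y x (M.J P x (𝒯.basis τ)) - M.J P y (M.trans y x (𝒯.basis τ)) := by
      simp only [LinearMap.add_apply, map_add]
      abel
    rw [e]
    refine sub_mem (add_mem (A.hat_I_sub_mem _ τ) (P.hat_mem_polyBelow _ (M.J_basis_mem x τ))) ?_
    exact P.map_mem_polyBelow _ (M.J_basis_mem y) fun σ hσ => 𝒯.repr_hat_eq_zero _ hσ
  · have e : M.PiAt y (M.trans y x ((A.I 0 + M.J P x) (𝒯.basis τ)) -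
        (A.I 0 + M.J P y) (M.trans y x (𝒯.basis τ))) = 0 := by
      rw [map_sub, M.PiAt_trans, M.PiAt_I_add_J hβ A hcan hadm, M.PiAt_I_add_J hβ A hcan hadm,
        M.PiAt_trans, sub_self]
    simp only [e, zero_apply, tendsto_const_nhds_iff]

end Model

end Lift

/-! ### Bounds of the lift of `K` -/

section LiftBounds

/-- The average `∫₀¹ E r dr - (e - 1) E 1`. -/
def kAvg (E : ℝ → ℝ) : ℝ := (∫ r in (0 : ℝ)..1, E r) - (Real.exp 1 - 1) * E 1

theorem kAvg_add {E F : ℝ → ℝ} (hE : IntervalIntegrable E volume 0 1)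
    (hF : IntervalIntegrable F volume 0 1) : kAvg (fun r => E r + F r) = kAvg E + kAvg F := by
  unfold kAvg
  rw [intervalIntegral.integral_add hE hF]
  ring

theorem kAvg_sub {E F : ℝ → ℝ} (hE : IntervalIntegrable E volume 0 1)
    (hF : IntervalIntegrable F volume 0 1) : kAvg (fun r => E r - F r) = kAvg E - kAvg F := by
  unfold kAvg
  rw [intervalIntegral.integral_sub hE hF]
  ring

theorem kAvg_const_mul (a : ℝ) (E : ℝ → ℝ) : kAvg (fun r => a * E r) = a * kAvg E := by
  unfold kAvg
  rw [intervalIntegral.integral_const_mul]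
  ring

theorem kAvg_sum {α : Type*} (s : Finset α) {E : α → ℝ → ℝ}
    (hE : ∀ i ∈ s, IntervalIntegrable (E i) volume 0 1) :
    kAvg (fun r => ∑ i ∈ s, E i r) = ∑ i ∈ s, kAvg (E i) := by
  unfold kAvg
  rw [intervalIntegral.integral_finsetSum hE, Finset.mul_sum, ← Finset.sum_sub_distrib]

/-- One exponent `ε` has to serve for all terms of a finite sum in `abs_integral_sub_le`;
nonpositive entries are ignored. -/
theorem exists_pos_forall_le {α : Type*} (s : Finset α) (e : α → ℝ) :
    ∃ ε : ℝ, 0 < ε ∧ ∀ i ∈ s, 0 < e i → ε ≤ e i := by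
  classical
  induction s using Finset.induction_on with
  | empty => exact ⟨1, one_pos, by simp⟩
  | insert a s _ ih =>
    obtain ⟨ε, hε, h⟩ := ih
    by_cases ha : 0 < e a
    · refine ⟨min ε (e a), lt_min hε ha, fun i hi h0 => ?_⟩
      rcases Finset.mem_insert.1 hi with rfl | hi
      · exact min_le_right _ _
      · exact (min_le_left _ _).trans (h i hi h0)
    · refine ⟨ε, hε, fun i hi h0 => ?_⟩
      rcases Finset.mem_insert.1 hi with rfl | hi
      · exact absurd h0 ha
      · exact h i hi h0

/-- Normal form for power counting: the total degree in `D` is separated from a power of the ratio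
`c / D`, and the sign of `q + 4` decides whether the term is summable below or above the scale `D`.
-/
theorem rpow_mul_rpow_eq {c D : ℝ} (hc : 0 < c) (hD : 0 < D) (p q : ℝ) :
    D ^ p * c ^ q = D ^ (p + q + 4) * (c ^ (-4 : ℝ) * (c / D) ^ (q + 4)) := by
  rw [Real.div_rpow hc.le hD.le, show p + q + 4 = p + (q + 4) by ring, Real.rpow_add hD]
  have h1 : D ^ (q + 4) ≠ 0 := (Real.rpow_pos_of_pos hD _).ne'
  have h2 : c ^ q = c ^ (-4 : ℝ) * c ^ (q + 4) := by
    rw [← Real.rpow_add hc]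
    congr 1
    ring
  rw [h2]
  field_simp

theorem rpow_mul_rpow_le_of_lt {c D : ℝ} (hc : 0 < c) (hcD : c < D) {p q s ε : ℝ}
    (hs : p + q + 4 = s) (hε : ε ≤ q + 4) :
    D ^ p * c ^ q ≤ D ^ s * (c ^ (-4 : ℝ) * (c / D) ^ ε) := by
  have hD : 0 < D := hc.trans hcD
  rw [rpow_mul_rpow_eq hc hD, hs]
  have : (c / D) ^ (q + 4) ≤ (c / D) ^ ε :=
    Real.rpow_le_rpow_of_exponent_ge (by positivity) ((div_le_one hD).2 hcD.le) hε
  gcongr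

theorem rpow_mul_rpow_le_of_ge {c D : ℝ} (hc : 0 < c) (hD : 0 < D) (hcD : D ≤ c) {p q s ε : ℝ}
    (hs : p + q + 4 = s) (hε : ε ≤ -(q + 4)) :
    D ^ p * c ^ q ≤ D ^ s * (c ^ (-4 : ℝ) * (c / D) ^ (-ε)) := by
  rw [rpow_mul_rpow_eq hc hD, hs]
  have : (c / D) ^ (q + 4) ≤ (c / D) ^ (-ε) :=
    Real.rpow_le_rpow_of_exponent_le ((one_le_div hD).2 hcD) (by linarith)
  gcongr

variable {d : ℕ} {ι κ T Tp : Type*} [AddCommGroup T] [Module ℝ T] [CommRing Tp] [Bialgebra ℝ Tp]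
  {𝒯 : RegularityStructure ι κ T Tp}

/-- The summation lemma with `D = 1`: all scales are small and the second regime is the single point
`c = 1`. -/
theorem HasOrder.exists_dKAt_le {γ : ℝ} {n : MIdx d} (hn : (sdeg n : ℝ) < γ + 2) (m : ℕ) :
    ∃ K : ℝ, 0 ≤ K ∧ ∀ (ζ : Distr d) (x : Spacetime d) (C : ℝ), HasOrder ζ x γ C m →
      |dKAt n ζ x| ≤ K * C := by
  obtain ⟨K, hK, h⟩ := HasOrder.exists_qKer_le (d := d) γ n m
  have hε : 0 < γ + 2 - sdeg n := by linarith
  refine ⟨(8 / (γ + 2 - sdeg n) + 2) * K, by positivity, fun ζ x C hζ => ?_⟩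
  have hC := hζ.nonneg
  have hb : ∀ c, 0 < c → c ≤ 1 → |ζ (qKer n (c ^ 4) x)| ≤ K * C * c ^ (γ - sdeg n - 2) :=
    fun c hc hc1 => by simpa using h ζ x C hζ x c hc hc1
  rw [mul_assoc]
  refine abs_integral_sub_le hε one_pos (by positivity) (fun c hc hc1 _ => ?_) fun c hc hc1 hc2 => ?_
  · refine (hb c hc hc1).trans (mul_le_mul_of_nonneg_left ?_ (by positivity))
    rw [div_one, ← Real.rpow_add hc]
    exact le_of_eq (by ring_nf)
  · obtain rfl : c = 1 := le_antisymm hc1 hc2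
    simpa using hb 1 one_pos le_rfl

/-- Here it enters that `γ` is not an integer: the Taylor remainder vanishes to an order strictly
larger than needed, so it is summable over the scales above `D`. -/
theorem lt_natCeil_of_ne_int {γ : ℝ} (hint : ∀ k : ℤ, γ ≠ k) (n : MIdx d) :
    γ + 2 - sdeg n < (⌈γ + 2 - sdeg n⌉₊ : ℝ) := by
  refine lt_of_le_of_ne (Nat.le_ceil _) fun h => hint (⌈γ + 2 - (sdeg n : ℝ)⌉₊ + sdeg n - 2) ?_
  push_cast
  rw [← h]
  ring

namespace Model

variable (M : Model d 𝒯) {P : PolynomialPart d 𝒯}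

theorem PiAt_X_qKer (hcan : M.IsCanonical P) (y : Spacetime d) (r : ℝ) {k n : MIdx d}
    (h : sdeg k < sdeg n) : M.PiAt y (𝒯.basis (P.X k)) (qKer n r y) = 0 := by
  rw [qKer, M.PiAt_X_reflectAt hcan, moment_mderiv]
  obtain ⟨i, hi⟩ : ∃ i, ¬ n i ≤ k i := by
    by_contra hh
    push Not at hh
    exact absurd (sdeg_mono (show n ≤ k from hh)) (by omega)
  rw [Finset.prod_eq_zero (Finset.mem_univ i) (Nat.descFactorial_of_lt (not_le.1 hi))]
  simp

theorem exists_PiAt_qKer_le (hβ : ∀ τ, -2 < 𝒯.deg τ) (n : MIdx d) (σ : ι) : ∃ Q : ℝ, 0 ≤ Q ∧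
    ∀ y c, 0 < c → c ≤ 1 →
      |M.PiAt y (𝒯.basis σ) (qKer n (c ^ 4) y)| ≤ Q * c ^ (𝒯.deg σ - sdeg n - 2) := by
  obtain ⟨C, hC⟩ := M.exists_hasOrder_PiAt hβ σ
  obtain ⟨K, hK, h⟩ := HasOrder.exists_qKer_le (d := d) (𝒯.deg σ) n (growth (𝒯.deg σ))
  have := (hC 0).nonneg
  exact ⟨K * C, by positivity, fun y c hc hc1 => by simpa using h _ y C (hC y) y c hc hc1⟩

/-- The integrand of the coefficient of `Xⁿ / n!` in `𝒦 f (y) - Γ_{yx} 𝒦 f (x)`, apart from the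
contribution of `I`. -/
def liftIntegrand (γ : ℝ) (f : Spacetime d → T) (Λ : Distr d) (n : MIdx d) (y x : Spacetime d)
    (r : ℝ) : ℝ :=
  (∑ σ ∈ (𝒯.low γ).filter (fun σ => (sdeg n : ℝ) < 𝒯.deg σ + 2),
    𝒯.basis.repr (f y - M.trans y x (f x)) σ * M.PiAt y (𝒯.basis σ) (qKer n r y)) +
  (Λ - M.PiAt y (f y)) (qKer n r y) -
  jet (γ + 2 - sdeg n) (fun k => (Λ - M.PiAt x (f x)) (qKer (n + k) r x)) (y - x)

theorem sub_PiAt_apply {γ : ℝ} {f : Spacetime d → T} {N : ℝ} (hf : M.ModelledBound γ f N)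
    (Λ : Distr d) (y x : Spacetime d) (φ : 𝓢(Spacetime d, ℝ)) :
    (Λ - M.PiAt x (f x)) φ = (Λ - M.PiAt y (f y)) φ + ∑ σ ∈ 𝒯.low γ,
      𝒯.basis.repr (f y - M.trans y x (f x)) σ * M.PiAt y (𝒯.basis σ) φ := by
  have h : M.PiAt y (f y - M.trans y x (f x)) φ = ∑ σ ∈ 𝒯.low γ,
      𝒯.basis.repr (f y - M.trans y x (f x)) σ * M.PiAt y (𝒯.basis σ) φ := by
    conv_lhs => rw [𝒯.eq_sum_of_mem_below (sub_mem (hf.mem y) (M.trans_mem_below y x (hf.mem x))),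
      map_sum, sum_apply]
    simp only [map_smul, smul_apply, smul_eq_mul]
  rw [← h, map_sub, M.PiAt_trans]
  simp

/-- Below `D` all three groups of terms carry a positive power of `c / D` and are bounded one by
one. Above `D` they are too large separately; changing the base point rewrites them as a Taylor
remainder at `x` minus the summands omitted from the filtered sum, each with a negative power or
zero. -/
theorem exists_liftIntegrand_le (hβ : ∀ τ, -2 < 𝒯.deg τ) (A : IntegrationOperators P)
    (hcan : M.IsCanonical P) {γ : ℝ} (hint : ∀ k : ℤ, γ ≠ k) {n : MIdx d}
    (hn : (sdeg n : ℝ) < γ + 2) (m : ℕ) : ∃ K : ℝ, 0 ≤ K ∧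
      ∀ (f : Spacetime d → T) (N : ℝ) (Λ : Distr d), M.ModelledBound γ f N →
        (∀ x, HasOrder (Λ - M.PiAt x (f x)) x γ N m) → ∀ x y, y ≠ x →
          |kAvg (M.liftIntegrand γ f Λ n y x)| ≤ K * N * pdist y x ^ (γ + 2 - sdeg n) := by
  choose Q hQ0 hQ using M.exists_PiAt_qKer_le hβ n
  choose K₂ hK₂ h₂ using fun k : MIdx d => HasOrder.exists_qKer_le (d := d) γ (n + k) m
  obtain ⟨K₃, M₃, hK₃, h₃⟩ := HasOrder.exists_taylor_le (d := d) γ (γ + 2 - sdeg n) n m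
  have ha : 0 < γ + 2 - sdeg n := by linarith
  have hceil := lt_natCeil_of_ne_int hint n
  obtain ⟨ε₁, hε₁, hε₁'⟩ := exists_pos_forall_le (𝒯.low γ) fun σ => |𝒯.deg σ + 2 - sdeg n|
  obtain ⟨ε₂, hε₂, hε₂'⟩ := exists_pos_forall_le (belowDeg d (γ + 2 - sdeg n))
    fun k => γ + 2 - sdeg n - sdeg k
  set a := γ + 2 - (sdeg n : ℝ) with ha'
  -- The distances from the critical exponent: `ε₁` for the model terms, `ε₂` for the jet, `a` for
  -- the error at `y`, and `⌈a⌉₊ - a` for the Taylor remainder.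
  set ε := min (min ε₁ ε₂) (min a (⌈a⌉₊ - a)) with hε
  have hε0 : 0 < ε := lt_min (lt_min hε₁ hε₂) (lt_min ha (by linarith))
  have e1 : ε ≤ ε₁ := (min_le_left _ _).trans (min_le_left _ _)
  have e2 : ε ≤ ε₂ := (min_le_left _ _).trans (min_le_right _ _)
  have e3 : ε ≤ a := (min_le_right _ _).trans (min_le_left _ _)
  have e4 : ε ≤ ⌈a⌉₊ - a := (min_le_right _ _).trans (min_le_right _ _)
  set S := (∑ σ ∈ 𝒯.low γ, Q σ) + K₂ 0 + (∑ k ∈ belowDeg d a, K₂ k) + K₃ * 2 ^ M₃ with hS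
  have hSQ : 0 ≤ ∑ σ ∈ 𝒯.low γ, Q σ := Finset.sum_nonneg fun σ _ => hQ0 σ
  have hSK : 0 ≤ ∑ k ∈ belowDeg d a, K₂ k := Finset.sum_nonneg fun k _ => hK₂ k
  have hK₂0 := hK₂ 0
  have hS0 : 0 ≤ S := by positivity
  refine ⟨(8 / ε + 2) * S, by positivity, fun f N Λ hf hζ x y hxy => ?_⟩
  have hN := (hζ x).nonneg
  have hD := pdist_pos hxy
  set D := pdist y x with hD'
  rw [mul_assoc, mul_assoc]
  have hΔ : ∀ σ ∈ 𝒯.low γ, |𝒯.basis.repr (f y - M.trans y x (f x)) σ| ≤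
      N * D ^ (γ - 𝒯.deg σ) := fun σ hσ => hf.holder x y σ (𝒯.mem_low.1 hσ)
  have hterm : ∀ σ ∈ 𝒯.low γ, ∀ c, 0 < c → c ≤ 1 →
      |𝒯.basis.repr (f y - M.trans y x (f x)) σ * M.PiAt y (𝒯.basis σ) (qKer n (c ^ 4) y)| ≤
        Q σ * N * (D ^ (γ - 𝒯.deg σ) * c ^ (𝒯.deg σ - sdeg n - 2)) := by
    intro σ hσ c hc hc1
    rw [abs_mul]
    calc _ ≤ (N * D ^ (γ - 𝒯.deg σ)) * (Q σ * c ^ (𝒯.deg σ - sdeg n - 2)) :=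
          mul_le_mul (hΔ σ hσ) (hQ σ y c hc hc1) (abs_nonneg _) (by positivity)
      _ = _ := by ring
  refine abs_integral_sub_le hε0 hD (by positivity) (fun c hc hc1 hcD => ?_)
    fun c hc hc1 hcD => ?_
  · set Y := D ^ a * (c ^ (-4 : ℝ) * (c / D) ^ ε) with hY
    have hY0 : 0 ≤ Y := by positivity
    have b1 : |∑ σ ∈ (𝒯.low γ).filter (fun σ => (sdeg n : ℝ) < 𝒯.deg σ + 2),
        𝒯.basis.repr (f y - M.trans y x (f x)) σ * M.PiAt y (𝒯.basis σ) (qKer n (c ^ 4) y)| ≤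
        (∑ σ ∈ 𝒯.low γ, Q σ) * N * Y := by
      rw [Finset.sum_mul, Finset.sum_mul]
      refine (Finset.abs_sum_le_sum_abs _ _).trans ((Finset.sum_le_sum fun σ hσ => ?_).trans
        (Finset.sum_le_sum_of_subset_of_nonneg (Finset.filter_subset _ _) fun σ _ _ =>
          mul_nonneg (mul_nonneg (hQ0 σ) hN) hY0))
      obtain ⟨hσ1, hσ2⟩ := Finset.mem_filter.1 hσ
      have hp : 0 < 𝒯.deg σ + 2 - sdeg n := by linarith
      have h4 := hε₁' σ hσ1 (abs_pos.2 hp.ne')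
      rw [abs_of_pos hp] at h4
      refine (hterm σ hσ1 c hc hc1).trans (mul_le_mul_of_nonneg_left
        (rpow_mul_rpow_le_of_lt hc hcD (by ring) (by linarith)) (mul_nonneg (hQ0 σ) hN))
    have b2 : |(Λ - M.PiAt y (f y)) (qKer n (c ^ 4) y)| ≤ K₂ 0 * N * Y := by
      have h4 := h₂ 0 _ y N (hζ y) y c hc hc1
      simp only [add_zero, pdist_self, zero_div, one_pow, mul_one] at h4
      refine h4.trans (mul_le_mul_of_nonneg_left ?_ (by positivity))
      have h5 := rpow_mul_rpow_le_of_lt hc hcD (p := 0) (q := γ - sdeg n - 2) (s := a) (ε := ε)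
        (by ring) (by linarith)
      rwa [Real.rpow_zero, one_mul] at h5
    have b3 : |jet a (fun k => (Λ - M.PiAt x (f x)) (qKer (n + k) (c ^ 4) x)) (y - x)| ≤
        (∑ k ∈ belowDeg d a, K₂ k) * N * Y := by
      rw [jet, Finset.sum_mul, Finset.sum_mul]
      refine (Finset.abs_sum_le_sum_abs _ _).trans (Finset.sum_le_sum fun k hk => ?_)
      have hk' := mem_belowDeg.1 hk
      have h4 := h₂ k _ x N (hζ x) x c hc hc1
      simp only [pdist_self, zero_div, add_zero, one_pow, mul_one] at h4
      have h5 : |mpow (y - x) k| ≤ D ^ (sdeg k : ℝ) := by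
        rw [Real.rpow_natCast, hD', pdist_eq]
        exact abs_mpow_le _ _
      have h6 : |(mfact k : ℝ)⁻¹| ≤ 1 := by
        rw [abs_of_nonneg (by positivity)]
        exact inv_le_one_of_one_le₀ (by exact_mod_cast mfact_pos k)
      have hε' := hε₂' k hk (by linarith)
      rw [abs_mul, abs_mul]
      calc _ ≤ D ^ (sdeg k : ℝ) * (1 * (K₂ k * N * c ^ (γ - sdeg (n + k) - 2))) :=
            mul_le_mul h5 (mul_le_mul h6 h4 (abs_nonneg _) zero_le_one) (by positivity)
              (by positivity)
        _ = K₂ k * N * (D ^ (sdeg k : ℝ) * c ^ (γ - sdeg (n + k) - 2)) := by ring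
        _ ≤ _ := by
          refine mul_le_mul_of_nonneg_left (rpow_mul_rpow_le_of_lt hc hcD ?_ ?_)
            (mul_nonneg (hK₂ k) hN)
          · rw [sdeg_add]; push_cast; ring
          · rw [sdeg_add]; push_cast; linarith
    have b4 : 0 ≤ K₃ * 2 ^ M₃ * N * Y := by positivity
    calc |M.liftIntegrand γ f Λ n y x (c ^ 4)| ≤ _ := (abs_sub _ _).trans
          (add_le_add ((abs_add_le _ _).trans (add_le_add b1 b2)) b3)
      _ ≤ S * N * Y := by rw [hS]; linarith
      _ = _ := by rw [hY]; ring
  · set Y := D ^ a * (c ^ (-4 : ℝ) * (c / D) ^ (-ε)) with hY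
    have hY0 : 0 ≤ Y := by positivity
    -- Completing the filtered sum to all `σ` changes the base point of the error from `y` to `x`;
    -- the price is the complementary sum with `|σ| + 2 ≤ |n|`.
    have hE : M.liftIntegrand γ f Λ n y x (c ^ 4) =
        ((Λ - M.PiAt x (f x)) (qKer n (c ^ 4) y) -
          jet a (fun k => (Λ - M.PiAt x (f x)) (qKer (n + k) (c ^ 4) x)) (y - x)) -
        ∑ σ ∈ (𝒯.low γ).filter (fun σ => ¬ (sdeg n : ℝ) < 𝒯.deg σ + 2),
          𝒯.basis.repr (f y - M.trans y x (f x)) σ * M.PiAt y (𝒯.basis σ) (qKer n (c ^ 4) y) := by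
      rw [M.sub_PiAt_apply hf Λ y x (qKer n (c ^ 4) y), liftIntegrand,
        ← Finset.sum_filter_add_sum_filter_not (𝒯.low γ) (fun σ => (sdeg n : ℝ) < 𝒯.deg σ + 2)]
      ring
    have b1 : |(Λ - M.PiAt x (f x)) (qKer n (c ^ 4) y) -
          jet a (fun k => (Λ - M.PiAt x (f x)) (qKer (n + k) (c ^ 4) x)) (y - x)| ≤
        K₃ * 2 ^ M₃ * N * Y := by
      refine (h₃ _ x N (hζ x) y c hc hc1).trans ?_
      have hle : D / c ≤ 1 := (div_le_one hc).2 hcD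
      have h4 : (1 + D / c) ^ M₃ ≤ 2 ^ M₃ := by gcongr; linarith
      have h5 : D ^ (⌈a⌉₊ : ℝ) * c ^ (γ - sdeg n - 2 - ⌈a⌉₊) ≤ Y :=
        rpow_mul_rpow_le_of_ge hc hD hcD (by ring) (by linarith)
      have h6 : c ^ (γ - sdeg n - 2) * (D / c) ^ ⌈a⌉₊ =
          D ^ (⌈a⌉₊ : ℝ) * c ^ (γ - sdeg n - 2 - ⌈a⌉₊) := by
        rw [Real.rpow_sub hc _ (⌈a⌉₊ : ℝ), div_pow, Real.rpow_natCast, Real.rpow_natCast]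
        ring
      calc K₃ * N * (c ^ (γ - sdeg n - 2) * ((D / c) ^ ⌈a⌉₊ * (1 + D / c) ^ M₃))
          = K₃ * N * ((c ^ (γ - sdeg n - 2) * (D / c) ^ ⌈a⌉₊) * (1 + D / c) ^ M₃) := by ring
        _ ≤ K₃ * N * (Y * 2 ^ M₃) := by rw [h6]; gcongr
        _ = _ := by ring
    have b2 : |∑ σ ∈ (𝒯.low γ).filter (fun σ => ¬ (sdeg n : ℝ) < 𝒯.deg σ + 2),
        𝒯.basis.repr (f y - M.trans y x (f x)) σ * M.PiAt y (𝒯.basis σ) (qKer n (c ^ 4) y)| ≤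
        (∑ σ ∈ 𝒯.low γ, Q σ) * N * Y := by
      rw [Finset.sum_mul, Finset.sum_mul]
      refine (Finset.abs_sum_le_sum_abs _ _).trans ((Finset.sum_le_sum fun σ hσ => ?_).trans
        (Finset.sum_le_sum_of_subset_of_nonneg (Finset.filter_subset _ _) fun σ _ _ =>
          mul_nonneg (mul_nonneg (hQ0 σ) hN) hY0))
      obtain ⟨hσ1, hσ2⟩ := Finset.mem_filter.1 hσ
      -- In the complementary sum the critical exponent `|σ| + 2 = |n|` must be avoided. Monomials
      -- vanish exactly because `∂ⁿ` kills lower degrees, and the other homogeneities are not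
      -- integers.
      by_cases hX : σ ∈ Set.range P.X
      · obtain ⟨k, rfl⟩ := hX
        rw [P.deg_X] at hσ2
        have hkn : sdeg k < sdeg n := by
          have : (sdeg k : ℝ) < sdeg n := by linarith
          exact_mod_cast this
        rw [M.PiAt_X_qKer hcan y _ hkn, mul_zero, abs_zero]
        exact mul_nonneg (mul_nonneg (hQ0 _) hN) hY0
      · have hne := A.deg_ne_int hβ hX (sdeg n - 2)
        push_cast at hne
        have hp : 𝒯.deg σ + 2 - sdeg n < 0 :=
          lt_of_le_of_ne (by linarith) fun h0 => hne (by linarith)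
        have h4 := hε₁' σ hσ1 (abs_pos.2 hp.ne)
        rw [abs_of_neg hp] at h4
        refine (hterm σ hσ1 c hc hc1).trans (mul_le_mul_of_nonneg_left
          (rpow_mul_rpow_le_of_ge hc hD hcD (by ring) (by linarith)) (mul_nonneg (hQ0 σ) hN))
    have b3 : 0 ≤ K₂ 0 * N * Y := by positivity
    have b4 : 0 ≤ (∑ k ∈ belowDeg d a, K₂ k) * N * Y := by positivity
    rw [hE]
    calc _ ≤ _ := (abs_sub _ _).trans (add_le_add b1 b2)
      _ ≤ S * N * Y := by rw [hS]; linarith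
      _ = _ := by rw [hY]; ring

end Model

end LiftBounds

/-! ### The lift as a modelled distribution of order `γ + 2` -/

section LiftModelled

variable {d : ℕ} {ι κ T Tp : Type*} [AddCommGroup T] [Module ℝ T] [CommRing Tp] [Bialgebra ℝ Tp]
  {𝒯 : RegularityStructure ι κ T Tp}

theorem RegularityStructure.hom_le_below {a b : ℝ} (h : a < b) : 𝒯.hom a ≤ 𝒯.below b :=
  Submodule.span_mono (Set.image_mono fun σ (hσ : 𝒯.deg σ = a) => show 𝒯.deg σ < b by linarith)

theorem RegularityStructure.repr_eq_zero_of_mem_hom {v : T} {a : ℝ} (h : v ∈ 𝒯.hom a) {τ : ι}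
    (hτ : 𝒯.deg τ ≠ a) : 𝒯.basis.repr v τ = 0 := by
  by_contra h0
  exact hτ ((𝒯.basis.mem_span_image.1 h) (Finsupp.mem_support_iff.2 h0))

theorem RegularityStructure.repr_map {v : T} {γ : ℝ} (h : v ∈ 𝒯.below γ) (L : T →ₗ[ℝ] T) (τ : ι) :
    𝒯.basis.repr (L v) τ =
      ∑ σ ∈ 𝒯.low γ, 𝒯.basis.repr v σ * 𝒯.basis.repr (L (𝒯.basis σ)) τ := by
  conv_lhs => rw [𝒯.eq_sum_of_mem_below h]
  simp

namespace PolynomialPart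

variable (P : PolynomialPart d 𝒯)

theorem repr_eq_zero_of_mem_polyBelow {a : ℝ} {v : T} (hv : v ∈ P.polyBelow a) {τ : ι}
    (hτ : τ ∉ Set.range P.X) : 𝒯.basis.repr v τ = 0 := by
  obtain ⟨w, rfl⟩ := P.eq_poly_of_mem hv
  rw [poly, map_sum, Finsupp.finsetSum_apply]
  refine Finset.sum_eq_zero fun n _ => ?_
  rw [map_smul, Finsupp.smul_apply, Module.Basis.repr_self,
    Finsupp.single_eq_of_ne (fun h => hτ ⟨n, h.symm⟩), smul_zero]

theorem repr_poly_X {a : ℝ} (w : MIdx d → ℝ) (n : MIdx d) :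
    𝒯.basis.repr (P.poly a w) (P.X n) = if (sdeg n : ℝ) < a then (mfact n : ℝ)⁻¹ * w n else 0 := by
  have h : 𝒯.basis.repr (P.poly a w) (P.X n) =
      ∑ l ∈ belowDeg d a, if l = n then (mfact n : ℝ)⁻¹ * w n else 0 := by
    rw [poly, map_sum, Finsupp.finsetSum_apply]
    refine Finset.sum_congr rfl fun l _ => ?_
    rw [map_smul, Finsupp.smul_apply, Module.Basis.repr_self]
    split_ifs with hl
    · rw [hl, Finsupp.single_eq_same, smul_eq_mul, mul_one]
    · rw [Finsupp.single_eq_of_ne (fun h => hl (P.X_injective h.symm)), smul_zero]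
  rw [h, Finset.sum_ite_eq']
  simp only [mem_belowDeg]

end PolynomialPart

theorem abs_inv_mfact_le (n : MIdx d) : |(mfact n : ℝ)⁻¹| ≤ 1 := by
  rw [abs_of_nonneg (by positivity)]
  exact inv_le_one_of_one_le₀ (by exact_mod_cast mfact_pos n)

namespace Model

variable (M : Model d 𝒯) {P : PolynomialPart d 𝒯}

/-- The lift of `K` for a given reconstruction `Λ` of `f`. -/
def lift (A : IntegrationOperators P) (γ : ℝ) (Λ : Distr d) (f : Spacetime d → T)
    (x : Spacetime d) : T :=
  (A.I 0 + M.J P x) (f x) + P.poly (γ + 2) fun l => dKAt l (Λ - M.PiAt x (f x)) x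

theorem exists_repr_I_add_J_le (hβ : ∀ τ, -2 < 𝒯.deg τ) (A : IntegrationOperators P) (σ τ : ι) :
    ∃ C : ℝ, 0 ≤ C ∧ ∀ x, |𝒯.basis.repr ((A.I 0 + M.J P x) (𝒯.basis σ)) τ| ≤ C := by
  suffices h : ∃ C : ℝ, 0 ≤ C ∧ ∀ x, |𝒯.basis.repr (M.J P x (𝒯.basis σ)) τ| ≤ C by
    obtain ⟨C, hC, h⟩ := h
    refine ⟨|𝒯.basis.repr (A.I 0 (𝒯.basis σ)) τ| + C, by positivity, fun x => ?_⟩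
    rw [LinearMap.add_apply, map_add, Finsupp.add_apply]
    exact (abs_add_le _ _).trans (by linarith [h x])
  by_cases hτ : τ ∈ Set.range P.X
  · obtain ⟨n, rfl⟩ := hτ
    simp only [J_basis, P.repr_poly_X]
    by_cases hn : (sdeg n : ℝ) < 𝒯.deg σ + 2
    · obtain ⟨C, hC⟩ := M.exists_hasOrder_PiAt hβ σ
      obtain ⟨K, hK, h⟩ := HasOrder.exists_dKAt_le hn (growth (𝒯.deg σ))
      have := (hC 0).nonneg
      refine ⟨K * C, by positivity, fun x => ?_⟩
      rw [if_pos hn, abs_mul]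
      exact (mul_le_of_le_one_left (abs_nonneg _) (abs_inv_mfact_le n)).trans (h _ x C (hC x))
    · exact ⟨0, le_rfl, fun x => by simp [hn]⟩
  · exact ⟨0, le_rfl, fun x => by
      rw [P.repr_eq_zero_of_mem_polyBelow (M.J_basis_mem x σ) hτ, abs_zero]⟩

theorem lift_mem (A : IntegrationOperators P) {γ : ℝ} (Λ : Distr d) {f : Spacetime d → T}
    (hf : ∀ x, f x ∈ 𝒯.below γ) (x : Spacetime d) : M.lift A γ Λ f x ∈ 𝒯.below (γ + 2) := by
  refine add_mem ?_ (P.polyBelow_le_below _ (P.poly_mem _ _))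
  rw [𝒯.eq_sum_of_mem_below (hf x), map_sum]
  refine Submodule.sum_mem _ fun σ hσ => ?_
  have hσ' := 𝒯.mem_low.1 hσ
  rw [map_smul]
  refine Submodule.smul_mem _ _ (add_mem ?_ ?_)
  · have hI := A.I_graded 0 (by simp [sdeg_zero]) σ
    simp only [sdeg_zero, Nat.cast_zero, sub_zero] at hI
    exact 𝒯.hom_le_below (by linarith) hI
  · exact P.polyBelow_le_below _ (P.polyBelow_mono (by linarith) (M.J_basis_mem x σ))

theorem exists_lift_coeff_le (hβ : ∀ τ, -2 < 𝒯.deg τ) (A : IntegrationOperators P) (γ : ℝ) (m : ℕ)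
    (τ : ι) : ∃ K : ℝ, 0 ≤ K ∧ ∀ (f : Spacetime d → T) (N : ℝ) (Λ : Distr d),
      M.ModelledBound γ f N → (∀ x, HasOrder (Λ - M.PiAt x (f x)) x γ N m) → ∀ x,
        |𝒯.basis.repr (M.lift A γ Λ f x) τ| ≤ K * N := by
  choose C hC0 hC using fun σ => M.exists_repr_I_add_J_le hβ A σ τ
  obtain ⟨K, hK, h⟩ : ∃ K : ℝ, 0 ≤ K ∧ ∀ (ζ : Distr d) (x : Spacetime d) (N : ℝ),
      HasOrder ζ x γ N m → |𝒯.basis.repr (P.poly (γ + 2) fun l => dKAt l ζ x) τ| ≤ K * N := by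
    by_cases hτ : τ ∈ Set.range P.X
    · obtain ⟨n, rfl⟩ := hτ
      simp only [P.repr_poly_X]
      by_cases hn : (sdeg n : ℝ) < γ + 2
      · obtain ⟨K, hK, h⟩ := HasOrder.exists_dKAt_le hn m
        refine ⟨K, hK, fun ζ x N hζ => ?_⟩
        rw [if_pos hn, abs_mul]
        exact (mul_le_of_le_one_left (abs_nonneg _) (abs_inv_mfact_le n)).trans (h _ x N hζ)
      · exact ⟨0, le_rfl, fun ζ x N hζ => by simp [hn]⟩
    · exact ⟨0, le_rfl, fun ζ x N _ => by
        rw [P.repr_eq_zero_of_mem_polyBelow (P.poly_mem _ _) hτ, abs_zero, zero_mul]⟩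
  refine ⟨(∑ σ ∈ 𝒯.low γ, C σ) + K, add_nonneg (Finset.sum_nonneg fun σ _ => hC0 σ) hK,
    fun f N Λ hf hζ x => ?_⟩
  rw [lift, map_add, Finsupp.add_apply, 𝒯.repr_map (hf.mem x), add_mul, Finset.sum_mul]
  refine (abs_add_le _ _).trans (add_le_add ?_ (h _ x N (hζ x)))
  refine (Finset.abs_sum_le_sum_abs _ _).trans (Finset.sum_le_sum fun σ hσ => ?_)
  rw [abs_mul, mul_comm]
  exact mul_le_mul (hC σ x) (hf.coeff x σ (𝒯.mem_low.1 hσ)) (abs_nonneg _) (hC0 σ)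

/-- The filter and the truncations retain exactly terms whose integrals converge separately, so the
average may be split although it was estimated as a whole. -/
theorem kAvg_liftIntegrand (hβ : ∀ τ, -2 < 𝒯.deg τ) {γ : ℝ} {f : Spacetime d → T} {Λ : Distr d}
    {N : ℝ} {m : ℕ} (hζ : ∀ x, HasOrder (Λ - M.PiAt x (f x)) x γ N m) {n : MIdx d}
    (hn : (sdeg n : ℝ) < γ + 2) (y x : Spacetime d) :
    kAvg (M.liftIntegrand γ f Λ n y x) =
      (∑ σ ∈ (𝒯.low γ).filter (fun σ => (sdeg n : ℝ) < 𝒯.deg σ + 2),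
        𝒯.basis.repr (f y - M.trans y x (f x)) σ * dKAt n (M.PiAt y (𝒯.basis σ)) y) +
      dKAt n (Λ - M.PiAt y (f y)) y -
      jet (γ + 2 - sdeg n) (fun k => dKAt (n + k) (Λ - M.PiAt x (f x)) x) (y - x) := by
  have i1 : ∀ σ ∈ (𝒯.low γ).filter (fun σ => (sdeg n : ℝ) < 𝒯.deg σ + 2), IntervalIntegrable
      (fun r => 𝒯.basis.repr (f y - M.trans y x (f x)) σ * M.PiAt y (𝒯.basis σ) (qKer n r y))
      volume 0 1 := fun σ hσ =>
    IntervalIntegrable.const_mul (M.dKAtConverges_PiAt hβ y σ n (Finset.mem_filter.1 hσ).2) _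
  have i2 : IntervalIntegrable (fun r => (Λ - M.PiAt y (f y)) (qKer n r y)) volume 0 1 :=
    (hζ y).dKAtConverges hn
  have i3 : ∀ k ∈ belowDeg d (γ + 2 - sdeg n), IntervalIntegrable (fun r => mpow (y - x) k *
      ((mfact k : ℝ)⁻¹ * (Λ - M.PiAt x (f x)) (qKer (n + k) r x))) volume 0 1 := fun k hk => by
    have hk' := mem_belowDeg.1 hk
    refine IntervalIntegrable.const_mul (IntervalIntegrable.const_mul
      ((hζ x).dKAtConverges (n := n + k) ?_) _) _
    rw [sdeg_add]
    push_cast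
    linarith
  have s1 := IntervalIntegrable.sum _ i1
  have s3 := IntervalIntegrable.sum _ i3
  have e1 := kAvg_sum _ i1
  have e3 := kAvg_sum _ i3
  simp only [kAvg_const_mul] at e1 e3
  rw [Finset.sum_fn] at s1 s3
  unfold liftIntegrand jet
  rw [kAvg_sub (s1.add i2) s3, kAvg_add s1 i2, e1, e3]
  rfl

/-- `trans_I_add_J` cancels the dependence on `f x` against its transport to `y`, and `trans_poly`
re-expands the polynomial part; apart from `I` of an increment only polynomials are left. -/
theorem lift_sub_trans (hβ : ∀ τ, -2 < 𝒯.deg τ) {S : PolynomialProduct P}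
    (A : IntegrationOperators P) (hcan : M.IsCanonical P) (hadm : M.IsAdmissible S A) (γ : ℝ)
    (Λ : Distr d) (f : Spacetime d → T) (y x : Spacetime d) :
    M.lift A γ Λ f y - M.trans y x (M.lift A γ Λ f x) = A.I 0 (f y - M.trans y x (f x)) +
      (M.J P y (f y - M.trans y x (f x)) + (P.poly (γ + 2) fun l => dKAt l (Λ - M.PiAt y (f y)) y) -
        P.poly (γ + 2) fun n => jet (γ + 2 - sdeg n)
          (fun k => dKAt (n + k) (Λ - M.PiAt x (f x)) x) (y - x)) := by
  rw [lift, lift, map_add, M.trans_I_add_J hβ A hcan hadm, M.trans_poly hcan]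
  simp only [LinearMap.add_apply, map_sub]
  abel

theorem repr_lift_sub_trans_X (hβ : ∀ τ, -2 < 𝒯.deg τ) {γ : ℝ} {f : Spacetime d → T} {Λ : Distr d}
    {N : ℝ} {m : ℕ} (hf : M.ModelledBound γ f N)
    (hζ : ∀ x, HasOrder (Λ - M.PiAt x (f x)) x γ N m) {n : MIdx d} (hn : (sdeg n : ℝ) < γ + 2)
    (y x : Spacetime d) : 𝒯.basis.repr (M.J P y (f y - M.trans y x (f x)) +
      (P.poly (γ + 2) fun l => dKAt l (Λ - M.PiAt y (f y)) y) -
        P.poly (γ + 2) fun n => jet (γ + 2 - sdeg n)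
          (fun k => dKAt (n + k) (Λ - M.PiAt x (f x)) x) (y - x)) (P.X n) =
      (mfact n : ℝ)⁻¹ * kAvg (M.liftIntegrand γ f Λ n y x) := by
  rw [M.kAvg_liftIntegrand hβ hζ hn, map_sub, map_add, Finsupp.sub_apply, Finsupp.add_apply,
    P.repr_poly_X, P.repr_poly_X, if_pos hn, if_pos hn,
    𝒯.repr_map (sub_mem (hf.mem y) (M.trans_mem_below y x (hf.mem x)))]
  simp only [J_basis, P.repr_poly_X]
  rw [mul_sub, mul_add, Finset.mul_sum, Finset.sum_filter]
  congr 2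
  refine Finset.sum_congr rfl fun σ _ => ?_
  split_ifs
  · ring
  · ring

/-- The `I` part raises homogeneities by exactly two and inherits the Hölder bound of `f`. The rest
is polynomial, with coefficients controlled by `exists_liftIntegrand_le`. -/
theorem exists_lift_holder_le (hβ : ∀ τ, -2 < 𝒯.deg τ) {S : PolynomialProduct P}
    (A : IntegrationOperators P) (hcan : M.IsCanonical P) (hadm : M.IsAdmissible S A) {γ : ℝ}
    (hint : ∀ k : ℤ, γ ≠ k) (m : ℕ) {τ : ι} (hτ : 𝒯.deg τ < γ + 2) : ∃ K : ℝ, 0 ≤ K ∧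
      ∀ (f : Spacetime d → T) (N : ℝ) (Λ : Distr d), M.ModelledBound γ f N →
        (∀ x, HasOrder (Λ - M.PiAt x (f x)) x γ N m) → ∀ x y,
          |𝒯.basis.repr (M.lift A γ Λ f y - M.trans y x (M.lift A γ Λ f x)) τ| ≤
            K * N * pdist y x ^ (γ + 2 - 𝒯.deg τ) := by
  obtain ⟨K, hK, h⟩ : ∃ K : ℝ, 0 ≤ K ∧ ∀ (f : Spacetime d → T) (N : ℝ) (Λ : Distr d),
      M.ModelledBound γ f N → (∀ x, HasOrder (Λ - M.PiAt x (f x)) x γ N m) → ∀ x y, y ≠ x →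
        |𝒯.basis.repr (M.J P y (f y - M.trans y x (f x)) +
          (P.poly (γ + 2) fun l => dKAt l (Λ - M.PiAt y (f y)) y) -
            P.poly (γ + 2) fun n => jet (γ + 2 - sdeg n)
              (fun k => dKAt (n + k) (Λ - M.PiAt x (f x)) x) (y - x)) τ| ≤
          K * N * pdist y x ^ (γ + 2 - 𝒯.deg τ) := by
    by_cases hX : τ ∈ Set.range P.X
    · obtain ⟨n, rfl⟩ := hX
      rw [P.deg_X] at hτ ⊢
      obtain ⟨K, hK, h⟩ := M.exists_liftIntegrand_le hβ A hcan hint hτ m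
      refine ⟨K, hK, fun f N Λ hf hζ x y hxy => ?_⟩
      rw [M.repr_lift_sub_trans_X hβ hf hζ hτ, abs_mul]
      exact (mul_le_of_le_one_left (abs_nonneg _) (abs_inv_mfact_le n)).trans
        (h f N Λ hf hζ x y hxy)
    · refine ⟨0, le_rfl, fun f N Λ hf hζ x y _ => ?_⟩
      rw [P.repr_eq_zero_of_mem_polyBelow (a := γ + 2) _ hX, abs_zero, zero_mul, zero_mul]
      refine sub_mem (add_mem (P.map_mem_polyBelow _ (M.J_basis_mem y) fun σ hσ => ?_)
        (P.poly_mem _ _)) (P.poly_mem _ _)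
      exact hf.repr_eq_zero M x y hσ.le
  set C := ∑ σ ∈ 𝒯.low γ, |𝒯.basis.repr (A.I 0 (𝒯.basis σ)) τ| with hC
  have hC0 : 0 ≤ C := Finset.sum_nonneg fun σ _ => abs_nonneg _
  refine ⟨C + K, by positivity, fun f N Λ hf hζ x y => ?_⟩
  have hN := (hζ x).nonneg
  have hD := pdist_nonneg y x
  rcases eq_or_ne y x with rfl | hxy
  · rw [M.trans_self, sub_self, map_zero, Finsupp.zero_apply, abs_zero]
    positivity
  rw [M.lift_sub_trans hβ A hcan hadm, map_add, Finsupp.add_apply, add_mul, add_mul]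
  refine (abs_add_le _ _).trans (add_le_add ?_ (h f N Λ hf hζ x y hxy))
  rw [𝒯.repr_map (sub_mem (hf.mem y) (M.trans_mem_below y x (hf.mem x))), hC, Finset.sum_mul,
    Finset.sum_mul]
  refine (Finset.abs_sum_le_sum_abs _ _).trans (Finset.sum_le_sum fun σ hσ => ?_)
  rw [abs_mul, mul_comm]
  have hI := A.I_graded 0 (by simp [sdeg_zero]) σ
  simp only [sdeg_zero, Nat.cast_zero, sub_zero] at hI
  by_cases hdeg : 𝒯.deg τ = 𝒯.deg σ + 2
  · rw [mul_assoc, show γ + 2 - 𝒯.deg τ = γ - 𝒯.deg σ by linarith]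
    exact mul_le_mul_of_nonneg_left (hf.holder x y σ (𝒯.mem_low.1 hσ)) (abs_nonneg _)
  · rw [𝒯.repr_eq_zero_of_mem_hom hI hdeg, abs_zero, zero_mul, zero_mul, zero_mul]

/-- The lift maps modelled distributions of order `γ` to modelled distributions of order `γ + 2`. -/
theorem exists_modelledBound_lift (hβ : ∀ τ, -2 < 𝒯.deg τ) {S : PolynomialProduct P}
    (A : IntegrationOperators P) (hcan : M.IsCanonical P) (hadm : M.IsAdmissible S A) {γ : ℝ}
    (hint : ∀ k : ℤ, γ ≠ k) (m : ℕ) : ∃ K : ℝ, 0 ≤ K ∧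
      ∀ (f : Spacetime d → T) (N : ℝ) (Λ : Distr d), M.ModelledBound γ f N →
        (∀ x, HasOrder (Λ - M.PiAt x (f x)) x γ N m) →
          M.ModelledBound (γ + 2) (M.lift A γ Λ f) (K * N) := by
  choose K₁ hK₁ h₁ using M.exists_lift_coeff_le hβ A γ m
  have h : ∀ τ, ∃ K : ℝ, 0 ≤ K ∧ (𝒯.deg τ < γ + 2 →
      ∀ (f : Spacetime d → T) (N : ℝ) (Λ : Distr d), M.ModelledBound γ f N →
        (∀ x, HasOrder (Λ - M.PiAt x (f x)) x γ N m) → ∀ x y,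
          |𝒯.basis.repr (M.lift A γ Λ f y - M.trans y x (M.lift A γ Λ f x)) τ| ≤
            K * N * pdist y x ^ (γ + 2 - 𝒯.deg τ)) := fun τ => by
    by_cases hτ : 𝒯.deg τ < γ + 2
    · obtain ⟨K, hK, h⟩ := M.exists_lift_holder_le hβ A hcan hadm hint m hτ
      exact ⟨K, hK, fun _ => h⟩
    · exact ⟨0, le_rfl, fun h => absurd h hτ⟩
  choose K₂ hK₂ h₂ using h
  have hs₁ : 0 ≤ ∑ τ ∈ 𝒯.low (γ + 2), K₁ τ := Finset.sum_nonneg fun τ _ => hK₁ τ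
  have hs₂ : 0 ≤ ∑ τ ∈ 𝒯.low (γ + 2), K₂ τ := Finset.sum_nonneg fun τ _ => hK₂ τ
  refine ⟨(∑ τ ∈ 𝒯.low (γ + 2), K₁ τ) + ∑ τ ∈ 𝒯.low (γ + 2), K₂ τ, by positivity,
    fun f N Λ hf hζ => ⟨M.lift_mem A Λ hf.mem, fun x τ hτ => ?_, fun x y τ hτ => ?_⟩⟩
  · have hN := (hζ x).nonneg
    refine (h₁ τ f N Λ hf hζ x).trans (mul_le_mul_of_nonneg_right ?_ hN)
    linarith [Finset.single_le_sum (fun τ _ => hK₁ τ) (𝒯.mem_low.2 hτ)]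
  · have hN := (hζ x).nonneg
    have hD := pdist_nonneg y x
    refine (h₂ τ hτ f N Λ hf hζ x y).trans ?_
    have : K₂ τ ≤ (∑ τ ∈ 𝒯.low (γ + 2), K₁ τ) + ∑ τ ∈ 𝒯.low (γ + 2), K₂ τ := by
      linarith [Finset.single_le_sum (fun τ _ => hK₂ τ) (𝒯.mem_low.2 hτ)]
    gcongr

end Model

end LiftModelled

/-! ### The reconstruction of the lift -/

section LiftReconstruction

variable {d : ℕ} {ι κ T Tp : Type*} [AddCommGroup T] [Module ℝ T] [CommRing Tp] [Bialgebra ℝ Tp]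
  {𝒯 : RegularityStructure ι κ T Tp}

theorem integrable_abs_gauss_weight (t : ℝ) {D : ℝ} (hD : 0 < D) (k : ℕ) :
    Integrable fun w : Spacetime d => |gauss t 0 w| * (1 + pnorm w / D) ^ k := by
  refine ((polyBdd_pnorm_weight D k hD).integrable_mul (gauss t 0)).abs.congr
    (Filter.Eventually.of_forall fun w => ?_)
  have := pnorm_nonneg w
  simp only [abs_mul]
  rw [abs_of_nonneg (a := (1 + pnorm w / D) ^ k) (by positivity)]

theorem exists_moment_gauss_le (l : MIdx d) : ∃ C : ℝ, 0 ≤ C ∧ ∀ D : ℝ, 0 < D →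
    |moment l (gauss (D ^ 4) 0)| ≤ C * D ^ (sdeg l : ℝ) := by
  obtain ⟨C, hC, h⟩ := exists_integral_mderiv_gauss_le (0 : MIdx d) (sdeg l)
  refine ⟨C, hC, fun D hD => ?_⟩
  have h1 := h D 0 hD le_rfl (by positivity)
  simp only [mderiv_zero, sdeg_zero, pow_zero, mul_one] at h1
  have h2 := abs_integral_mul_le (a := gauss (D ^ 4) 0) (U := fun w : Spacetime d => mpow (-w) l)
    (A := fun w => D ^ sdeg l * (1 + pnorm w / D) ^ sdeg l)
    (by
      refine ((integrable_abs_gauss_weight (D ^ 4) hD (sdeg l)).const_mul (D ^ sdeg l)).congr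
        (Filter.Eventually.of_forall fun w => ?_)
      simp only
      ring)
    (fun w => by
      refine (abs_mpow_le _ _).trans ?_
      rw [pnorm_neg, ← mul_pow]
      have := pnorm_nonneg w
      gcongr
      rw [mul_add, mul_div_cancel₀ _ hD.ne']
      linarith)
  have e : moment l (gauss (D ^ 4) 0) = ∫ w, gauss (D ^ 4) 0 w * mpow (-w) l := by
    unfold moment
    simp only [mul_comm]
  rw [e, Real.rpow_natCast]
  refine h2.trans ?_
  calc _ = D ^ sdeg l * ∫ w, |gauss (D ^ 4) 0 w| * (1 + pnorm w / D) ^ sdeg l := by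
        rw [← integral_const_mul]
        refine integral_congr_ae (Filter.Eventually.of_forall fun w => ?_)
        simp only
        ring
    _ ≤ D ^ sdeg l * C := by gcongr
    _ = _ := mul_comm _ _

theorem rpow_le_of_le_two_mul {D e : ℝ} (hD : 0 < D) (h1 : D ≤ e) (h2 : e ≤ 2 * D) (p : ℝ) :
    e ^ p ≤ 2 ^ |p| * D ^ p := by
  have h3 : 1 ≤ e / D := (one_le_div hD).2 h1
  have h4 : (e / D) ^ p ≤ 2 ^ |p| :=
    (Real.rpow_le_rpow_of_exponent_le h3 (le_abs_self p)).trans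
      (Real.rpow_le_rpow (by linarith) ((div_le_iff₀ hD).2 h2) (abs_nonneg p))
  rw [Real.div_rpow (hD.le.trans h1) hD.le, div_le_iff₀ (Real.rpow_pos_of_pos hD p)] at h4
  exact h4

/-- The integrand of `K ζ` minus its Taylor polynomial at `x`, tested against `p_t(x, ·)`. -/
def taylorIntegrand (γ : ℝ) (ζ : Distr d) (x : Spacetime d) (ψ : 𝓢(Spacetime d, ℝ)) (r : ℝ) : ℝ :=
  KrDistr r ζ (reflectAt x ψ) -
    ∑ l ∈ belowDeg d (γ + 2), ((mfact l : ℝ)⁻¹ * moment l ψ) * ζ (qKer l r x)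

/-- Averaging the Taylor remainder of `K_r ζ` at `x - w` against `ψ` reproduces the subtraction of
the polynomial, because the jet is integrated into moments. -/
theorem taylorIntegrand_eq (γ : ℝ) (ζ : Distr d) (x : Spacetime d) (ψ : 𝓢(Spacetime d, ℝ)) (r : ℝ) :
    taylorIntegrand γ ζ x ψ r = ∫ w, ψ w * (ζ (qKer 0 r (x - w)) -
      jet (γ + 2) (fun l => ζ (qKer (0 + l) r x)) (x - w - x)) := by
  have i1 : Integrable fun w => ψ w * ζ (qKer 0 r (x - w)) := by
    have := ((polyBdd_reflectAt ζ (mderiv 0 (qConv d r))).comp_sub_const (-x)).comp_neg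
    refine (this.integrable_mul ψ).congr (Filter.Eventually.of_forall fun w => ?_)
    simp only [sub_neg_eq_add, neg_add_eq_sub, qKer]
  have i2 : ∀ l ∈ belowDeg d (γ + 2), Integrable fun w =>
      ((mfact l : ℝ)⁻¹ * ζ (qKer l r x)) * (mpow (-w) l * ψ w) := fun l _ =>
    (integrable_moment l ψ).const_mul _
  have e : ∀ w, ψ w * jet (γ + 2) (fun l => ζ (qKer (0 + l) r x)) (x - w - x) =
      ∑ l ∈ belowDeg d (γ + 2), ((mfact l : ℝ)⁻¹ * ζ (qKer l r x)) * (mpow (-w) l * ψ w) := by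
    intro w
    rw [jet, Finset.mul_sum, sub_right_comm, sub_self, zero_sub]
    refine Finset.sum_congr rfl fun l _ => ?_
    rw [zero_add]
    ring
  simp only [mul_sub, e]
  rw [integral_sub i1 (integrable_finsetSum _ i2), integral_finsetSum _ i2, taylorIntegrand,
    KrDistr_reflectAt, distr_reflectAt_sconv]
  simp only [integral_const_mul, qKer, mderiv_zero]
  congr 1
  refine Finset.sum_congr rfl fun l _ => ?_
  rw [moment]
  ring

/-- Same splitting as for the Hölder bound, now with `D` the length of the testing kernel: below `D`
the two terms are bounded separately, above `D` the averaged Taylor remainder is used. -/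
theorem HasOrder.exists_taylorIntegrand_le {γ : ℝ} (hint : ∀ k : ℤ, γ ≠ k) (m : ℕ) :
    ∃ K : ℝ, 0 ≤ K ∧ ∀ (ζ : Distr d) (x : Spacetime d) (N : ℝ), HasOrder ζ x γ N m →
      ∀ D, 0 < D → D ≤ 1 →
        |kAvg (taylorIntegrand γ ζ x (gauss (D ^ 4) 0))| ≤ K * N * D ^ (γ + 2) := by
  obtain ⟨K₁, hK₁, h₁⟩ := HasOrder.exists_KrDistr_le (d := d) γ 0 m
  choose K₂ hK₂ h₂ using fun l : MIdx d => HasOrder.exists_qKer_le (d := d) γ l m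
  obtain ⟨K₃, M₃, hK₃, h₃⟩ := HasOrder.exists_taylor_le (d := d) γ (γ + 2) 0 m
  choose C hC0 hC using exists_moment_gauss_le (d := d)
  have hceil := lt_natCeil_of_ne_int hint (0 : MIdx d)
  simp only [sdeg_zero, Nat.cast_zero, sub_zero] at hceil
  set L := ⌈γ + 2⌉₊ with hL
  obtain ⟨K₄, hK₄, h₄⟩ := exists_integral_mderiv_gauss_le (0 : MIdx d) (L + M₃)
  obtain ⟨ε₂, hε₂, hε₂'⟩ := exists_pos_forall_le (belowDeg d (γ + 2)) fun l => γ + 2 - sdeg l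
  set ε := min ε₂ (min 4 (L - (γ + 2))) with hε
  have hε0 : 0 < ε := lt_min hε₂ (lt_min (by norm_num) (by linarith))
  have e1 : ε ≤ ε₂ := min_le_left _ _
  have e2 : ε ≤ 4 := (min_le_right _ _).trans (min_le_left _ _)
  have e3 : ε ≤ L - (γ + 2) := (min_le_right _ _).trans (min_le_right _ _)
  have hsum : 0 ≤ ∑ l ∈ belowDeg d (γ + 2), C l * K₂ l :=
    Finset.sum_nonneg fun l _ => mul_nonneg (hC0 l) (hK₂ l)
  set S := K₁ * 2 ^ |γ - 2| + (∑ l ∈ belowDeg d (γ + 2), C l * K₂ l) + K₃ * K₄ with hS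
  have hS0 : 0 ≤ S := by positivity
  refine ⟨(8 / ε + 2) * S, by positivity, fun ζ x N hζ D hD hD1 => ?_⟩
  have hN := hζ.nonneg
  rw [mul_assoc, mul_assoc]
  refine abs_integral_sub_le hε0 hD (by positivity) (fun c hc hc1 hcD => ?_)
    fun c hc hc1 hcD => ?_
  · set Y := D ^ (γ + 2) * (c ^ (-4 : ℝ) * (c / D) ^ ε) with hY
    have hY0 : 0 ≤ Y := by positivity
    have b1 : |KrDistr (c ^ 4) ζ (reflectAt x (gauss (D ^ 4) 0))| ≤ K₁ * 2 ^ |γ - 2| * N * Y := by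
      -- The two kernels combine to the total time `c ^ 4 + D ^ 4`, whose length `e` lies between
      -- `D` and `2 * D`. So the bound does not degenerate as `c → 0`, and its exponent relative to
      -- `c` is `4`.
      obtain ⟨e, he, he4⟩ := exists_fourth_root (show 0 < c ^ 4 + D ^ 4 by positivity)
      have h := h₁ ζ x N hζ x (c ^ 4) (D ^ 4) e (by positivity) (pow_le_one₀ hc.le hc1)
        (by positivity) (pow_le_one₀ hD.le hD1) he he4
      simp only [mderiv_zero, sdeg_zero, Nat.cast_zero, sub_zero, pdist_self, zero_div, add_zero,
        one_pow, mul_one] at h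
      have hle1 : D ≤ e := by
        refine le_of_pow_le_pow_left₀ (n := 4) (by norm_num) he.le ?_
        rw [he4]
        have : 0 < c ^ 4 := by positivity
        linarith
      have hle2 : e ≤ 2 * D := by
        refine le_of_pow_le_pow_left₀ (n := 4) (by norm_num) (by positivity) ?_
        rw [he4, mul_pow]
        have h5 : c ^ 4 ≤ D ^ 4 := by gcongr
        have h6 : 0 < D ^ 4 := by positivity
        linarith
      have h7 := rpow_le_of_le_two_mul hD hle1 hle2 (γ - 2)
      have h8 := rpow_mul_rpow_le_of_lt hc hcD (p := γ - 2) (q := 0) (s := γ + 2) (ε := ε)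
        (by ring) (by linarith)
      rw [Real.rpow_zero, mul_one] at h8
      calc _ ≤ K₁ * N * (2 ^ |γ - 2| * D ^ (γ - 2)) := h.trans (by gcongr)
        _ ≤ K₁ * N * (2 ^ |γ - 2| * Y) := by gcongr
        _ = _ := by ring
    have b2 : |∑ l ∈ belowDeg d (γ + 2), ((mfact l : ℝ)⁻¹ * moment l (gauss (D ^ 4) 0)) *
        ζ (qKer l (c ^ 4) x)| ≤ (∑ l ∈ belowDeg d (γ + 2), C l * K₂ l) * N * Y := by
      rw [Finset.sum_mul, Finset.sum_mul]
      refine (Finset.abs_sum_le_sum_abs _ _).trans (Finset.sum_le_sum fun l hl => ?_)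
      have hl' := mem_belowDeg.1 hl
      have hε' := hε₂' l hl (by linarith)
      have h := h₂ l ζ x N hζ x c hc hc1
      simp only [pdist_self, zero_div, add_zero, one_pow, mul_one] at h
      have hCl := hC0 l
      rw [abs_mul, abs_mul]
      calc _ ≤ (1 * (C l * D ^ (sdeg l : ℝ))) * (K₂ l * N * c ^ (γ - sdeg l - 2)) :=
            mul_le_mul (mul_le_mul (abs_inv_mfact_le l) (hC l D hD) (abs_nonneg _) zero_le_one) h
              (abs_nonneg _) (by positivity)
        _ = C l * K₂ l * N * (D ^ (sdeg l : ℝ) * c ^ (γ - sdeg l - 2)) := by ring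
        _ ≤ _ := mul_le_mul_of_nonneg_left (rpow_mul_rpow_le_of_lt hc hcD (by ring) (by linarith))
            (mul_nonneg (mul_nonneg hCl (hK₂ l)) hN)
    have b3 : 0 ≤ K₃ * K₄ * N * Y := by positivity
    calc |taylorIntegrand γ ζ x (gauss (D ^ 4) 0) (c ^ 4)| ≤ _ :=
          (abs_sub _ _).trans (add_le_add b1 b2)
      _ ≤ S * N * Y := by rw [hS]; linarith
      _ = _ := by rw [hY]; ring
  · set Y := D ^ (γ + 2) * (c ^ (-4 : ℝ) * (c / D) ^ (-ε)) with hY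
    have hY0 : 0 ≤ Y := by positivity
    have h5 : D ^ (L : ℝ) * c ^ (γ - 2 - L) ≤ Y :=
      rpow_mul_rpow_le_of_ge hc hD hcD (by ring) (by linarith)
    have h6 : c ^ (γ - 2) * (D / c) ^ L = D ^ (L : ℝ) * c ^ (γ - 2 - L) := by
      rw [Real.rpow_sub hc _ (L : ℝ), div_pow, Real.rpow_natCast, Real.rpow_natCast]
      ring
    have h7 : ∀ w, |ζ (qKer 0 (c ^ 4) (x - w)) -
        jet (γ + 2) (fun l => ζ (qKer (0 + l) (c ^ 4) x)) (x - w - x)| ≤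
          K₃ * N * Y * (1 + pnorm w / D) ^ (L + M₃) := by
      intro w
      have h8 := h₃ ζ x N hζ (x - w) c hc hc1
      have hw := pnorm_nonneg w
      have e : pdist (x - w) x = pnorm w := by
        rw [pdist_eq, sub_right_comm, sub_self, zero_sub, pnorm_neg]
      rw [e, sdeg_zero, Nat.cast_zero, sub_zero] at h8
      refine h8.trans ?_
      have h9 : pnorm w / c ≤ pnorm w / D := by gcongr
      have h10 : (pnorm w / c) ^ L ≤ (D / c) ^ L * (1 + pnorm w / D) ^ L := by
        rw [← mul_pow]
        gcongr
        rw [mul_add, mul_one, div_mul_div_cancel₀' hD.ne']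
        have : 0 ≤ D / c := by positivity
        linarith
      have h11 : (1 + pnorm w / c) ^ M₃ ≤ (1 + pnorm w / D) ^ M₃ := by gcongr
      calc _ ≤ K₃ * N * (c ^ (γ - 2) * (((D / c) ^ L * (1 + pnorm w / D) ^ L) *
            (1 + pnorm w / D) ^ M₃)) := by gcongr
        _ = K₃ * N * (c ^ (γ - 2) * (D / c) ^ L) * (1 + pnorm w / D) ^ (L + M₃) := by
          rw [pow_add]; ring
        _ ≤ _ := by rw [h6]; gcongr
    have h8 := h₄ D 0 hD le_rfl (by positivity)
    simp only [mderiv_zero, sdeg_zero, pow_zero, mul_one] at h8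
    have b1 : 0 ≤ K₁ * 2 ^ |γ - 2| * N * Y := by positivity
    have b2 : 0 ≤ (∑ l ∈ belowDeg d (γ + 2), C l * K₂ l) * N * Y := by positivity
    rw [taylorIntegrand_eq]
    have hI : Integrable fun w : Spacetime d => |gauss (D ^ 4) 0 w| *
        (K₃ * N * Y * (1 + pnorm w / D) ^ (L + M₃)) := by
      refine ((integrable_abs_gauss_weight (D ^ 4) hD (L + M₃)).const_mul (K₃ * N * Y)).congr
        (Filter.Eventually.of_forall fun w => ?_)
      simp only
      ring
    calc _ ≤ ∫ w, |gauss (D ^ 4) 0 w| * (K₃ * N * Y * (1 + pnorm w / D) ^ (L + M₃)) :=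
          abs_integral_mul_le hI h7
      _ = K₃ * N * Y * ∫ w, |gauss (D ^ 4) 0 w| * (1 + pnorm w / D) ^ (L + M₃) := by
          rw [← integral_const_mul]
          refine integral_congr_ae (Filter.Eventually.of_forall fun w => ?_)
          simp only
          ring
      _ ≤ K₃ * N * Y * K₄ := by gcongr
      _ ≤ S * N * Y := by rw [hS]; linarith
      _ = _ := by rw [hY]; ring

theorem HasOrder.kAvg_taylorIntegrand {γ : ℝ} {ζ : Distr d} {x : Spacetime d} {N : ℝ} {m : ℕ}
    (hζ : HasOrder ζ x γ N m) (ψ : 𝓢(Spacetime d, ℝ)) : kAvg (taylorIntegrand γ ζ x ψ) =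
      KopLM ζ (reflectAt x ψ) -
        ∑ l ∈ belowDeg d (γ + 2), ((mfact l : ℝ)⁻¹ * moment l ψ) * dKAt l ζ x := by
  have i : ∀ l ∈ belowDeg d (γ + 2), IntervalIntegrable
      (fun r => ((mfact l : ℝ)⁻¹ * moment l ψ) * ζ (qKer l r x)) volume 0 1 := fun l hl =>
    IntervalIntegrable.const_mul (hζ.dKAtConverges (mem_belowDeg.1 hl)) _
  have s := IntervalIntegrable.sum _ i
  have e := kAvg_sum _ i
  simp only [kAvg_const_mul] at e
  rw [Finset.sum_fn] at s
  unfold taylorIntegrand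
  rw [kAvg_sub (intervalIntegrable_KrDistr ζ _) s, e, KopLM_apply]
  rfl

namespace Model

variable (M : Model d 𝒯) {P : PolynomialPart d 𝒯}

/-- `K Λ` is a reconstruction of the lift. -/
theorem exists_recBound_lift (hβ : ∀ τ, -2 < 𝒯.deg τ) {S : PolynomialProduct P}
    (A : IntegrationOperators P) (hcan : M.IsCanonical P) (hadm : M.IsAdmissible S A) {γ : ℝ}
    (hint : ∀ k : ℤ, γ ≠ k) (m : ℕ) : ∃ K : ℝ, 0 ≤ K ∧
      ∀ (f : Spacetime d → T) (N : ℝ) (Λ : Distr d),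
        (∀ x, HasOrder (Λ - M.PiAt x (f x)) x γ N m) →
          M.RecBound (γ + 2) (M.lift A γ Λ f) (KopLM Λ) (K * N) := by
  obtain ⟨K, hK, h⟩ := HasOrder.exists_taylorIntegrand_le (d := d) hint m
  refine ⟨K, hK, fun f N Λ hζ x c hc hc1 => ?_⟩
  refine le_trans (le_of_eq ?_) (h _ x N (hζ x) c hc hc1)
  -- By `PiAt_I_add_J` the model applied to the lift is `K Π_x f(x)` plus the Taylor polynomial of
  -- the error, so subtracting it from `K Λ` leaves `K` of the error minus that polynomial.
  rw [(hζ x).kAvg_taylorIntegrand, lift, map_add, M.PiAt_I_add_J hβ A hcan hadm, map_sub,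
    PolynomialPart.poly, map_sum]
  simp only [sub_apply, add_apply, sum_apply, map_smul, smul_apply, smul_eq_mul,
    M.PiAt_X_reflectAt hcan]
  rw [sub_add_eq_sub_sub]
  congr 2
  refine Finset.sum_congr rfl fun l _ => ?_
  ring

end Model

end LiftReconstruction

/-! ### The reconstruction operator and the lift -/

section Schauder

variable {d : ℕ} {ι κ T Tp : Type*} [AddCommGroup T] [Module ℝ T] [CommRing Tp] [Bialgebra ℝ Tp]
  {𝒯 : RegularityStructure ι κ T Tp}

namespace Model

variable (M : Model d 𝒯) {P : PolynomialPart d 𝒯}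

theorem K_eq_lift (A : IntegrationOperators P) (γ : ℝ) (f : Spacetime d → T) :
    M.K A γ f = M.lift A γ (M.R γ f) f := rfl

theorem ModelledBound.mono {M : Model d 𝒯} {γ : ℝ} {f : Spacetime d → T} {N N' : ℝ}
    (h : M.ModelledBound γ f N) (hN : N ≤ N') : M.ModelledBound γ f N' :=
  ⟨h.mem, fun x τ hτ => (h.coeff x τ hτ).trans hN, fun x y τ hτ => (h.holder x y τ hτ).trans
    (mul_le_mul_of_nonneg_right hN (Real.rpow_nonneg (pdist_nonneg y x) _))⟩

/-- Uniqueness makes the choice in `R` immaterial; linearity of `R` and the intertwining relation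
are obtained by exhibiting a reconstruction. -/
theorem R_eq {γ : ℝ} (hγ : 0 < γ) {f : Spacetime d → T} {Λ : Distr d}
    (h : M.IsReconstruction γ f Λ) : M.R γ f = Λ := by
  have hex : ∃ Λ, M.IsReconstruction γ f Λ := ⟨Λ, h⟩
  rw [R, dif_pos hex]
  exact M.isReconstruction_unique hγ hex.choose_spec h

theorem IsReconstruction.add_smul {M : Model d 𝒯} {γ : ℝ} {f f' : Spacetime d → T} {Λ Λ' : Distr d}
    (h : M.IsReconstruction γ f Λ) (h' : M.IsReconstruction γ f' Λ') (a b : ℝ) :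
    M.IsReconstruction γ (a • f + b • f') (a • Λ + b • Λ') := by
  obtain ⟨C, hC⟩ := h
  obtain ⟨C', hC'⟩ := h'
  refine ⟨|a| * C + |b| * C', fun x t ht ht1 => ?_⟩
  have e : (a • Λ + b • Λ' - M.PiAt x ((a • f + b • f') x)) (pKer t x) =
      a * (Λ - M.PiAt x (f x)) (pKer t x) + b * (Λ' - M.PiAt x (f' x)) (pKer t x) := by
    simp only [Pi.add_apply, Pi.smul_apply, map_add, map_smul, sub_apply, add_apply, smul_apply,
      smul_eq_mul]
    ring
  rw [e, add_mul, mul_assoc, mul_assoc]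
  refine (abs_add_le _ _).trans (add_le_add ?_ ?_)
  · rw [abs_mul]
    exact mul_le_mul_of_nonneg_left (hC x t ht ht1) (abs_nonneg _)
  · rw [abs_mul]
    exact mul_le_mul_of_nonneg_left (hC' x t ht ht1) (abs_nonneg _)

/-- The reconstruction operator exists, with a bound of the order of the local errors. -/
theorem exists_hasOrder_R (hβ : ∀ τ, -2 < 𝒯.deg τ) {γ : ℝ} (hγ : 0 < γ) :
    ∃ K : ℝ, 1 ≤ K ∧ ∀ f ∈ M.modelled γ, M.IsReconstruction γ f (M.R γ f) ∧
      ∀ x, HasOrder (M.R γ f - M.PiAt x (f x)) x γ (K * (M.modelledNorm γ f).toReal) (growth γ) := by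
  obtain ⟨K₁, hK₁, h₁⟩ := M.exists_reconstruction hβ hγ
  obtain ⟨K₂, hK₂, h₂⟩ := M.exists_hasOrder_sub hβ γ
  -- The summand `1` makes the constant at least `1`, so that one number later bounds both the
  -- coefficients of `f` and the local errors.
  refine ⟨1 + K₂ + K₁, by linarith, fun f hf => ?_⟩
  have hN : 0 ≤ (M.modelledNorm γ f).toReal := ENNReal.toReal_nonneg
  have hb := M.modelledBound_of_mem hf
  obtain ⟨Λ, hΛ⟩ := h₁ f _ hN hb
  have hrec := M.isReconstruction_iff.2 ⟨_, hΛ⟩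
  rw [M.R_eq hγ hrec]
  refine ⟨hrec, fun x y c hc hc1 => (h₂ f _ Λ _ hN (by positivity) hb hΛ x y c hc hc1).trans ?_⟩
  have := pdist_nonneg y x
  gcongr
  linarith

theorem lift_add_smul (A : IntegrationOperators P) {γ : ℝ} {f f' : Spacetime d → T}
    {Λ Λ' : Distr d}
    (h : ∀ x l, (sdeg l : ℝ) < γ + 2 → dKAtConverges l (Λ - M.PiAt x (f x)) x)
    (h' : ∀ x l, (sdeg l : ℝ) < γ + 2 → dKAtConverges l (Λ' - M.PiAt x (f' x)) x) (a b : ℝ) :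
    M.lift A γ (a • Λ + b • Λ') (a • f + b • f') =
      a • M.lift A γ Λ f + b • M.lift A γ Λ' f' := by
  funext x
  have e : a • Λ + b • Λ' - M.PiAt x ((a • f + b • f') x) =
      a • (Λ - M.PiAt x (f x)) + b • (Λ' - M.PiAt x (f' x)) := by
    simp only [Pi.add_apply, Pi.smul_apply, map_add, map_smul, smul_sub]
    abel
  have e' : (P.poly (γ + 2) fun l => dKAt l (a • (Λ - M.PiAt x (f x)) +
      b • (Λ' - M.PiAt x (f' x))) x) =
      a • (P.poly (γ + 2) fun l => dKAt l (Λ - M.PiAt x (f x)) x) +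
        b • P.poly (γ + 2) fun l => dKAt l (Λ' - M.PiAt x (f' x)) x := by
    simp only [PolynomialPart.poly, Finset.smul_sum, ← Finset.sum_add_distrib, smul_smul, ← add_smul]
    refine Finset.sum_congr rfl fun l hl => ?_
    have hl' := mem_belowDeg.1 hl
    rw [dKAt_add ((h x l hl').smul a) ((h' x l hl').smul b), dKAt_smul, dKAt_smul]
    congr 1
    ring
  rw [Pi.add_apply, Pi.smul_apply, Pi.smul_apply, lift, e, e', Pi.add_apply, Pi.smul_apply,
    Pi.smul_apply, map_add, map_smul, map_smul, lift, lift, smul_add, smul_add]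
  exact add_add_add_comm _ _ _ _

end Model

end Schauder

end RegStruct

end

/-! ### Schauder estimate and intertwining relation -/

theorem mainTheorem2 {d : ℕ} {ι κ T Tp : Type*} [AddCommGroup T] [Module ℝ T]
    [CommRing Tp] [Bialgebra ℝ Tp] {𝒯 : RegStruct.RegularityStructure ι κ T Tp}
    (hβ : ∀ τ, -2 < 𝒯.deg τ)
    {P : RegStruct.PolynomialPart d 𝒯} (S : RegStruct.PolynomialProduct P)
    (A : RegStruct.IntegrationOperators P)
    (M : RegStruct.Model d 𝒯) (hcan : M.IsCanonical P) (hadm : M.IsAdmissible S A)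
    (γ : ℝ) (hγ : 0 < γ) (hint : ∀ k : ℤ, γ ≠ k) :
    -- the reconstruction operator is well defined
    (∀ f ∈ M.modelled γ, M.IsReconstruction γ f (M.R γ f) ∧
      ∀ Λ, M.IsReconstruction γ f Λ → Λ = M.R γ f) ∧
    -- the integrals in the definition of the lift converge
    (∀ x τ n, (RegStruct.sdeg n : ℝ) < 𝒯.deg τ + 2 →
      RegStruct.dKAtConverges n (M.PiAt x (𝒯.basis τ)) x) ∧
    (∀ f ∈ M.modelled γ, ∀ x l, (RegStruct.sdeg l : ℝ) < γ + 2 →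
      RegStruct.dKAtConverges l (M.R γ f - M.PiAt x (f x)) x) ∧
    -- the lift is a bounded linear map
    (∀ f ∈ M.modelled γ, M.K A γ f ∈ M.modelled (γ + 2)) ∧
    (∀ f ∈ M.modelled γ, ∀ f' ∈ M.modelled γ, ∀ a b : ℝ,
      M.K A γ (a • f + b • f') = a • M.K A γ f + b • M.K A γ f') ∧
    (∃ C : NNReal, ∀ f ∈ M.modelled γ,
      M.modelledNorm (γ + 2) (M.K A γ f) ≤ C * M.modelledNorm γ f) ∧
    -- the intertwining relation
    (∀ f ∈ M.modelled γ, ∀ φ, RegStruct.KDistr (M.R γ f) φ = M.R (γ + 2) (M.K A γ f) φ) := by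
  obtain ⟨K, hK, hR⟩ := M.exists_hasOrder_R hβ hγ
  obtain ⟨K₁, hK₁, h₁⟩ := M.exists_modelledBound_lift hβ A hcan hadm hint
    (RegStruct.Model.growth γ)
  obtain ⟨K₂, hK₂, h₂⟩ := M.exists_recBound_lift hβ A hcan hadm hint (RegStruct.Model.growth γ)
  have hconv : ∀ f ∈ M.modelled γ, ∀ x l, (RegStruct.sdeg l : ℝ) < γ + 2 →
      RegStruct.dKAtConverges l (M.R γ f - M.PiAt x (f x)) x :=
    fun f hf x l hl => ((hR f hf).2 x).dKAtConverges hl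
  have hb : ∀ f ∈ M.modelled γ, M.ModelledBound (γ + 2) (M.K A γ f)
      (K₁ * (K * (M.modelledNorm γ f).toReal)) := fun f hf =>
    h₁ f _ _ ((M.modelledBound_of_mem hf).mono
      (le_mul_of_one_le_left ENNReal.toReal_nonneg hK)) (hR f hf).2
  refine ⟨fun f hf => ⟨(hR f hf).1, fun Λ hΛ => (M.R_eq hγ hΛ).symm⟩,
    fun x τ n hn => M.dKAtConverges_PiAt hβ x τ n hn, hconv,
    fun f hf => (hb f hf).mem_modelled M, fun f hf f' hf' a b => ?_, ?_, fun f hf φ => ?_⟩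
  -- The linear combination of the reconstructions reconstructs the linear combination, so `R` is
  -- linear; convergence of the integrals allows the polynomial part to be split.
  · rw [M.K_eq_lift, M.R_eq hγ ((hR f hf).1.add_smul (hR f' hf').1 a b),
      M.lift_add_smul A (hconv f hf) (hconv f' hf')]
    rfl
  · refine ⟨Real.toNNReal (2 * (K₁ * K)), fun f hf => ((hb f hf).modelledNorm_le M).trans ?_⟩
    rw [show 2 * (K₁ * (K * (M.modelledNorm γ f).toReal)) =
      2 * (K₁ * K) * (M.modelledNorm γ f).toReal by ring, ENNReal.ofReal_mul (by positivity),
      ENNReal.ofReal_toReal hf.2.ne]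
    rfl
  -- `K (R f)` reconstructs the lift at order `γ + 2 > 0`, so uniqueness at that order identifies it
  -- with `R (γ + 2)` of the lift.
  · have hrec : M.IsReconstruction (γ + 2) (M.K A γ f) (RegStruct.KopLM (M.R γ f)) :=
      M.isReconstruction_iff.2 ⟨_, h₂ f _ _ (hR f hf).2⟩
    rw [M.R_eq (by linarith) hrec, RegStruct.KopLM_apply]
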